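/- Let $D$ be an oriented planar rectangular diagram of a link: a grid of size $n\ge 2$ with one $O$ and one $X$ in each row and each column (never in the same square), the $X$ and $O$ of each column joined by a vertical segment oriented from $X$ to $O$, the $O$ and $X$ of each row joined by a horizontal segment oriented from $O$ to $X$, vertical segments passing over horizontal ones. Around each vertical segment draw a narrow figure-eight winding clockwise around its top puncture and counterclockwise around its bottom puncture, with its self-intersection off the horizontal segments (the punctures are the $X$'s and $O$'s). Let $\mathcal G$ be the set of Bigelow's generators: the sets of $n$ intersection points between figure-eights and horizontal segments that have exactly one point on each figure-eight and on each horizontal segment. Let $\mathbf x\in\mathcal G$ consist of the points nearest to the $X$'s. For $g\in\mathcal G$ let $\overline P(g)$ be the number of points of $g$ on upward oriented parts of figure-eights, $T(g)$ the number of pairs of points of $g$ of which the first is to the left of and below the second, and $Q(g)$ the total winding number around all punctures of the closed curves that run from $g$ along the horizontal segments to $\mathbf x$ and back along the figure-eights to $g$. Let $\mathrm{rot}(D)$ be the number of counterclockwise minus the number of clockwise Seifert circles, $w(D)$ the writhe, and put $$J(g)=2(T(g)-Q(g))-2T(\mathbf x)+\mathrm{rot}(D)+w(D),\qquad P(g)=\overline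 P(g)-\overline P(\mathbf x)-\mathrm{rot}(D)-w(D).$$ Let $\mathrm{Kh}_{odd}^{i,j}(D;R)$ denote the odd Khovanov homology of Ozsv\'ath, Rasmussen and Szab\'o in homological degree $i$ and quantum degree $j$ with coefficients in $R$. It is the homology of the cube of resolutions of $D$ with the exterior algebras on the circles at its vertices, defined from an orientation of the arrows at the crossings and an edge assignment (of type X or of type Y). Fix one of these two types. Then the following hold. (1) For every $D$, every choice of figure-eights and every choice of arrows and of an edge assignment of this type, there is a differential $\delta$ ($\delta^2=0$) on the free abelian group $B$ generated by $\mathcal G$ that preserves $J$, raises $P$ by $1$, and whose homology is odd Khovanov homology: for all $k,j\in\mathbb Z$ the homology of $(B,\delta)$ in the degrees $P=k$, $J=j$ is isomorphic to $\mathrm{Kh}_{odd}^{k+j,j}(D;\mathbb Z)$ (so that $P=i-j$ and $J=j$). (2) Over $\mathbb Q$ the differential is canonical: one can choose, for all $D$, figure-eights, arrows and edge assignments of this type, a differential $\delta$ on the $\mathbb Q$-vector space generated by $\mathcal G$ with the properties in (1) over $\mathbb Q$, such that the following holds. If an orientation-preserving diffeomorphism $f$ of the plane sends the oriented rectangular diagram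 $D$ to the oriented rectangular diagram $D'$, horizontal segments to horizontal segments (and vertical segments to vertical segments), then, for any figure-eights, arrows and edge assignments of the fixed type on $D$ and on $D'$, the two chain complexes are isomorphic. More precisely, there is a bijection $\sigma:\mathcal G(D)\to\mathcal G(D')$ that preserves $P$ and $J$ and is compatible with $f$ (the punctures and crossings nearest to the points of $g$ are sent by $f$ to those nearest to the points of $\sigma(g)$), and there are signs $\eta_g=\pm1$, such that $g\mapsto\eta_g\,\sigma(g)$ is an isomorphism of chain complexes. -/

import Mathlib

open scoped ContDiff

noncomputable section

/-- A grid diagram of size `n ≥ 2`: every column `c` carries one `O`, in row `O c`, and one `X`,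
in row `X c`; every row carries one of each; no square carries both.
Columns are numbered from left to right and rows from bottom to top. -/
structure GridDiagram (n : ℕ) where
  two_le : 2 ≤ n
  O : Equiv.Perm (Fin n)
  X : Equiv.Perm (Fin n)
  ne : ∀ c, O c ≠ X c

/-- The two sides of a narrow figure-eight drawn around a vertical segment. -/
inductive Side
  | left
  | right

/-- The four directions in which an edge can leave a lattice point. -/
inductive Dir
  | north
  | east
  | south
  | west

/-- The signed number of times the segment from `u` to `v` crosses the horizontal ray that starts
at `p` and points to the right (with the usual half-open rule at the ends of the segment):
`+1` upwards, `-1` downwards. -/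
def rayCrossing (p u v : ℤ × ℤ) : ℤ :=
  let area := (v.1 - u.1) * (p.2 - u.2) - (v.2 - u.2) * (p.1 - u.1)
  if u.2 ≤ p.2 ∧ p.2 < v.2 ∧ 0 < area then 1
  else if v.2 ≤ p.2 ∧ p.2 < u.2 ∧ area < 0 then -1
  else 0

/-- The sum of `rayCrossing` over the edges of a polygonal path. Summed over the paths
that make up a family of closed polygons avoiding `p`, it is the total winding number around `p`
(counterclockwise turns count positively). -/
def pathCrossing (p : ℤ × ℤ) (path : List (ℤ × ℤ)) : ℤ :=
  ((path.zip path.tail).map fun e => rayCrossing p e.1 e.2).sum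

/-- The homology of `d` in one degree: the kernel of `d` on the degree part `cur`, modulo the image
of the preceding degree part `prev`. -/
abbrev homologyAt {R M : Type*} [CommRing R] [AddCommGroup M] [Module R M]
    (d : M →ₗ[R] M) (prev cur : Submodule R M) : Type _ :=
  ↥(cur ⊓ LinearMap.ker d) ⧸ (prev.map d).submoduleOf (cur ⊓ LinearMap.ker d)

namespace GridDiagram

variable {n : ℕ} (D : GridDiagram n)

/-! ### The planar rectangular diagram -/

/-- The vertical segment in column `c` goes from row `lo c` to row `hi c`. -/
def lo (c : Fin n) : Fin n := min (D.O c) (D.X c)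

def hi (c : Fin n) : Fin n := max (D.O c) (D.X c)

/-- The horizontal segment in row `r` goes from column `lft r` to column `rgt r`. -/
def lft (r : Fin n) : Fin n := min (D.O.symm r) (D.X.symm r)

def rgt (r : Fin n) : Fin n := max (D.O.symm r) (D.X.symm r)

/-- The crossings `(column, row)` of the diagram; the vertical strand passes over. -/
abbrev Crossing : Type :=
  {p : Fin n × Fin n //
    (D.lo p.1 < p.2 ∧ p.2 < D.hi p.1) ∧ (D.lft p.2 < p.1 ∧ p.1 < D.rgt p.2)}

/-- Vertical segments are oriented from `X` to `O`. -/
def Upward (c : Fin n) : Prop := D.X c < D.O c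

/-- Horizontal segments are oriented from `O` to `X`. -/
def Rightward (r : Fin n) : Prop := D.O.symm r < D.X.symm r

/-- A crossing is positive when (direction of the over-strand, direction of the under-strand) is a
positively oriented basis of the plane: up and left, or down and right. -/
def IsPositive (x : D.Crossing) : Prop := ¬ (D.Upward x.1.1 ↔ D.Rightward x.1.2)

def nPos : ℤ := Nat.card {x : D.Crossing // D.IsPositive x}

def nNeg : ℤ := Nat.card {x : D.Crossing // ¬ D.IsPositive x}

def writhe : ℤ := D.nPos - D.nNeg

/-! ### Resolutions and their circles -/

/-- The unit edges of the diagram. `(true, c, r)` is the vertical edge from `(c, r)` to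
`(c, r + 1)`, and `(false, c, r)` is the horizontal edge from `(c, r)` to `(c + 1, r)`. -/
abbrev Edge : Type :=
  {e : Bool × Fin n × Fin n //
    (e.1 = true ∧ D.lo e.2.1 ≤ e.2.2 ∧ e.2.2 < D.hi e.2.1) ∨
    (e.1 = false ∧ D.lft e.2.2 ≤ e.2.1 ∧ e.2.1 < D.rgt e.2.2)}

variable {D} in
/-- `e.LeavesAt d c r`: the edge `e` leaves the lattice point `(c, r)` in direction `d`. -/
def Edge.LeavesAt (e : D.Edge) (d : Dir) (c r : Fin n) : Prop :=
  match d with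
  | .north => e.1.1 = true ∧ e.1.2.1 = c ∧ e.1.2.2 = r
  | .south => e.1.1 = true ∧ e.1.2.1 = c ∧ (e.1.2.2 : ℕ) + 1 = r
  | .east => e.1.1 = false ∧ e.1.2.1 = c ∧ e.1.2.2 = r
  | .west => e.1.1 = false ∧ (e.1.2.1 : ℕ) + 1 = c ∧ e.1.2.2 = r

/-- A resolution of the diagram: `false` is the 0-smoothing and `true` the 1-smoothing. -/
abbrev Resolution : Type := D.Crossing → Bool

/-- How a smoothing joins the four ends at a crossing. As the vertical strand passes over,
the 0-smoothing joins north with east and south with west, and the 1-smoothing joins north with west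
and south with east. -/
def smoothingJoins : Bool → Dir → Dir → Prop
  | false, .north, .east => True
  | false, .south, .west => True
  | true, .north, .west => True
  | true, .south, .east => True
  | _, _, _ => False

/-- Two edges that share a lattice point and are connected there in the resolution `ρ`. At a lattice
point that is not a crossing (a corner, or an interior point of a single segment) the two edges
of the diagram that end there are connected. -/
def Touch (ρ : D.Resolution) (e e' : D.Edge) : Prop :=
  ∃ (c r : Fin n) (d d' : Dir), e.LeavesAt d c r ∧ e'.LeavesAt d' c r ∧
    ∀ h : (D.lo c < r ∧ r < D.hi c) ∧ (D.lft r < c ∧ c < D.rgt r),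
      smoothingJoins (ρ ⟨(c, r), h⟩) d d'

/-- The circles of a resolution: classes of edges under the equivalence relation generated
by `Touch`. -/
abbrev Circle (ρ : D.Resolution) : Type := Quot (D.Touch ρ)

variable {D} in
/-- The circle of `ρ` that contains a given edge. -/
def circleOf (ρ : D.Resolution) (e : D.Edge) : D.Circle ρ := Quot.mk _ e

instance (ρ : D.Resolution) : Finite (D.Circle ρ) :=
  Finite.of_surjective (Quot.mk (D.Touch ρ)) Quot.mk_surjective

variable {D} in
/-- The edge going north from a crossing. -/
def Crossing.northEdge (x : D.Crossing) : D.Edge :=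
  ⟨(true, x.1.1, x.1.2), Or.inl ⟨rfl, x.2.1.1.le, x.2.1.2⟩⟩

variable {D} in
/-- The edge going south from a crossing. -/
def Crossing.southEdge (x : D.Crossing) : D.Edge :=
  ⟨(true, x.1.1, ⟨(x.1.2 : ℕ) - 1, (Nat.sub_le _ _).trans_lt x.1.2.2⟩), Or.inl ⟨rfl, by
    have h := x.2.1
    simp only [Fin.lt_def, Fin.le_def] at h ⊢
    omega⟩⟩

/-! ### Rotation number -/

open Classical in
/-- The oriented resolution, whose circles are the Seifert circles. -/
def seifert : D.Resolution := fun x => if D.IsPositive x then false else true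

open Classical in
/-- The signed area `∮ x dy` enclosed by a Seifert circle with its orientation. -/
def signedArea (C : D.Circle D.seifert) : ℤ :=
  ∑ e : D.Edge, if e.1.1 = true ∧ circleOf D.seifert e = C then
    (if D.Upward e.1.2.1 then 1 else -1) * ((e.1.2.1 : ℕ) : ℤ) else 0

/-- The rotation number: a Seifert circle contributes `+1` if it is oriented counterclockwise
(positive signed area) and `-1` if it is oriented clockwise (negative signed area). -/
def rot : ℤ := ∑ᶠ C : D.Circle D.seifert, Int.sign (D.signedArea C)

/-! ### Figure-eights and Bigelow's generators -/

/-- The choice of the narrow figure-eights: the self-intersection of the figure-eight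
around the vertical segment in column `c` lies between the rows `knot c` and `knot c + 1`. -/
structure FigureEights where
  knot : Fin n → Fin n
  lo_le : ∀ c, D.lo c ≤ knot c
  lt_hi : ∀ c, knot c < D.hi c

/-- `D.IsPoint c r a`: side `a` of the figure-eight in column `c` meets the horizontal
segment in row `r`. There are two such points near each crossing and one near each puncture. -/
def IsPoint (c r : Fin n) (a : Side) : Prop :=
  (D.lo c ≤ r ∧ r ≤ D.hi c) ∧
    match a with
    | .left => D.lft r < c ∧ c ≤ D.rgt r
    | .right => D.lft r ≤ c ∧ c < D.rgt r

/-- Bigelow's generators: one intersection point on each figure-eight (in column `c` it lies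
in row `row c`, on the side `side c`), such that each horizontal segment carries exactly
one of them. -/
structure Gen where
  row : Equiv.Perm (Fin n)
  side : Fin n → Side
  isPoint : ∀ c, D.IsPoint c (row c) (side c)

open Classical in
/-- The generator `𝐱` of the intersection points nearest to the `X`'s. -/
def xGen : D.Gen where
  row := D.X
  side c := if D.lft (D.X c) = c then .right else .left
  isPoint c := by
    have hne : D.O.symm (D.X c) ≠ c := fun h => D.ne c ((Equiv.symm_apply_eq _).1 h).symm
    refine ⟨⟨min_le_right _ _, le_max_right _ _⟩, ?_⟩
    have h1 : D.lft (D.X c) = min (D.O.symm (D.X c)) c := by simp [lft]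
    have h2 : D.rgt (D.X c) = max (D.O.symm (D.X c)) c := by simp [rgt]
    rcases lt_or_gt_of_ne hne with h | h
    · have h3 : D.lft (D.X c) = D.O.symm (D.X c) := by rw [h1, min_eq_left h.le]
      have h4 : D.rgt (D.X c) = c := by rw [h2, max_eq_right h.le]
      rw [if_neg (by rw [h3]; exact hne)]
      exact ⟨h3 ▸ h, h4.ge⟩
    · have h3 : D.lft (D.X c) = c := by rw [h1, min_eq_right h.le]
      have h4 : D.rgt (D.X c) = D.O.symm (D.X c) := by rw [h2, max_eq_left h.le]
      rw [if_pos h3]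
      exact ⟨h3.le, h4 ▸ h⟩

section Gradings

variable {D} (s : D.FigureEights)

/-- Figure-eights wind clockwise around their top puncture and counterclockwise around their bottom
puncture. So the left side is oriented upward above the self-intersection and the right side is
oriented upward below it. -/
def FigureEights.IsUp (c r : Fin n) : Side → Prop
  | .left => s.knot c < r
  | .right => r ≤ s.knot c

open Classical in
/-- The grading `P̄`: the number of points on upward oriented parts of the figure-eights. -/
def Pbar (g : D.Gen) : ℤ := ∑ c, if s.IsUp c (g.row c) (g.side c) then 1 else 0

open Classical in
/-- The grading `T`: the number of pairs of points of `g`, the first of which lies to the left of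
and below the second. The points lie in distinct columns and distinct rows, so columns and rows
decide this. -/
def T (g : D.Gen) : ℤ := ∑ c, ∑ c', if c < c' ∧ g.row c < g.row c' then 1 else 0

/-- The punctures and the points of intersection, in a lattice four times finer than the grid. -/
def puncture (c r : Fin n) : ℤ × ℤ := (4 * (c : ℕ), 4 * (r : ℕ))

def sidePoint (c r : Fin n) : Side → ℤ × ℤ
  | .left => (4 * (c : ℕ) - 1, 4 * (r : ℕ))
  | .right => (4 * (c : ℕ) + 1, 4 * (r : ℕ))

/-- The vertices of the figure-eight in column `c`, a closed polygon, in the order of its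
orientation and starting at its lower left corner. -/
def FigureEights.polygon (c : Fin n) : List (ℤ × ℤ) :=
  let l : ℤ := 4 * (c : ℕ) - 1
  let r : ℤ := 4 * (c : ℕ) + 1
  let bot : ℤ := 4 * (D.lo c : ℕ) - 1
  let top : ℤ := 4 * (D.hi c : ℕ) + 1
  let mid : ℤ := 4 * (s.knot c : ℕ) + 2
  [(l, bot), (r, bot), (r, mid - 1), (l, mid + 1), (l, top), (r, top), (r, mid + 1), (l, mid - 1)]

open Classical in
/-- The path along the figure-eight in column `c`, following its orientation from its lower left
corner to the point on side `a` in row `r`. -/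
def FigureEights.pathTo (c r : Fin n) (a : Side) : List (ℤ × ℤ) :=
  (s.polygon c).take
    (match a with
      | .right => if r ≤ s.knot c then 2 else 6
      | .left => if s.knot c < r then 4 else 8) ++ [sidePoint c r a]

/-- The sum of the winding numbers around `p` of the closed curves that run from `g` along the
horizontal segments to `h`, and then along the figure-eights back to `g`. -/
def winding (p : ℤ × ℤ) (g h : D.Gen) : ℤ :=
  (∑ r, pathCrossing p
    [sidePoint (g.row.symm r) r (g.side (g.row.symm r)),
      sidePoint (h.row.symm r) r (h.side (h.row.symm r))]) +
  ∑ c, pathCrossing p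
    ((s.pathTo c (h.row c) (h.side c)).reverse ++ s.pathTo c (g.row c) (g.side c))

/-- The relative grading `Q(g) - Q(h)`: the total winding number around all punctures. -/
def Qrel (g h : D.Gen) : ℤ :=
  ∑ c, (winding s (puncture c (D.O c)) g h + winding s (puncture c (D.X c)) g h)

/-- The grading `Q`, normalized by `Q(𝐱) = 0`. -/
def Q (g : D.Gen) : ℤ := Qrel s g D.xGen

/-- The Jones grading. -/
def J (g : D.Gen) : ℤ := 2 * (T g - Q s g) - 2 * T D.xGen + D.rot + D.writhe

/-- The homological grading. -/
def P (g : D.Gen) : ℤ := Pbar s g - Pbar s D.xGen - D.rot - D.writhe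

/-- The part of the free module on Bigelow's generators in which `P = k` and `J = j`. -/
def genPart (R : Type) [CommRing R] (k j : ℤ) : Submodule R (D.Gen →₀ R) :=
  Finsupp.supported R R {g | P s g = k ∧ J s g = j}

end Gradings

/-! ### Odd Khovanov homology -/

section Odd

variable {D}

/-- The free module on the circles of a resolution. -/
abbrev V (R : Type) [CommRing R] (ρ : D.Resolution) : Type := D.Circle ρ →₀ R

/-- The linear map that sends a circle of `ρ` to a circle of `ρ'` with which it shares an edge.
If `ρ'` arises from `ρ` by merging two circles, this is the quotient map. If `ρ'` arises by
splitting a circle in two, it is a section of the quotient map that identifies the two. -/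
def circleMap (R : Type) [CommRing R] (ρ ρ' : D.Resolution) : V R ρ →ₗ[R] V R ρ' :=
  Finsupp.lmapDomain R R fun C => circleOf ρ' (Quot.out C)

/-- An orientation of the arrows at the crossings. The arrow joins the two arcs of the 0-smoothing;
turned by 90 degrees counterclockwise, it joins the two arcs of the 1-smoothing. Its tail is on the
arc that contains the north edge if the value is `true`, and on the arc that contains
the south edge otherwise; this holds for both smoothings. -/
abbrev Arrows (D : GridDiagram n) : Type := D.Crossing → Bool

def Arrows.tail (o : Arrows D) (x : D.Crossing) : D.Edge :=
  if o x then x.northEdge else x.southEdge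

def Arrows.head (o : Arrows D) (x : D.Crossing) : D.Edge :=
  if o x then x.southEdge else x.northEdge

open Classical in
/-- The map of exterior algebras belonging to an edge `ρ → ρ'` of the cube of resolutions
that changes the crossing `x` from `0` to `1`: for a merge, the map induced by the quotient map;
for a split into the circles `a₁` at the tail and `a₂` at the head of the arrow,
the exterior product with `a₁ - a₂` from the left. -/
def edgeMap (R : Type) [CommRing R] (o : Arrows D) (x : D.Crossing) (ρ ρ' : D.Resolution) :
    ExteriorAlgebra R (V R ρ) →ₗ[R] ExteriorAlgebra R (V R ρ') :=
  if circleOf ρ' (o.tail x) = circleOf ρ' (o.head x) then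
    (ExteriorAlgebra.map (circleMap R ρ ρ')).toLinearMap
  else
    LinearMap.mulLeft R (ExteriorAlgebra.ι R
      (Finsupp.single (circleOf ρ' (o.tail x)) 1 - Finsupp.single (circleOf ρ' (o.head x)) 1)) ∘ₗ
      (ExteriorAlgebra.map (circleMap R ρ ρ')).toLinearMap

/-- The resolution obtained from `ρ` by giving `x` the 1-smoothing. -/
def Resolution.up (ρ : D.Resolution) (x : D.Crossing) : D.Resolution := Function.update ρ x true

/-- The resolution obtained from `ρ` by giving `x` the 0-smoothing. -/
def Resolution.down (ρ : D.Resolution) (x : D.Crossing) : D.Resolution := Function.update ρ x false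

/-- The faces of the cube on which both composites split a circle and merge the two parts
again: the arcs at `x` and `y` have their ends on the same circle, and they are interleaved there,
so that changing `x` separates the two ends of the arc at `y`. -/
def IsLadybug (ρ : D.Resolution) (x y : D.Crossing) : Prop :=
  circleOf ρ y.northEdge = circleOf ρ y.southEdge ∧
    circleOf (Resolution.up ρ x) y.northEdge ≠ circleOf (Resolution.up ρ x) y.southEdge

/-- The two kinds of such faces (types X and Y), distinguished by the cyclic order in which
the tails and heads of the two arrows occur on the circle: after changing `x`, the tail at `y` lies
on the circle at the tail of `x`, or on the circle at the head of `x`. -/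
def TailMeetsTail (o : Arrows D) (ρ : D.Resolution) (x y : D.Crossing) : Prop :=
  circleOf (Resolution.up ρ x) (o.tail y) = circleOf (Resolution.up ρ x) (o.tail x)

/-- The data that define an odd Khovanov complex: an orientation of the arrows and an edge
assignment, that is, a sign for each edge `ρ → ρ.up x` of the cube such that each face of the signed
cube anticommutes (which determines the product of the four signs of the face unless both
composites vanish). On the faces where both composites vanish the product of the four signs is `1`
for one of the two kinds of faces and `-1` for the other; `τ` tells for which kind it is `1`,
so the two values of `τ` give the edge assignments of type X and of type Y. -/
structure EdgeAssignment (D : GridDiagram n) (τ : Bool) where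
  arrows : Arrows D
  sign : D.Resolution → D.Crossing → ℤˣ
  anticomm : ∀ (ρ : D.Resolution) (x y : D.Crossing), x ≠ y → ρ x = false → ρ y = false →
    ((sign ρ x * sign (Resolution.up ρ x) y : ℤˣ) : ℤ) •
        (edgeMap ℤ arrows y (Resolution.up ρ x) (Resolution.up (Resolution.up ρ x) y) ∘ₗ
          edgeMap ℤ arrows x ρ (Resolution.up ρ x)) +
      ((sign ρ y * sign (Resolution.up ρ y) x : ℤˣ) : ℤ) •
        (edgeMap ℤ arrows x (Resolution.up ρ y) (Resolution.up (Resolution.up ρ x) y) ∘ₗ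
          edgeMap ℤ arrows y ρ (Resolution.up ρ y)) = 0
  ladybug : ∀ (ρ : D.Resolution) (x y : D.Crossing), x ≠ y → ρ x = false → ρ y = false →
    IsLadybug ρ x y →
      (sign ρ x * sign (Resolution.up ρ x) y * (sign ρ y * sign (Resolution.up ρ y) x) = 1 ↔
        (TailMeetsTail arrows ρ x y ↔ τ = true))

/-- The odd Khovanov complex, as an ungraded module. -/
abbrev OddComplex (D : GridDiagram n) (R : Type) [CommRing R] : Type :=
  ∀ ρ : D.Resolution, ExteriorAlgebra R (V R ρ)

/-- The differential of the odd Khovanov complex: the signed sum of all edge maps. -/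
def oddDifferential (R : Type) [CommRing R] {τ : Bool} (E : EdgeAssignment D τ) :
    OddComplex D R →ₗ[R] OddComplex D R :=
  LinearMap.pi fun ρ' => ∑ x : {x : D.Crossing // ρ' x = true},
    ((E.sign (Resolution.down ρ' x) x : ℤˣ) : ℤ) •
      (edgeMap R E.arrows x (Resolution.down ρ' x) ρ' ∘ₗ LinearMap.proj (Resolution.down ρ' x))

/-- The number of 1-smoothings of a resolution. -/
def Resolution.height (ρ : D.Resolution) : ℤ := Nat.card {x : D.Crossing // ρ x = true}

/-- The part of the odd Khovanov complex in homological degree `i` and quantum degree `j`: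
the `p`-th exterior power of the module of a resolution `ρ` with `k` circles and `h` 1-smoothings
lies in homological degree `h - n₋` and in quantum degree `k - 2p + h + n₊ - 2n₋`. -/
def oddPart (D : GridDiagram n) (R : Type) [CommRing R] (i j : ℤ) :
    Submodule R (OddComplex D R) :=
  Submodule.pi Set.univ fun ρ =>
    ⨆ (p : ℕ) (_ : Resolution.height ρ - D.nNeg = i ∧
      (Nat.card (D.Circle ρ) : ℤ) - 2 * p + Resolution.height ρ + D.nPos - 2 * D.nNeg = j),
      ⋀[R]^p (V R ρ)

/-- Odd Khovanov homology in homological degree `i` and quantum degree `j`,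
with coefficients in `R`. -/
abbrev OddKh (R : Type) [CommRing R] {τ : Bool} (E : EdgeAssignment D τ) (i j : ℤ) : Type :=
  homologyAt (oddDifferential R E) (oddPart D R (i - 1) j) (oddPart D R i j)

/-- `δ` is a differential on the free module generated by Bigelow's generators that respects `J`,
increases `P` by `1`, and whose homology is odd Khovanov homology: for all `k` and `j`
the homology in the degrees `P = k` and `J = j` is the odd Khovanov homology in homological degree
`i` and quantum degree `j` where `i - j = k`. -/
structure ComputesOddKh (R : Type) [CommRing R] (s : D.FigureEights) {τ : Bool}
    (E : EdgeAssignment D τ) (δ : (D.Gen →₀ R) →ₗ[R] (D.Gen →₀ R)) : Prop where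
  sq_zero : δ ∘ₗ δ = 0
  degree : ∀ g h : D.Gen, δ (Finsupp.single g 1) h ≠ 0 → J s h = J s g ∧ P s h = P s g + 1
  homology : ∀ k j : ℤ,
    Nonempty (homologyAt δ (genPart s R (k - 1) j) (genPart s R k j) ≃ₗ[R] OddKh R E (k + j) j)

end Odd

/-! ### Diffeomorphisms of the plane -/

/-- The point of the plane in column `c` and row `r`. -/
def planePoint (c r : Fin n) : ℝ × ℝ := ((c : ℕ), (r : ℕ))

def hSegment (r : Fin n) : Set (ℝ × ℝ) := segment ℝ (planePoint (D.lft r) r) (planePoint (D.rgt r) r)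

def vSegment (c : Fin n) : Set (ℝ × ℝ) := segment ℝ (planePoint c (D.lo c)) (planePoint c (D.hi c))

/-- `f` is an orientation-preserving diffeomorphism of the plane that sends the oriented rectangular
diagram `D` to the oriented rectangular diagram `D'`, horizontal segments to horizontal segments. -/
structure Carries {m : ℕ} (D : GridDiagram n) (D' : GridDiagram m)
    (f : Diffeomorph (modelWithCornersSelf ℝ (ℝ × ℝ)) (modelWithCornersSelf ℝ (ℝ × ℝ))
      (ℝ × ℝ) (ℝ × ℝ) ∞) : Prop where
  orientation : ∀ p, 0 < (fderiv ℝ f p).det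
  horizontal : ∀ r, ∃ r', f '' D.hSegment r = D'.hSegment r'
  vertical : ∀ c, ∃ c', f '' D.vSegment c = D'.vSegment c'
  punctureO : f '' Set.range (fun c => planePoint c (D.O c)) =
    Set.range fun c => planePoint c (D'.O c)
  punctureX : f '' Set.range (fun c => planePoint c (D.X c)) =
    Set.range fun c => planePoint c (D'.X c)

variable {D} in
/-- The set `ḡ` of the punctures and crossings nearest to the points of a generator. -/
def Gen.nearest (g : D.Gen) : Set (ℝ × ℝ) := Set.range fun c => planePoint c (g.row c)

end GridDiagram

end

/-! A basis vector of the odd Khovanov complex is a resolution with a set of its circles. Read it as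
an orientation of the circles, clockwise for those in the set and counterclockwise for the others;
this orients every edge of the diagram. The heart of the proof is a dichotomy: a nonzero matrix
coefficient of the differential either preserves the orientation of all edges or strictly decreases
the signed area enclosed by the oriented diagram (`Allowed.omega_eq_or_area_lt`). Hence the area
filters the complex, and the leading part of the differential is the part that preserves the
orientation.

For a fixed orientation both smoothings of a crossing are compatible with it when the two vertical
ends point both inwards or both outwards, and only one smoothing is when the strands run straight
through. The leading differential changes the smoothing exactly at the crossings with both vertical
ends pointing inwards, the free crossings. So the states with a given orientation form cubes with
coefficients 1 and -1 (`isCube`), and a cube of positive dimension contracts (`IsCube.contraction`).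
What survives are the critical states, those without free crossings. In such a state the orientation
diverges from exactly one point of each vertical segment and converges to exactly one point of each
horizontal segment, and these are the same points. If such a point is a crossing, both smoothings
are possible there, matching its two intersection points with the figure-eight. So the critical
states are Bigelow's generators (`genState_injective`, `exists_genState_eq`), and the perturbation
lemma moves the differential to them (`Perturbation.homology`).

The gradings are compared by summation over the lattice. The number of circles labelled 1 minus the
number labelled -1 is the turning number of the oriented diagram, which telescopes along each column
and is computed by the points on upward arcs (`turning_genState`). The number of 1-smoothings is
extracted from a product of sign functions at each lattice point; expanding the product yields `T`,
the winding numbers and a constant (`local_balance`, `sum_balance`). Together this is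
`deg_genState`.

The planar topology comes from one source, a discrete Umlaufsatz (`turning_number`). A checkerboard
colouring orients the circles of all resolutions simultaneously. With this orientation every circle
turns once, in the direction given by the sign of its area (`circle_turning_area`), and a surgery
changes the total turning by exactly one (`spin_surgery`). This decides merge or split and controls
nesting.

The contraction depends on weights on the free crossings. A single crossing with weight 1 works over
the integers; equal weights work over the rationals and are natural. Edge assignments of the same
type differ by signs at the vertices of the cube, because composites are nonzero on all faces except
the ladybugs, and there the type fixes the sign (`edgeSign_cocycle`, `exists_gauge`). At a puncture
or crossing the derivative of the given diffeomorphism is diagonal with positive determinant, so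
directions are either kept or turned by 180 degrees, consistently along segments
(`Carries.vMono_iff_hMono`). Both smoothings are invariant under a half turn, so the whole
construction is carried over up to signs. -/

noncomputable section

section
/-! ### Turning of closed lattice paths -/

/-- The four unit vectors of the square lattice. -/
def IsUnitStep (a : ℤ × ℤ) : Prop := a = (1, 0) ∨ a = (-1, 0) ∨ a = (0, 1) ∨ a = (0, -1)

/-- Signed crossing of the negative vertical axis by a unit step from `u` to `v`. -/
def axisCrossing (u v : ℤ × ℤ) : ℤ :=
  ((if 0 ≤ v.1 then 1 else 0) - (if 0 ≤ u.1 then 1 else 0)) * (if u.2 < 0 then 1 else 0)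

/-- Left turns from west to south minus right turns from south to west. -/
def turnCount (a b : ℤ × ℤ) : ℤ :=
  (if a = (-1, 0) ∧ b = (0, -1) then 1 else 0) - (if a = (0, -1) ∧ b = (-1, 0) then 1 else 0)

/-- Homotopy invariance: a lattice square without a corner at the origin does not wind around the
origin, so both ways from one corner to the opposite one cross the axis equally often. Degenerate
squares are included. -/
theorem axisCrossing_square {v a b : ℤ × ℤ} (ha : IsUnitStep a) (hb : IsUnitStep b)
    (h0 : v ≠ 0) (h1 : v + a ≠ 0) (h2 : v + b ≠ 0) (h3 : v + a + b ≠ 0) :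
    axisCrossing v (v + a) + axisCrossing (v + a) (v + a + b) =
      axisCrossing v (v + b) + axisCrossing (v + b) (v + a + b) := by
  obtain ⟨x, y⟩ := v
  rcases ha with rfl | rfl | rfl | rfl <;> rcases hb with rfl | rfl | rfl | rfl <;>
    simp only [axisCrossing, Prod.mk_add_mk, ne_eq, Prod.mk_eq_zero, not_and] at * <;>
    split_ifs <;> omega

/-- Near the diagonal of the triangle of secants: passing from the secant of one step to that of the
next through the secant of both is a turn of the path. -/
theorem axisCrossing_corner {a b : ℤ × ℤ} (ha : IsUnitStep a) (hb : IsUnitStep b)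
    (h : a + b ≠ 0) :
    axisCrossing a (a + b) + axisCrossing (a + b) b = turnCount a b := by
  rcases ha with rfl | rfl | rfl | rfl <;> rcases hb with rfl | rfl | rfl | rfl <;>
    simp [axisCrossing, turnCount] at h ⊢

theorem IsUnitStep.neg {a : ℤ × ℤ} (ha : IsUnitStep a) : IsUnitStep (-a) := by
  rcases ha with rfl | rfl | rfl | rfl <;> simp [IsUnitStep]

section Secants

variable (p : ℕ → ℤ × ℤ)

/-- Crossings of the axis by the secant to the fixed end `p j` while its beginning moves from `p i`
to `p (j - 1)`. -/
def secantColumn (i j : ℕ) : ℤ :=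
  ∑ k ∈ Finset.Ico i (j - 1), axisCrossing (p j - p k) (p j - p (k + 1))

variable {p} {N : ℕ} (hstep : ∀ i, IsUnitStep (p (i + 1) - p i))
  (hne : ∀ i j, i < j → j < i + N → p j - p i ≠ 0)

include hstep hne

/-- Adjacent columns of the triangle of secants are compared by pushing the path across one square
at a time. The bound on `d` keeps every secant shorter than a period, hence nonzero. -/
theorem secantColumn_succ (j : ℕ) (d : ℕ) (hd : d + 1 ≤ j) (hN : d + 2 < N) :
    axisCrossing (p j - p (j - 1 - d)) (p (j + 1) - p (j - 1 - d)) +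
        secantColumn p (j - 1 - d) (j + 1) =
      secantColumn p (j - 1 - d) j +
        turnCount (p j - p (j - 1)) (p (j + 1) - p j) := by
  induction d with
  | zero =>
    obtain ⟨m, rfl⟩ : ∃ m, j = m + 1 := ⟨j - 1, by omega⟩
    have := axisCrossing_corner (hstep m) (hstep (m + 1))
      (by have := hne m (m + 2) (by omega) (by omega); intro h; apply this; rw [← h]; abel)
    simp only [secantColumn, Nat.add_sub_cancel, Nat.sub_zero, Finset.Ico_self, Finset.sum_empty,
      Nat.Ico_succ_singleton, Finset.sum_singleton, zero_add]
    rw [← this]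
    congr 2 <;> abel
  | succ d ih =>
    have ih := ih (by omega) (by omega)
    obtain ⟨m, rfl⟩ : ∃ m, j = m + 2 + d := ⟨j - 2 - d, by omega⟩
    have e1 : m + 2 + d - 1 - d = m + 1 := by omega
    have e2 : m + 2 + d - 1 - (d + 1) = m := by omega
    rw [e1] at ih
    rw [e2]
    have s1 : secantColumn p m (m + 2 + d + 1) =
        axisCrossing (p (m + 2 + d + 1) - p m) (p (m + 2 + d + 1) - p (m + 1)) +
          secantColumn p (m + 1) (m + 2 + d + 1) := by
      simp only [secantColumn]
      rw [Finset.sum_eq_sum_Ico_succ_bot (by omega)]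
    have s2 : secantColumn p m (m + 2 + d) =
        axisCrossing (p (m + 2 + d) - p m) (p (m + 2 + d) - p (m + 1)) +
          secantColumn p (m + 1) (m + 2 + d) := by
      simp only [secantColumn]
      rw [Finset.sum_eq_sum_Ico_succ_bot (by omega)]
    have n0 := hne m (m + 2 + d) (by omega) (by omega)
    have n1 := hne m (m + 2 + d + 1) (by omega) (by omega)
    have n2 := hne (m + 1) (m + 2 + d) (by omega) (by omega)
    have n3 := hne (m + 1) (m + 2 + d + 1) (by omega) (by omega)
    have q1 : p (m + 2 + d) - p m + (p (m + 2 + d + 1) - p (m + 2 + d)) =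
      p (m + 2 + d + 1) - p m := by abel
    have q2 : p (m + 2 + d) - p m + -(p (m + 1) - p m) = p (m + 2 + d) - p (m + 1) := by abel
    have q3 : p (m + 2 + d + 1) - p m + -(p (m + 1) - p m) =
      p (m + 2 + d + 1) - p (m + 1) := by abel
    have sq := axisCrossing_square (v := p (m + 2 + d) - p m) (hstep (m + 2 + d)) (hstep m).neg n0
      (by rwa [q1]) (by rwa [q2]) (by rwa [q1, q3])
    rw [q1, q2, q3] at sq
    linarith

/-- Hopf's argument: the turning of the tangent, measured along the diagonal of the triangle of
secants, may be measured along the two other sides. -/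
theorem sum_turnCount_eq_secants (j : ℕ) (hj : j < N) (hN : 1 ≤ j) :
    ∑ k ∈ Finset.range (j - 1), turnCount (p (k + 1) - p k) (p (k + 2) - p (k + 1)) =
      (∑ l ∈ Finset.Ico 1 j, axisCrossing (p l - p 0) (p (l + 1) - p 0)) + secantColumn p 0 j := by
  induction j, hN using Nat.le_induction with
  | base => simp [secantColumn]
  | succ j h1 ih =>
    have ih := ih (by omega)
    have key := secantColumn_succ hstep hne j (j - 1) (by omega) (by omega)
    rw [Nat.sub_self] at key
    obtain ⟨m, rfl⟩ : ∃ m, j = m + 1 := ⟨j - 1, by omega⟩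
    rw [Nat.add_sub_cancel, Finset.sum_range_succ, Finset.sum_Ico_succ_top (by omega)]
    simp only [Nat.add_sub_cancel] at ih key
    rw [ih]
    have : m + 2 = m + 1 + 1 := rfl
    rw [this]
    linarith

end Secants

end

/-! ### The Umlaufsatz for simple closed lattice paths -/

section
theorem sum_range_periodic_shift {N : ℕ} {f : ℕ → ℤ} (hf : ∀ i, f (i + N) = f i) (s : ℕ) :
    ∑ k ∈ Finset.range N, f (k + s) = ∑ k ∈ Finset.range N, f k := by
  induction s with
  | zero => rfl
  | succ s ih =>
    rw [← ih]
    have h1 := Finset.sum_range_succ (fun k => f (k + s)) N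
    have h2 := Finset.sum_range_succ' (fun k => f (k + s)) N
    have h3 : f (N + s) = f (0 + s) := by rw [add_comm, hf, zero_add]
    have h4 : ∑ k ∈ Finset.range N, f (k + 1 + s) = ∑ k ∈ Finset.range N, f (k + (s + 1)) :=
      Finset.sum_congr rfl fun k _ => by congr 1; ring
    rw [← h4]
    linarith

theorem secantColumn_eq_zero {p : ℕ → ℤ × ℤ} {i j : ℕ}
    (h : ∀ k, (p k).1 ≤ (p j).1) : secantColumn p i j = 0 := by
  refine Finset.sum_eq_zero fun k _ => ?_
  have h1 := h k
  have h2 := h (k + 1)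
  simp [axisCrossing, h1, h2]

theorem turning_number_of_extremal {p : ℕ → ℤ × ℤ} {N : ℕ} (hN : 3 ≤ N)
    (hper : ∀ i, p (i + N) = p i)
    (hstep : ∀ i, IsUnitStep (p (i + 1) - p i))
    (hne : ∀ i j, i < j → j < i + N → p j - p i ≠ 0)
    (hmax : ∀ i, (p i).1 ≤ (p 0).1 ∧ ((p i).1 = (p 0).1 → (p 0).2 ≤ (p i).2)) :
    ∃ σ : ℤ, (σ = 1 ∨ σ = -1) ∧
      ∑ k ∈ Finset.range N, turnCount (p (k + 1) - p k) (p (k + 2) - p (k + 1)) = σ ∧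
      ∃ k, p (k + 1) = p k + (0, σ) ∧ ∀ i, (p i).1 ≤ (p k).1 := by
  obtain ⟨M, rfl⟩ : ∃ M, N = M + 3 := ⟨N - 3, by omega⟩
  have hp0 : p (M + 3) = p 0 := by simpa using hper 0
  have hp1 : p (M + 4) = p 1 := by rw [show M + 4 = 1 + (M + 3) by ring]; exact hper 1
  -- Seen from the lowest of the rightmost points, every other point lies to the left or straight
  -- above, so these secants never meet the negative vertical axis.
  have row : ∀ j, ∑ l ∈ Finset.Ico 1 j, axisCrossing (p l - p 0) (p (l + 1) - p 0) = 0 := by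
    intro j
    refine Finset.sum_eq_zero fun l _ => ?_
    have h1 := hmax l
    have h2 := hmax (l + 1)
    have h3 := hstep l
    simp only [IsUnitStep, Prod.ext_iff, Prod.fst_sub, Prod.snd_sub] at h3
    simp only [axisCrossing, Prod.fst_sub, Prod.snd_sub]
    split_ifs <;> omega
  -- The triangle stops at `N - 1`, because the secant over a whole period vanishes. The column of
  -- index `N` is reached by one more comparison, down to index 1 only, and it vanishes because its
  -- secants lead to a rightmost point.
  have s1 := sum_turnCount_eq_secants hstep hne (M + 2) (by omega) (by omega)
  have s2 := secantColumn_succ hstep hne (M + 2) M (by omega) (by omega)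
  have e1 : M + 2 - 1 - M = 1 := by omega
  have e2 : M + 2 - 1 = M + 1 := by omega
  rw [e1, e2, secantColumn_eq_zero (j := M + 2 + 1) (by rw [hp0]; exact fun k => (hmax k).1)] at s2
  rw [row, e2] at s1
  have s3 : secantColumn p 0 (M + 2) =
      axisCrossing (p (M + 2) - p 0) (p (M + 2) - p 1) + secantColumn p 1 (M + 2) := by
    simp only [secantColumn]
    rw [Finset.sum_eq_sum_Ico_succ_bot (by omega)]
  rw [Finset.sum_range_succ, Finset.sum_range_succ]
  have a0 := hstep 0
  have a2 := hstep (M + 2)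
  have hdist := hne 1 (M + 2) (by omega) (by omega)
  have m1 := hmax 1
  have m2 := hmax (M + 2)
  simp only [show M + 2 + 1 = M + 3 by ring, show M + 2 + 2 = M + 4 by ring,
    show M + 1 + 1 = M + 2 by ring, zero_add] at *
  rw [hp0, hp1] at *
  rw [s1, s3]
  generalize turnCount (p (M + 2) - p (M + 1)) (p 0 - p (M + 2)) = D at *
  generalize secantColumn p 1 (M + 2) = S at *
  have hS : S + D = axisCrossing (p (M + 2) - p 1) (p 0 - p 1) := by linarith
  set u := p (M + 2) with hu
  -- The two neighbours of the extremal point are different, and only the places above it and to its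
  -- left are available.
  have cases : (p 1 = p 0 + (0, 1) ∧ u = p 0 + (-1, 0)) ∨
      (p 1 = p 0 + (-1, 0) ∧ u = p 0 + (0, 1)) := by
    simp only [IsUnitStep, Prod.ext_iff, Prod.fst_sub, Prod.snd_sub, Prod.fst_add,
      Prod.snd_add, ne_eq, Prod.fst_zero, Prod.snd_zero] at *
    omega
  rcases cases with ⟨h1, h2⟩ | ⟨h1, h2⟩
  · refine ⟨1, Or.inl rfl, ?_, 0, h1, fun i => (hmax i).1⟩
    rw [h1, h2] at hS ⊢
    have q : axisCrossing (p 0 + (-1, 0) - p 0) (p 0 + (-1, 0) - (p 0 + (0, 1))) +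
        axisCrossing (p 0 + (-1, 0) - (p 0 + (0, 1))) (p 0 - (p 0 + (0, 1))) = 1 := by
      simp [axisCrossing]
    have q' : turnCount (p 0 - (p 0 + (-1, 0))) (p 0 + (0, 1) - p 0) = 0 := by
      simp [turnCount]
    rw [q']
    linarith
  · refine ⟨-1, Or.inr rfl, ?_, M + 2, ?_, fun i => ?_⟩
    · rw [h1, h2] at hS ⊢
      have q : axisCrossing (p 0 + (0, 1) - p 0) (p 0 + (0, 1) - (p 0 + (-1, 0))) +
          axisCrossing (p 0 + (0, 1) - (p 0 + (-1, 0))) (p 0 - (p 0 + (-1, 0))) = 0 := by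
        simp [axisCrossing]
      have q' : turnCount (p 0 - (p 0 + (0, 1))) (p 0 + (-1, 0) - p 0) = -1 := by
        simp [turnCount]
      rw [q']
      linarith
    · rw [show M + 2 + 1 = 0 + (M + 3) by ring, hper, ← hu, h2]
      simp [add_assoc]
    · rw [← hu, h2]
      simpa using (hmax i).1

/-- The turning number of a simple closed lattice path is `1` or `-1`, and it is the direction
of some step on its rightmost vertical line. -/
theorem turning_number {p : ℕ → ℤ × ℤ} {N : ℕ} (hN : 3 ≤ N) (hper : ∀ i, p (i + N) = p i)
    (hstep : ∀ i, IsUnitStep (p (i + 1) - p i))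
    (hne : ∀ i j, i < j → j < i + N → p j ≠ p i) :
    ∃ σ : ℤ, (σ = 1 ∨ σ = -1) ∧
      ∑ k ∈ Finset.range N, turnCount (p (k + 1) - p k) (p (k + 2) - p (k + 1)) = σ ∧
      ∃ k, p (k + 1) = p k + (0, σ) ∧ ∀ i, (p i).1 ≤ (p k).1 := by
  have hmod : ∀ i, ∃ j < N, p i = p j := fun i => by
    refine ⟨i % N, Nat.mod_lt _ (by omega), ?_⟩
    have : Function.Periodic p N := hper
    exact (this.map_mod_nat i).symm
  -- The path is shifted so that it starts at the lowest of its rightmost points.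
  obtain ⟨i0, -, hi0⟩ := Finset.exists_max_image (Finset.range N) 
    (fun i => toLex ((p i).1, -(p i).2)) ⟨0, by simp; omega⟩
  have hmax : ∀ i, (p i).1 ≤ (p i0).1 ∧ ((p i).1 = (p i0).1 → (p i0).2 ≤ (p i).2) := fun i => by
    obtain ⟨j, hj, h⟩ := hmod i
    have := hi0 j (Finset.mem_range.2 hj)
    rw [Prod.Lex.toLex_le_toLex] at this
    rw [h]
    simp only at this
    omega
  obtain ⟨σ, hσ, hs, k, hk, hk'⟩ := turning_number_of_extremal (p := fun i => p (i + i0)) hN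
    (fun i => by rw [add_right_comm]; exact hper _)
    (fun i => by rw [add_right_comm]; exact hstep _)
    (fun i j h h' => sub_ne_zero.2 (hne _ _ (by omega) (by omega)))
    (fun i => by simpa using hmax (i + i0))
  refine ⟨σ, hσ, ?_, k + i0, ?_, fun i => ?_⟩
  · rw [← hs, ← sum_range_periodic_shift _ i0]
    · refine Finset.sum_congr rfl fun k _ => ?_
      rw [add_right_comm k i0 1, add_right_comm k i0 2]
    · intro i
      rw [add_right_comm i N 1, add_right_comm i N 2, hper, hper, hper]
  · rw [add_right_comm]; exact hk
  · obtain ⟨j, -, h⟩ := hmod i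
    rw [h]
    have h1 := hk' 0
    simp only [zero_add] at h1
    exact (hmax j).1.trans h1

end

section
namespace GridDiagram

variable {n : ℕ} (D : GridDiagram n)

/-! ### Local structure of a rectangular diagram -/

theorem lo_lt_hi (c : Fin n) : D.lo c < D.hi c := by
  have := D.ne c
  simp only [lo, hi]
  exact min_lt_max.2 this

theorem lft_lt_rgt (r : Fin n) : D.lft r < D.rgt r := by
  simp only [lft, rgt]
  refine min_lt_max.2 fun h => D.ne (D.X.symm r) ?_
  rw [Equiv.apply_symm_apply, ← h, Equiv.apply_symm_apply]

theorem eq_lo_or_eq_hi (c r : Fin n) : r = D.lo c ∨ r = D.hi c ↔ r = D.O c ∨ r = D.X c := by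
  simp only [lo, hi]
  rcases le_total (D.O c) (D.X c) with h | h <;> simp [h, or_comm]

theorem eq_lft_or_eq_rgt (c r : Fin n) : c = D.lft r ∨ c = D.rgt r ↔ r = D.O c ∨ r = D.X c := by
  have h1 : c = D.O.symm r ↔ r = D.O c := by rw [Equiv.eq_symm_apply, eq_comm]
  have h2 : c = D.X.symm r ↔ r = D.X c := by rw [Equiv.eq_symm_apply, eq_comm]
  rw [← h1, ← h2]
  simp only [lft, rgt]
  rcases le_total (D.O.symm r) (D.X.symm r) with h | h <;> simp [h, or_comm]

theorem corner_iff (c r : Fin n) : (r = D.lo c ∨ r = D.hi c) ↔ (c = D.lft r ∨ c = D.rgt r) := by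
  rw [eq_lo_or_eq_hi, eq_lft_or_eq_rgt]

/-- The diagram has an edge leaving the lattice point `(c, r)` in the given direction. -/
def HasEnd (c r : Fin n) : Dir → Prop
  | .north => D.lo c ≤ r ∧ r < D.hi c
  | .south => D.lo c < r ∧ r ≤ D.hi c
  | .east => D.lft r ≤ c ∧ c < D.rgt r
  | .west => D.lft r < c ∧ c ≤ D.rgt r

/-- The crossings, as a condition on lattice points. -/
def IsCrossing (c r : Fin n) : Prop :=
  (D.lo c < r ∧ r < D.hi c) ∧ (D.lft r < c ∧ c < D.rgt r)

/-- The form used by `omega`: with these inequalities every case distinction at a lattice point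
becomes linear arithmetic. -/
theorem fin_corner_iff (c r : Fin n) :
    (D.lo c : ℕ) < D.hi c ∧ (D.lft r : ℕ) < D.rgt r ∧
    (((r : ℕ) = D.lo c ∨ (r : ℕ) = D.hi c) ↔ ((c : ℕ) = D.lft r ∨ (c : ℕ) = D.rgt r)) := by
  have := D.corner_iff c r
  simp only [Fin.ext_iff] at this
  exact ⟨D.lo_lt_hi c, D.lft_lt_rgt r, this⟩

variable {D}

theorem Edge.LeavesAt.hasEnd {e : D.Edge} {d : Dir} {c r : Fin n} (h : e.LeavesAt d c r) :
    D.HasEnd c r d := by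
  obtain ⟨⟨b, c', r'⟩, he⟩ := e
  cases d <;> simp only [Edge.LeavesAt, HasEnd] at h ⊢ <;> obtain ⟨rfl, h1, h2⟩ := h <;>
    simp only [Bool.false_eq_true, true_and, false_and, or_false, false_or,
      reduceCtorEq] at he
  · subst h1 h2; exact he
  · subst h1 h2; exact he
  · subst h1; simp only [Fin.lt_def, Fin.le_def] at *; omega
  · subst h2; simp only [Fin.lt_def, Fin.le_def] at *; omega

variable (D) in
theorem exists_leavesAt {d : Dir} {c r : Fin n} (h : D.HasEnd c r d) :
    ∃ e : D.Edge, e.LeavesAt d c r := by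
  cases d
  · exact ⟨⟨(true, c, r), Or.inl ⟨rfl, h⟩⟩, rfl, rfl, rfl⟩
  · exact ⟨⟨(false, c, r), Or.inr ⟨rfl, h⟩⟩, rfl, rfl, rfl⟩
  · have h' := h
    simp only [HasEnd, Fin.lt_def, Fin.le_def] at h'
    refine ⟨⟨(true, c, ⟨r - 1, by omega⟩), Or.inl ⟨rfl, ?_⟩⟩, rfl, rfl, ?_⟩
    · simp only [Fin.lt_def, Fin.le_def]; omega
    · simp only; omega
  · have h' := h
    simp only [HasEnd, Fin.lt_def, Fin.le_def] at h'
    refine ⟨⟨(false, ⟨c - 1, by omega⟩, r), Or.inr ⟨rfl, ?_⟩⟩, rfl, ?_, rfl⟩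
    · simp only [Fin.lt_def, Fin.le_def]; omega
    · simp only; omega

theorem Edge.LeavesAt.unique {e e' : D.Edge} {d : Dir} {c r : Fin n} (h : e.LeavesAt d c r)
    (h' : e'.LeavesAt d c r) : e = e' := by
  obtain ⟨⟨b, c1, r1⟩, he⟩ := e
  obtain ⟨⟨b', c2, r2⟩, he'⟩ := e'
  cases d <;> simp only [Edge.LeavesAt] at h h' <;> simp only [Subtype.mk.injEq, Prod.mk.injEq,
    Fin.ext_iff] <;> simp only [Fin.ext_iff] at h h' <;>
    exact ⟨h.1.trans h'.1.symm, by omega, by omega⟩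

/-- The sign of a direction: `1` for north and east. -/
def _root_.Dir.sgn : Dir → ℤ
  | .north => 1
  | .east => 1
  | .south => -1
  | .west => -1

/-! ### The checkerboard orientation -/

variable (D) in
/-- The colour of the face that contains the points to the left of column `x` at height
slightly above row `y`. -/
def faceSign (x y : ℤ) : ℤ :=
  ∏ c : Fin n, if ((c : ℕ) : ℤ) < x ∧ ((D.lo c : ℕ) : ℤ) ≤ y ∧ y < ((D.hi c : ℕ) : ℤ) then -1 else 1

theorem faceSign_eq (x y : ℤ) : D.faceSign x y = 1 ∨ D.faceSign x y = -1 := by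
  unfold faceSign
  induction (Finset.univ : Finset (Fin n)) using Finset.induction_on with
  | empty => simp
  | insert a s ha ih =>
    rw [Finset.prod_insert ha]
    split_ifs <;> rcases ih with h | h <;> rw [h] <;> simp

open Classical in
theorem faceSign_right (c : Fin n) (y : ℤ) :
    D.faceSign ((c : ℕ) + 1) y =
      D.faceSign (c : ℕ) y * if ((D.lo c : ℕ) : ℤ) ≤ y ∧ y < ((D.hi c : ℕ) : ℤ) then -1 else 1 := by
  have h : (if ((D.lo c : ℕ) : ℤ) ≤ y ∧ y < ((D.hi c : ℕ) : ℤ) then (-1 : ℤ) else 1) =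
      ∏ c' : Fin n, if c' = c then
        (if ((D.lo c : ℕ) : ℤ) ≤ y ∧ y < ((D.hi c : ℕ) : ℤ) then (-1 : ℤ) else 1) else 1 := by
    rw [Finset.prod_ite_eq' Finset.univ c]; simp
  rw [h, faceSign, faceSign, ← Finset.prod_mul_distrib]
  refine Finset.prod_congr rfl fun c' _ => ?_
  by_cases hc : c' = c
  · subst hc
    simp
  · have : (c' : ℕ) ≠ c := fun h => hc (Fin.ext h)
    have h2 : ((c' : ℕ) : ℤ) < (c : ℕ) + 1 ↔ ((c' : ℕ) : ℤ) < (c : ℕ) := by omega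
    simp [hc, h2]

open Classical in
-- Between the heights just below and just above row `r`, only the columns of the two punctures of
-- this row change their state. The sign changes if exactly one of them lies to the left of `x`.
theorem faceSign_up (x : ℤ) (r : Fin n) :
    D.faceSign x (r : ℕ) =
      D.faceSign x ((r : ℕ) - 1) *
        if ((D.lft r : ℕ) : ℤ) < x ∧ x ≤ ((D.rgt r : ℕ) : ℤ) then -1 else 1 := by
  have key : D.faceSign x (r : ℕ) * D.faceSign x ((r : ℕ) - 1) =
      if ((D.lft r : ℕ) : ℤ) < x ∧ x ≤ ((D.rgt r : ℕ) : ℤ) then -1 else 1 := by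
    have h1 : D.faceSign x (r : ℕ) * D.faceSign x ((r : ℕ) - 1) =
        ∏ c : Fin n, ((if c = D.O.symm r then (if ((c : ℕ) : ℤ) < x then (-1 : ℤ) else 1) else 1) *
          (if c = D.X.symm r then (if ((c : ℕ) : ℤ) < x then (-1 : ℤ) else 1) else 1)) := by
      rw [faceSign, faceSign, ← Finset.prod_mul_distrib]
      refine Finset.prod_congr rfl fun c _ => ?_
      have hO : c = D.O.symm r ↔ (D.O c : ℕ) = r := by rw [Equiv.eq_symm_apply, Fin.ext_iff]
      have hX : c = D.X.symm r ↔ (D.X c : ℕ) = r := by rw [Equiv.eq_symm_apply, Fin.ext_iff]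
      have hne : (D.O c : ℕ) ≠ D.X c := fun h => D.ne c (Fin.ext h)
      have hl : (D.lo c : ℕ) = min (D.O c : ℕ) (D.X c) := by
        simp only [lo]; exact Fin.coe_min _ _
      have hh : (D.hi c : ℕ) = max (D.O c : ℕ) (D.X c) := by
        simp only [hi]; exact Fin.coe_max _ _
      simp only [hO, hX]
      split_ifs <;> first | rfl | omega
    rw [h1, Finset.prod_mul_distrib, Finset.prod_ite_eq' Finset.univ, Finset.prod_ite_eq']
    have hne : (D.O.symm r : ℕ) ≠ D.X.symm r := fun h => by
      apply D.ne (D.X.symm r)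
      rw [Equiv.apply_symm_apply, ← Fin.ext h, Equiv.apply_symm_apply]
    have hl : (D.lft r : ℕ) = min (D.O.symm r : ℕ) (D.X.symm r) := by
      simp only [lft]; exact Fin.coe_min _ _
    have hh : (D.rgt r : ℕ) = max (D.O.symm r : ℕ) (D.X.symm r) := by
      simp only [rgt]; exact Fin.coe_max _ _
    simp only [Finset.mem_univ, if_true]
    split_ifs <;> first | rfl | omega
  rw [← key, mul_comm (D.faceSign x (r : ℕ)), ← mul_assoc]
  rcases D.faceSign_eq x ((r : ℕ) - 1) with h | h <;> rw [h] <;> ring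

/-- The checkerboard orientation of the edges; `1` means north or east. -/
def chi (e : D.Edge) : ℤ :=
  if e.1.1 then -D.faceSign (e.1.2.1 : ℕ) (e.1.2.2 : ℕ)
  else -D.faceSign ((e.1.2.1 : ℕ) + 1) (e.1.2.2 : ℕ)

theorem chi_eq (e : D.Edge) : chi e = 1 ∨ chi e = -1 := by
  unfold chi
  split_ifs
  · rcases D.faceSign_eq (e.1.2.1 : ℕ) (e.1.2.2 : ℕ) with h | h <;> simp [h]
  · rcases D.faceSign_eq ((e.1.2.1 : ℕ) + 1) (e.1.2.2 : ℕ) with h | h <;> simp [h]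

variable (D) in
/-- The checkerboard orientation at a lattice point: `1` for directions that are oriented
outwards. -/
def chiOut (c r : Fin n) : Dir → ℤ
  | .north => -D.faceSign (c : ℕ) (r : ℕ)
  | .south => D.faceSign (c : ℕ) ((r : ℕ) - 1)
  | .east => -D.faceSign ((c : ℕ) + 1) (r : ℕ)
  | .west => D.faceSign (c : ℕ) (r : ℕ)

theorem Edge.LeavesAt.sgn_mul_chi {e : D.Edge} {d : Dir} {c r : Fin n} (h : e.LeavesAt d c r) :
    d.sgn * chi e = D.chiOut c r d := by
  cases d <;> obtain ⟨h0, h1, h2⟩ := h <;> simp only [chi, chiOut, Dir.sgn, h0]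
  · simp [h1, h2]
  · simp [h1, h2]
  · rw [← h1, ← h2]; simp
  · rw [← h1, ← h2]; simp

theorem chiOut_eq (c r : Fin n) (d : Dir) : D.chiOut c r d = 1 ∨ D.chiOut c r d = -1 := by
  cases d <;> simp only [chiOut]
  · rcases D.faceSign_eq (c : ℕ) (r : ℕ) with h | h <;> simp [h]
  · rcases D.faceSign_eq ((c : ℕ) + 1) (r : ℕ) with h | h <;> simp [h]
  · rcases D.faceSign_eq (c : ℕ) ((r : ℕ) - 1) with h | h <;> simp [h]
  · rcases D.faceSign_eq (c : ℕ) (r : ℕ) with h | h <;> simp [h]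

/-- Whether a direction is vertical. -/
def _root_.Dir.vert : Dir → Bool
  | .north => true
  | .south => true
  | .east => false
  | .west => false

/-- The reason for the checkerboard orientation: at every lattice point it is coherent with each way
of joining two ends that a smoothing permits, so it orients the circles of all resolutions at once.
-/
theorem chiOut_add {c r : Fin n} {d d' : Dir} (h : D.HasEnd c r d) (h' : D.HasEnd c r d')
    (hd : d ≠ d') (hc : D.IsCrossing c r → d.vert ≠ d'.vert) :
    D.chiOut c r d + D.chiOut c r d' = 0 := by
  obtain ⟨k1, k2, k3⟩ := D.fin_corner_iff c r
  have q1 := D.faceSign_right c (r : ℕ)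
  have q2 := D.faceSign_right c ((r : ℕ) - 1)
  have q3 := D.faceSign_up (c : ℕ) r
  have q4 := D.faceSign_up ((c : ℕ) + 1) r
  cases d <;> cases d' <;> (try exact absurd rfl hd) <;>
    simp only [HasEnd, chiOut, IsCrossing, Fin.lt_def, Fin.le_def, Dir.vert, ne_eq, not_true_eq_false,
      not_false_eq_true, imp_false, implies_true, Bool.true_eq_false,
      Bool.false_eq_true] at h h' hc ⊢ <;>
    split_ifs at q1 q2 q3 q4 <;> omega

/-- Going around a crossing the colours of the faces alternate, so opposite ends are both outward or
both inward. -/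
theorem chiOut_crossing {c r : Fin n} (h : D.IsCrossing c r) :
    D.chiOut c r .north = D.chiOut c r .south ∧ D.chiOut c r .east = D.chiOut c r .west ∧
      D.chiOut c r .east = -D.chiOut c r .north := by
  have q1 := D.faceSign_right c (r : ℕ)
  have q3 := D.faceSign_up (c : ℕ) r
  simp only [IsCrossing, chiOut, Fin.lt_def] at *
  split_ifs at q1 q3 <;> omega

end GridDiagram

end

section
namespace GridDiagram

variable {n : ℕ} {D : GridDiagram n}

/-! ### Traversing the circles of a resolution -/

/-- The resolution connects the ends `d` and `d'` at the lattice point `(c, r)`. -/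
def Joined (ρ : D.Resolution) (c r : Fin n) (d d' : Dir) : Prop :=
  d ≠ d' ∧ ∀ h : D.IsCrossing c r,
    smoothingJoins (ρ ⟨(c, r), h⟩) d d' ∨ smoothingJoins (ρ ⟨(c, r), h⟩) d' d

theorem Joined.symm {ρ : D.Resolution} {c r : Fin n} {d d' : Dir} (h : Joined ρ c r d d') :
    Joined ρ c r d' d := ⟨h.1.symm, fun hc => (h.2 hc).symm⟩

theorem Joined.vert_ne {ρ : D.Resolution} {c r : Fin n} {d d' : Dir} (h : Joined ρ c r d d')
    (hc : D.IsCrossing c r) : d.vert ≠ d'.vert := by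
  have := h.2 hc
  cases ρ ⟨(c, r), hc⟩ <;> cases d <;> cases d' <;> simp_all [smoothingJoins, Dir.vert]

theorem exists_joined (ρ : D.Resolution) {c r : Fin n} {d : Dir} (h : D.HasEnd c r d) :
    ∃ d', D.HasEnd c r d' ∧ Joined ρ c r d d' := by
  by_cases hc : D.IsCrossing c r
  · have hall : ∀ d, D.HasEnd c r d := by
      intro d
      obtain ⟨⟨h1, h2⟩, h3, h4⟩ := hc
      cases d
      exacts [⟨h1.le, h2⟩, ⟨h3.le, h4⟩, ⟨h1, h2.le⟩, ⟨h3, h4.le⟩]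
    cases hρ : ρ ⟨(c, r), hc⟩ <;> cases d
    · exact ⟨.east, hall _, by simp, fun _ => by rw [hρ]; simp [smoothingJoins]⟩
    · exact ⟨.north, hall _, by simp, fun _ => by rw [hρ]; simp [smoothingJoins]⟩
    · exact ⟨.west, hall _, by simp, fun _ => by rw [hρ]; simp [smoothingJoins]⟩
    · exact ⟨.south, hall _, by simp, fun _ => by rw [hρ]; simp [smoothingJoins]⟩
    · exact ⟨.west, hall _, by simp, fun _ => by rw [hρ]; simp [smoothingJoins]⟩
    · exact ⟨.south, hall _, by simp, fun _ => by rw [hρ]; simp [smoothingJoins]⟩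
    · exact ⟨.east, hall _, by simp, fun _ => by rw [hρ]; simp [smoothingJoins]⟩
    · exact ⟨.north, hall _, by simp, fun _ => by rw [hρ]; simp [smoothingJoins]⟩
  · suffices ∃ d', D.HasEnd c r d' ∧ d ≠ d' by
      obtain ⟨d', h1, h2⟩ := this
      exact ⟨d', h1, h2, fun h => absurd h hc⟩
    by_contra! hno
    obtain ⟨k1, k2, k3⟩ := D.fin_corner_iff c r
    have h1 := hno .north
    have h2 := hno .south
    have h3 := hno .east
    have h4 := hno .west
    simp only [IsCrossing, Fin.lt_def, HasEnd, Fin.le_def] at *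
    cases d <;> simp only [reduceCtorEq, imp_false, not_and, not_lt, not_le] at * <;> omega

theorem Joined.chiOut_add {ρ : D.Resolution} {c r : Fin n} {d d' : Dir} (h : Joined ρ c r d d')
    (h1 : D.HasEnd c r d) (h2 : D.HasEnd c r d') : D.chiOut c r d + D.chiOut c r d' = 0 :=
  GridDiagram.chiOut_add h1 h2 h.1 fun hc => h.vert_ne hc

/-- At a crossing the smoothing decides. Elsewhere any two different ends have opposite outward
signs, so there cannot be three of them. -/
theorem Joined.unique {ρ : D.Resolution} {c r : Fin n} {d d' d'' : Dir} (h : Joined ρ c r d d')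
    (h' : Joined ρ c r d d'') (h1 : D.HasEnd c r d) (h2 : D.HasEnd c r d')
    (h3 : D.HasEnd c r d'') : d' = d'' := by
  by_cases hc : D.IsCrossing c r
  · have a := h.2 hc
    have b := h'.2 hc
    generalize ρ ⟨(c, r), hc⟩ = x at a b
    cases x <;> cases d <;> cases d' <;> cases d'' <;> simp [smoothingJoins] at a b ⊢
  · by_contra hne
    have a := h.chiOut_add h1 h2
    have b := h'.chiOut_add h1 h3
    have e := GridDiagram.chiOut_add h2 h3 hne fun h => absurd h hc
    rcases D.chiOut_eq c r d with q | q <;> omega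

theorem circleOf_eq_of_joined {ρ : D.Resolution} {c r : Fin n} {d d' : Dir} {e e' : D.Edge}
    (h : Joined ρ c r d d') (h1 : e.LeavesAt d c r) (h2 : e'.LeavesAt d' c r) :
    circleOf ρ e = circleOf ρ e' := by
  by_cases hc : D.IsCrossing c r
  · rcases h.2 hc with h3 | h3
    · exact Quot.sound ⟨c, r, d, d', h1, h2, fun _ => h3⟩
    · exact (Quot.sound ⟨c, r, d', d, h2, h1, fun _ => h3⟩).symm
  · exact Quot.sound ⟨c, r, d, d', h1, h2, fun h => absurd h hc⟩

theorem Touch.joined {ρ : D.Resolution} {e e' : D.Edge} (h : D.Touch ρ e e') :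
    e = e' ∨ ∃ c r d d', e.LeavesAt d c r ∧ e'.LeavesAt d' c r ∧ Joined ρ c r d d' := by
  obtain ⟨c, r, d, d', h1, h2, h3⟩ := h
  by_cases hd : d = d'
  · subst hd
    exact Or.inl (h1.unique h2)
  · exact Or.inr ⟨c, r, d, d', h1, h2, hd, fun hc => Or.inl (h3 hc)⟩

/-- The circle of an edge is determined by any function that is constant along joined edges. -/
theorem circle_induction {ρ : D.Resolution} {α : Type*} (f : D.Edge → α)
    (hf : ∀ e e' c r d d', e.LeavesAt d c r → e'.LeavesAt d' c r → Joined ρ c r d d' →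
      f e = f e') {e e' : D.Edge} (h : circleOf ρ e = circleOf ρ e') : f e = f e' := by
  have : ∀ e e', D.Touch ρ e e' → f e = f e' := fun e e' h => by
    rcases h.joined with rfl | ⟨c, r, d, d', h1, h2, h3⟩
    · rfl
    · exact hf _ _ _ _ _ _ h1 h2 h3
  exact congrArg (Quot.lift f this) h

/-- An end of the edge `e` that the checkerboard orientation enters. -/
theorem exists_head (e : D.Edge) : ∃ c r d, e.LeavesAt d c r ∧ D.chiOut c r d = -1 := by
  obtain ⟨⟨b, c, r⟩, he⟩ := e
  have hc := chi_eq (⟨(b, c, r), he⟩ : D.Edge)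
  cases b
  · have he' : D.lft r ≤ c ∧ c < D.rgt r := by simpa using he
    have l1 : Edge.LeavesAt (⟨(false, c, r), he⟩ : D.Edge) .east c r := ⟨rfl, rfl, rfl⟩
    have hlt : (c : ℕ) + 1 < n := by have := (D.rgt r).2; have := he'.2; omega
    have l2 : Edge.LeavesAt (⟨(false, c, r), he⟩ : D.Edge) .west ⟨c + 1, hlt⟩ r := ⟨rfl, rfl, rfl⟩
    have s1 := Edge.LeavesAt.sgn_mul_chi l1
    have s2 := Edge.LeavesAt.sgn_mul_chi l2
    simp only [Dir.sgn] at s1 s2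
    rcases hc with hc | hc
    · exact ⟨_, _, _, l2, by omega⟩
    · exact ⟨_, _, _, l1, by omega⟩
  · have he' : D.lo c ≤ r ∧ r < D.hi c := by simpa using he
    have l1 : Edge.LeavesAt (⟨(true, c, r), he⟩ : D.Edge) .north c r := ⟨rfl, rfl, rfl⟩
    have hlt : (r : ℕ) + 1 < n := by have := (D.hi c).2; have := he'.2; omega
    have l2 : Edge.LeavesAt (⟨(true, c, r), he⟩ : D.Edge) .south c ⟨r + 1, hlt⟩ := ⟨rfl, rfl, rfl⟩
    have s1 := Edge.LeavesAt.sgn_mul_chi l1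
    have s2 := Edge.LeavesAt.sgn_mul_chi l2
    simp only [Dir.sgn] at s1 s2
    rcases hc with hc | hc
    · exact ⟨_, _, _, l2, by omega⟩
    · exact ⟨_, _, _, l1, by omega⟩

/-- The two ends of an edge have opposite directions and therefore opposite outward signs. -/
theorem head_unique {e : D.Edge} {c r c' r' : Fin n} {d d' : Dir} (h : e.LeavesAt d c r)
    (h' : e.LeavesAt d' c' r') (hx : D.chiOut c r d = D.chiOut c' r' d') :
    c = c' ∧ r = r' ∧ d = d' := by
  have a := h.sgn_mul_chi
  have b := h'.sgn_mul_chi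
  have q := chi_eq e
  cases d <;> cases d' <;> simp only [Edge.LeavesAt] at h h' <;>
    simp only [h.1, Bool.true_eq_false, Bool.false_eq_true, false_and] at h' <;>
    simp only [Dir.sgn, Fin.ext_iff] at * <;>
    first | (exfalso; omega) | (refine ⟨?_, ?_, trivial⟩ <;> omega)

theorem exists_next (ρ : D.Resolution) (e : D.Edge) :
    ∃ e' : D.Edge, ∃ c r d d', e.LeavesAt d c r ∧ e'.LeavesAt d' c r ∧ Joined ρ c r d d' ∧
      D.chiOut c r d = -1 ∧ D.chiOut c r d' = 1 := by
  obtain ⟨c, r, d, h1, h2⟩ := exists_head e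
  obtain ⟨d', h3, h4⟩ := exists_joined ρ h1.hasEnd
  obtain ⟨e', h5⟩ := D.exists_leavesAt h3
  have := h4.chiOut_add h1.hasEnd h3
  exact ⟨e', c, r, d, d', h1, h5, h4, h2, by omega⟩

/-- The edge that follows `e` on its circle, with respect to the checkerboard orientation. -/
def next (ρ : D.Resolution) (e : D.Edge) : D.Edge := (exists_next ρ e).choose

theorem next_spec (ρ : D.Resolution) (e : D.Edge) : ∃ c r d d', e.LeavesAt d c r ∧
    (next ρ e).LeavesAt d' c r ∧ Joined ρ c r d d' ∧ D.chiOut c r d = -1 ∧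
      D.chiOut c r d' = 1 := (exists_next ρ e).choose_spec

theorem next_injective (ρ : D.Resolution) : Function.Injective (next ρ) := by
  intro e e' h
  obtain ⟨c, r, d, f, h1, h2, h3, h4, h5⟩ := next_spec ρ e
  obtain ⟨c', r', d', f', k1, k2, k3, k4, k5⟩ := next_spec ρ e'
  rw [← h] at k2
  obtain ⟨rfl, rfl, rfl⟩ := head_unique h2 k2 (by rw [h5, k5])
  have := h3.symm.unique k3.symm h2.hasEnd h1.hasEnd k1.hasEnd
  subst this
  exact h1.unique k1

theorem next_eq_of_joined {ρ : D.Resolution} {c r : Fin n} {d d' : Dir} {e e' : D.Edge}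
    (h : Joined ρ c r d d') (h1 : e.LeavesAt d c r) (h2 : e'.LeavesAt d' c r)
    (hd : D.chiOut c r d = -1) : next ρ e = e' := by
  obtain ⟨c', r', f, f', k1, k2, k3, k4, k5⟩ := next_spec ρ e
  obtain ⟨rfl, rfl, rfl⟩ := head_unique h1 k1 (by rw [hd, k4])
  have := h.unique k3 h1.hasEnd h2.hasEnd k2.hasEnd
  subst this
  exact k2.unique h2

/-- `next` as a permutation of the edges. -/
def nextPerm (ρ : D.Resolution) : Equiv.Perm D.Edge :=
  Equiv.ofBijective (next ρ) (Finite.injective_iff_bijective.1 (next_injective ρ))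

theorem circleOf_next (ρ : D.Resolution) (e : D.Edge) :
    circleOf ρ (next ρ e) = circleOf ρ e := by
  obtain ⟨c, r, d, d', h1, h2, h3, -, -⟩ := next_spec ρ e
  exact (circleOf_eq_of_joined h3 h1 h2).symm

theorem circleOf_iterate_next (ρ : D.Resolution) (e : D.Edge) (k : ℕ) :
    circleOf ρ ((next ρ)^[k] e) = circleOf ρ e := by
  induction k with
  | zero => rfl
  | succ k ih => rw [Function.iterate_succ_apply', circleOf_next, ih]

/-- Of two joined edges one follows the other in the checkerboard orientation, so the circles are
exactly the cycles of the permutation `nextPerm`. -/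
theorem exists_iterate_next {ρ : D.Resolution} {e e' : D.Edge}
    (h : circleOf ρ e = circleOf ρ e') : ∃ k : ℕ, (next ρ)^[k] e = e' := by
  have key : (nextPerm ρ).SameCycle e e' := by
    let s : Setoid D.Edge := Equiv.Perm.SameCycle.setoid (nextPerm ρ)
    have := circle_induction (ρ := ρ) (fun e => (Quotient.mk s e)) ?_ h
    · exact Quotient.exact this
    · intro e e' c r d d' h1 h2 h3
      apply Quotient.sound
      change (nextPerm ρ).SameCycle e e'
      have := h3.chiOut_add h1.hasEnd h2.hasEnd
      rcases chiOut_eq (D := D) c r d with q | q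
      · have : next ρ e' = e := next_eq_of_joined h3.symm h2 h1 (by omega)
        rw [← this]
        exact (Equiv.Perm.sameCycle_apply_left (f := nextPerm ρ)).2 (Equiv.Perm.SameCycle.refl _ _)
      · have : next ρ e = e' := next_eq_of_joined h3 h1 h2 q
        rw [← this]
        exact (Equiv.Perm.sameCycle_apply_right (f := nextPerm ρ)).2 (Equiv.Perm.SameCycle.refl _ _)
  obtain ⟨k, hk⟩ := key.exists_nat_pow_eq
  refine ⟨k, ?_⟩
  rw [← hk, Equiv.Perm.coe_pow]
  rfl

open Classical in
/-- Summation over a circle along its orientation. -/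
theorem sum_circle (ρ : D.Resolution) (e : D.Edge) (f : D.Edge → ℤ) :
    ∃ L : ℕ, 0 < L ∧ (next ρ)^[L] e = e ∧
      (∀ i j, i < j → j < i + L → (next ρ)^[i] e ≠ (next ρ)^[j] e) ∧
      ∑ k ∈ Finset.range L, f ((next ρ)^[k] e) =
        ∑ e', if circleOf ρ e' = circleOf ρ e then f e' else 0 := by
  have hinj := next_injective ρ
  have hp : e ∈ Function.periodicPts (next ρ) := hinj.mem_periodicPts e
  have hL := Function.minimalPeriod_pos_of_mem_periodicPts hp
  refine ⟨Function.minimalPeriod (next ρ) e, hL, Function.iterate_minimalPeriod, ?_, ?_⟩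
  · intro i j hij hj h
    obtain ⟨t, rfl⟩ : ∃ t, j = i + t := ⟨j - i, by omega⟩
    rw [Function.iterate_add_apply] at h
    have h2 := (hinj.iterate i) h
    have : Function.IsPeriodicPt (next ρ) t e := h2.symm
    have := this.minimalPeriod_le (by omega)
    omega
  · rw [← Finset.sum_filter]
    refine Finset.sum_bij (fun k _ => (next ρ)^[k] e) ?_ ?_ ?_ ?_
    · intro k _
      simp [circleOf_iterate_next]
    · intro a ha b hb h
      exact Function.iterate_injOn_Iio_minimalPeriod (Finset.mem_range.1 ha) (Finset.mem_range.1 hb) h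
    · intro b hb
      obtain ⟨k, hk⟩ := exists_iterate_next (Finset.mem_filter.1 hb).2.symm
      refine ⟨k % Function.minimalPeriod (next ρ) e, Finset.mem_range.2 (Nat.mod_lt _ hL), ?_⟩
      rw [Function.iterate_mod_minimalPeriod_eq, hk]
    · intros; rfl

end GridDiagram

end

section
namespace GridDiagram

variable {n : ℕ} {D : GridDiagram n}

/-! ### The turning of a circle -/

/-- The unit vector of a direction. -/
def _root_.Dir.vec : Dir → ℤ × ℤ
  | .north => (0, 1)
  | .east => (1, 0)
  | .south => (0, -1)
  | .west => (-1, 0)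

def heading (e : D.Edge) : ℤ × ℤ := if e.1.1 then (0, chi e) else (chi e, 0)

def tailPoint (e : D.Edge) : ℤ × ℤ :=
  (((e.1.2.1 : ℕ) : ℤ), ((e.1.2.2 : ℕ) : ℤ)) +
    if chi e = 1 then 0 else if e.1.1 then (0, 1) else (1, 0)

theorem Edge.LeavesAt.tail {e : D.Edge} {d : Dir} {c r : Fin n} (h : e.LeavesAt d c r)
    (hd : D.chiOut c r d = 1) :
    heading e = d.vec ∧ tailPoint e = (((c : ℕ) : ℤ), ((r : ℕ) : ℤ)) := by
  have q := h.sgn_mul_chi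
  rw [hd] at q
  cases d <;> obtain ⟨h0, h1, h2⟩ := h <;> simp only [Dir.sgn, Fin.ext_iff] at q h1 h2
  · have : chi e = 1 := by omega
    simp [heading, tailPoint, h0, this, Dir.vec, h1, h2]
  · have : chi e = 1 := by omega
    simp [heading, tailPoint, h0, this, Dir.vec, h1, h2]
  · have : chi e = -1 := by omega
    simp [heading, tailPoint, h0, this, Dir.vec, h1, ← h2]
  · have : chi e = -1 := by omega
    simp [heading, tailPoint, h0, this, Dir.vec, ← h1, h2]

theorem Edge.LeavesAt.head {e : D.Edge} {d : Dir} {c r : Fin n} (h : e.LeavesAt d c r)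
    (hd : D.chiOut c r d = -1) :
    heading e = -d.vec ∧ tailPoint e = (((c : ℕ) : ℤ), ((r : ℕ) : ℤ)) + d.vec := by
  have q := h.sgn_mul_chi
  rw [hd] at q
  cases d <;> obtain ⟨h0, h1, h2⟩ := h <;> simp only [Dir.sgn, Fin.ext_iff] at q h1 h2
  · have : chi e = -1 := by omega
    simp [heading, tailPoint, h0, this, Dir.vec, h1, h2]
  · have : chi e = -1 := by omega
    simp [heading, tailPoint, h0, this, Dir.vec, h1, h2]
  · have : chi e = 1 := by omega
    simp [heading, tailPoint, h0, this, Dir.vec, h1, ← h2]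
  · have : chi e = 1 := by omega
    simp [heading, tailPoint, h0, this, Dir.vec, ← h1, h2]

open Classical in
/-- The turning weight of a lattice point: a vertical end that is oriented outwards contributes
this weight to the turning number of the circle through it, in quarters of a full turn. -/
def kappa (ρ : D.Resolution) (c : Fin n) (y : ℕ) : ℤ :=
  if hy : y < n then
    if h : D.IsCrossing c ⟨y, hy⟩ then (if ρ ⟨(c, ⟨y, hy⟩), h⟩ then 1 else -1)
    else if y = D.lo c ∨ y = D.hi c then
      (if (y = D.lo c ↔ c = D.lft ⟨y, hy⟩) then -1 else 1)
    else 0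
  else 0

/-- The turning weight of an edge with its checkerboard orientation. -/
def edgeTurn (ρ : D.Resolution) (e : D.Edge) : ℤ :=
  if e.1.1 then kappa ρ e.1.2.1 e.1.2.2 - kappa ρ e.1.2.1 (e.1.2.2 + 1) else 0

def kappaTail (ρ : D.Resolution) (e : D.Edge) : ℤ :=
  if e.1.1 then (if chi e = 1 then kappa ρ e.1.2.1 e.1.2.2 else kappa ρ e.1.2.1 (e.1.2.2 + 1)) else 0

def kappaHead (ρ : D.Resolution) (e : D.Edge) : ℤ :=
  if e.1.1 then (if chi e = 1 then kappa ρ e.1.2.1 (e.1.2.2 + 1) else kappa ρ e.1.2.1 e.1.2.2) else 0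

theorem kappaTail_sub_kappaHead (ρ : D.Resolution) (e : D.Edge) :
    kappaTail ρ e - kappaHead ρ e = chi e * edgeTurn ρ e := by
  unfold kappaTail kappaHead edgeTurn
  split_ifs with h1 h2
  · rw [h2]; ring
  · rw [(chi_eq e).resolve_left h2]; ring
  · ring

theorem Edge.LeavesAt.kappaTail {e : D.Edge} {d : Dir} {c r : Fin n} (h : e.LeavesAt d c r)
    (hd : D.chiOut c r d = 1) (ρ : D.Resolution) :
    GridDiagram.kappaTail ρ e = if d.vert then kappa ρ c r else 0 := by
  have q := h.sgn_mul_chi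
  rw [hd] at q
  cases d <;> obtain ⟨h0, h1, h2⟩ := h <;> simp only [Dir.sgn] at q <;>
    simp only [GridDiagram.kappaTail, h0, Dir.vert, if_true, if_false, Bool.false_eq_true]
  · have : chi e = 1 := by omega
    simp [this, h1, h2]
  · have : chi e = -1 := by omega
    simp [this, h1, h2]

theorem Edge.LeavesAt.kappaHead {e : D.Edge} {d : Dir} {c r : Fin n} (h : e.LeavesAt d c r)
    (hd : D.chiOut c r d = -1) (ρ : D.Resolution) :
    GridDiagram.kappaHead ρ e = if d.vert then kappa ρ c r else 0 := by
  have q := h.sgn_mul_chi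
  rw [hd] at q
  cases d <;> obtain ⟨h0, h1, h2⟩ := h <;> simp only [Dir.sgn] at q <;>
    simp only [GridDiagram.kappaHead, h0, Dir.vert, if_true, if_false, Bool.false_eq_true]
  · have : chi e = -1 := by omega
    simp [this, h1, h2]
  · have : chi e = 1 := by omega
    simp [this, h1, h2]

/-- Quarter turns from south. -/
def angle (a : ℤ × ℤ) : ℤ :=
  if a = (0, -1) then 0 else if a = (1, 0) then 1 else if a = (0, 1) then 2 else 3

/-- Both sides are the signed quarter turn at the lattice point. On the right it is the change of
`angle`, corrected by 4 where the angle jumps, between west and south. Since `angle` telescopes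
around a circle, the weights on the left add up to four times the turning number. -/
theorem turnCount_of_joined {ρ : D.Resolution} {c r : Fin n} {d d' : Dir}
    (h : Joined ρ c r d d') (h1 : D.HasEnd c r d) (h2 : D.HasEnd c r d') :
    ((if d'.vert then kappa ρ c r else 0) - if d.vert then kappa ρ c r else 0) =
      4 * turnCount (-d.vec) d'.vec + angle d'.vec - angle (-d.vec) := by
  by_cases hc : D.IsCrossing c r
  · have a := h.2 hc
    have hk : kappa ρ c r = if ρ ⟨(c, r), hc⟩ then 1 else -1 := by simp [kappa, hc]
    rw [hk]
    generalize ρ ⟨(c, r), hc⟩ = x at a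
    cases x <;> cases d <;> cases d' <;> simp [smoothingJoins] at a <;>
      simp [Dir.vert, Dir.vec, turnCount, angle]
  · obtain ⟨k1, k2, k3⟩ := D.fin_corner_iff c r
    have hd := h.1
    have hk : kappa ρ c r = if (r : ℕ) = D.lo c ∨ (r : ℕ) = D.hi c then
        (if ((r : ℕ) = D.lo c ↔ (c : ℕ) = D.lft r) then -1 else 1) else 0 := by
      simp [kappa, hc, Fin.ext_iff]
    rw [hk]
    cases d <;> cases d' <;> (try exact absurd rfl hd) <;>
      simp only [HasEnd, IsCrossing, Fin.lt_def, Fin.le_def] at h1 h2 hc <;>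
      simp only [Dir.vert, Dir.vec, turnCount, angle] <;>
      simp <;> split_ifs <;> omega

open Classical in
/-- The refined corner point between an edge and the next one. -/
def refPoint (ρ : D.Resolution) (e : D.Edge) (j : ℕ) : ℤ × ℤ :=
  -- The lattice is refined by a factor of three to separate the arcs of a smoothing. Each edge has
  -- two inner points; the third point is the lattice point at its head, moved diagonally into the
  -- smoothed corner at a crossing.
  if j = 0 then 3 • tailPoint e + heading e
  else if j = 1 then 3 • tailPoint e + 2 • heading e
  else 3 • (tailPoint e + heading e) +
    if ∃ c r : Fin n, D.IsCrossing c r ∧ tailPoint e + heading e = (((c : ℕ) : ℤ), ((r : ℕ) : ℤ)) then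
      heading (next ρ e) - heading e else 0

open Classical in
theorem refPoint_spec (ρ : D.Resolution) (e : D.Edge) : ∃ c r d d', e.LeavesAt d c r ∧
    (next ρ e).LeavesAt d' c r ∧ Joined ρ c r d d' ∧ D.chiOut c r d = -1 ∧
      D.chiOut c r d' = 1 ∧
    heading e = -d.vec ∧ heading (next ρ e) = d'.vec ∧
    refPoint ρ e 0 = 3 • (((c : ℕ) : ℤ), ((r : ℕ) : ℤ)) + 2 • d.vec ∧
    refPoint ρ e 1 = 3 • (((c : ℕ) : ℤ), ((r : ℕ) : ℤ)) + d.vec ∧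
    refPoint ρ e 2 = 3 • (((c : ℕ) : ℤ), ((r : ℕ) : ℤ)) +
      (if D.IsCrossing c r then d.vec + d'.vec else 0) ∧
    refPoint ρ (next ρ e) 0 = 3 • (((c : ℕ) : ℤ), ((r : ℕ) : ℤ)) + d'.vec ∧
    refPoint ρ (next ρ e) 1 = 3 • (((c : ℕ) : ℤ), ((r : ℕ) : ℤ)) + 2 • d'.vec := by
  obtain ⟨c, r, d, d', h1, h2, h3, h4, h5⟩ := next_spec ρ e
  refine ⟨c, r, d, d', h1, h2, h3, h4, h5, ?_⟩
  obtain ⟨a1, a2⟩ := h1.head h4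
  obtain ⟨b1, b2⟩ := h2.tail h5
  refine ⟨a1, b1, ?_, ?_, ?_, ?_, ?_⟩
  · simp only [refPoint, a1, a2, if_true]; module
  · simp only [refPoint, a1, a2, if_true, if_false, one_ne_zero]; module
  · have : (∃ c' r' : Fin n, D.IsCrossing c' r' ∧
        tailPoint e + heading e = (((c' : ℕ) : ℤ), ((r' : ℕ) : ℤ))) ↔ D.IsCrossing c r := by
      rw [a1, a2, add_neg_cancel_right]
      constructor
      · rintro ⟨c', r', h, h'⟩
        simp only [Prod.mk.injEq, Nat.cast_inj] at h'
        rwa [Fin.ext h'.1, Fin.ext h'.2]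
      · exact fun h => ⟨c, r, h, rfl⟩
    simp only [refPoint, this, if_false, OfNat.ofNat_ne_zero, OfNat.ofNat_ne_one]
    rw [a1, a2, b1, add_neg_cancel_right]
    split_ifs
    · module
    · rfl
  · simp only [refPoint, b1, b2, if_true]
  · simp only [refPoint, b1, b2, if_true, if_false, one_ne_zero]

theorem isUnitStep_vec (d : Dir) : IsUnitStep d.vec := by
  cases d <;> simp [IsUnitStep, Dir.vec]

/-- Cutting the corner at a crossing replaces one turn by the same turn, its reverse and the same
turn again, and `turnCount` is antisymmetric; so the refinement does not affect the turning. -/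
theorem refPoint_steps (ρ : D.Resolution) (e : D.Edge) :
    IsUnitStep (refPoint ρ e 1 - refPoint ρ e 0) ∧
    IsUnitStep (refPoint ρ e 2 - refPoint ρ e 1) ∧
    IsUnitStep (refPoint ρ (next ρ e) 0 - refPoint ρ e 2) ∧
    turnCount (refPoint ρ e 1 - refPoint ρ e 0) (refPoint ρ e 2 - refPoint ρ e 1) +
      turnCount (refPoint ρ e 2 - refPoint ρ e 1) (refPoint ρ (next ρ e) 0 - refPoint ρ e 2) +
      turnCount (refPoint ρ (next ρ e) 0 - refPoint ρ e 2)
        (refPoint ρ (next ρ e) 1 - refPoint ρ (next ρ e) 0) =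
      turnCount (heading e) (heading (next ρ e)) := by
  obtain ⟨c, r, d, d', -, -, -, -, -, a1, b1, r0, r1, r2, s0, s1⟩ := refPoint_spec ρ e
  have t1 : refPoint ρ e 1 - refPoint ρ e 0 = -d.vec := by rw [r0, r1]; module
  have t4 : refPoint ρ (next ρ e) 1 - refPoint ρ (next ρ e) 0 = d'.vec := by rw [s0, s1]; module
  have ud := (isUnitStep_vec d).neg
  have ud' := isUnitStep_vec d'
  have anti : ∀ a b, turnCount a b = -turnCount b a := fun a b => by
    simp only [turnCount, and_comm (a := a = _)]; ring
  have diag : ∀ a, turnCount a a = 0 := fun a => by have := anti a a; omega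
  by_cases hc : D.IsCrossing c r
  · rw [if_pos hc] at r2
    have t2 : refPoint ρ e 2 - refPoint ρ e 1 = d'.vec := by rw [r2, r1]; module
    have t3 : refPoint ρ (next ρ e) 0 - refPoint ρ e 2 = -d.vec := by rw [r2, s0]; module
    rw [t1, t2, t3, t4, a1, b1]
    refine ⟨ud, ud', ud, ?_⟩
    have := anti (-d.vec) d'.vec
    omega
  · rw [if_neg hc] at r2
    have t2 : refPoint ρ e 2 - refPoint ρ e 1 = -d.vec := by rw [r2, r1]; module
    have t3 : refPoint ρ (next ρ e) 0 - refPoint ρ e 2 = d'.vec := by rw [r2, s0]; module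
    rw [t1, t2, t3, t4, a1, b1]
    refine ⟨ud, ud, ud', ?_⟩
    rw [diag, diag]
    ring

theorem refPoint_inner (ρ : D.Resolution) (e : D.Edge) {j : ℕ} (hj : j < 2) :
    ∃ t : ℤ, (t = 1 ∨ t = 2) ∧ (t = if j = 0 then (if chi e = 1 then 1 else 2) else
      (if chi e = 1 then 2 else 1)) ∧
    refPoint ρ e j = if e.1.1 then (3 * ((e.1.2.1 : ℕ) : ℤ), 3 * ((e.1.2.2 : ℕ) : ℤ) + t)
      else (3 * ((e.1.2.1 : ℕ) : ℤ) + t, 3 * ((e.1.2.2 : ℕ) : ℤ)) := by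
  have hc := chi_eq e
  refine ⟨_, ?_, rfl, ?_⟩
  · split_ifs <;> simp
  · unfold refPoint tailPoint heading
    interval_cases j <;> rcases hc with h | h <;> cases e.1.1 <;> simp [h] <;> ring

open Classical in
-- This makes the refined path of a circle simple. An inner point has one coordinate not divisible
-- by three, which identifies the edge; a corner point is within distance one, in each coordinate,
-- of the triple of a unique lattice point.
theorem refPoint_injective (ρ : D.Resolution) {e e' : D.Edge} {j j' : ℕ} (hj : j < 3)
    (hj' : j' < 3) (h : refPoint ρ e j = refPoint ρ e' j') : e = e' ∧ j = j' := by
  have inner_outer : ∀ (e e' : D.Edge) (j : ℕ), j < 2 → refPoint ρ e j ≠ refPoint ρ e' 2 := by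
    intro e e' j hj h
    obtain ⟨t, ht, -, h1⟩ := refPoint_inner ρ e hj
    obtain ⟨c, r, d, d', -, -, hJ, -, -, a1, b1, r0, r1, r2, s0, s1⟩ := refPoint_spec ρ e'
    rw [h1, r2] at h
    by_cases hc : D.IsCrossing c r
    · have := hJ.vert_ne hc
      rw [if_pos hc] at h
      cases d <;> cases d' <;> simp only [Dir.vert, ne_eq, not_true_eq_false] at this <;>
        split_ifs at h <;> simp [Dir.vec] at h <;> omega
    · rw [if_neg hc] at h
      split_ifs at h <;> simp at h <;> omega
  rcases Nat.lt_or_ge j 2 with hj2 | hj2 <;> rcases Nat.lt_or_ge j' 2 with hj2' | hj2'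
  · obtain ⟨t, ht, ht', h1⟩ := refPoint_inner ρ e hj2
    obtain ⟨u, hu, hu', h2⟩ := refPoint_inner ρ e' hj2'
    rw [h1, h2] at h
    have he : e = e' := by
      obtain ⟨⟨b, c, r⟩, he⟩ := e
      obtain ⟨⟨b', c', r'⟩, he'⟩ := e'
      simp only [Subtype.mk.injEq, Prod.mk.injEq, Fin.ext_iff]
      cases b <;> cases b' <;> simp at h ⊢ <;> omega
    subst he
    refine ⟨rfl, ?_⟩
    have htu : t = u := by
      split_ifs at h <;> simp at h <;> omega
    split_ifs at ht' hu' <;> omega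
  · obtain rfl : j' = 2 := by omega
    exact absurd h (inner_outer _ _ _ hj2)
  · obtain rfl : j = 2 := by omega
    exact absurd h.symm (inner_outer _ _ _ hj2')
  · obtain rfl : j = 2 := by omega
    obtain rfl : j' = 2 := by omega
    refine ⟨?_, rfl⟩
    obtain ⟨c, r, d, f, l, m, hJ, i, o, -, -, -, -, r2, -, -⟩ := refPoint_spec ρ e
    obtain ⟨c', r', d', f', l', m', hJ', i', o', -, -, -, -, r2', -, -⟩ := refPoint_spec ρ e'
    rw [r2, r2'] at h
    have bound : ∀ (c r : Fin n) (d f : Dir), Joined ρ c r d f →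
        -1 ≤ (if D.IsCrossing c r then d.vec + f.vec else 0).1 ∧ 
        (if D.IsCrossing c r then d.vec + f.vec else 0).1 ≤ 1 ∧
        -1 ≤ (if D.IsCrossing c r then d.vec + f.vec else 0).2 ∧
        (if D.IsCrossing c r then d.vec + f.vec else 0).2 ≤ 1 := by
      intro c r d f hJ
      split_ifs with hc
      · have := hJ.vert_ne hc
        cases d <;> cases f <;> simp [Dir.vert, Dir.vec] at this ⊢
      · simp
    have b1 := bound _ _ _ _ hJ
    have b2 := bound _ _ _ _ hJ'
    rw [Prod.ext_iff] at h
    simp only [Prod.fst_add, Prod.snd_add, Prod.smul_fst, Prod.smul_snd] at h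
    have hcc : c = c' := by apply Fin.ext; simp at h; omega
    have hrr : r = r' := by apply Fin.ext; simp at h; omega
    subst hcc hrr
    by_cases hc : D.IsCrossing c r
    · have v := hJ.vert_ne hc
      have v' := hJ'.vert_ne hc
      obtain ⟨x1, x2, x3⟩ := D.chiOut_crossing hc
      -- At a crossing the checkerboard orientation enters along one axis only, and the displacement
      -- along this axis tells from which side.
      have : d = d' := by
        simp only [if_pos hc] at h
        cases d <;> cases d' <;> first | rfl | (exfalso; omega) | (exfalso; cases f <;> cases f' <;>
            simp [Dir.vert, Dir.vec] at v v' h)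
      subst this
      exact l.unique l'
    · by_contra hne
      have hd : d ≠ d' := by rintro rfl; exact hne (l.unique l')
      have := chiOut_add l.hasEnd l'.hasEnd hd fun h => absurd h hc
      omega

end GridDiagram

end

/-! ### The turning number of a circle of a resolution -/

section
namespace GridDiagram

variable {n : ℕ} {D : GridDiagram n}

/-- The refined lattice path along a circle. -/
def refPath (ρ : D.Resolution) (e : D.Edge) (m : ℕ) : ℤ × ℤ :=
  refPoint ρ ((next ρ)^[m / 3] e) (m % 3)

theorem refPath_zero (ρ : D.Resolution) (e : D.Edge) (k : ℕ) :
    refPath ρ e (3 * k) = refPoint ρ ((next ρ)^[k] e) 0 := by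
  rw [refPath, Nat.mul_div_cancel_left _ (by omega), Nat.mul_mod_right]

theorem refPath_one (ρ : D.Resolution) (e : D.Edge) (k : ℕ) :
    refPath ρ e (3 * k + 1) = refPoint ρ ((next ρ)^[k] e) 1 := by
  rw [refPath]; congr 3 <;> omega

theorem refPath_two (ρ : D.Resolution) (e : D.Edge) (k : ℕ) :
    refPath ρ e (3 * k + 2) = refPoint ρ ((next ρ)^[k] e) 2 := by
  rw [refPath]; congr 3 <;> omega

theorem refPath_three (ρ : D.Resolution) (e : D.Edge) (k : ℕ) :
    refPath ρ e (3 * k + 3) = refPoint ρ (next ρ ((next ρ)^[k] e)) 0 := by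
  rw [← Function.iterate_succ_apply' (next ρ)]; exact refPath_zero ρ e (k + 1)

theorem refPath_four (ρ : D.Resolution) (e : D.Edge) (k : ℕ) :
    refPath ρ e (3 * k + 4) = refPoint ρ (next ρ ((next ρ)^[k] e)) 1 := by
  rw [← Function.iterate_succ_apply' (next ρ)]; exact refPath_one ρ e (k + 1)

theorem sum_turnCount_refPath (ρ : D.Resolution) (e : D.Edge) (L : ℕ) :
    ∑ k ∈ Finset.range (3 * L), turnCount (refPath ρ e (k + 1) - refPath ρ e k)
        (refPath ρ e (k + 2) - refPath ρ e (k + 1)) =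
      ∑ k ∈ Finset.range L,
        turnCount (heading ((next ρ)^[k] e)) (heading (next ρ ((next ρ)^[k] e))) := by
  induction L with
  | zero => rfl
  | succ L ih =>
    rw [Finset.sum_range_succ, ← ih, show 3 * (L + 1) = 3 * L + 1 + 1 + 1 by ring,
      Finset.sum_range_succ, Finset.sum_range_succ, Finset.sum_range_succ]
    have := (refPoint_steps ρ ((next ρ)^[L] e)).2.2.2
    simp only [add_assoc, Nat.reduceAdd, refPath_zero, refPath_one, refPath_two,
      refPath_three, refPath_four] at this ⊢
    rw [this]

/-- The contributions of `angle` cancel around the closed circle, and the weights at tails may be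
summed one edge later. -/
theorem sum_kappa_eq_turnCount (ρ : D.Resolution) (e : D.Edge) (L : ℕ)
    (hL : (next ρ)^[L] e = e) :
    ∑ k ∈ Finset.range L, chi ((next ρ)^[k] e) * edgeTurn ρ ((next ρ)^[k] e) =
      4 * ∑ k ∈ Finset.range L,
        turnCount (heading ((next ρ)^[k] e)) (heading (next ρ ((next ρ)^[k] e))) := by
  have shift : ∀ f : D.Edge → ℤ, ∑ k ∈ Finset.range L, f (next ρ ((next ρ)^[k] e)) =
      ∑ k ∈ Finset.range L, f ((next ρ)^[k] e) := by
    intro f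
    have h1 := Finset.sum_range_succ (fun k => f ((next ρ)^[k] e)) L
    have h2 := Finset.sum_range_succ' (fun k => f ((next ρ)^[k] e)) L
    simp only [Function.iterate_succ_apply', hL, Function.iterate_zero, id] at h1 h2
    linarith
  have step : ∀ e : D.Edge, kappaTail ρ (next ρ e) - kappaHead ρ e =
      4 * turnCount (heading e) (heading (next ρ e)) + angle (heading (next ρ e)) -
        angle (heading e) := by
    intro e
    obtain ⟨c, r, d, d', h1, h2, h3, h4, h5⟩ := next_spec ρ e
    rw [h2.kappaTail h5, h1.kappaHead h4, (h1.head h4).1, (h2.tail h5).1]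
    exact turnCount_of_joined h3 h1.hasEnd h2.hasEnd
  have hs := Finset.sum_congr rfl fun k (_ : k ∈ Finset.range L) => step ((next ρ)^[k] e)
  simp only [← kappaTail_sub_kappaHead]
  rw [Finset.sum_sub_distrib, Finset.sum_sub_distrib, Finset.sum_add_distrib, shift (kappaTail ρ),
    shift (fun e => angle (heading e)), ← Finset.mul_sum] at hs
  rw [Finset.sum_sub_distrib]
  linarith

open Classical in
/-- With its checkerboard orientation, every circle turns once around, in the direction of some
vertical edge in its rightmost column. -/
theorem circle_turning (ρ : D.Resolution) (e : D.Edge) : ∃ σ : ℤ, (σ = 1 ∨ σ = -1) ∧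
      (∑ e', if circleOf ρ e' = circleOf ρ e then chi e' * edgeTurn ρ e' else 0) = 4 * σ ∧
      ∃ f : D.Edge, circleOf ρ f = circleOf ρ e ∧ f.1.1 = true ∧ chi f = σ ∧
        ∀ e' : D.Edge, circleOf ρ e' = circleOf ρ e → e'.1.1 = true → e'.1.2.1 ≤ f.1.2.1 := by
  obtain ⟨L, hL, hper, hinj, hsum⟩ := sum_circle ρ e (fun e => chi e * edgeTurn ρ e)
  have iterL : ∀ k, (next ρ)^[k + L] e = (next ρ)^[k] e := fun k => by
    rw [Function.iterate_add_apply, hper]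
  have cases3 : ∀ i, ∃ k, i = 3 * k ∨ i = 3 * k + 1 ∨ i = 3 * k + 2 := fun i => ⟨i / 3, by omega⟩
  obtain ⟨σ, hσ, hs, k, hk, hmax⟩ := turning_number (p := refPath ρ e) (N := 3 * L) (by omega)
    (fun i => by
      rw [refPath, refPath, Nat.add_mul_mod_self_left, Nat.add_mul_div_left _ _ (by omega), iterL])
    (fun i => by
      obtain ⟨k, rfl | rfl | rfl⟩ := cases3 i
      · rw [refPath_zero, refPath_one]; exact (refPoint_steps _ _).1
      · rw [refPath_one, refPath_two]; exact (refPoint_steps _ _).2.1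
      · rw [refPath_two, refPath_three]; exact (refPoint_steps _ _).2.2.1)
    (fun i j hij hj h => by
      obtain ⟨h1, h2⟩ := refPoint_injective ρ (Nat.mod_lt _ (by omega)) (Nat.mod_lt _ (by omega)) h
      have : i / 3 < j / 3 := by omega
      exact hinj _ _ this (by omega) h1.symm)
  rw [sum_turnCount_refPath] at hs
  refine ⟨σ, hσ, ?_, ?_⟩
  · rw [← hsum, sum_kappa_eq_turnCount ρ e L hper, hs]
  have vertX : ∀ f : D.Edge, f.1.1 = true → (refPoint ρ f 0).1 = 3 * ((f.1.2.1 : ℕ) : ℤ) := by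
    intro f hf
    obtain ⟨t, -, -, h⟩ := refPoint_inner ρ f (j := 0) (by omega)
    rw [h, hf]
    rfl
  have vertOf : ∀ f : D.Edge, heading f = (0, σ) → f.1.1 = true ∧ chi f = σ := by
    intro f hf
    have := chi_eq f
    unfold heading at hf
    split_ifs at hf with h
    · exact ⟨h, by simpa using hf⟩
    · simp only [Prod.mk.injEq] at hf; omega
  -- The rightmost vertical step of the refined path has to be traced back to a vertical edge of the
  -- circle. It is an inner step of an edge, a step into a corner or a step out of a corner.
  have finish : ∀ m, heading ((next ρ)^[m] e) = (0, σ) →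
      (refPath ρ e k).1 = (refPoint ρ ((next ρ)^[m] e) 0).1 →
      ∃ f : D.Edge, circleOf ρ f = circleOf ρ e ∧ f.1.1 = true ∧ chi f = σ ∧
        ∀ e' : D.Edge, circleOf ρ e' = circleOf ρ e → e'.1.1 = true → e'.1.2.1 ≤ f.1.2.1 := by
    intro m h1 h2
    obtain ⟨h3, h4⟩ := vertOf _ h1
    refine ⟨_, circleOf_iterate_next ρ e m, h3, h4, fun e' he' hv => ?_⟩
    obtain ⟨q, rfl⟩ := exists_iterate_next he'.symm
    have := hmax (3 * q)
    rw [h2, vertX _ h3, refPath_zero, vertX _ hv] at this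
    rw [Fin.le_def]
    omega
  obtain ⟨m, rfl | rfl | rfl⟩ := cases3 k
  · obtain ⟨c, r, d, d', -, -, hJ, -, -, a1, b1, r0, r1, r2, s0, s1⟩ :=
      refPoint_spec ρ ((next ρ)^[m] e)
    rw [refPath_one, refPath_zero] at hk
    refine finish m ?_ (by rw [refPath_zero])
    rw [r0, r1] at hk
    rw [a1]
    rw [show 3 • (((c : ℕ) : ℤ), ((r : ℕ) : ℤ)) + 2 • d.vec + (0, σ) =
      3 • (((c : ℕ) : ℤ), ((r : ℕ) : ℤ)) + d.vec + (d.vec + (0, σ)) by module] at hk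
    have h2 := left_eq_add.1 hk
    rw [neg_eq_iff_add_eq_zero, h2]
  · obtain ⟨c, r, d, d', -, -, hJ, -, -, a1, b1, r0, r1, r2, s0, s1⟩ :=
      refPoint_spec ρ ((next ρ)^[m] e)
    have m1 := hmax (3 * m)
    have m3 := hmax (3 * m + 3)
    rw [show 3 * m + 1 + 1 = 3 * m + 2 by ring, refPath_two, refPath_one, r1, r2] at hk
    rw [refPath_zero, refPath_one, r0, r1] at m1
    rw [refPath_three, refPath_one, s0, r1] at m3
    -- At a crossing this step would belong to a cut corner, and one of the neighbouring points of
    -- the path would lie further to the right.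
    by_cases hc : D.IsCrossing c r
    · exfalso
      have := hJ.vert_ne hc
      rw [if_pos hc] at hk
      cases d <;> cases d' <;> simp [Dir.vec, Dir.vert] at hk m1 m3 this
    · rw [if_neg hc] at hk
      have h2 : d.vec + (0, σ) = 0 := by
        rw [add_assoc] at hk
        exact (add_left_cancel hk).symm
      have h3 : heading ((next ρ)^[m] e) = (0, σ) := by rw [a1, neg_eq_iff_add_eq_zero, h2]
      refine finish m h3 ?_
      have h4 := congrArg Prod.fst h2
      rw [refPath_one, r0, r1]
      simp at h4 ⊢
      omega
  · obtain ⟨c, r, d, d', -, -, hJ, -, -, a1, b1, r0, r1, r2, s0, s1⟩ :=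
      refPoint_spec ρ ((next ρ)^[m] e)
    have m1 := hmax (3 * m + 1)
    have m3 := hmax (3 * m + 4)
    rw [show 3 * m + 2 + 1 = 3 * m + 3 by ring, refPath_two, refPath_three, s0, r2] at hk
    rw [refPath_one, refPath_two, r1, r2] at m1
    rw [refPath_four, refPath_two, s1, r2] at m3
    by_cases hc : D.IsCrossing c r
    · exfalso
      have := hJ.vert_ne hc
      rw [if_pos hc] at hk m1 m3
      cases d <;> cases d' <;> simp [Dir.vec, Dir.vert] at hk m1 m3 this
    · rw [if_neg hc] at hk
      have h2 : d'.vec = (0, σ) := by rw [add_zero] at hk; exact add_left_cancel hk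
      refine finish (m + 1) ?_ ?_
      · rw [Function.iterate_succ_apply', b1, h2]
      · rw [Function.iterate_succ_apply', refPath_two, r2, s0, h2, if_neg hc]
        simp

end GridDiagram

end

section
namespace GridDiagram

variable {n : ℕ} {D : GridDiagram n}

/-! ### The signed area of a circle -/

section Winding

open Classical

variable (ρ : D.Resolution) (C : D.Circle ρ)

/-- The head of each edge is the tail of the next, so `nextPerm` cancels the values of the
potential. Indicator functions as potentials give the local rules for winding numbers. -/
theorem sum_circle_potential (φ : ℤ × ℤ → ℤ) :
    (∑ e, if circleOf ρ e = C then φ (tailPoint e + heading e) - φ (tailPoint e) else 0) = 0 := by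
  have h1 : (∑ e, if circleOf ρ e = C then φ (tailPoint e + heading e) else 0) =
      ∑ e, if circleOf ρ e = C then φ (tailPoint e) else 0 := by
    rw [← Equiv.sum_comp (nextPerm ρ) (fun e => if circleOf ρ e = C then φ (tailPoint e) else 0)]
    refine Finset.sum_congr rfl fun e _ => ?_
    change _ = if circleOf ρ (next ρ e) = C then φ (tailPoint (next ρ e)) else 0
    rw [circleOf_next]
    obtain ⟨c, r, d, d', h1, h2, h3, h4, h5⟩ := next_spec ρ e
    rw [(h1.head h4).1, (h1.head h4).2, (h2.tail h5).2, add_neg_cancel_right]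
  have h2 : ∀ e : D.Edge,
      (if circleOf ρ e = C then φ (tailPoint e + heading e) - φ (tailPoint e) else 0) =
      (if circleOf ρ e = C then φ (tailPoint e + heading e) else 0) -
        if circleOf ρ e = C then φ (tailPoint e) else 0 := fun e => by split_ifs <;> simp
  simp only [h2]
  rw [Finset.sum_sub_distrib, h1, sub_self]

/-- The winding number of a circle around the face to the right of column `x`, above row `y`. -/
def winding' (x y : ℤ) : ℤ := ∑ e : D.Edge, if circleOf ρ e = C then
  (if e.1.1 = true ∧ x < ((e.1.2.1 : ℕ) : ℤ) ∧ ((e.1.2.2 : ℕ) : ℤ) = y then chi e else 0) else 0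

/-- The flow of a circle through the vertical or horizontal lattice edge at `(x, y)`. -/
def flow (b : Bool) (x y : ℤ) : ℤ := ∑ e : D.Edge, if circleOf ρ e = C then
  (if e.1.1 = b ∧ ((e.1.2.1 : ℕ) : ℤ) = x ∧ ((e.1.2.2 : ℕ) : ℤ) = y then chi e else 0) else 0

theorem flow_eq_chi {e : D.Edge} (he : circleOf ρ e = C) :
    flow ρ C e.1.1 (e.1.2.1 : ℕ) (e.1.2.2 : ℕ) = chi e := by
  unfold flow
  rw [Finset.sum_eq_single e]
  · simp [he]
  · rintro ⟨⟨b, c, r⟩, he'⟩ - hne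
    refine ite_eq_right_iff.2 fun _ => if_neg fun h => hne ?_
    obtain ⟨⟨b', c', r'⟩, he⟩ := e
    simp only [Nat.cast_inj, ← Fin.ext_iff] at h
    simp only [Subtype.mk.injEq, Prod.mk.injEq]
    exact h
  · simp

theorem flow_eq_zero (b : Bool) (x y : ℤ)
    (h : ∀ e : D.Edge, circleOf ρ e = C → e.1.1 = b → ((e.1.2.1 : ℕ) : ℤ) = x →
      ((e.1.2.2 : ℕ) : ℤ) = y → False) : flow ρ C b x y = 0 :=
  Finset.sum_eq_zero fun e _ => by
    split_ifs with h1 h2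
    · exact (h e h1 h2.1 h2.2.1 h2.2.2).elim
    all_goals rfl

theorem winding'_left (x y : ℤ) : winding' ρ C (x - 1) y = winding' ρ C x y + flow ρ C true x y := by
  unfold winding' flow
  rw [← Finset.sum_add_distrib]
  refine Finset.sum_congr rfl fun e _ => ?_
  cases e.1.1 <;> simp <;> split_ifs <;> omega

theorem heading_potential (e : D.Edge) (φ : ℤ × ℤ → ℤ) :
    φ (tailPoint e + heading e) - φ (tailPoint e) = chi e *
      (φ ((((e.1.2.1 : ℕ) : ℤ), ((e.1.2.2 : ℕ) : ℤ)) + if e.1.1 then (0, 1) else (1, 0)) -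
        φ (((e.1.2.1 : ℕ) : ℤ), ((e.1.2.2 : ℕ) : ℤ))) := by
  unfold tailPoint heading
  rcases chi_eq e with h | h <;> cases e.1.1 <;> simp [h]

theorem winding'_up (x y : ℤ) :
    winding' ρ C x y = winding' ρ C x (y - 1) + flow ρ C false x y := by
  have := sum_circle_potential ρ C (fun p => if x < p.1 ∧ p.2 = y then 1 else 0)
  simp only [fun e : D.Edge => heading_potential e (fun p => if x < p.1 ∧ p.2 = y then 1 else 0)]
    at this
  have h2 : winding' ρ C x (y - 1) + flow ρ C false x y - winding' ρ C x y = 0 := by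
    rw [← this]
    unfold winding' flow
    rw [← Finset.sum_add_distrib, ← Finset.sum_sub_distrib]
    refine Finset.sum_congr rfl fun e _ => ?_
    by_cases hC : circleOf ρ e = C
    · simp only [hC, if_true]
      cases e.1.1 <;> simp <;> split_ifs <;> omega
    · simp [hC]
  linarith

theorem winding'_outer (y : ℤ) : winding' ρ C (-1) y = 0 := by
  have := sum_circle_potential ρ C (fun p => if y < p.2 then 1 else 0)
  simp only [fun e : D.Edge => heading_potential e (fun p => if y < p.2 then 1 else 0)] at this
  rw [← this]
  unfold winding'
  refine Finset.sum_congr rfl fun e _ => ?_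
  by_cases hC : circleOf ρ e = C
  · simp only [hC, if_true]
    cases e.1.1 <;> simp <;> split_ifs <;> omega
  · simp [hC]

/-- The winding number around the face to the right of an edge of the circle. -/
def rightWinding (e : D.Edge) : ℤ :=
  if e.1.1 then winding' ρ C ((e.1.2.1 : ℕ) - if chi e = 1 then 0 else 1) (e.1.2.2 : ℕ)
  else winding' ρ C (e.1.2.1 : ℕ) ((e.1.2.2 : ℕ) - if chi e = 1 then 1 else 0)

theorem vertical_windings {e : D.Edge} (he : circleOf ρ e = C) (hv : e.1.1 = true) :
    (chi e = 1 ∧ winding' ρ C (e.1.2.1 : ℕ) (e.1.2.2 : ℕ) = rightWinding ρ C e ∧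
      winding' ρ C ((e.1.2.1 : ℕ) - 1) (e.1.2.2 : ℕ) = rightWinding ρ C e + 1) ∨
    (chi e = -1 ∧ winding' ρ C (e.1.2.1 : ℕ) (e.1.2.2 : ℕ) = rightWinding ρ C e + 1 ∧
      winding' ρ C ((e.1.2.1 : ℕ) - 1) (e.1.2.2 : ℕ) = rightWinding ρ C e) := by
  have h := flow_eq_chi ρ C he
  have h2 := winding'_left ρ C (e.1.2.1 : ℕ) (e.1.2.2 : ℕ)
  rw [hv] at h
  rw [h] at h2
  simp only [rightWinding, hv, if_true]
  rcases chi_eq e with h1 | h1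
  · refine Or.inl ⟨h1, ?_, ?_⟩ <;> rw [if_pos h1] <;> simp only [sub_zero] <;> omega
  · refine Or.inr ⟨h1, ?_, ?_⟩ <;> rw [if_neg (by omega)]
    omega

theorem flow_zero_of_not_hasEnd {c r : Fin n} (d : Dir) (hd : ¬ D.HasEnd c r d) : (match d with
      | .north => flow ρ C true (c : ℕ) (r : ℕ)
      | .south => flow ρ C true (c : ℕ) ((r : ℕ) - 1)
      | .east => flow ρ C false (c : ℕ) (r : ℕ)
      | .west => flow ρ C false ((c : ℕ) - 1) (r : ℕ)) = 0 := by
  cases d <;> refine flow_eq_zero _ _ _ _ _ fun f _ hb hx hy => hd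
    (Edge.LeavesAt.hasEnd (e := f) ?_) <;> simp only [Edge.LeavesAt, Fin.ext_iff] <;>
    exact ⟨hb, by omega, by omega⟩

theorem flow_of_leavesAt {c r : Fin n} {d : Dir} {e : D.Edge} (h : e.LeavesAt d c r)
    (he : circleOf ρ e = C) : (match d with
      | .north => flow ρ C true (c : ℕ) (r : ℕ)
      | .south => flow ρ C true (c : ℕ) ((r : ℕ) - 1)
      | .east => flow ρ C false (c : ℕ) (r : ℕ)
      | .west => flow ρ C false ((c : ℕ) - 1) (r : ℕ)) = d.sgn * D.chiOut c r d := by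
  have q := h.sgn_mul_chi
  have f := flow_eq_chi ρ C he
  cases d <;> obtain ⟨h0, h1, h2⟩ := h <;> simp only [Dir.sgn] at q ⊢ <;> rw [h0] at f
  · rw [← h1, ← h2, f, h1, h2]; omega
  · rw [← h1, ← h2, f, h1, h2]; omega
  · rw [← h2, Nat.cast_add, Nat.cast_one, add_sub_cancel_right, ← h1, f, h1]; omega
  · rw [← h1, Nat.cast_add, Nat.cast_one, add_sub_cancel_right, ← h2, f, h2]; omega

theorem rightWinding_out {c r : Fin n} {d : Dir} {e : D.Edge} (h : e.LeavesAt d c r)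
    (hd : D.chiOut c r d = 1) : rightWinding ρ C e = (match d with
      | .north => winding' ρ C (c : ℕ) (r : ℕ)
      | .south => winding' ρ C ((c : ℕ) - 1) ((r : ℕ) - 1)
      | .east => winding' ρ C (c : ℕ) ((r : ℕ) - 1)
      | .west => winding' ρ C ((c : ℕ) - 1) (r : ℕ)) := by
  have q := h.sgn_mul_chi
  rw [hd] at q
  cases d <;> obtain ⟨h0, h1, h2⟩ := h <;> simp only [Dir.sgn] at q ⊢
  · simp [rightWinding, h0, show chi e = 1 by omega, h1, h2]
  · simp [rightWinding, h0, show chi e = 1 by omega, h1, h2]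
  · simp [rightWinding, h0, show chi e = -1 by omega, h1, ← h2]
  · simp [rightWinding, h0, show chi e = -1 by omega, ← h1, h2]

theorem rightWinding_in {c r : Fin n} {d : Dir} {e : D.Edge} (h : e.LeavesAt d c r)
    (hd : D.chiOut c r d = -1) : rightWinding ρ C e = (match d with
      | .north => winding' ρ C ((c : ℕ) - 1) (r : ℕ)
      | .south => winding' ρ C (c : ℕ) ((r : ℕ) - 1)
      | .east => winding' ρ C (c : ℕ) (r : ℕ)
      | .west => winding' ρ C ((c : ℕ) - 1) ((r : ℕ) - 1)) := by
  have q := h.sgn_mul_chi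
  rw [hd] at q
  cases d <;> obtain ⟨h0, h1, h2⟩ := h <;> simp only [Dir.sgn] at q ⊢
  · simp [rightWinding, h0, show chi e = -1 by omega, h1, h2]
  · simp [rightWinding, h0, show chi e = -1 by omega, h1, h2]
  · simp [rightWinding, h0, show chi e = 1 by omega, h1, ← h2]
  · simp [rightWinding, h0, show chi e = 1 by omega, ← h1, h2]

/-- At a right turn the face on the right stays the same. At a left turn the two faces are separated
by two edges of the circle with opposite flows, and on a straight passage only by a place without an
edge. -/
theorem rightWinding_next {e : D.Edge} (he : circleOf ρ e = C) :
    rightWinding ρ C (next ρ e) = rightWinding ρ C e := by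
  obtain ⟨c, r, d, d', h1, h2, h3, h4, h5⟩ := next_spec ρ e
  have he' : circleOf ρ (next ρ e) = C := by rw [circleOf_next, he]
  rw [rightWinding_in ρ C h1 h4, rightWinding_out ρ C h2 h5]
  have f1 := flow_of_leavesAt ρ C h1 he
  have f2 := flow_of_leavesAt ρ C h2 he'
  have w1 := winding'_left ρ C (c : ℕ) (r : ℕ)
  have w2 := winding'_left ρ C (c : ℕ) ((r : ℕ) - 1)
  have w3 := winding'_up ρ C (c : ℕ) (r : ℕ)
  have w4 := winding'_up ρ C ((c : ℕ) - 1) (r : ℕ)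
  -- Collinear ends are joined only in the interior of a single segment, where no perpendicular end
  -- exists.
  have straight : d.vert = d'.vert → ∀ d₁, d₁.vert ≠ d.vert → ¬ D.HasEnd c r d₁ := by
    intro hv d₁ h₁ hE
    have hc : ¬ D.IsCrossing c r := fun hc => h3.vert_ne hc hv
    have a := chiOut_add h1.hasEnd hE (by rintro rfl; exact h₁ rfl) fun h => absurd h hc
    have b := chiOut_add h2.hasEnd hE (by rintro rfl; exact h₁ hv.symm) fun h => absurd h hc
    omega
  have zero := fun d => flow_zero_of_not_hasEnd ρ C (c := c) (r := r) d
  have zn := zero .north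
  have zs := zero .south
  have ze := zero .east
  have zw := zero .west
  have hd := h3.1
  cases d <;> cases d' <;> (try exact absurd rfl hd) <;>
    simp only [Dir.sgn, h4, h5] at f1 f2 ⊢ <;> try omega
  · have := ze (straight rfl _ (by simp [Dir.vert])); simp only at this; omega
  · have := zn (straight rfl _ (by simp [Dir.vert])); simp only at this; omega
  · have := zw (straight rfl _ (by simp [Dir.vert])); simp only at this; omega
  · have := zs (straight rfl _ (by simp [Dir.vert])); simp only at this; omega

theorem rightWinding_eq {e e' : D.Edge} (he : circleOf ρ e = C) (he' : circleOf ρ e' = C) :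
    rightWinding ρ C e = rightWinding ρ C e' := by
  obtain ⟨k, rfl⟩ := exists_iterate_next (he.trans he'.symm)
  clear he'
  induction k with
  | zero => rfl
  | succ k ih =>
    rw [Function.iterate_succ_apply', rightWinding_next, ih]
    rw [circleOf_iterate_next, he]

theorem winding'_eq_zero {x y : ℤ}
    (h : ∀ e : D.Edge, circleOf ρ e = C → e.1.1 = true → ((e.1.2.1 : ℕ) : ℤ) ≤ x) :
    winding' ρ C x y = 0 :=
  Finset.sum_eq_zero fun e _ => by
    split_ifs with h1 h2
    · have := h e h1 h2.1; omega
    all_goals rfl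

/-- Coming from the far right, where the winding number is zero, it changes only across edges of the
circle; beside these it is `rightWinding` or `rightWinding + 1`, the same two values along the whole
circle. -/
theorem winding'_values {e : D.Edge} (he : circleOf ρ e = C) (k : ℕ) (y : ℤ) :
    winding' ρ C (n - k) y = 0 ∨ winding' ρ C (n - k) y = rightWinding ρ C e ∨
      winding' ρ C (n - k) y = rightWinding ρ C e + 1 := by
  induction k with
  | zero => exact Or.inl (winding'_eq_zero ρ C fun e _ _ => by have := e.1.2.1.2; omega)
  | succ k ih =>
    have h := winding'_left ρ C (n - k) y
    rw [show ((n : ℤ) - k - 1) = n - ↑(k + 1) by push_cast; ring] at h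
    by_cases hf : ∃ f : D.Edge, circleOf ρ f = C ∧ f.1.1 = true ∧ ((f.1.2.1 : ℕ) : ℤ) = n - k ∧
      ((f.1.2.2 : ℕ) : ℤ) = y
    · obtain ⟨f, h1, h2, h3, h4⟩ := hf
      have := vertical_windings ρ C h1 h2
      rw [h3, h4, show ((n : ℤ) - k - 1) = n - ↑(k + 1) by push_cast; ring,
        rightWinding_eq ρ C h1 he] at this
      omega
    · rw [h, flow_eq_zero ρ C true _ _ fun f h1 h2 h3 h4 => hf ⟨f, h1, h2, h3, h4⟩, add_zero]
      exact ih

/-- A vertical edge in column `c` contributes to the winding numbers of the faces in the `c` columns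
of faces to its left, which is its weight in the area. -/
theorem area_eq_sum_winding' :
    (∑ e, if circleOf ρ e = C then
      (if e.1.1 = true then chi e * ((e.1.2.1 : ℕ) : ℤ) else 0) else 0) =
    ∑ x ∈ Finset.range n, ∑ y ∈ Finset.range n, winding' ρ C x y := by
  unfold winding'
  rw [Finset.sum_congr rfl fun x _ => Finset.sum_comm, Finset.sum_comm]
  refine Finset.sum_congr rfl fun e _ => ?_
  by_cases hC : circleOf ρ e = C
  · simp only [hC, if_true]
    by_cases hv : e.1.1 = true
    · simp only [hv, true_and, if_true]
      have h1 : ∀ x : ℕ, (∑ y ∈ Finset.range n, if (x : ℤ) < ((e.1.2.1 : ℕ) : ℤ) ∧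
          ((e.1.2.2 : ℕ) : ℤ) = (y : ℤ) then chi e else 0) =
          if x < (e.1.2.1 : ℕ) then chi e else 0 := by
        intro x
        rw [Finset.sum_eq_single (e.1.2.2 : ℕ)]
        · simp
        · intro b _ hb
          rw [if_neg]; rintro ⟨-, h⟩; exact hb (by exact_mod_cast h.symm)
        · intro h; exact absurd (Finset.mem_range.2 e.1.2.2.2) h
      simp only [h1]
      rw [← Finset.sum_filter, Finset.sum_const, nsmul_eq_mul]
      have : (Finset.range n).filter (fun x => x < (e.1.2.1 : ℕ)) =
          Finset.range (e.1.2.1 : ℕ) := by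
        ext x; simp only [Finset.mem_filter, Finset.mem_range]
        have := e.1.2.1.2
        omega
      rw [this, Finset.card_range, mul_comm]
    · simp [hv]
  · simp [hC]

/-- With its checkerboard orientation, every circle turns once around, and its signed area has
the sign of its turning number. -/
theorem circle_turning_area (e : D.Edge) (he : circleOf ρ e = C) : ∃ σ : ℤ, (σ = 1 ∨ σ = -1) ∧
      (∑ e', if circleOf ρ e' = C then chi e' * edgeTurn ρ e' else 0) = 4 * σ ∧
      0 < σ * ∑ e, if circleOf ρ e = C then
        (if e.1.1 = true then chi e * ((e.1.2.1 : ℕ) : ℤ) else 0) else 0 := by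
  subst he
  obtain ⟨σ, hσ, hs, f, hf, hv, hc, hmax⟩ := circle_turning ρ e
  refine ⟨σ, hσ, hs, ?_⟩
  rw [area_eq_sum_winding']
  set C := circleOf ρ e
  -- To the right of the rightmost edge `f` the winding number is zero. As `f` is directed by `σ`,
  -- this determines the two values beside the circle.
  have hz : winding' ρ C (f.1.2.1 : ℕ) (f.1.2.2 : ℕ) = 0 := winding'_eq_zero ρ C fun e' h h' => by
    have := hmax e' h h'
    rw [Fin.le_def] at this
    omega
  have hw := vertical_windings ρ C hf hv
  have hpos : 1 ≤ (f.1.2.1 : ℕ) := by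
    by_contra h0
    have h1 : (f.1.2.1 : ℕ) = 0 := by omega
    have := winding'_outer ρ C (f.1.2.2 : ℕ)
    rw [h1] at hw hz
    simp only [Nat.cast_zero, zero_sub] at hw hz
    omega
  -- All winding numbers are therefore `0` or `σ`, so the area has the sign of `σ`; it is not zero
  -- because the face to the left of `f` has winding number `σ`.
  have hval : ∀ x ∈ Finset.range n, ∀ y : ℤ, 0 ≤ σ * winding' ρ C x y := by
    intro x hx y
    rw [Finset.mem_range] at hx
    have := winding'_values ρ C hf (n - x) y
    rw [show (n : ℤ) - ↑(n - x) = x by omega] at this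
    rcases hσ with rfl | rfl <;> omega
  have hle : (((f.1.2.1 : ℕ) - 1 : ℕ) : ℤ) = ((f.1.2.1 : ℕ) : ℤ) - 1 := by omega
  rw [Finset.mul_sum]
  simp only [Finset.mul_sum]
  have hx0 : (f.1.2.1 : ℕ) - 1 ∈ Finset.range n := by
    have := f.1.2.1.2
    rw [Finset.mem_range]; omega
  refine Finset.sum_pos' (fun x hx => Finset.sum_nonneg fun y _ => hval x hx y) ⟨_, hx0, ?_⟩
  refine Finset.sum_pos' (fun y _ => hval _ hx0 y)
    ⟨(f.1.2.2 : ℕ), Finset.mem_range.2 f.1.2.2.2, ?_⟩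
  rw [hle]
  rcases hσ with rfl | rfl <;> omega

end Winding

end GridDiagram

end

section
namespace GridDiagram

variable {n : ℕ} {D : GridDiagram n}

open Classical

/-! ### Surgery on the circles at a crossing -/

/-- The turning number of a circle with its checkerboard orientation. -/
def spin (ρ : D.Resolution) (C : D.Circle ρ) : ℤ :=
  (∑ e, if circleOf ρ e = C then chi e * edgeTurn ρ e else 0) / 4

/-- The signed area of a circle with its checkerboard orientation. -/
def chiArea (ρ : D.Resolution) (C : D.Circle ρ) : ℤ :=
  ∑ e : D.Edge, if circleOf ρ e = C then
    (if e.1.1 = true then chi e * ((e.1.2.1 : ℕ) : ℤ) else 0) else 0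

theorem exists_circleOf {ρ : D.Resolution} (C : D.Circle ρ) : ∃ e, circleOf ρ e = C :=
  Quot.exists_rep C

theorem spin_spec (ρ : D.Resolution) (C : D.Circle ρ) : (spin ρ C = 1 ∨ spin ρ C = -1) ∧
    (∑ e, if circleOf ρ e = C then chi e * edgeTurn ρ e else 0) = 4 * spin ρ C ∧
    0 < spin ρ C * chiArea ρ C := by
  obtain ⟨e, he⟩ := exists_circleOf C
  obtain ⟨σ, h1, h2, h3⟩ := circle_turning_area ρ C e he
  have : spin ρ C = σ := by unfold spin; omega
  rw [this]
  exact ⟨h1, h2, h3⟩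

theorem spin_eq (ρ : D.Resolution) (C : D.Circle ρ) : spin ρ C = 1 ∨ spin ρ C = -1 :=
  (spin_spec ρ C).1

theorem Crossing.hasEnd (x : D.Crossing) (d : Dir) : D.HasEnd x.1.1 x.1.2 d := by
  obtain ⟨_, ⟨h1, h2⟩, h3, h4⟩ := x
  cases d
  exacts [⟨h1.le, h2⟩, ⟨h3.le, h4⟩, ⟨h1, h2.le⟩, ⟨h3, h4.le⟩]

/-- The edge that leaves a crossing in a given direction. -/
def Crossing.edge (x : D.Crossing) (d : Dir) : D.Edge := (D.exists_leavesAt (x.hasEnd d)).choose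

theorem Crossing.edge_leavesAt (x : D.Crossing) (d : Dir) : (x.edge d).LeavesAt d x.1.1 x.1.2 :=
  (D.exists_leavesAt (x.hasEnd d)).choose_spec

theorem Crossing.northEdge_eq (x : D.Crossing) : x.northEdge = x.edge .north :=
  Edge.LeavesAt.unique (d := .north) (c := x.1.1) (r := x.1.2) ⟨rfl, rfl, rfl⟩ (x.edge_leavesAt _)

theorem Crossing.southEdge_eq (x : D.Crossing) : x.southEdge = x.edge .south := by
  refine Edge.LeavesAt.unique (d := .south) (c := x.1.1) (r := x.1.2) ⟨rfl, rfl, ?_⟩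
    (x.edge_leavesAt _)
  have := x.2.1
  simp only [Fin.lt_def, southEdge] at *
  omega

theorem Crossing.joined {x : D.Crossing} {ρ : D.Resolution} {d d' : Dir}
    (h : smoothingJoins (ρ x) d d') : circleOf ρ (x.edge d) = circleOf ρ (x.edge d') := by
  refine circleOf_eq_of_joined ⟨?_, fun _ => Or.inl h⟩ (x.edge_leavesAt d) (x.edge_leavesAt d')
  rintro rfl
  generalize ρ x = b at h
  cases b <;> cases d <;> simp [smoothingJoins] at h

/-- The circles of `ρ` through the crossing `x` are identified. -/
def pinch (ρ : D.Resolution) (x : D.Crossing) (C : D.Circle ρ) : D.Circle ρ :=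
  if C = circleOf ρ x.southEdge then circleOf ρ x.northEdge else C

theorem pinch_edge (ρ : D.Resolution) (x : D.Crossing) (d : Dir) :
    pinch ρ x (circleOf ρ (x.edge d)) = circleOf ρ x.northEdge := by
  have : circleOf ρ (x.edge d) = circleOf ρ x.northEdge ∨
      circleOf ρ (x.edge d) = circleOf ρ x.southEdge := by
    rw [x.northEdge_eq, x.southEdge_eq]
    have hj : ∀ d d', smoothingJoins (ρ x) d d' →
      circleOf ρ (x.edge d) = circleOf ρ (x.edge d') := fun d d' => Crossing.joined
    generalize ρ x = b at hj
    cases b <;> cases d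
    · exact Or.inl rfl
    · exact Or.inl (hj .north .east trivial).symm
    · exact Or.inr rfl
    · exact Or.inr (hj .south .west trivial).symm
    · exact Or.inl rfl
    · exact Or.inr (hj .south .east trivial).symm
    · exact Or.inr rfl
    · exact Or.inl (hj .north .west trivial).symm
  unfold pinch
  split_ifs with h
  · rfl
  · exact this.resolve_right h

/-- Two resolutions that differ at most at `x`. -/
def DifferAt (x : D.Crossing) (ρ ρ' : D.Resolution) : Prop := ∀ y, y ≠ x → ρ y = ρ' y

theorem DifferAt.symm {x : D.Crossing} {ρ ρ' : D.Resolution} (h : DifferAt x ρ ρ') :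
    DifferAt x ρ' ρ := fun y hy => (h y hy).symm

theorem differAt_up (x : D.Crossing) (ρ : D.Resolution) : DifferAt x ρ (ρ.up x) :=
  fun y hy => by simp [Resolution.up, hy]

/-- Away from `x` both resolutions join the same ends, and the four ends at `x` are identified
anyway; so `pinch` is constant on the circles of either resolution. -/
theorem pinch_eq_of_circleOf_eq {x : D.Crossing} {ρ ρ' : D.Resolution} (h : DifferAt x ρ ρ')
    {e e' : D.Edge} (he : circleOf ρ' e = circleOf ρ' e') :
    pinch ρ x (circleOf ρ e) = pinch ρ x (circleOf ρ e') := by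
  refine circle_induction (ρ := ρ') (fun e => pinch ρ x (circleOf ρ e)) ?_ he
  intro e e' c r d d' h1 h2 h3
  by_cases hx : (c, r) = x.1
  · have e1 : e = x.edge d := h1.unique (by
      have := x.edge_leavesAt d; rw [← hx] at this; exact this)
    have e2 : e' = x.edge d' := h2.unique (by
      have := x.edge_leavesAt d'; rw [← hx] at this; exact this)
    simp only [e1, e2, pinch_edge]
  · refine congrArg (pinch ρ x) (circleOf_eq_of_joined (c := c) (r := r) (d := d) (d' := d')
      ⟨h3.1, fun hc => ?_⟩ h1 h2)
    rw [h _ (fun hy => hx (congrArg Subtype.val hy))]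
    exact h3.2 hc

/-- The circles of `ρ` through `x`. -/
def Through (x : D.Crossing) (ρ : D.Resolution) (e : D.Edge) : Prop :=
  circleOf ρ e = circleOf ρ x.northEdge ∨ circleOf ρ e = circleOf ρ x.southEdge

theorem through_iff_pinch (x : D.Crossing) (ρ : D.Resolution) (e : D.Edge) :
    Through x ρ e ↔ pinch ρ x (circleOf ρ e) = circleOf ρ x.northEdge := by
  unfold Through pinch
  split_ifs with h <;> simp [h]

theorem pinch_of_not_through {x : D.Crossing} {ρ : D.Resolution} {e : D.Edge}
    (h : ¬ Through x ρ e) : pinch ρ x (circleOf ρ e) = circleOf ρ e :=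
  if_neg fun h' => h (Or.inr h')

theorem Through.of_differAt {x : D.Crossing} {ρ ρ' : D.Resolution} (h : DifferAt x ρ ρ')
    {e : D.Edge} (he : Through x ρ' e) : Through x ρ e := by
  rw [through_iff_pinch]
  rcases he with he | he
  · rw [pinch_eq_of_circleOf_eq h he, x.northEdge_eq, pinch_edge, x.northEdge_eq]
  · rw [pinch_eq_of_circleOf_eq h he, x.southEdge_eq, pinch_edge]

theorem through_congr {x : D.Crossing} {ρ ρ' : D.Resolution} (h : DifferAt x ρ ρ') (e : D.Edge) :
    Through x ρ e ↔ Through x ρ' e := ⟨Through.of_differAt h.symm, Through.of_differAt h⟩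

theorem circleOf_eq_iff_of_not_through {x : D.Crossing} {ρ ρ' : D.Resolution}
    (h : DifferAt x ρ ρ') {e e' : D.Edge} (he : ¬ Through x ρ e) :
    circleOf ρ e' = circleOf ρ e ↔ circleOf ρ' e' = circleOf ρ' e := by
  have key : ∀ {ρ ρ' : D.Resolution}, DifferAt x ρ ρ' → ¬ Through x ρ e →
      circleOf ρ' e' = circleOf ρ' e → circleOf ρ e' = circleOf ρ e := by
    intro ρ ρ' h he h'
    have h2 := pinch_eq_of_circleOf_eq h h'
    have h3 : ¬ Through x ρ e' := by
      rw [through_iff_pinch, h2, ← through_iff_pinch]; exact he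
    rwa [pinch_of_not_through he, pinch_of_not_through h3] at h2
  exact ⟨key h.symm (by rwa [← through_congr h]), key h he⟩

/-- The crossing `x` connects a circle of `ρ` to itself. -/
def SameAt (x : D.Crossing) (ρ : D.Resolution) : Prop :=
  circleOf ρ x.northEdge = circleOf ρ x.southEdge

theorem SameAt.refines {x : D.Crossing} {ρ ρ' : D.Resolution} (h : DifferAt x ρ ρ')
    (hs : SameAt x ρ) {e e' : D.Edge} (he : circleOf ρ' e = circleOf ρ' e') :
    circleOf ρ e = circleOf ρ e' := by
  have := pinch_eq_of_circleOf_eq h he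
  have hp : ∀ C, pinch ρ x C = C := fun C => by
    unfold pinch
    split_ifs with h
    · rw [h, hs]
    · rfl
  rwa [hp, hp] at this

theorem sum_through (x : D.Crossing) (ρ : D.Resolution) (f : D.Edge → ℤ) :
    (∑ e, if Through x ρ e then f e else 0) =
      (∑ e, if circleOf ρ e = circleOf ρ x.northEdge then f e else 0) +
      if SameAt x ρ then 0 else ∑ e, if circleOf ρ e = circleOf ρ x.southEdge then f e else 0 := by
  unfold SameAt
  split_ifs with h
  · rw [add_zero]
    refine Finset.sum_congr rfl fun e _ => ?_
    simp [Through, ← h]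
  · rw [← Finset.sum_add_distrib]
    refine Finset.sum_congr rfl fun e _ => ?_
    unfold Through
    by_cases h1 : circleOf ρ e = circleOf ρ x.northEdge
    · simp [h1, h]
    · simp [h1]

theorem kappa_crossing (ρ : D.Resolution) (x : D.Crossing) :
    kappa ρ x.1.1 x.1.2 = if ρ x then 1 else -1 := by
  have h : D.IsCrossing x.1.1 x.1.2 := x.2
  simp [kappa, h]

theorem kappa_congr {x : D.Crossing} {ρ ρ' : D.Resolution} (h : DifferAt x ρ ρ') {c : Fin n}
    {y : ℕ} (hne : ¬ (c = x.1.1 ∧ y = (x.1.2 : ℕ))) : kappa ρ c y = kappa ρ' c y := by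
  unfold kappa
  split_ifs with h1 h2 h3 h4 <;> try rfl
  all_goals
    have := h ⟨(c, ⟨y, h1⟩), h2⟩ (by rintro rfl; exact hne ⟨rfl, rfl⟩)
    simp_all

theorem edgeTurn_congr {x : D.Crossing} {ρ ρ' : D.Resolution} (h : DifferAt x ρ ρ') {e : D.Edge}
    (h1 : e ≠ x.edge .north) (h2 : e ≠ x.edge .south) : edgeTurn ρ e = edgeTurn ρ' e := by
  unfold edgeTurn
  split_ifs with hv
  · rw [kappa_congr h, kappa_congr h]
    · rintro ⟨a, b⟩
      exact h2 (Edge.LeavesAt.unique (d := .south) ⟨hv, a, b⟩ (x.edge_leavesAt _))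
    · rintro ⟨a, b⟩
      exact h1 (Edge.LeavesAt.unique (d := .north) ⟨hv, a, Fin.ext b⟩ (x.edge_leavesAt _))
  · rfl

theorem edgeTurn_north {x : D.Crossing} {ρ ρ' : D.Resolution} (h : DifferAt x ρ ρ')
    (h0 : ρ x = false) (h1 : ρ' x = true) :
    edgeTurn ρ' (x.edge .north) = edgeTurn ρ (x.edge .north) + 2 := by
  obtain ⟨a, b, c⟩ := x.edge_leavesAt .north
  unfold edgeTurn
  rw [if_pos a, if_pos a, b, c, kappa_crossing, kappa_crossing, h0, h1,
    kappa_congr h (by rintro ⟨-, h⟩; omega)]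
  simp; ring

theorem edgeTurn_south {x : D.Crossing} {ρ ρ' : D.Resolution} (h : DifferAt x ρ ρ')
    (h0 : ρ x = false) (h1 : ρ' x = true) :
    edgeTurn ρ' (x.edge .south) = edgeTurn ρ (x.edge .south) - 2 := by
  obtain ⟨a, b, c⟩ := x.edge_leavesAt .south
  unfold edgeTurn
  rw [if_pos a, if_pos a, b, c, kappa_crossing, kappa_crossing, h0, h1,
    kappa_congr h (y := ((x.edge .south).1.2.2 : ℕ)) (by rintro ⟨-, h⟩; omega)]
  simp; ring

theorem Crossing.edge_ne (x : D.Crossing) {d d' : Dir} (h : d.vert = true) (h' : d'.vert = true)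
    (hne : d ≠ d') : x.edge d ≠ x.edge d' := by
  intro he
  have h1 := x.edge_leavesAt d
  have h2 := x.edge_leavesAt d'
  rw [← he] at h2
  cases d <;> cases d' <;> simp [Dir.vert, Edge.LeavesAt] at h h' hne h1 h2 <;>
    obtain ⟨h10, h11, h12⟩ := h1 <;> obtain ⟨h20, h21, h22⟩ := h2
  · rw [h12] at h22; omega
  · rw [h22] at h12; omega

/-- The checkerboard orientation at a crossing: `1` if the vertical ends are oriented outwards. -/
def crossOut (x : D.Crossing) : ℤ := D.chiOut x.1.1 x.1.2 .north

theorem crossOut_eq (x : D.Crossing) : crossOut x = 1 ∨ crossOut x = -1 := chiOut_eq _ _ _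

theorem chi_northEdge (x : D.Crossing) : chi x.northEdge = crossOut x := by
  have := (x.edge_leavesAt .north).sgn_mul_chi
  rw [x.northEdge_eq, crossOut, ← this]
  simp [Dir.sgn]

theorem chi_southEdge (x : D.Crossing) : chi x.southEdge = -crossOut x := by
  have := (x.edge_leavesAt .south).sgn_mul_chi
  rw [x.southEdge_eq, crossOut, (D.chiOut_crossing x.2).1, ← this]
  simp [Dir.sgn]

/-- Only the turning weight at `x` changes, from -1 to 1. Both vertical ends at `x` feel this
change, each contributing `2 * crossOut x`. -/
theorem sum_through_turn {x : D.Crossing} {ρ ρ' : D.Resolution} (h : DifferAt x ρ ρ')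
    (h0 : ρ x = false) (h1 : ρ' x = true) :
    (∑ e, if Through x ρ' e then chi e * edgeTurn ρ' e else 0) =
      (∑ e, if Through x ρ e then chi e * edgeTurn ρ e else 0) + 4 * crossOut x := by
  have hne : x.edge .north ≠ x.edge .south := x.edge_ne rfl rfl (by simp)
  have step : ∀ e, (if Through x ρ' e then chi e * edgeTurn ρ' e else 0) =
      (if Through x ρ e then chi e * edgeTurn ρ e else 0) +
        ((if e = x.edge .north then 2 * crossOut x else 0) +
          if e = x.edge .south then 2 * crossOut x else 0) := by
    intro e
    simp only [← through_congr h]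
    by_cases hn : e = x.edge .north
    · have : Through x ρ e := Or.inl (by rw [hn, x.northEdge_eq])
      rw [if_pos this, if_pos this, if_pos hn, if_neg (hn ▸ hne), hn, edgeTurn_north h h0 h1]
      rw [← x.northEdge_eq, chi_northEdge]; ring
    · by_cases hs : e = x.edge .south
      · have : Through x ρ e := Or.inr (by rw [hs, x.southEdge_eq])
        rw [if_pos this, if_pos this, if_neg hn, if_pos hs, hs, edgeTurn_south h h0 h1]
        rw [← x.southEdge_eq, chi_southEdge]; ring
      · rw [edgeTurn_congr h hn hs]
        simp [hn, hs]
  simp only [step]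
  rw [Finset.sum_add_distrib, Finset.sum_add_distrib, Finset.sum_ite_eq', Finset.sum_ite_eq']
  simp only [Finset.mem_univ, if_true]
  ring

/-- After division by four: the turning numbers of the circles through `x` have a sum that changes
by one unit, with a sign depending on the colouring at `x` only. -/
theorem spin_surgery {x : D.Crossing} {ρ ρ' : D.Resolution} (h : DifferAt x ρ ρ')
    (h0 : ρ x = false) (h1 : ρ' x = true) :
    spin ρ' (circleOf ρ' x.northEdge) +
        (if SameAt x ρ' then 0 else spin ρ' (circleOf ρ' x.southEdge)) =
      spin ρ (circleOf ρ x.northEdge) +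
        (if SameAt x ρ then 0 else spin ρ (circleOf ρ x.southEdge)) + crossOut x := by
  have := sum_through_turn h h0 h1
  rw [sum_through, sum_through, (spin_spec _ _).2.1, (spin_spec _ _).2.1, (spin_spec _ _).2.1,
    (spin_spec _ _).2.1] at this
  split_ifs at this ⊢ <;> omega

/-- Surgery merges two circles or splits one. -/
theorem sameAt_up {x : D.Crossing} {ρ ρ' : D.Resolution} (h : DifferAt x ρ ρ')
    (h0 : ρ x = false) (h1 : ρ' x = true) : SameAt x ρ' ↔ ¬ SameAt x ρ := by
  -- Each side is a sum of one or two signs and the sums differ by an odd number, so one side has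
  -- one circle and the other has two.
  have := spin_surgery h h0 h1
  have a := spin_eq ρ (circleOf ρ x.northEdge)
  have b := spin_eq ρ (circleOf ρ x.southEdge)
  have c := spin_eq ρ' (circleOf ρ' x.northEdge)
  have d := spin_eq ρ' (circleOf ρ' x.southEdge)
  have e := crossOut_eq x
  by_cases p : SameAt x ρ <;> by_cases q : SameAt x ρ' <;> simp only [p, q, if_true, if_false] at this ⊢
    <;> simp <;> omega

theorem spin_of_not_through {x : D.Crossing} {ρ ρ' : D.Resolution} (h : DifferAt x ρ ρ')
    {e : D.Edge} (he : ¬ Through x ρ e) : spin ρ' (circleOf ρ' e) = spin ρ (circleOf ρ e) := by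
  unfold spin
  congr 1
  refine Finset.sum_congr rfl fun f _ => ?_
  rw [← circleOf_eq_iff_of_not_through h he]
  by_cases hf : circleOf ρ f = circleOf ρ e
  · rw [if_pos hf, if_pos hf, edgeTurn_congr h]
    · rintro rfl
      exact he (Or.inl (by rw [← hf, x.northEdge_eq]))
    · rintro rfl
      exact he (Or.inr (by rw [← hf, x.southEdge_eq]))
  · rw [if_neg hf, if_neg hf]

end GridDiagram

end

section
namespace GridDiagram

variable {n : ℕ} {D : GridDiagram n}

open Classical

/-! ### Labelled resolutions and oriented diagrams -/

/-- The label of the circle through an edge: `-1` for the circles of `S`. -/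
def label (ρ : D.Resolution) (S : Finset (D.Circle ρ)) (e : D.Edge) : ℤ :=
  if circleOf ρ e ∈ S then -1 else 1

theorem label_eq (ρ : D.Resolution) (S : Finset (D.Circle ρ)) (e : D.Edge) :
    label ρ S e = 1 ∨ label ρ S e = -1 := by
  unfold label; split_ifs <;> simp

theorem label_congr {ρ : D.Resolution} {S : Finset (D.Circle ρ)} {e e' : D.Edge}
    (h : circleOf ρ e = circleOf ρ e') : label ρ S e = label ρ S e' := by
  unfold label; rw [h]

/-- The orientation of the edges in which circles labelled `1` run counterclockwise and circles
labelled `-1` run clockwise. -/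
def omega (ρ : D.Resolution) (S : Finset (D.Circle ρ)) (e : D.Edge) : ℤ :=
  label ρ S e * spin ρ (circleOf ρ e) * chi e

theorem pm_mul {a b : ℤ} (ha : a = 1 ∨ a = -1) (hb : b = 1 ∨ b = -1) : a * b = 1 ∨ a * b = -1 := by
  rcases ha with rfl | rfl <;> rcases hb with rfl | rfl <;> simp

theorem omega_eq (ρ : D.Resolution) (S : Finset (D.Circle ρ)) (e : D.Edge) :
    omega ρ S e = 1 ∨ omega ρ S e = -1 :=
  pm_mul (pm_mul (label_eq _ _ _) (spin_eq _ _)) (chi_eq _)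

theorem omega_mul_chi (ρ : D.Resolution) (S : Finset (D.Circle ρ)) (e : D.Edge) :
    omega ρ S e * chi e = label ρ S e * spin ρ (circleOf ρ e) := by
  unfold omega
  rcases chi_eq e with h | h <;> rw [h] <;> ring

theorem omega_mul_chi_congr {ρ : D.Resolution} {S : Finset (D.Circle ρ)} {e e' : D.Edge}
    (h : circleOf ρ e = circleOf ρ e') : omega ρ S e * chi e = omega ρ S e' * chi e' := by
  rw [omega_mul_chi, omega_mul_chi, label_congr h, h]

theorem omega_injective {ρ : D.Resolution} {S S' : Finset (D.Circle ρ)}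
    (h : omega ρ S = omega ρ S') : S = S' := by
  ext C
  obtain ⟨e, rfl⟩ := exists_circleOf C
  have h1 := congrFun h e
  have : label ρ S e = label ρ S' e := by
    unfold omega at h1
    have a := spin_eq ρ (circleOf ρ e)
    have b := chi_eq e
    rcases a with a | a <;> rcases b with b | b <;> rw [a, b] at h1 <;> omega
  unfold label at this
  split_ifs at this <;> tauto

theorem exists_omega_eq {ρ : D.Resolution} {Ω : D.Edge → ℤ} (h1 : ∀ e, Ω e = 1 ∨ Ω e = -1)
    (h2 : ∀ e e', circleOf ρ e = circleOf ρ e' → Ω e * chi e = Ω e' * chi e') :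
    ∃ S, omega ρ S = Ω := by
  have : Fintype (D.Circle ρ) := Fintype.ofFinite _
  refine ⟨Finset.univ.filter fun C => Ω (Quot.out C) * chi (Quot.out C) * spin ρ C = -1, ?_⟩
  funext e
  have ho : circleOf ρ (Quot.out (circleOf ρ e)) = circleOf ρ e := Quot.out_eq _
  have := h2 _ _ ho
  unfold omega label
  simp only [Finset.mem_filter, Finset.mem_univ, true_and, this]
  have a := spin_eq ρ (circleOf ρ e)
  have b := chi_eq e
  have c := h1 e
  rcases a with a | a <;> rcases b with b | b <;> rcases c with c | c <;> simp [a, b, c]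

/-- If the vertical ends at `x` are both inward or both outward, the orientation is a constant
multiple of the checkerboard orientation on everything that passes through `x`. Hence it remains
coherent after surgery. -/
theorem exists_omega_eq_of_coherent {x : D.Crossing} {ρ ρ' : D.Resolution} (h : DifferAt x ρ ρ')
    {S : Finset (D.Circle ρ)} (hx : omega ρ S x.northEdge = -omega ρ S x.southEdge) :
    ∃ S', omega ρ' S' = omega ρ S := by
  refine exists_omega_eq (omega_eq ρ S) fun e e' he => ?_
  have hp := pinch_eq_of_circleOf_eq h he
  have hx' : omega ρ S x.northEdge * chi x.northEdge = omega ρ S x.southEdge * chi x.southEdge := by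
    rw [chi_northEdge, chi_southEdge, hx]; ring
  have key : ∀ e, omega ρ S e * chi e =
      omega ρ S (Quot.out (pinch ρ x (circleOf ρ e))) * chi (Quot.out (pinch ρ x (circleOf ρ e))) := by
    intro e
    unfold pinch
    split_ifs with h1
    · rw [omega_mul_chi_congr h1, ← hx']
      exact omega_mul_chi_congr (Quot.out_eq (circleOf ρ x.northEdge)).symm
    · exact omega_mul_chi_congr (Quot.out_eq (circleOf ρ e)).symm
  rw [key e, key e', hp]

/-- The labels of two resolutions that differ by surgery at `x` are related as in the edge maps
of the Khovanov cube. -/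
def Allowed (x : D.Crossing) (ρ ρ' : D.Resolution) (S : Finset (D.Circle ρ))
    (S' : Finset (D.Circle ρ')) : Prop :=
  (∀ e, ¬ Through x ρ e → label ρ' S' e = label ρ S e) ∧
  if SameAt x ρ then
    label ρ' S' x.northEdge + label ρ' S' x.southEdge = label ρ S x.northEdge - 1
  else label ρ' S' x.northEdge + 1 = label ρ S x.northEdge + label ρ S x.southEdge

/-- The area enclosed by an oriented diagram. -/
def area (Ω : D.Edge → ℤ) : ℤ := ∑ e : D.Edge, if e.1.1 = true then Ω e * ((e.1.2.1 : ℕ) : ℤ) else 0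

/-- The turning number of an oriented diagram, in quarters. -/
def turning (ρ : D.Resolution) (Ω : D.Edge → ℤ) : ℤ := ∑ e, Ω e * edgeTurn ρ e

theorem sum_omega_circle (ρ : D.Resolution) (S : Finset (D.Circle ρ)) (e : D.Edge)
    (f : D.Edge → ℤ) :
    (∑ e', if circleOf ρ e' = circleOf ρ e then omega ρ S e' * f e' else 0) =
      label ρ S e * spin ρ (circleOf ρ e) *
        ∑ e', if circleOf ρ e' = circleOf ρ e then chi e' * f e' else 0 := by
  rw [Finset.mul_sum]
  refine Finset.sum_congr rfl fun e' _ => ?_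
  split_ifs with h
  · rw [omega, label_congr h, h]; ring
  · simp

theorem sum_split_through (x : D.Crossing) (ρ : D.Resolution) (f : D.Edge → ℤ) :
    ∑ e, f e = (∑ e, if Through x ρ e then f e else 0) +
      ∑ e, if Through x ρ e then 0 else f e := by
  rw [← Finset.sum_add_distrib]
  refine Finset.sum_congr rfl fun e _ => ?_
  split_ifs <;> simp

/-- Spin and area of a circle have the same sign, so label times spin times area is label times
absolute area. Circles of equal spin merge by adding absolute areas, and circles of opposite spin by
subtracting them. In the allowed labellings the labelled area then drops unless the orientations on
both circles agree with that of the result. -/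
theorem merge_arith {l1 l2 l s1 s2 s o a1 a2 a : ℤ} (h1 : l1 = 1 ∨ l1 = -1) (h2 : l2 = 1 ∨ l2 = -1)
    (h3 : l = 1 ∨ l = -1) (k1 : s1 = 1 ∨ s1 = -1) (k2 : s2 = 1 ∨ s2 = -1)
    (k3 : s = 1 ∨ s = -1) (ho : o = 1 ∨ o = -1) (hl : l + 1 = l1 + l2) (hs : s = s1 + s2 + o)
    (ha : a = a1 + a2) (p1 : 0 < s1 * a1) (p2 : 0 < s2 * a2) (p : 0 < s * a) :
    (l * s = l1 * s1 ∧ l * s = l2 * s2 ∧ l1 * s1 = -o) ∨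
      l * s * a < l1 * s1 * a1 + l2 * s2 * a2 := by
  rcases h1 with rfl | rfl <;> rcases h2 with rfl | rfl <;> rcases h3 with rfl | rfl <;>
    (try omega) <;>
  rcases k1 with rfl | rfl <;> rcases k2 with rfl | rfl <;> rcases k3 with rfl | rfl <;>
    rcases ho with rfl | rfl <;> omega

/-- The mirror image of a merge: the area drops strictly unless both parts inherit the orientation
of the split circle. -/
theorem split_arith {l1 l2 l s1 s2 s o a1 a2 a : ℤ} (h1 : l1 = 1 ∨ l1 = -1) (h2 : l2 = 1 ∨ l2 = -1)
    (h3 : l = 1 ∨ l = -1) (k1 : s1 = 1 ∨ s1 = -1) (k2 : s2 = 1 ∨ s2 = -1)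
    (k3 : s = 1 ∨ s = -1) (ho : o = 1 ∨ o = -1) (hl : l1 + l2 = l - 1) (hs : s1 + s2 = s + o)
    (ha : a = a1 + a2) (p1 : 0 < s1 * a1) (p2 : 0 < s2 * a2) (p : 0 < s * a) :
    (l * s = l1 * s1 ∧ l * s = l2 * s2 ∧ l * s = -o) ∨
      l1 * s1 * a1 + l2 * s2 * a2 < l * s * a := by
  rcases h1 with rfl | rfl <;> rcases h2 with rfl | rfl <;> rcases h3 with rfl | rfl <;>
    (try omega) <;>
  rcases k1 with rfl | rfl <;> rcases k2 with rfl | rfl <;> rcases k3 with rfl | rfl <;>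
    rcases ho with rfl | rfl <;> omega

section Surgery

variable {x : D.Crossing} {ρ ρ' : D.Resolution} (h : DifferAt x ρ ρ') (h0 : ρ x = false)
  (h1 : ρ' x = true) {S : Finset (D.Circle ρ)} {S' : Finset (D.Circle ρ')}

include h

theorem Allowed.omega_of_not_through (ha : Allowed x ρ ρ' S S') {e : D.Edge}
    (he : ¬ Through x ρ e) : omega ρ' S' e = omega ρ S e := by
  unfold omega
  rw [ha.1 e he, spin_of_not_through h he]

include h0 h1

/-- A circle with its labelled orientation has turning number equal to its label, and edge maps
lower the sum of the labels by one. This is the source of the homogeneity of the differential. -/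
theorem Allowed.turning (ha : Allowed x ρ ρ' S S') :
    turning ρ' (omega ρ' S') = turning ρ (omega ρ S) - 4 := by
  have key : ∀ (ρ : D.Resolution) (S : Finset (D.Circle ρ)),
      (∑ e, if Through x ρ e then omega ρ S e * edgeTurn ρ e else 0) =
        4 * (label ρ S x.northEdge + if SameAt x ρ then 0 else label ρ S x.southEdge) := by
    intro ρ S
    have sq : ∀ C, spin ρ C * spin ρ C = 1 := fun C => by
      rcases spin_eq ρ C with h | h <;> rw [h] <;> ring
    have : ∀ e, label ρ S e * spin ρ (circleOf ρ e) * (4 * spin ρ (circleOf ρ e)) =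
        4 * label ρ S e := fun e => by linear_combination 4 * label ρ S e * sq (circleOf ρ e)
    rw [sum_through, sum_omega_circle, sum_omega_circle, (spin_spec _ _).2.1, (spin_spec _ _).2.1,
      this, this]
    split_ifs <;> ring
  unfold GridDiagram.turning
  rw [sum_split_through x ρ' fun e => omega ρ' S' e * edgeTurn ρ' e,
    sum_split_through x ρ fun e => omega ρ S e * edgeTurn ρ e, key, key]
  have rest : (∑ e, if Through x ρ' e then 0 else omega ρ' S' e * edgeTurn ρ' e) =
      ∑ e, if Through x ρ e then 0 else omega ρ S e * edgeTurn ρ e := by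
    refine Finset.sum_congr rfl fun e _ => ?_
    rw [← through_congr h]
    split_ifs with he
    · rfl
    · rw [ha.omega_of_not_through h he, edgeTurn_congr h]
      · rintro rfl; exact he (Or.inl (by rw [x.northEdge_eq]))
      · rintro rfl; exact he (Or.inr (by rw [x.southEdge_eq]))
  have hs := sameAt_up h h0 h1
  have h2 := ha.2
  rw [rest]
  by_cases p : SameAt x ρ
  · have q : ¬ SameAt x ρ' := fun q => hs.1 q p
    simp only [p, q, if_true, if_false] at h2 ⊢
    omega
  · have q : SameAt x ρ' := hs.2 p
    simp only [p, q, if_true, if_false] at h2 ⊢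
    omega

/-- An edge map either preserves the orientation of the edges or decreases the enclosed area. -/
theorem Allowed.omega_eq_or_area_lt (ha : Allowed x ρ ρ' S S') :
    (omega ρ' S' = omega ρ S ∧ omega ρ S x.northEdge = -1 ∧ omega ρ S x.southEdge = 1) ∨
      area (omega ρ' S') < area (omega ρ S) := by
  let f : D.Edge → ℤ := fun e => if e.1.1 = true then ((e.1.2.1 : ℕ) : ℤ) else 0
  have harea : ∀ Ω : D.Edge → ℤ, area Ω = ∑ e, Ω e * f e := fun Ω =>
    Finset.sum_congr rfl fun e _ => by simp only [f]; split_ifs <;> simp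
  have hca : ∀ (ρ : D.Resolution) (C : D.Circle ρ), chiArea ρ C =
      ∑ e, if circleOf ρ e = C then chi e * f e else 0 := fun ρ C =>
    Finset.sum_congr rfl fun e _ => by simp only [f]; split_ifs <;> simp
  have rest : (∑ e, if Through x ρ' e then 0 else omega ρ' S' e * f e) =
      ∑ e, if Through x ρ e then 0 else omega ρ S e * f e := by
    refine Finset.sum_congr rfl fun e _ => ?_
    rw [← through_congr h]
    split_ifs with he
    · rfl
    · rw [ha.omega_of_not_through h he]
  have hchi : (∑ e, if Through x ρ' e then chi e * f e else 0) =
      ∑ e, if Through x ρ e then chi e * f e else 0 := by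
    simp only [← through_congr h]
  rw [sum_through, sum_through, ← hca, ← hca, ← hca, ← hca] at hchi
  rw [harea, harea, sum_split_through x ρ' fun e => omega ρ' S' e * f e,
    sum_split_through x ρ fun e => omega ρ S e * f e, rest]
  rw [sum_through x ρ', sum_through x ρ, sum_omega_circle, sum_omega_circle, sum_omega_circle,
    sum_omega_circle, ← hca, ← hca, ← hca, ← hca]
  have hsp := spin_surgery h h0 h1
  have hs := sameAt_up h h0 h1
  have h2 := ha.2
  have omN : omega ρ S x.northEdge =
    label ρ S x.northEdge * spin ρ (circleOf ρ x.northEdge) * crossOut x := by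
    rw [omega, chi_northEdge]
  have omS : omega ρ S x.southEdge =
    -(label ρ S x.southEdge * spin ρ (circleOf ρ x.southEdge) * crossOut x) := by
    rw [omega, chi_southEdge]; ring
  have oo : crossOut x * crossOut x = 1 := by
    rcases crossOut_eq x with h | h <;> rw [h] <;> ring
  have pN := (spin_spec ρ (circleOf ρ x.northEdge)).2.2
  have pS := (spin_spec ρ (circleOf ρ x.southEdge)).2.2
  have pN' := (spin_spec ρ' (circleOf ρ' x.northEdge)).2.2
  have pS' := (spin_spec ρ' (circleOf ρ' x.southEdge)).2.2
  -- Orientations are compared through label times spin, since both resolutions use the same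
  -- checkerboard orientation.
  have ext : (∀ e, Through x ρ e → label ρ' S' e * spin ρ' (circleOf ρ' e) =
      label ρ S e * spin ρ (circleOf ρ e)) → omega ρ' S' = omega ρ S := fun hh => by
    funext e
    by_cases he : Through x ρ e
    · unfold omega; rw [hh e he]
    · exact ha.omega_of_not_through h he
  have th : ∀ (ρ : D.Resolution) (S : Finset (D.Circle ρ)) (e e' : D.Edge),
      circleOf ρ e = circleOf ρ e' →
      label ρ S e * spin ρ (circleOf ρ e) = label ρ S e' * spin ρ (circleOf ρ e') :=
    fun ρ S e e' h => by rw [label_congr h, h]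
  by_cases p : SameAt x ρ
  · have q : ¬ SameAt x ρ' := fun q => hs.1 q p
    simp only [p, q, if_true, if_false, add_zero] at h2 hsp hchi ⊢
    rcases split_arith (label_eq ρ' S' x.northEdge) (label_eq ρ' S' x.southEdge)
      (label_eq ρ S x.northEdge) (spin_eq _ _) (spin_eq _ _) (spin_eq _ _) (crossOut_eq x) h2 hsp
      hchi.symm pN' pS' pN with ⟨g1, g2, g3⟩ | hlt
    · left
      have hSN := th ρ S _ _ p
      refine ⟨ext fun e he => ?_, ?_, ?_⟩
      · rcases (through_congr h e).1 he with h' | h'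
        · have : circleOf ρ e = circleOf ρ x.northEdge := p.refines h h'
          rw [th _ _ _ _ h', th _ _ _ _ this]; omega
        · have : circleOf ρ e = circleOf ρ x.southEdge := p.refines h h'
          rw [th _ _ _ _ h', th _ _ _ _ this]; omega
      · rw [omN, g3]; linarith
      · rw [omS, ← hSN, g3]; linarith
    · right; linarith
  · have q : SameAt x ρ' := hs.2 p
    simp only [p, q, if_true, if_false, add_zero] at h2 hsp hchi ⊢
    rcases merge_arith (label_eq ρ S x.northEdge) (label_eq ρ S x.southEdge)
      (label_eq ρ' S' x.northEdge) (spin_eq _ _) (spin_eq _ _) (spin_eq _ _) (crossOut_eq x) h2 hsp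
      hchi pN pS pN' with ⟨g1, g2, g3⟩ | hlt
    · left
      have hSN := th ρ' S' _ _ q
      refine ⟨ext fun e he => ?_, ?_, ?_⟩
      · rcases he with h' | h'
        · have : circleOf ρ' e = circleOf ρ' x.northEdge := q.refines h.symm h'
          rw [th _ _ _ _ h', th _ _ _ _ this]; omega
        · have : circleOf ρ' e = circleOf ρ' x.southEdge := q.refines h.symm h'
          rw [th _ _ _ _ h', th _ _ _ _ this]; omega
      · rw [omN, g3]; linarith
      · rw [omS, ← g2, g1, g3]; linarith
    · right; linarith

/-- The converse of the case of equality: if both vertical ends point into `x`, the labels are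
forced to be minus spin times `crossOut`, and `spin_surgery` becomes the rule for labels. -/
theorem allowed_of_omega_eq (hω : omega ρ' S' = omega ρ S) (hN : omega ρ S x.northEdge = -1)
    (hS : omega ρ S x.southEdge = 1) : Allowed x ρ ρ' S S' := by
  have canc : ∀ {a b s c : ℤ}, s = 1 ∨ s = -1 → c = 1 ∨ c = -1 → a * s * c = b * s * c → a = b := by
    intro a b s c hs hc h
    rcases hs with rfl | rfl <;> rcases hc with rfl | rfl <;> omega
  refine ⟨fun e he => ?_, ?_⟩
  · have := congrFun hω e
    unfold omega at this
    rw [spin_of_not_through h he] at this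
    exact canc (spin_eq _ _) (chi_eq _) this
  · have hN' : omega ρ' S' x.northEdge = -1 := by rw [hω, hN]
    have hS' : omega ρ' S' x.southEdge = 1 := by rw [hω, hS]
    have val : ∀ {l s o : ℤ}, l = 1 ∨ l = -1 → s = 1 ∨ s = -1 → o = 1 ∨ o = -1 → l * s * o = -1 →
        l = -(s * o) := by
      intro l s o hl hs ho h
      rcases hl with rfl | rfl <;> rcases hs with rfl | rfl <;> rcases ho with rfl | rfl <;> omega
    have hsp := spin_surgery h h0 h1
    have hs := sameAt_up h h0 h1
    unfold omega at hN hS hN' hS'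
    rw [chi_northEdge] at hN hN'
    rw [chi_southEdge] at hS hS'
    have v1 := val (label_eq _ _ _) (spin_eq _ _) (crossOut_eq x) hN
    have v2 := val (label_eq _ _ _) (spin_eq _ _) (crossOut_eq x) hN'
    have v3 := val (label_eq _ _ _) (spin_eq _ _) (crossOut_eq x) (by linarith : _ = (-1 : ℤ))
      (l := label ρ S x.southEdge) (s := spin ρ (circleOf ρ x.southEdge))
    have v4 := val (label_eq _ _ _) (spin_eq _ _) (crossOut_eq x) (by linarith : _ = (-1 : ℤ))
      (l := label ρ' S' x.southEdge) (s := spin ρ' (circleOf ρ' x.southEdge))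
    rw [v1, v2, v3, v4]
    have oo := crossOut_eq x
    by_cases p : SameAt x ρ
    · have q : ¬ SameAt x ρ' := fun q => hs.1 q p
      simp only [p, q, if_true, if_false, add_zero] at hsp ⊢
      rcases oo with o | o <;> rw [o] at hsp ⊢ <;> omega
    · have q : SameAt x ρ' := hs.2 p
      simp only [p, q, if_true, if_false, add_zero] at hsp ⊢
      rcases oo with o | o <;> rw [o] at hsp ⊢ <;> omega

end Surgery

/-- A circle of spin 1 or -1 that is oriented by its label and its spin turns by its label. -/
theorem turning_omega (ρ : D.Resolution) (S : Finset (D.Circle ρ)) :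
    turning ρ (omega ρ S) = 4 * ((Nat.card (D.Circle ρ) : ℤ) - 2 * S.card) := by
  have : Fintype (D.Circle ρ) := Fintype.ofFinite _
  have h1 : ∀ e, omega ρ S e * edgeTurn ρ e =
      ∑ C : D.Circle ρ, if circleOf ρ e = C then omega ρ S e * edgeTurn ρ e else 0 := by
    intro e; rw [Finset.sum_ite_eq]; simp
  unfold turning
  rw [Finset.sum_congr rfl fun e _ => h1 e, Finset.sum_comm]
  have h2 : ∀ C : D.Circle ρ, (∑ e, if circleOf ρ e = C then omega ρ S e * edgeTurn ρ e else 0) =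
      4 * if C ∈ S then -1 else 1 := by
    intro C
    obtain ⟨e, rfl⟩ := exists_circleOf C
    rw [sum_omega_circle, (spin_spec _ _).2.1, label]
    rcases spin_eq ρ (circleOf ρ e) with h | h <;> rw [h] <;> split_ifs <;> ring
  rw [Finset.sum_congr rfl fun C _ => h2 C, ← Finset.mul_sum]
  congr 1
  have h3 : ∀ C : D.Circle ρ, (if C ∈ S then (-1 : ℤ) else 1) = 1 - 2 * if C ∈ S then 1 else 0 := by
    intro C; split_ifs <;> ring
  simp only [h3]
  rw [Finset.sum_sub_distrib, ← Finset.mul_sum, Finset.sum_boole]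
  simp

end GridDiagram

end

/-! ### Signed bases of exterior algebras of free modules -/

section
namespace ExteriorAlgebra

variable {I J : Type}

/-- The exterior product of a list of standard basis vectors. -/
def wedge (R : Type) [CommRing R] (l : List I) : ExteriorAlgebra R (I →₀ R) :=
  (l.map fun i => ι R (Finsupp.single i (1 : R))).prod

theorem wedge_cons (R : Type) [CommRing R] (i : I) (l : List I) :
    wedge R (i :: l) = ι R (Finsupp.single i (1 : R)) * wedge R l := by
  simp [wedge]

/-- The sign is chosen before the ring. This uniformity lets one integral matrix describe the
differential over all coefficient rings. -/
theorem exists_wedge_perm {l l' : List I} (h : l.Perm l') :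
    ∃ ε : ℤˣ, ∀ (R : Type) [CommRing R], wedge R l = (ε : ℤ) • wedge R l' := by
  induction h with
  | nil => exact ⟨1, fun R _ => by simp⟩
  | cons i _ ih =>
    obtain ⟨ε, h⟩ := ih
    exact ⟨ε, fun R _ => by rw [wedge_cons, wedge_cons, h R, mul_smul_comm]⟩
  | swap i j l =>
    refine ⟨-1, fun R _ => ?_⟩
    rw [wedge_cons, wedge_cons, wedge_cons, wedge_cons, ← mul_assoc, ← mul_assoc,
      eq_neg_of_add_eq_zero_left (ι_add_mul_swap (R := R) (Finsupp.single j 1) (Finsupp.single i 1))]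
    simp
  | trans _ _ ih ih' =>
    obtain ⟨ε, h⟩ := ih
    obtain ⟨ε', h'⟩ := ih'
    exact ⟨ε * ε', fun R _ => by rw [h R, h' R, smul_smul, Units.val_mul]⟩

theorem map_wedge (φ : I → J) (l : List I) (R : Type) [CommRing R] :
    map (Finsupp.lmapDomain R R φ) (wedge R l) = wedge R (l.map φ) := by
  induction l with
  | nil => simp [wedge]
  | cons i l ih =>
    rw [wedge_cons, map_mul, ih, List.map_cons, wedge_cons, map_apply_ι]
    simp

variable [LinearOrder I]

/-- The standard basis of the exterior algebra of a free module. -/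
def stdBasis (R : Type) [CommRing R] (I : Type) [LinearOrder I] :
    Module.Basis (Finset I) R (ExteriorAlgebra R (I →₀ R)) :=
  Finsupp.basisSingleOne.ExteriorAlgebra

theorem wedge_eq_zero {l : List I} (h : ¬ l.Nodup) (R : Type) [CommRing R] : wedge R l = 0 := by
  induction l with
  | nil => simp at h
  | cons i l ih =>
    rw [wedge_cons]
    by_cases hi : i ∈ l
    · obtain ⟨ε, he⟩ := exists_wedge_perm (List.perm_cons_erase hi)
      rw [he R, wedge_cons, mul_smul_comm, ← mul_assoc, ι_sq_zero, zero_mul, smul_zero]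
    · rw [ih fun hl => h (List.nodup_cons.2 ⟨hi, hl⟩), mul_zero]

/-- It fixes the order of the factors of a basis vector by a list that is common to all coefficient
rings. -/
theorem exists_list (S : Finset I) : ∃ l : List I, l.Nodup ∧ l.toFinset = S ∧
    ∀ (R : Type) [CommRing R], stdBasis R I S = wedge R l := by
  let f : Fin S.card ↪o I := Set.powersetCard.ofFinEmbEquiv.symm (Set.powersetCard.prodEquiv.symm S).2
  refine ⟨List.ofFn f, List.nodup_ofFn.2 f.injective, ?_, fun R _ => ?_⟩
  · ext i
    rw [List.mem_toFinset, List.mem_ofFn]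
    exact (Set.powersetCard.mem_range_ofFinEmbEquiv_symm_iff_mem _ i)
  · rw [stdBasis, basis_apply, wedge, List.map_ofFn]
    refine (ιMulti_apply _).trans ?_
    simp [Function.comp_def, f]

/-- The elements of a finite set, in the order of the exterior product that represents the
corresponding basis vector. -/
def toList (S : Finset I) : List I := (exists_list S).choose

theorem nodup_toList (S : Finset I) : (toList S).Nodup := (exists_list S).choose_spec.1

theorem toFinset_toList (S : Finset I) : (toList S).toFinset = S := (exists_list S).choose_spec.2.1

theorem mem_toList {S : Finset I} {i : I} : i ∈ toList S ↔ i ∈ S := by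
  rw [← List.mem_toFinset, toFinset_toList]

theorem stdBasis_eq (S : Finset I) (R : Type) [CommRing R] :
    stdBasis R I S = wedge R (toList S) := (exists_list S).choose_spec.2.2 R

theorem exists_sign (l : List I) : ∃ a : ℤ, (l.Nodup → a = 1 ∨ a = -1) ∧ (¬ l.Nodup → a = 0) ∧
    ∀ (R : Type) [CommRing R], wedge R l = a • stdBasis R I l.toFinset := by
  by_cases h : l.Nodup
  · have hp : l.Perm (toList l.toFinset) := by
      rw [List.perm_ext_iff_of_nodup h (nodup_toList _)]
      intro i
      rw [mem_toList, List.mem_toFinset]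
    obtain ⟨ε, he⟩ := exists_wedge_perm hp
    refine ⟨ε, fun _ => ?_, fun h' => absurd h h', fun R _ => by rw [he R, stdBasis_eq]⟩
    rcases Int.units_eq_one_or ε with rfl | rfl <;> simp
  · exact ⟨0, fun h' => absurd h' h, fun _ => rfl, fun R _ => by rw [wedge_eq_zero h, zero_smul]⟩

/-- The coefficient of an exterior product of basis vectors. -/
def wedgeSign (l : List I) : ℤ := (exists_sign l).choose

theorem wedgeSign_eq {l : List I} (h : l.Nodup) : wedgeSign l = 1 ∨ wedgeSign l = -1 :=
  (exists_sign l).choose_spec.1 h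

theorem wedgeSign_eq_zero {l : List I} (h : ¬ l.Nodup) : wedgeSign l = 0 :=
  (exists_sign l).choose_spec.2.1 h

theorem wedge_eq (l : List I) (R : Type) [CommRing R] :
    wedge R l = wedgeSign l • stdBasis R I l.toFinset := (exists_sign l).choose_spec.2.2 R

/-- The exterior powers are spanned by basis vectors. -/
theorem span_stdBasis (R : Type) [CommRing R] (I : Type) [LinearOrder I] (p : ℕ) :
    Submodule.span R (stdBasis R I '' {S | S.card = p}) = ⋀[R]^p (I →₀ R) := by
  apply le_antisymm
  · rw [Submodule.span_le]
    rintro _ ⟨S, hS, rfl⟩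
    rw [stdBasis, basis_apply_ofCard _ hS]
    exact ιMulti_range R p (Set.mem_range_self _)
  · have h := (Finsupp.basisSingleOne (ι := I) (R := R)).exteriorPower p |>.span_eq
    have h2 : (⊤ : Submodule R (⋀[R]^p (I →₀ R))).map (Submodule.subtype _) = ⋀[R]^p (I →₀ R) := by
      simp
    rw [← h2, ← h, Submodule.map_span, Submodule.span_le]
    rintro _ ⟨_, ⟨S, rfl⟩, rfl⟩
    refine Submodule.subset_span ⟨S, ?_, ?_⟩
    · exact S.2
    · rw [stdBasis, Submodule.subtype_apply, ← basis_eq_coe_basis]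

/-- Multiplication by `w` kills every multiple of `w`. For a split, the lift of circles to the new
resolution is determined only up to the difference of the two parts, and this difference is the
factor `w`; so the choice does not matter. -/
theorem ι_mul_map_congr {R M N : Type*} [CommRing R] [AddCommGroup M] [Module R M] [AddCommGroup N]
    [Module R N] (w : N) (f f' : M →ₗ[R] N) (h : ∀ v, ∃ a : R, f v - f' v = a • w)
    (y : ExteriorAlgebra R M) : ι R w * map f y = ι R w * map f' y := by
  have key : ∀ v (z : ExteriorAlgebra R N), ι R w * (ι R (f v) * z) = ι R w * (ι R (f' v) * z) := by
    intro v z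
    obtain ⟨a, ha⟩ := h v
    rw [sub_eq_iff_eq_add.1 ha, map_add, map_smul, add_mul, mul_add, smul_mul_assoc, mul_smul_comm,
      ← mul_assoc, ι_sq_zero, zero_mul, smul_zero, zero_add]
  have swap : ∀ v (z : ExteriorAlgebra R N), ι R w * (ι R v * z) = -(ι R v * (ι R w * z)) := by
    intro v z
    rw [← mul_assoc, ← mul_assoc, eq_neg_of_add_eq_zero_left (ι_add_mul_swap w v), neg_mul]
  induction y using CliffordAlgebra.left_induction with
  | algebraMap r => simp
  | add x y hx hy => rw [map_add, map_add, mul_add, mul_add, hx, hy]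
  | ι_mul y v hy =>
    have e : ∀ f : M →ₗ[R] N, map f (ι R v * y) = ι R (f v) * map f y := fun f => by
      rw [map_mul, map_apply_ι]
    exact (congrArg (ι R w * ·) (e f)).trans <| (key v _).trans <| (swap _ _).trans <|
      (congrArg (fun z => -(ι R (f' v) * z)) hy).trans <| (swap _ _).symm.trans
        (congrArg (ι R w * ·) (e f')).symm

end ExteriorAlgebra

end

section
namespace GridDiagram

variable {n : ℕ} {D : GridDiagram n}

open Classical ExteriorAlgebra

/-! ### The matrix of the differential -/

instance circleFintype (ρ : D.Resolution) : Fintype (D.Circle ρ) := Fintype.ofFinite _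

instance circleLinearOrder (ρ : D.Resolution) : LinearOrder (D.Circle ρ) :=
  LinearOrder.lift' (Finite.equivFin (D.Circle ρ)) (Equiv.injective _)

/-- Sends a circle of `ρ` to a circle of `ρ'` with which it shares an edge. -/
def circleFun (ρ ρ' : D.Resolution) (C : D.Circle ρ) : D.Circle ρ' := circleOf ρ' (Quot.out C)

/-- The coefficient of the basis vector of `t` in the exterior product of a list of circles. -/
def wedgeCoeff {I : Type} [LinearOrder I] (l : List I) (t : Finset I) : ℤ :=
  if t = l.toFinset then wedgeSign l else 0

theorem wedge_eq_sum {I : Type} [LinearOrder I] [Fintype I] (R : Type) [CommRing R] (l : List I) :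
    wedge R l = ∑ t, wedgeCoeff l t • stdBasis R I t := by
  simp [wedgeCoeff, wedge_eq, ite_smul]

theorem wedgeCoeff_ne_zero {I : Type} [LinearOrder I] (l : List I) (t : Finset I) :
    wedgeCoeff l t ≠ 0 ↔ l.Nodup ∧ ∀ i, i ∈ t ↔ i ∈ l := by
  unfold wedgeCoeff
  have : t = l.toFinset ↔ ∀ i, i ∈ t ↔ i ∈ l := by simp [Finset.ext_iff]
  split_ifs with h
  · rw [← this]
    by_cases hl : l.Nodup
    · rcases wedgeSign_eq hl with h' | h' <;> simp [h', hl, h]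
    · simp [wedgeSign_eq_zero hl, hl]
  · rw [← this]
    simp [h]

theorem wedgeCoeff_eq {I : Type} [LinearOrder I] (l : List I) (t : Finset I) :
    wedgeCoeff l t = 0 ∨ wedgeCoeff l t = 1 ∨ wedgeCoeff l t = -1 := by
  unfold wedgeCoeff
  split_ifs
  · by_cases hl : l.Nodup
    · exact Or.inr (wedgeSign_eq hl)
    · exact Or.inl (wedgeSign_eq_zero hl)
  · exact Or.inl rfl

theorem Arrows.ends (o : Arrows D) (x : D.Crossing) :
    (o.tail x = x.northEdge ∧ o.head x = x.southEdge) ∨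
      (o.tail x = x.southEdge ∧ o.head x = x.northEdge) := by
  unfold Arrows.tail Arrows.head
  split_ifs <;> simp

theorem Arrows.same_iff (o : Arrows D) (x : D.Crossing) (ρ : D.Resolution) :
    circleOf ρ (o.tail x) = circleOf ρ (o.head x) ↔ SameAt x ρ := by
  rcases o.ends x with ⟨h, h'⟩ | ⟨h, h'⟩ <;> rw [h, h']
  · rfl
  · exact eq_comm

/-- The matrix coefficient of an edge map of the cube. -/
def edgeCoeff (o : Arrows D) (x : D.Crossing) (ρ ρ' : D.Resolution) (S : Finset (D.Circle ρ))
    (S' : Finset (D.Circle ρ')) : ℤ :=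
  if SameAt x ρ' then
    wedgeCoeff ((toList S).map (circleFun ρ ρ')) S'
  else wedgeCoeff (circleOf ρ' (o.tail x) :: (toList S).map (circleFun ρ ρ')) S' -
    wedgeCoeff (circleOf ρ' (o.head x) :: (toList S).map (circleFun ρ ρ')) S'

theorem edgeMap_stdBasis (R : Type) [CommRing R] (o : Arrows D) (x : D.Crossing)
    (ρ ρ' : D.Resolution) (S : Finset (D.Circle ρ)) :
    edgeMap R o x ρ ρ' (stdBasis R _ S) =
      ∑ S', edgeCoeff o x ρ ρ' S S' • stdBasis R (D.Circle ρ') S' := by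
  have hm : ExteriorAlgebra.map (circleMap R ρ ρ') (stdBasis R _ S) =
      wedge R ((toList S).map (circleFun ρ ρ')) := by
    rw [stdBasis_eq]
    exact map_wedge _ _ _
  unfold edgeMap edgeCoeff
  simp only [o.same_iff]
  split_ifs with h
  · rw [← wedge_eq_sum, ← hm]
    rfl
  · simp only [sub_smul]
    rw [Finset.sum_sub_distrib, ← wedge_eq_sum, ← wedge_eq_sum, wedge_cons, wedge_cons, ← sub_mul,
      ← hm, ← map_sub]
    rfl

theorem label_eq_neg_one {ρ : D.Resolution} {S : Finset (D.Circle ρ)} {e : D.Edge} :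
    label ρ S e = -1 ↔ circleOf ρ e ∈ S := by
  unfold label
  split_ifs with h <;> simp [h]

section Surgery

variable {x : D.Crossing} {ρ ρ' : D.Resolution} (h : DifferAt x ρ ρ')

include h

theorem circleFun_eq_iff {e : D.Edge} (he : ¬ Through x ρ e) (C : D.Circle ρ) :
    circleFun ρ ρ' C = circleOf ρ' e ↔ C = circleOf ρ e := by
  have hC : circleOf ρ (Quot.out C) = C := Quot.out_eq C
  rw [circleFun, ← circleOf_eq_iff_of_not_through h he, hC]

theorem circleFun_through (C : D.Circle ρ) :
    (circleFun ρ ρ' C = circleOf ρ' x.northEdge ∨ circleFun ρ ρ' C = circleOf ρ' x.southEdge) ↔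
      (C = circleOf ρ x.northEdge ∨ C = circleOf ρ x.southEdge) := by
  have hC : circleOf ρ (Quot.out C) = C := Quot.out_eq C
  have := through_congr h (Quot.out C)
  unfold Through at this
  rw [hC] at this
  exact this.symm

theorem circleFun_injOn {S : Finset (D.Circle ρ)} (hs : SameAt x ρ ∨
    ¬ (circleOf ρ x.northEdge ∈ S ∧ circleOf ρ x.southEdge ∈ S)) :
    Set.InjOn (circleFun ρ ρ') S := by
  intro C hC C' hC' he
  obtain ⟨e, rfl⟩ := exists_circleOf C
  by_cases ht : Through x ρ e
  · have h1 := circleFun_through h (circleOf ρ e)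
    have h2 := circleFun_through h C'
    rw [← he, h1] at h2
    have h3 := h2.1 ht
    unfold Through at ht
    unfold SameAt at hs
    rcases ht with ht | ht <;> rcases h3 with h3 | h3 <;>
      rw [ht, h3] <;> rw [ht] at hC <;> rw [h3] at hC' <;> simp only [Finset.mem_coe] at hC hC' <;>
      tauto
  · have : circleFun ρ ρ' (circleOf ρ e) = circleOf ρ' e := (circleFun_eq_iff h ht _).2 rfl
    rw [this] at he
    exact ((circleFun_eq_iff h ht _).1 he.symm).symm

theorem mem_map_circleFun {e : D.Edge} (he : ¬ Through x ρ e) (S : Finset (D.Circle ρ)) :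
    circleOf ρ' e ∈ (toList S).map (circleFun ρ ρ') ↔ circleOf ρ e ∈ S := by
  rw [List.mem_map]
  constructor
  · rintro ⟨C, hC, h'⟩
    rw [circleFun_eq_iff h he] at h'
    rw [← h', ← mem_toList]; exact hC
  · intro hm
    exact ⟨_, mem_toList.2 hm, (circleFun_eq_iff h he _).2 rfl⟩

end Surgery

theorem nodup_map_toList {I J : Type} [LinearOrder I] (f : I → J) (S : Finset I) :
    ((toList S).map f).Nodup ↔ Set.InjOn f S := by
  rw [List.nodup_map_iff_inj_on (nodup_toList S)]
  constructor
  · intro h a ha b hb; exact h a (mem_toList.2 ha) b (mem_toList.2 hb)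
  · intro h a ha b hb; exact h (mem_toList.1 ha) (mem_toList.1 hb)

theorem forall_circle_iff {x : D.Crossing} {ρ ρ' : D.Resolution} (h : DifferAt x ρ ρ')
    {p : D.Circle ρ' → Prop} : (∀ C, p C) ↔
      (∀ e, ¬ Through x ρ e → p (circleOf ρ' e)) ∧
        p (circleOf ρ' x.northEdge) ∧ p (circleOf ρ' x.southEdge) := by
  refine ⟨fun h => ⟨fun e _ => h _, h _, h _⟩, fun ⟨h1, h2, h3⟩ C => ?_⟩
  obtain ⟨e, rfl⟩ := exists_circleOf C
  by_cases he : Through x ρ e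
  · rcases (through_congr h e).1 he with h' | h' <;> rw [h'] <;> assumption
  · exact h1 e he

theorem ite_neg_one_congr {p q : Prop} {_ : Decidable p} {_ : Decidable q} : ((if p then (-1 : ℤ) else 1) = if q then -1 else 1) ↔ (p ↔ q) := by
  by_cases p <;> by_cases q <;> simp [*]

/-- Bookkeeping for a split: `s` says that the split circle belongs to the set, `t1` and `t2` tell
to which part it is lifted, and the two alternatives are the products with the first and with the
second part. -/
theorem split_labels {l l1 l2 : ℤ} {s s1 s2 t1 t2 : Prop} (hl : l = 1 ∨ l = -1)
    (hl1 : l1 = 1 ∨ l1 = -1) (hl2 : l2 = 1 ∨ l2 = -1) (hs : l = -1 ↔ s) (hs1 : l1 = -1 ↔ s1)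
    (hs2 : l2 = -1 ↔ s2) (ht : ¬ (t1 ∧ t2)) (ht' : t1 ∨ t2) :
    ((¬ (s ∧ t1) ∧ s1 ∧ (s2 ↔ s ∧ t2)) ∨ (¬ (s ∧ t2) ∧ (s1 ↔ s ∧ t1) ∧ s2)) ↔
      l1 + l2 = l - 1 := by
  rw [← hs, ← hs1, ← hs2]
  rcases hl with rfl | rfl <;> rcases hl1 with rfl | rfl <;> rcases hl2 with rfl | rfl <;>
    norm_num <;> tauto

/-- The coefficients of an edge map vanish except for the allowed changes of labels. -/
theorem edgeCoeff_ne_zero (o : Arrows D) {x : D.Crossing} {ρ ρ' : D.Resolution}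
    (h : DifferAt x ρ ρ') (h0 : ρ x = false) (h1 : ρ' x = true) (S : Finset (D.Circle ρ))
    (S' : Finset (D.Circle ρ')) :
    edgeCoeff o x ρ ρ' S S' ≠ 0 ↔ Allowed x ρ ρ' S S' := by
  have hs := sameAt_up h h0 h1
  have hlab : (∀ e, ¬ Through x ρ e → label ρ' S' e = label ρ S e) ↔
      ∀ e, ¬ Through x ρ e → (circleOf ρ' e ∈ S' ↔
        circleOf ρ' e ∈ (toList S).map (circleFun ρ ρ')) := by
    refine forall_congr' fun e => forall_congr' fun he => ?_
    rw [mem_map_circleFun h he]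
    unfold label
    exact ite_neg_one_congr
  have hmem : ∀ C, C ∈ (toList S).map (circleFun ρ ρ') ↔ ∃ C' ∈ S, circleFun ρ ρ' C' = C := by
    intro C
    rw [List.mem_map]
    simp only [mem_toList]
  unfold edgeCoeff Allowed
  rw [hlab]
  by_cases p : SameAt x ρ
  · have q : ¬ SameAt x ρ' := fun q => hs.1 q p
    rw [if_neg q, if_pos p]
    have hN := (circleFun_through h (circleOf ρ x.northEdge)).2 (Or.inl rfl)
    have hin : ∀ C, (C = circleOf ρ' x.northEdge ∨ C = circleOf ρ' x.southEdge) →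
        (C ∈ (toList S).map (circleFun ρ ρ') ↔
          circleOf ρ x.northEdge ∈ S ∧ circleFun ρ ρ' (circleOf ρ x.northEdge) = C) := by
      intro C hC
      rw [hmem]
      constructor
      · rintro ⟨C', hC', rfl⟩
        have := (circleFun_through h C').1 hC
        rw [← (show _ = _ from p), or_self] at this
        subst this
        exact ⟨hC', rfl⟩
      · rintro ⟨h1, h2⟩
        exact ⟨_, h1, h2⟩
    have hinN := hin _ (Or.inl rfl)
    have hinS := hin _ (Or.inr rfl)
    have hnd : ((toList S).map (circleFun ρ ρ')).Nodup :=
      (nodup_map_toList _ _).2 (circleFun_injOn h (Or.inl p))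
    have cons : ∀ i, wedgeCoeff (i :: (toList S).map (circleFun ρ ρ')) S' ≠ 0 ↔
        i ∉ (toList S).map (circleFun ρ ρ') ∧ ∀ j, j ∈ S' ↔ j = i ∨
          j ∈ (toList S).map (circleFun ρ ρ') := by
      intro i
      rw [wedgeCoeff_ne_zero, List.nodup_cons]
      simp only [List.mem_cons, hnd, and_true]
    have sep : ∀ {a b : ℤ}, (a ≠ 0 → b = 0) → (a - b ≠ 0 ↔ a ≠ 0 ∨ b ≠ 0) := by
      intro a b hab
      by_cases a0 : a = 0
      · simp [a0]
      · simp [hab a0]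
    have nt : ∀ e, ¬ Through x ρ e → circleOf ρ' e ≠ circleOf ρ' x.northEdge ∧
        circleOf ρ' e ≠ circleOf ρ' x.southEdge := by
      intro e he
      rw [through_congr h] at he
      exact not_or.1 he
    have rN : ∀ {e}, ¬ Through x ρ e → (circleOf ρ' e = circleOf ρ' x.northEdge) = False :=
      fun he => eq_false (nt _ he).1
    have rS : ∀ {e}, ¬ Through x ρ e → (circleOf ρ' e = circleOf ρ' x.southEdge) = False :=
      fun he => eq_false (nt _ he).2
    have q' : circleOf ρ' x.northEdge ≠ circleOf ρ' x.southEdge := q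
    have cN : wedgeCoeff (circleOf ρ' x.northEdge :: (toList S).map (circleFun ρ ρ')) S' ≠ 0 ↔
        circleOf ρ' x.northEdge ∉ (toList S).map (circleFun ρ ρ') ∧
          (∀ e, ¬ Through x ρ e → (circleOf ρ' e ∈ S' ↔
            circleOf ρ' e ∈ (toList S).map (circleFun ρ ρ'))) ∧ circleOf ρ' x.northEdge ∈ S' ∧
          (circleOf ρ' x.southEdge ∈ S' ↔
            circleOf ρ' x.southEdge ∈ (toList S).map (circleFun ρ ρ')) := by
      rw [cons, forall_circle_iff h]
      refine and_congr_right' (and_congr (forall_congr' fun e => forall_congr' fun he => ?_)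
        (and_congr ?_ ?_))
      · rw [rN he, false_or]
      · simp
      · rw [eq_false q'.symm, false_or]
    have cS : wedgeCoeff (circleOf ρ' x.southEdge :: (toList S).map (circleFun ρ ρ')) S' ≠ 0 ↔
        circleOf ρ' x.southEdge ∉ (toList S).map (circleFun ρ ρ') ∧
          (∀ e, ¬ Through x ρ e → (circleOf ρ' e ∈ S' ↔
            circleOf ρ' e ∈ (toList S).map (circleFun ρ ρ'))) ∧
          (circleOf ρ' x.northEdge ∈ S' ↔
            circleOf ρ' x.northEdge ∈ (toList S).map (circleFun ρ ρ')) ∧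
          circleOf ρ' x.southEdge ∈ S' := by
      rw [cons, forall_circle_iff h]
      refine and_congr_right' (and_congr (forall_congr' fun e => forall_congr' fun he => ?_)
        (and_congr ?_ ?_))
      · rw [rS he, false_or]
      · rw [eq_false q', false_or]
      · simp
    -- The terms of tail and head never contribute to the same basis vector, so they cannot cancel.
    have both : wedgeCoeff (circleOf ρ' x.northEdge :: (toList S).map (circleFun ρ ρ')) S' ≠ 0 →
        wedgeCoeff (circleOf ρ' x.southEdge :: (toList S).map (circleFun ρ ρ')) S' = 0 := by
      intro h1
      by_contra h2
      exact (cN.1 h1).1 ((cS.1 h2).2.2.1.1 (cN.1 h1).2.2.1)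
    have tot : wedgeCoeff (circleOf ρ' (o.tail x) :: (toList S).map (circleFun ρ ρ')) S' -
        wedgeCoeff (circleOf ρ' (o.head x) :: (toList S).map (circleFun ρ ρ')) S' ≠ 0 ↔
        wedgeCoeff (circleOf ρ' x.northEdge :: (toList S).map (circleFun ρ ρ')) S' ≠ 0 ∨
        wedgeCoeff (circleOf ρ' x.southEdge :: (toList S).map (circleFun ρ ρ')) S' ≠ 0 := by
      rcases o.ends x with ⟨h1, h2⟩ | ⟨h1, h2⟩ <;> rw [h1, h2]
      · exact sep both
      · rw [sep fun h1 => by_contra fun h2 => h1 (both h2), or_comm]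
    rw [tot, cN, cS]
    have hd : ¬ (circleFun ρ ρ' (circleOf ρ x.northEdge) = circleOf ρ' x.northEdge ∧
        circleFun ρ ρ' (circleOf ρ x.northEdge) = circleOf ρ' x.southEdge) :=
      fun h => q' (h.1.symm.trans h.2)
    have arith := split_labels (label_eq ρ S x.northEdge) (label_eq ρ' S' x.northEdge)
      (label_eq ρ' S' x.southEdge) label_eq_neg_one label_eq_neg_one label_eq_neg_one hd hN
    rw [← arith, ← hinN, ← hinS, and_left_comm, and_left_comm (a := _ ∉ _) (b := ∀ e, _), ← and_or_left]
  · have q : SameAt x ρ' := hs.2 p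
    have hin : circleOf ρ' x.northEdge ∈ (toList S).map (circleFun ρ ρ') ↔
        circleOf ρ x.northEdge ∈ S ∨ circleOf ρ x.southEdge ∈ S := by
      rw [hmem]
      constructor
      · rintro ⟨C', hC', h'⟩
        rcases (circleFun_through h C').1 (Or.inl h') with rfl | rfl
        exacts [Or.inl hC', Or.inr hC']
      · have hq : ∀ C, circleFun ρ ρ' C = circleOf ρ' x.southEdge →
          circleFun ρ ρ' C = circleOf ρ' x.northEdge := fun C hC => hC.trans q.symm
        rintro (h' | h')
        · exact ⟨_, h', ((circleFun_through h _).2 (Or.inl rfl)).elim id (hq _)⟩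
        · exact ⟨_, h', ((circleFun_through h _).2 (Or.inr rfl)).elim id (hq _)⟩
    -- The exterior product vanishes after a merge exactly if both merged circles are factors.
    have hinj : Set.InjOn (circleFun ρ ρ') S ↔
        ¬ (circleOf ρ x.northEdge ∈ S ∧ circleOf ρ x.southEdge ∈ S) := by
      refine ⟨fun hi ⟨h1, h2⟩ => p (hi h1 h2 ?_), fun h' => circleFun_injOn h (Or.inr h')⟩
      have e1 := (circleFun_through h _).2 (Or.inl rfl : _ ∨ circleOf ρ x.northEdge = _)
      have e2 := (circleFun_through h _).2 (Or.inr rfl : circleOf ρ x.southEdge = _ ∨ _)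
      rw [← (show _ = _ from q), or_self] at e1 e2
      rw [e1, e2]
    rw [if_pos q, if_neg p, wedgeCoeff_ne_zero, nodup_map_toList, forall_circle_iff h,
      ← (show _ = _ from q), hinj, hin]
    unfold label
    by_cases s1 : circleOf ρ x.northEdge ∈ S <;> by_cases s2 : circleOf ρ x.southEdge ∈ S <;>
      by_cases s3 : circleOf ρ' x.northEdge ∈ S' <;> simp [s1, s2, s3]

end GridDiagram

end

/-! ### The basis of states and the square of the differential -/

section
namespace GridDiagram

variable {n : ℕ} {D : GridDiagram n}

open Classical ExteriorAlgebra

/-- A resolution with a set of circles. These index the standard basis of the odd Khovanov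
complex. -/
abbrev State (D : GridDiagram n) : Type := Σ ρ : D.Resolution, Finset (D.Circle ρ)

/-- The standard basis of the odd Khovanov complex. -/
def stateBasis (D : GridDiagram n) (R : Type) [CommRing R] :
    Module.Basis D.State R (OddComplex D R) :=
  Pi.basis fun ρ => stdBasis R (D.Circle ρ)

/-- `ρ'` arises from `ρ` by giving `x` the 1-smoothing instead of the 0-smoothing. -/
def IsUp (ρ ρ' : D.Resolution) (x : D.Crossing) : Prop := ρ x = false ∧ ρ' = ρ.up x

theorem isUp_iff (ρ ρ' : D.Resolution) (x : D.Crossing) :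
    IsUp ρ ρ' x ↔ ρ' x = true ∧ ρ'.down x = ρ := by
  unfold IsUp Resolution.up Resolution.down
  constructor
  · rintro ⟨h, rfl⟩
    refine ⟨by simp, ?_⟩
    rw [Function.update_idem, ← h, Function.update_eq_self]
  · rintro ⟨h, rfl⟩
    refine ⟨by simp, ?_⟩
    rw [Function.update_idem, ← h, Function.update_eq_self]

theorem IsUp.unique {ρ ρ' : D.Resolution} {x y : D.Crossing} (h : IsUp ρ ρ' x) (h' : IsUp ρ ρ' y) :
    x = y := by
  by_contra hne
  have := congrFun (h.2.symm.trans h'.2) x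
  simp [Resolution.up, hne, h.1] at this

/-- The matrix of the differential of the odd Khovanov complex. -/
def diffMatrix {τ : Bool} (E : EdgeAssignment D τ) : Matrix D.State D.State ℤ := fun t s =>
  ∑ x, if IsUp s.1 t.1 x then ((E.sign s.1 x : ℤˣ) : ℤ) * edgeCoeff E.arrows x s.1 t.1 s.2 t.2 else 0

theorem diffMatrix_apply {τ : Bool} (E : EdgeAssignment D τ) {s t : D.State} {x : D.Crossing}
    (h : IsUp s.1 t.1 x) :
    diffMatrix E t s = ((E.sign s.1 x : ℤˣ) : ℤ) * edgeCoeff E.arrows x s.1 t.1 s.2 t.2 := by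
  unfold diffMatrix
  rw [Finset.sum_eq_single x (fun y _ hy => if_neg fun h' => hy (h'.unique h)) (by simp), if_pos h]

theorem exists_isUp_of_ne_zero {τ : Bool} {E : EdgeAssignment D τ} {s t : D.State}
    (h : diffMatrix E t s ≠ 0) : ∃ x, IsUp s.1 t.1 x ∧ Allowed x s.1 t.1 s.2 t.2 := by
  obtain ⟨x, -, hx⟩ := Finset.exists_ne_zero_of_sum_ne_zero h
  have hu : IsUp s.1 t.1 x := by
    by_contra h'
    exact hx (if_neg h')
  rw [if_pos hu] at hx
  refine ⟨x, hu, (edgeCoeff_ne_zero E.arrows ?_ hu.1 ?_ _ _).1 (right_ne_zero_of_mul hx)⟩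
  · rw [hu.2]; exact differAt_up _ _
  · rw [hu.2]; simp [Resolution.up]

theorem oddDifferential_stateBasis (R : Type) [CommRing R] {τ : Bool} (E : EdgeAssignment D τ)
    (s : D.State) : oddDifferential R E (stateBasis D R s) =
      ∑ t, diffMatrix E t s • stateBasis D R t := by
  obtain ⟨ρ, S⟩ := s
  funext ρ'
  have hR : (∑ t, diffMatrix E t ⟨ρ, S⟩ • stateBasis D R t) ρ' =
      ∑ S', diffMatrix E ⟨ρ', S'⟩ ⟨ρ, S⟩ • stdBasis R (D.Circle ρ') S' := by
    rw [Fintype.sum_sigma, Finset.sum_apply, Finset.sum_eq_single ρ']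
    · rw [Finset.sum_apply]
      simp [stateBasis]
    · intro ρ'' _ hne
      rw [Finset.sum_apply]
      exact Finset.sum_eq_zero fun S'' _ => by simp [stateBasis, hne.symm]
    · simp
  have hL : oddDifferential R E (stateBasis D R ⟨ρ, S⟩) ρ' = ∑ x, if IsUp ρ ρ' x then
      ((E.sign ρ x : ℤˣ) : ℤ) • edgeMap R E.arrows x ρ ρ' (stdBasis R _ S) else 0 := by
    rw [oddDifferential, LinearMap.pi_apply, LinearMap.sum_apply]
    have e1 : ∀ f : D.Crossing → ExteriorAlgebra R (V R ρ'),
        (∑ x, if IsUp ρ ρ' x then f x else 0) = ∑ x : {x : D.Crossing // ρ' x = true},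
          if IsUp ρ ρ' x then f x else 0 := by
      intro f
      rw [← Finset.sum_subtype (Finset.univ.filter fun x => ρ' x = true) (by simp)
        (fun x => if IsUp ρ ρ' x then f x else 0)]
      refine (Finset.sum_filter_of_ne fun x _ hx => ?_).symm
      exact ((isUp_iff ρ ρ' x).1 (by_contra fun h' => hx (if_neg h'))).1
    rw [e1]
    refine Finset.sum_congr rfl fun x _ => ?_
    simp only [LinearMap.smul_apply, LinearMap.comp_apply, LinearMap.proj_apply, stateBasis,
      Pi.basis_apply]
    split_ifs with hu
    · obtain rfl := ((isUp_iff _ _ _).1 hu).2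
      rw [Pi.single_eq_same]
    · have : ρ'.down x ≠ ρ := fun h' => hu ((isUp_iff _ _ _).2 ⟨x.2, h'⟩)
      rw [Pi.single_eq_of_ne this, map_zero, smul_zero]
  rw [hR, hL]
  unfold diffMatrix
  simp only [Finset.sum_smul]
  rw [Finset.sum_comm]
  refine Finset.sum_congr rfl fun x _ => ?_
  split_ifs
  · rw [edgeMap_stdBasis, Finset.smul_sum]
    simp only [smul_smul]
  · simp

theorem edgeCoeff_anticomm {τ : Bool} (E : EdgeAssignment D τ) (ρ : D.Resolution)
    {x y : D.Crossing} (hne : x ≠ y) (hx : ρ x = false) (hy : ρ y = false)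
    (S : Finset (D.Circle ρ)) (T : Finset (D.Circle ((ρ.up x).up y))) :
    ((E.sign ρ x * E.sign (ρ.up x) y : ℤˣ) : ℤ) * (∑ U, edgeCoeff E.arrows x ρ (ρ.up x) S U *
      edgeCoeff E.arrows y (ρ.up x) ((ρ.up x).up y) U T) +
    ((E.sign ρ y * E.sign (ρ.up y) x : ℤˣ) : ℤ) * (∑ U, edgeCoeff E.arrows y ρ (ρ.up y) S U *
      edgeCoeff E.arrows x (ρ.up y) ((ρ.up x).up y) U T) = 0 := by
  have h := congrArg (fun φ => (stdBasis ℤ _).repr (φ (stdBasis ℤ _ S)) T)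
    (E.anticomm ρ x y hne hx hy)
  simp only [LinearMap.add_apply, LinearMap.smul_apply, LinearMap.comp_apply, edgeMap_stdBasis,
    map_sum, map_smul, map_add, Finsupp.add_apply, Finsupp.smul_apply, Finsupp.finsetSum_apply,
    Module.Basis.repr_self, LinearMap.zero_apply, map_zero, Finsupp.zero_apply, smul_eq_mul,
    Finsupp.single_apply, mul_ite, mul_one, mul_zero, Finset.sum_ite_eq', Finset.mem_univ, if_true]
    at h
  exact h

/-- A composite of two arrows changes two different crossings. The two orders of changing them
cancel by the sign condition on the face. -/
theorem diffMatrix_mul_self {τ : Bool} (E : EdgeAssignment D τ) :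
    diffMatrix E * diffMatrix E = 0 := by
  ext t s
  obtain ⟨ρ, S⟩ := s
  obtain ⟨ρ'', T⟩ := t
  let F : D.Crossing → D.Crossing → ℤ := fun x y => ∑ u : D.State,
    (if IsUp u.1 ρ'' y then
      ((E.sign u.1 y : ℤˣ) : ℤ) * edgeCoeff E.arrows y u.1 ρ'' u.2 T else 0) *
    if IsUp ρ u.1 x then ((E.sign ρ x : ℤˣ) : ℤ) * edgeCoeff E.arrows x ρ u.1 S u.2 else 0
  have hF : (diffMatrix E * diffMatrix E) ⟨ρ'', T⟩ ⟨ρ, S⟩ = ∑ x, ∑ y, F x y := by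
    rw [Matrix.mul_apply]
    simp only [diffMatrix, Finset.sum_mul_sum, F]
    rw [Finset.sum_congr rfl fun u _ => Finset.sum_comm, Finset.sum_comm]
    exact Finset.sum_congr rfl fun x _ => Finset.sum_comm
  have hne : ∀ {x y}, F x y ≠ 0 → x ≠ y ∧ ρ x = false ∧ ρ y = false ∧ ρ'' = (ρ.up x).up y := by
    intro x y h
    obtain ⟨u, -, hu⟩ := Finset.exists_ne_zero_of_sum_ne_zero h
    have h1 : IsUp u.1 ρ'' y := by
      by_contra h'; exact hu (by rw [if_neg h', zero_mul])
    have h2 : IsUp ρ u.1 x := by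
      by_contra h'; exact hu (by rw [if_neg h', mul_zero])
    obtain ⟨h1, h3⟩ := h1
    obtain ⟨h2, h4⟩ := h2
    rw [h4] at h1 h3
    have hxy : x ≠ y := by rintro rfl; simp [Resolution.up] at h1
    exact ⟨hxy, h2, by simpa [Resolution.up, hxy.symm] using h1, h3⟩
  have hval : ∀ {x y}, x ≠ y → ρ x = false → ρ y = false → ρ'' = (ρ.up x).up y →
      F x y = ((E.sign ρ x * E.sign (ρ.up x) y : ℤˣ) : ℤ) * (∑ U, edgeCoeff E.arrows x ρ (ρ.up x) S U *
      edgeCoeff E.arrows y (ρ.up x) ρ'' U T) := by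
    intro x y hxy hx hy h
    have hy' : ρ.up x y = false := by simpa [Resolution.up, hxy.symm] using hy
    simp only [F]
    rw [Fintype.sum_sigma, Finset.sum_eq_single (ρ.up x)]
    · rw [Finset.mul_sum]
      refine Finset.sum_congr rfl fun U _ => ?_
      rw [if_pos ⟨hy', h⟩, if_pos ⟨hx, rfl⟩]
      push_cast
      ring
    · intro ρ' _ hρ
      refine Finset.sum_eq_zero fun U _ => ?_
      rw [if_neg (c := IsUp ρ ρ' x) fun h' => hρ h'.2, mul_zero]
    · simp
  have hanti : ∀ x y, F x y + F y x = 0 := by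
    intro x y
    have comm : (ρ.up x).up y = (ρ.up y).up x ∨ x = y := by
      by_cases hxy : x = y
      · exact Or.inr hxy
      · exact Or.inl (Function.update_comm hxy _ _ _)
    by_cases h : x ≠ y ∧ ρ x = false ∧ ρ y = false ∧ ρ'' = (ρ.up x).up y
    · obtain ⟨hxy, hx, hy, rfl⟩ := h
      rw [hval hxy hx hy rfl, hval hxy.symm hy hx (comm.resolve_right hxy)]
      exact edgeCoeff_anticomm E ρ hxy hx hy S T
    · have h1 : F x y = 0 := by_contra fun h' => h (hne h')
      have h2 : F y x = 0 := by
        by_contra h'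
        obtain ⟨a, b, c, d⟩ := hne h'
        exact h ⟨a.symm, c, b, d.trans (comm.resolve_right a.symm).symm⟩
      rw [h1, h2, add_zero]
  -- The sum of an antisymmetric function equals its own negative, and the coefficients are
  -- integers.
  have h2 : (∑ x, ∑ y, F x y) + ∑ x, ∑ y, F x y = 0 := by
    calc _ = (∑ x, ∑ y, F x y) + ∑ x, ∑ y, F y x := by rw [Finset.sum_comm (f := fun x y => F y x)]
      _ = ∑ x, ∑ y, (F x y + F y x) := by simp only [Finset.sum_add_distrib]
      _ = 0 := by simp only [hanti, Finset.sum_const_zero]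
  rw [hF, Matrix.zero_apply]
  omega

end GridDiagram

end

section
/-! ### Homological perturbation -/

/-- The data of the homological perturbation lemma in a ring: `D` is a differential, `h` contracts
its leading part `d` onto the image of the idempotent `p`, and `v` is inverse to
`1 + h * (D - d)`. -/
structure Perturbation {A : Type*} [Ring A] (D d h p v : A) : Prop where
  sq : D * D = 0
  htpy : d * h + h * d = 1 - p
  hh : h * h = 0
  hp : h * p = 0
  ph : p * h = 0
  dp : d * p = 0
  pd : p * d = 0
  pp : p * p = p
  left : v * (1 + h * (D - d)) = 1
  right : (1 + h * (D - d)) * v = 1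

namespace Perturbation

variable {A : Type*} [Ring A] {D d h p v : A} (H : Perturbation D d h p v)

include H

theorem h_mul_v : h * v = h := by
  have := congrArg (h * ·) H.right
  simpa [add_mul, mul_add, ← mul_assoc, H.hh] using this

theorem p_mul_v : p * v = p := by
  have := congrArg (p * ·) H.right
  simpa [add_mul, mul_add, ← mul_assoc, H.ph] using this

theorem hdv : h * (D - d) * v = 1 - v := by
  have := H.right
  rw [add_mul, one_mul] at this
  exact eq_sub_of_add_eq' this

theorem vhd : v * (h * (D - d)) = 1 - v := by
  have := H.left
  rw [mul_add, mul_one] at this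
  exact eq_sub_of_add_eq' this

/-- The inclusion `v * p` of the reduced complex is a chain map. -/
theorem comm_incl : D * (v * p) = v * p * (p * D * v * p) := by
  -- The image of `v * p` is where `h` vanishes; that `D` does not leave it is the main point.
  have hz : h * (D * (v * p)) = 0 := by
    have e1 : h * D = (1 - p - d * h) + h * (D - d) := by rw [← H.htpy]; noncomm_ring
    calc h * (D * (v * p)) = (h * D) * v * p := by noncomm_ring
      _ = v * p - p * v * p - d * (h * v) * p + (h * (D - d) * v) * p := by rw [e1]; noncomm_ring
      _ = 0 := by
        rw [H.hdv, H.h_mul_v, H.p_mul_v, H.pp, mul_assoc, H.hp]; noncomm_ring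
  have h1 : (1 + h * (D - d)) * (D * (v * p)) = p * (D * (v * p)) := by
    have e2 : h * d = 1 - p - d * h := by rw [← H.htpy]; noncomm_ring
    calc _ = D * (v * p) + h * (D * D) * (v * p) - h * d * (D * (v * p)) := by noncomm_ring
      _ = p * (D * (v * p)) + d * (h * (D * (v * p))) := by rw [H.sq, e2]; noncomm_ring
      _ = _ := by rw [hz]; noncomm_ring
  calc D * (v * p) = v * (1 + h * (D - d)) * (D * (v * p)) := by rw [H.left, one_mul]
    _ = v * ((1 + h * (D - d)) * (D * (v * p))) := by noncomm_ring
    _ = v * (p * p * (D * (v * p))) := by rw [h1, H.pp]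
    _ = _ := by noncomm_ring

/-- The general rule that an inverse of `1 + a * b` gives the inverse `1 - b * (1 + a * b)⁻¹ * a` of
`1 + b * a`. -/
theorem u_left : (1 - (D - d) * v * h) * (1 + (D - d) * h) = 1 := by
  calc _ = 1 + (D - d) * h - (D - d) * (v * (1 + h * (D - d))) * h := by noncomm_ring
    _ = 1 := by rw [H.left]; noncomm_ring

theorem u_right : (1 + (D - d) * h) * (1 - (D - d) * v * h) = 1 := by
  calc _ = 1 + (D - d) * h - (D - d) * ((1 + h * (D - d)) * v) * h := by noncomm_ring
    _ = 1 := by rw [H.right]; noncomm_ring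

theorem pvp : p * v * p = p := by rw [H.p_mul_v, H.pp]

theorem pup : p * (1 - (D - d) * v * h) * p = p := by
  calc _ = p * p - p * (D - d) * v * (h * p) := by noncomm_ring
    _ = p := by rw [H.hp, H.pp]; noncomm_ring

theorem puh : p * (1 - (D - d) * v * h) * h = 0 := by
  calc _ = p * h - p * (D - d) * v * (h * h) := by noncomm_ring
    _ = 0 := by rw [H.hh, H.ph]; noncomm_ring

/-- The projection to the reduced complex is a chain map. -/
theorem comm_proj : p * (1 - (D - d) * v * h) * D =
    p * D * v * p * (p * (1 - (D - d) * v * h)) := by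
  set u := 1 - (D - d) * v * h with hu
  have hy : p * u * D * h = 0 := by
    have e1 : d * h = 1 - p - h * d := by rw [← H.htpy]; noncomm_ring
    have e2 : u * ((D - d) * h) = 1 - u := by
      have := H.u_left
      rw [mul_add, mul_one] at this
      exact eq_sub_of_add_eq' this
    calc p * u * D * h = p * u * (d * h) + p * (u * ((D - d) * h)) := by noncomm_ring
      _ = p - p * u * p - p * u * h * d := by rw [e1, e2]; noncomm_ring
      _ = 0 := by rw [H.pup, H.puh]; noncomm_ring
  have h1 : p * u * D * (1 + (D - d) * h) = p * u * D * p := by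
    have e1 : d * h = 1 - p - h * d := by rw [← H.htpy]; noncomm_ring
    calc _ = p * u * D + p * u * (D * D) * h - p * u * D * (d * h) := by noncomm_ring
      _ = p * u * D * p + p * u * D * h * d := by rw [H.sq, e1]; noncomm_ring
      _ = _ := by rw [hy]; noncomm_ring
  have h2 : p * u * D * p = p * D * v * p := by
    calc p * u * D * p = p * D * p - p * (D - d) * (v * (h * (D - d))) * p
          - p * (D - d) * v * h * (d * p) := by rw [hu]; noncomm_ring
      _ = p * D * v * p + (p * d) * p - (p * d) * v * p := by rw [H.vhd, H.dp]; noncomm_ring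
      _ = _ := by rw [H.pd]; noncomm_ring
  calc p * u * D = p * u * D * ((1 + (D - d) * h) * u) := by rw [H.u_right, mul_one]
    _ = p * u * D * (1 + (D - d) * h) * u := by noncomm_ring
    _ = p * u * D * (p * p) * u := by rw [h1, H.pp]
    _ = p * u * D * p * (p * u) := by noncomm_ring
    _ = _ := by rw [h2]

theorem proj_incl : p * (1 - (D - d) * v * h) * (v * p) = p := by
  calc _ = p * v * p - p * (D - d) * v * (h * v) * p := by noncomm_ring
    _ = p - p * (D - d) * v * (h * p) := by rw [H.h_mul_v, H.pvp]; noncomm_ring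
    _ = p := by rw [H.hp]; noncomm_ring

/-- Inclusion and projection of the reduced complex are inverse up to the homotopy `v * h`. The
identity is checked after multiplication with the units `1 + h * (D - d)` and `1 + (D - d) * h`,
where it no longer involves `v`. -/
theorem incl_proj : v * p * (p * (1 - (D - d) * v * h)) = 1 - D * (v * h) - v * h * D := by
  set u := 1 - (D - d) * v * h with hu
  have vh : v * h * (1 + (D - d) * h) = h := by
    calc _ = v * (1 + h * (D - d)) * h := by noncomm_ring
      _ = h := by rw [H.left, one_mul]
  have e : h * d * d * h = 0 := by
    have e1 : d * h = 1 - p - h * d := by rw [← H.htpy]; noncomm_ring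
    have e2 : h * d = 1 - p - d * h := by rw [← H.htpy]; noncomm_ring
    have e3 : h * d * d * h = (1 - p - d * h) * (1 - p - h * d) := by
      rw [← e1, ← e2]; noncomm_ring
    calc _ = (1 - p - d * h) * (1 - p - h * d) := e3
      _ = 1 - p - p + p * p - (h * d + d * h) + p * h * d + d * (h * p) + d * (h * h) * d := by
        noncomm_ring
      _ = 1 - p - (d * h + h * d) := by rw [H.pp, H.ph, H.hp, H.hh]; noncomm_ring
      _ = 0 := by rw [H.htpy]; noncomm_ring
  -- Expanding the product, all terms cancel except `1 - (d * h + h * d)`.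
  have key : (1 + h * (D - d)) * (1 - D * (v * h) - v * h * D) * (1 + (D - d) * h) = p := by
    calc _ = (1 + h * (D - d)) * (1 + (D - d) * h)
          - (1 + h * (D - d)) * D * (v * h * (1 + (D - d) * h))
          - ((1 + h * (D - d)) * v) * h * D * (1 + (D - d) * h) := by noncomm_ring
      _ = 1 - (d * h + h * d) - h * (D * D) * h + h * d * d * h := by
        rw [vh, H.right]; noncomm_ring
      _ = p := by rw [e, H.htpy, H.sq]; noncomm_ring
  calc v * p * (p * u) = v * (p * p) * u := by noncomm_ring
    _ = v * ((1 + h * (D - d)) * (1 - D * (v * h) - v * h * D) * (1 + (D - d) * h)) * u := by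
      rw [key, H.pp]
    _ = (v * (1 + h * (D - d))) * (1 - D * (v * h) - v * h * D) * ((1 + (D - d) * h) * u) := by
      noncomm_ring
    _ = _ := by rw [H.left, H.u_right]; noncomm_ring

theorem reduced_sq : p * D * v * p * (p * D * v * p) = 0 := by
  calc _ = p * D * (v * p * (p * D * v * p)) := by noncomm_ring
    _ = p * (D * D) * (v * p) := by rw [← H.comm_incl]; noncomm_ring
    _ = 0 := by rw [H.sq]; noncomm_ring

omit H

/-- A contraction can be replaced by one whose square is zero. -/
theorem special {A : Type*} [Ring A] {d h p : A} (dd : d * d = 0) (htpy : d * h + h * d = 1 - p)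
    (dp : d * p = 0) (hp : h * p = 0) (ph : p * h = 0) :
    (h * d * h) * (h * d * h) = 0 ∧ d * (h * d * h) + (h * d * h) * d = 1 - p := by
  have e1 : d * h = 1 - p - h * d := by rw [← htpy]; noncomm_ring
  have e2 : h * d = 1 - p - d * h := by rw [← htpy]; noncomm_ring
  have e : d * h * h * d = 0 := by
    calc d * h * h * d = (1 - p - h * d) * h * d := by rw [← e1]
      _ = h * d - p * h * d - h * (d * h) * d := by noncomm_ring
      _ = h * d - p * h * d - h * (1 - p - h * d) * d := by rw [e1]
      _ = - (p * h * d) + h * p * d + h * h * (d * d) := by noncomm_ring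
      _ = 0 := by rw [ph, hp, dd]; noncomm_ring
  constructor
  · calc _ = h * (d * h * h * d) * h := by noncomm_ring
      _ = 0 := by rw [e]; noncomm_ring
  · calc _ = d * h * (d * h) + h * d * (h * d) := by noncomm_ring
      _ = d * h * (1 - p - h * d) + h * d * (1 - p - d * h) := by rw [← e1, ← e2]
      _ = (d * h + h * d) - d * (h * p) - d * h * h * d - h * (d * p) - h * (d * d) * h := by
        noncomm_ring
      _ = _ := by rw [htpy, hp, dp, dd, e]; noncomm_ring

end Perturbation

/-! ### Homology -/

section Homology

variable {R M M' : Type*} [CommRing R] [AddCommGroup M] [Module R M] [AddCommGroup M'] [Module R M']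

theorem homologyAt_mapsTo {d : M →ₗ[R] M} {d' : M' →ₗ[R] M'} (f : M →ₗ[R] M')
    (hf : f ∘ₗ d = d' ∘ₗ f) {cur : Submodule R M} {cur' : Submodule R M'}
    (hcur : ∀ x ∈ cur, f x ∈ cur') :
    ∀ x ∈ cur ⊓ LinearMap.ker d, f x ∈ cur' ⊓ LinearMap.ker d' := by
  rintro x ⟨h1, h2⟩
  refine ⟨hcur x h1, ?_⟩
  have := LinearMap.congr_fun hf x
  simp only [LinearMap.comp_apply] at this
  change d' (f x) = 0
  rw [← this, show d x = 0 from h2, map_zero]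

/-- A chain map induces a map on homology. -/
def homologyAt.map {d : M →ₗ[R] M} {d' : M' →ₗ[R] M'} (f : M →ₗ[R] M') (hf : f ∘ₗ d = d' ∘ₗ f)
    {prev cur : Submodule R M} {prev' cur' : Submodule R M'} (hprev : ∀ x ∈ prev, f x ∈ prev')
    (hcur : ∀ x ∈ cur, f x ∈ cur') : homologyAt d prev cur →ₗ[R] homologyAt d' prev' cur' :=
  Submodule.mapQ _ _ (f.restrict (homologyAt_mapsTo f hf hcur)) <| by
    rintro ⟨x, hx⟩ ⟨y, hy, hxy⟩
    exact ⟨f y, hprev y hy, (LinearMap.congr_fun hf y).symm.trans (congrArg f hxy)⟩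

/-- Chain maps that are inverse up to homotopy induce isomorphisms on homology. -/
theorem homologyAt_equiv {d : M →ₗ[R] M} {d' : M' →ₗ[R] M'} (f : M →ₗ[R] M') (g : M' →ₗ[R] M)
    (H : M' →ₗ[R] M') (hf : f ∘ₗ d = d' ∘ₗ f) (hg : g ∘ₗ d' = d ∘ₗ g) (hgf : g ∘ₗ f = LinearMap.id)
    (hfg : f ∘ₗ g = LinearMap.id - d' ∘ₗ H - H ∘ₗ d') {prev cur : Submodule R M}
    {prev' cur' : Submodule R M'} (f1 : ∀ x ∈ prev, f x ∈ prev') (f2 : ∀ x ∈ cur, f x ∈ cur')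
    (g1 : ∀ x ∈ prev', g x ∈ prev) (g2 : ∀ x ∈ cur', g x ∈ cur) (h : ∀ x ∈ cur', H x ∈ prev') :
    Nonempty (homologyAt d prev cur ≃ₗ[R] homologyAt d' prev' cur') := by
  refine ⟨LinearEquiv.ofLinearMap (homologyAt.map f hf f1 f2) (homologyAt.map g hg g1 g2) ?_ ?_⟩
  · apply Submodule.linearMap_qext
    ext ⟨x, hx⟩
    refine (Submodule.Quotient.eq _).2 ?_
    refine ⟨-H x, neg_mem (h x hx.1), ?_⟩
    have := LinearMap.congr_fun hfg x
    simp only [LinearMap.comp_apply, LinearMap.sub_apply, LinearMap.id_apply,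
      LinearMap.mem_ker.1 hx.2, map_zero, sub_zero] at this
    change d' (-H x) = f (g x) - x
    rw [this, map_neg]
    abel
  · apply Submodule.linearMap_qext
    ext ⟨x, hx⟩
    change Submodule.Quotient.mk _ = Submodule.Quotient.mk _
    congr 1
    exact Subtype.ext (LinearMap.congr_fun hgf x)

end Homology

/-! ### Contracting a cube -/

section Cube

variable {S X R : Type} [Fintype S] [DecidableEq X] [CommRing R]

/-- A family of partial involutions `flip x`, defined on the set `dom x`, that change the value at
`x` of a vector of bits, and a differential whose nonzero coefficients lead from `0` to `1` along
these involutions. -/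
structure IsCube (dom : S → X → Prop) (bit : S → X → Bool) (flip : X → S → S)
    (d : Matrix S S R) : Prop where
  dom_flip : ∀ {s x}, dom s x → dom (flip x s) = dom s
  flip_flip : ∀ {s x}, dom s x → flip x (flip x s) = s
  bit_flip : ∀ {s x}, dom s x → bit (flip x s) = Function.update (bit s) x (!bit s x)
  comm : ∀ {s x y}, dom s x → dom s y → flip x (flip y s) = flip y (flip x s)
  ne_zero : ∀ {s t}, d t s ≠ 0 → ∃ x, dom s x ∧ bit s x = false ∧ t = flip x s
  sq_one : ∀ {s x}, dom s x → bit s x = false → d (flip x s) s * d (flip x s) s = 1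
  sq : d * d = 0

namespace IsCube

variable {dom : S → X → Prop} {bit : S → X → Bool} {flip : X → S → S} {d : Matrix S S R}

open Classical in
/-- The part of the differential that changes the bit at `x`. -/
def part (dom : S → X → Prop) (bit : S → X → Bool) (flip : X → S → S) (d : Matrix S S R) (x : X) :
    Matrix S S R := fun t s => if dom s x ∧ bit s x = false ∧ t = flip x s then d t s else 0

omit [DecidableEq X] in
open Classical in
theorem transpose_part_mul (A : Matrix S S R) (x : X) (a b : S) :
    ((part dom bit flip d x).transpose * A) a b =
      if dom a x ∧ bit a x = false then d (flip x a) a * A (flip x a) b else 0 := by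
  rw [Matrix.mul_apply, Finset.sum_eq_single (flip x a)]
  · rw [Matrix.transpose_apply, part]
    simp only [and_true]
    split_ifs <;> simp
  · intro u _ hu
    rw [Matrix.transpose_apply, part, if_neg fun h => hu h.2.2, zero_mul]
  · simp

variable (C : IsCube dom bit flip d)

include C

theorem flip_ne {s : S} {x y : X} (hx : dom s x) (hy : dom s y) (hxy : x ≠ y) :
    flip x s ≠ flip y s := by
  intro h
  have := congrFun ((C.bit_flip hx).symm.trans ((congrArg bit h).trans (C.bit_flip hy))) x
  simp [hxy] at this

theorem sum_part [Fintype X] : d = ∑ x, part dom bit flip d x := by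
  ext t s
  rw [Matrix.sum_apply]
  by_cases h : d t s = 0
  · rw [h]
    refine (Finset.sum_eq_zero fun x _ => ?_).symm
    unfold part
    split_ifs <;> first | rfl | exact h
  · obtain ⟨x, h1, h2, h3⟩ := C.ne_zero h
    rw [Finset.sum_eq_single x]
    · exact (if_pos ⟨h1, h2, h3⟩).symm
    · intro y _ hy
      exact if_neg fun h' => C.flip_ne h1 h'.1 hy.symm (h3.symm.trans h'.2.2)
    · simp

open Classical in
theorem part_apply' (x : X) (t s : S) : part dom bit flip d x t s =
    if dom t x ∧ bit t x = true ∧ s = flip x t then d t s else 0 := by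
  unfold part
  refine if_congr ⟨?_, ?_⟩ rfl rfl
  · rintro ⟨h1, h2, rfl⟩
    exact ⟨by rw [C.dom_flip h1]; exact h1, by rw [C.bit_flip h1]; simp [h2], (C.flip_flip h1).symm⟩
  · rintro ⟨h1, h2, rfl⟩
    exact ⟨by rw [C.dom_flip h1]; exact h1, by rw [C.bit_flip h1]; simp [h2], (C.flip_flip h1).symm⟩

open Classical in
theorem mul_transpose_part (A : Matrix S S R) (x : X) (a b : S) :
    (A * (part dom bit flip d x).transpose) a b =
      if dom b x ∧ bit b x = true then A a (flip x b) * d b (flip x b) else 0 := by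
  rw [Matrix.mul_apply, Finset.sum_eq_single (flip x b)]
  · rw [Matrix.transpose_apply, C.part_apply']
    simp only [and_true]
    split_ifs <;> simp
  · intro u _ hu
    rw [Matrix.transpose_apply, C.part_apply', if_neg fun h => hu h.2.2, mul_zero]
  · simp

/-- The vanishing coefficient of `d * d` between opposite corners of a square has only the two other
corners as intermediate states: any other intermediate state would have a wrong bit. -/
theorem square {s : S} {x y : X} (hne : x ≠ y) (hx : dom s x) (hy : dom s y) (bx : bit s x = false)
    (bY : bit s y = false) :
    d (flip y (flip x s)) (flip x s) * d (flip x s) s +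
      d (flip y (flip x s)) (flip y s) * d (flip y s) s = 0 := by
  classical
  have hy' : dom (flip x s) y := by rw [C.dom_flip hx]; exact hy
  have btop : bit (flip y (flip x s)) =
      Function.update (Function.update (bit s) x true) y true := by
    rw [C.bit_flip hy', C.bit_flip hx, bx, Function.update_of_ne hne.symm, bY]
    rfl
  have := congrFun (congrFun C.sq (flip y (flip x s))) s
  rw [Matrix.mul_apply, Finset.sum_eq_add (flip x s) (flip y s) (C.flip_ne hx hy hne)] at this
  · exact this
  · rintro u - ⟨h1, h2⟩
    by_contra h
    obtain ⟨z, d1, z1, rfl⟩ := C.ne_zero (right_ne_zero_of_mul h)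
    obtain ⟨z', d2, z2, h3⟩ := C.ne_zero (left_ne_zero_of_mul h)
    have e := congrFun (congrArg bit h3) z
    rw [btop, C.bit_flip d2, C.bit_flip d1] at e
    rw [C.bit_flip d1] at z2
    have n1 : z ≠ x := by rintro rfl; exact h1 rfl
    have n2 : z ≠ y := by rintro rfl; exact h2 rfl
    by_cases hz : z = z'
    · subst hz
      simp [z1] at z2
    · simp [n1, n2, hz, z1] at e
  · simp
  · simp

open Classical in
-- Each component pairs the states where `x` is available, with a coefficient of square 1. So its
-- transpose is its inverse from one half of the pairs to the other.
theorem part_comm_transpose_self [DecidableEq S] (x : X) :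
    part dom bit flip d x * (part dom bit flip d x).transpose +
      (part dom bit flip d x).transpose * part dom bit flip d x =
    Matrix.diagonal (fun s => if dom s x then 1 else 0) := by
  ext a b
  rw [Matrix.add_apply, C.mul_transpose_part, transpose_part_mul]
  by_cases hab : a = b
  · subst hab
    rw [Matrix.diagonal_apply_eq]
    by_cases ha : dom a x
    · have ff := C.flip_flip ha
      have df : dom (flip x a) x := by rw [C.dom_flip ha]; exact ha
      have bf : bit (flip x a) x = !bit a x := by rw [C.bit_flip ha]; simp
      cases hb : bit a x
      · have := C.sq_one ha hb
        simpa [ha, hb, part] using this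
      · rw [hb] at bf
        have := C.sq_one df bf
        rw [ff] at this
        simpa [ha, hb, C.part_apply'] using this
    · simp [ha]
  · rw [Matrix.diagonal_apply_ne _ hab]
    have inj : dom a x → dom b x → flip x a = flip x b → False := fun ha hb h => hab <| by
      rw [← C.flip_flip ha, h, C.flip_flip hb]
    rw [C.part_apply', part]
    have h1 : ¬ (dom b x ∧ dom a x ∧ flip x b = flip x a) := fun h => inj h.2.1 h.1 h.2.2.symm
    have h2 : ¬ (dom a x ∧ dom b x ∧ flip x a = flip x b) := fun h => inj h.1 h.2.1 h.2.2
    split_ifs <;> first | (simp; done) | (exfalso; tauto)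

/-- Since all coefficients have square 1, the anticommuting relation of a square may be multiplied
by two of its coefficients; this reverses the arrows in one direction. -/
theorem part_comm_transpose {x y : X} (hxy : x ≠ y) :
    part dom bit flip d y * (part dom bit flip d x).transpose +
      (part dom bit flip d x).transpose * part dom bit flip d y = 0 := by
  classical
  ext a b
  rw [Matrix.add_apply, C.mul_transpose_part, transpose_part_mul, Matrix.zero_apply]
  by_cases h : ∃ s, dom s x ∧ dom s y ∧ bit s x = false ∧ bit s y = false ∧ a = flip y s ∧
      b = flip x s
  · obtain ⟨s, hx, hy, bx, bY, rfl, rfl⟩ := h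
    have d1 : dom (flip x s) = dom s := C.dom_flip hx
    have d2 : dom (flip y s) = dom s := C.dom_flip hy
    have b1 : bit (flip x s) x = true := by rw [C.bit_flip hx]; simp [bx]
    have b2 : bit (flip y s) x = false := by rw [C.bit_flip hy]; simp [bx, hxy]
    have b3 : bit (flip x s) y = false := by rw [C.bit_flip hx]; simp [bY, hxy.symm]
    have ff : flip x (flip x s) = s := C.flip_flip hx
    have cm : flip x (flip y s) = flip y (flip x s) := C.comm hx hy
    rw [if_pos ⟨by rw [d1]; exact hx, b1⟩, if_pos ⟨by rw [d2]; exact hx, b2⟩, ff, cm,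
      part, part, if_pos ⟨hy, bY, rfl⟩, if_pos ⟨by rw [d1]; exact hy, b3, rfl⟩]
    have sq := C.square hxy hx hy bx bY
    have q1 := C.sq_one hx bx
    have q2 := C.sq_one (s := flip y s) (x := x) (by rw [d2]; exact hx) b2
    rw [cm] at q2
    linear_combination d (flip x s) s * d (flip y (flip x s)) (flip y s) * sq
      - d (flip y (flip x s)) (flip y s) * d (flip y (flip x s)) (flip x s) * q1
      - d (flip y s) s * d (flip x s) s * q2
  · have n1 : ¬ ((dom b x ∧ bit b x = true) ∧
        dom (flip x b) y ∧ bit (flip x b) y = false ∧ a = flip y (flip x b)) := by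
      rintro ⟨⟨h1, h2⟩, h3, h4, h5⟩
      refine h ⟨flip x b, ?_, h3, ?_, h4, h5, (C.flip_flip h1).symm⟩
      · rw [C.dom_flip h1]; exact h1
      · rw [C.bit_flip h1]; simp [h2]
    have n2 : ¬ ((dom a x ∧ bit a x = false) ∧
        dom b y ∧ bit b y = false ∧ flip x a = flip y b) := by
      rintro ⟨⟨h1, h2⟩, h3, h4, h5⟩
      have hdom : dom a = dom b := by rw [← C.dom_flip h1, h5, C.dom_flip h3]
      have hbx : dom b x := by rw [← hdom]; exact h1
      have e1 : bit (flip x a) x = true := by rw [C.bit_flip h1]; simp [h2]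
      rw [h5, C.bit_flip h3, Function.update_of_ne hxy] at e1
      refine h ⟨flip x b, ?_, ?_, ?_, ?_, ?_, (C.flip_flip hbx).symm⟩
      · rw [C.dom_flip hbx]; exact hbx
      · rw [C.dom_flip hbx]; exact h3
      · rw [C.bit_flip hbx]; simp [e1]
      · rw [C.bit_flip hbx, Function.update_of_ne hxy.symm, h4]
      · rw [← C.comm hbx h3, ← h5, C.flip_flip h1]
    rw [part, part]
    split_ifs <;> first | (simp; done) | (exfalso; tauto)

open Classical in
/-- The weighted transpose of the differential is a contraction. -/
theorem contraction [DecidableEq S] [Fintype X] (w : S → X → R)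
    (hw : ∀ {s x}, dom s x → w (flip x s) = w s) (hdom : ∀ {s x}, w s x ≠ 0 → dom s x) :
    d * (∑ x, (part dom bit flip d x).transpose * Matrix.diagonal fun s => w s x) +
      (∑ x, (part dom bit flip d x).transpose * Matrix.diagonal fun s => w s x) * d =
    Matrix.diagonal fun s => ∑ x, w s x := by
  -- The weights are constant on each cube, so they commute with the differential and may be pulled
  -- out.
  have comm : ∀ x y, Matrix.diagonal (fun s => w s x) * part dom bit flip d y =
      part dom bit flip d y * Matrix.diagonal fun s => w s x := by
    intro x y
    ext t s
    rw [Matrix.diagonal_mul, Matrix.mul_diagonal, part]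
    split_ifs with h
    · obtain ⟨h1, _, rfl⟩ := h
      rw [hw h1, mul_comm]
    · simp
  have e1 : ∀ x, d * ((part dom bit flip d x).transpose * Matrix.diagonal fun s => w s x) +
      (part dom bit flip d x).transpose * (Matrix.diagonal fun s => w s x) * d =
      Matrix.diagonal fun s => w s x := by
    intro x
    have e2 : (Matrix.diagonal fun s => w s x) * d = d * Matrix.diagonal fun s => w s x := by
      conv_lhs => rw [C.sum_part]
      conv_rhs => rw [C.sum_part]
      rw [Finset.mul_sum, Finset.sum_mul]
      exact Finset.sum_congr rfl fun y _ => comm x y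
    have e3 : d * (part dom bit flip d x).transpose + (part dom bit flip d x).transpose * d =
        Matrix.diagonal (fun s => if dom s x then 1 else 0) := by
      conv_lhs => rw [show d * (part dom bit flip d x).transpose +
        (part dom bit flip d x).transpose * d = ∑ y, (part dom bit flip d y *
          (part dom bit flip d x).transpose + (part dom bit flip d x).transpose *
          part dom bit flip d y) by
        rw [Finset.sum_add_distrib, ← Finset.sum_mul, ← Finset.mul_sum, ← C.sum_part]]
      rw [Finset.sum_eq_single x (fun y _ hy => C.part_comm_transpose hy.symm) (by simp),
        C.part_comm_transpose_self]
    rw [Matrix.mul_assoc, e2, ← Matrix.mul_assoc, ← Matrix.mul_assoc, ← Matrix.add_mul, e3,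
      Matrix.diagonal_mul_diagonal]
    congr 1
    funext s
    by_cases h : w s x = 0
    · simp [h]
    · simp [hdom h]
  rw [Finset.mul_sum, Finset.sum_mul, ← Finset.sum_add_distrib, Finset.sum_congr rfl fun x _ => e1 x]
  ext a b
  rw [Matrix.sum_apply]
  by_cases h : a = b
  · subst h; simp
  · simp [h]

end IsCube

end Cube

end

section
/-! ### The reduced complex -/

section Homogeneous

variable {S R : Type} [Fintype S] [DecidableEq S] [CommRing R]

/-- A matrix is homogeneous of degree `k` for the grading `deg` of its index set. -/
def Homogeneous (deg : S → ℤ × ℤ) (k : ℤ × ℤ) (M : Matrix S S R) : Prop :=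
  ∀ t s, M t s ≠ 0 → deg t = deg s + k

variable {deg : S → ℤ × ℤ} {k l : ℤ × ℤ} {M N : Matrix S S R}

omit [DecidableEq S] in
theorem Homogeneous.mul (hM : Homogeneous deg k M) (hN : Homogeneous deg l N) :
    Homogeneous deg (k + l) (M * N) := by
  intro t s h
  rw [Matrix.mul_apply] at h
  obtain ⟨u, -, hu⟩ := Finset.exists_ne_zero_of_sum_ne_zero h
  rw [hM _ _ (left_ne_zero_of_mul hu), hN _ _ (right_ne_zero_of_mul hu)]
  abel

omit [Fintype S] [DecidableEq S] in
theorem Homogeneous.add (hM : Homogeneous deg k M) (hN : Homogeneous deg k N) :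
    Homogeneous deg k (M + N) := by
  intro t s h
  by_cases h1 : M t s = 0
  · exact hN _ _ fun h2 => h (by rw [Matrix.add_apply, h1, h2, add_zero])
  · exact hM _ _ h1

omit [Fintype S] [DecidableEq S] in
theorem Homogeneous.neg (hM : Homogeneous deg k M) : Homogeneous deg k (-M) :=
  fun t s h => hM t s fun h' => h (by rw [Matrix.neg_apply, h', neg_zero])

omit [Fintype S] [DecidableEq S] in
theorem Homogeneous.sub (hM : Homogeneous deg k M) (hN : Homogeneous deg k N) :
    Homogeneous deg k (M - N) := by
  rw [sub_eq_add_neg]; exact hM.add hN.neg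

omit [Fintype S] [DecidableEq S] in
theorem Homogeneous.zero : Homogeneous deg k (0 : Matrix S S R) := fun _ _ h => absurd rfl h

omit [Fintype S] in
theorem Homogeneous.diagonal (a : S → R) : Homogeneous deg 0 (Matrix.diagonal a) := by
  intro t s h
  by_cases hts : t = s
  · rw [hts, add_zero]
  · exact absurd (Matrix.diagonal_apply_ne _ hts) h

omit [Fintype S] in
theorem Homogeneous.one : Homogeneous deg 0 (1 : Matrix S S R) := by
  rw [← Matrix.diagonal_one]; exact .diagonal _

theorem Homogeneous.pow (hM : Homogeneous deg 0 M) (i : ℕ) : Homogeneous deg 0 (M ^ i) := by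
  induction i with
  | zero => rw [pow_zero]; exact .one
  | succ i ih => rw [pow_succ]; simpa using ih.mul hM

omit [Fintype S] [DecidableEq S] in
theorem Homogeneous.sum {ι : Type} (s : Finset ι) (f : ι → Matrix S S R)
    (h : ∀ i ∈ s, Homogeneous deg k (f i)) : Homogeneous deg k (∑ i ∈ s, f i) :=
  Finset.sum_induction f (Homogeneous deg k) (fun _ _ => .add) .zero h

/-- A matrix whose coefficients decrease a function on the index set is nilpotent. -/
theorem isNilpotent_of_lt (A : S → ℤ) (h : ∀ t s, M t s ≠ 0 → A t < A s) : IsNilpotent M := by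
  have key : ∀ (i : ℕ) t s, (M ^ i) t s ≠ 0 → A t + i ≤ A s := by
    intro i
    induction i with
    | zero =>
      intro t s hts
      have : t = s := by
        by_contra hne
        exact hts (by rw [pow_zero, Matrix.one_apply_ne hne])
      simp [this]
    | succ i ih =>
      intro t s hts
      rw [pow_succ, Matrix.mul_apply] at hts
      obtain ⟨u, -, hu⟩ := Finset.exists_ne_zero_of_sum_ne_zero hts
      have h1 := ih _ _ (left_ne_zero_of_mul hu)
      have h2 := h _ _ (right_ne_zero_of_mul hu)
      push_cast
      omega
  obtain ⟨a, ha⟩ := (Set.finite_range A).bddAbove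
  obtain ⟨b, hb⟩ := (Set.finite_range A).bddBelow
  refine ⟨(a - b).toNat + 1, ?_⟩
  ext t s
  by_contra hts
  have h1 := key _ _ _ hts
  have h2 := ha ⟨s, rfl⟩
  have h3 := hb ⟨t, rfl⟩
  push_cast at h1
  omega

/-- The geometric series expresses the inverse by powers, so the inverse inherits homogeneity. -/
theorem exists_ringInverse_eq (hM : IsNilpotent M) :
    ∃ N : ℕ, Ring.inverse (1 + M) = ∑ i ∈ Finset.range N, (-M) ^ i := by
  obtain ⟨N, hN⟩ := hM
  refine ⟨N, ?_⟩
  have h0 : (-M) ^ N = 0 := by rw [neg_pow, hN, mul_zero]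
  have h1 : (∑ i ∈ Finset.range N, (-M) ^ i) * (1 + M) = 1 := by
    have := geom_sum_mul (-M) N
    rw [h0] at this
    calc _ = -((∑ i ∈ Finset.range N, (-M) ^ i) * (-M - 1)) := by noncomm_ring
      _ = 1 := by rw [this]; noncomm_ring
  have hu : IsUnit (1 + M) := IsNilpotent.isUnit_one_add ⟨N, hN⟩
  calc Ring.inverse (1 + M) =
      (∑ i ∈ Finset.range N, (-M) ^ i) * (1 + M) * Ring.inverse (1 + M) := by rw [h1, one_mul]
    _ = _ := by rw [mul_assoc, Ring.mul_inverse_cancel _ hu, mul_one]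

theorem Homogeneous.ringInverse (hM : Homogeneous deg 0 M) (hn : IsNilpotent M) :
    Homogeneous deg 0 (Ring.inverse (1 + M)) := by
  obtain ⟨N, hN⟩ := exists_ringInverse_eq hn
  rw [hN]
  exact .sum _ _ fun i _ => hM.neg.pow i

end Homogeneous

section Reduction

variable {S G R M : Type} [Fintype S] [DecidableEq S] [Fintype G] [DecidableEq G] [CommRing R]
  [AddCommGroup M] [Module R M]

theorem toLin_mem_span {S' M' : Type} [Fintype S'] [AddCommGroup M'] [Module R M']
    (β : Module.Basis S R M) (β' : Module.Basis S' R M') (N : Matrix S' S R) {a : Set S}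
    {b : Set S'} (h : ∀ t s, N t s ≠ 0 → s ∈ a → t ∈ b) :
    ∀ x ∈ Submodule.span R (β '' a), Matrix.toLin β β' N x ∈ Submodule.span R (β' '' b) := by
  intro x hx
  induction hx using Submodule.span_induction with
  | mem x hx =>
    obtain ⟨s, hs, rfl⟩ := hx
    rw [Matrix.toLin_self]
    refine Submodule.sum_mem _ fun t _ => ?_
    by_cases ht : N t s = 0
    · rw [ht, zero_smul]; exact Submodule.zero_mem _
    · exact Submodule.smul_mem _ _ (Submodule.subset_span ⟨t, h t s ht hs, rfl⟩)
  | zero => rw [map_zero]; exact Submodule.zero_mem _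
  | add x y _ _ hx hy => rw [map_add]; exact Submodule.add_mem _ hx hy
  | smul r x _ hx => rw [map_smul]; exact Submodule.smul_mem _ _ hx

/-- The matrix of the inclusion of a part of the basis. -/
def inclMatrix (R : Type) [CommRing R] (crit : G → S) : Matrix S G R :=
  fun s g => if s = crit g then 1 else 0

omit [Fintype G] [DecidableEq G] in
theorem transpose_mul_mul_inclMatrix (crit : G → S) (N : Matrix S S R) (g h : G) :
    ((inclMatrix R crit).transpose * N * inclMatrix R crit) g h = N (crit g) (crit h) := by
  simp [Matrix.mul_apply, inclMatrix]

omit [Fintype G] in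
theorem transpose_mul_inclMatrix {crit : G → S} (hc : Function.Injective crit) :
    (inclMatrix R crit).transpose * inclMatrix R crit = 1 := by
  ext g h
  simp [Matrix.mul_apply, inclMatrix, Matrix.one_apply, hc.eq_iff, eq_comm]

open Classical in
omit [Fintype S] [DecidableEq G] in
theorem inclMatrix_mul_transpose {crit : G → S} (hc : Function.Injective crit) :
    inclMatrix R crit * (inclMatrix R crit).transpose =
      Matrix.diagonal fun s => if ∃ g, crit g = s then 1 else 0 := by
  ext s t
  rw [Matrix.mul_apply]
  by_cases hs : ∃ g, crit g = s
  · obtain ⟨g, rfl⟩ := hs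
    rw [Finset.sum_eq_single g]
    · by_cases ht : crit g = t
      · subst ht; simp [inclMatrix]
      · simp [inclMatrix, ht, Ne.symm ht]
    · intro g' _ hg
      simp [inclMatrix, hc.eq_iff, hg.symm]
    · simp
  · rw [Finset.sum_eq_zero]
    · by_cases ht : s = t
      · subst ht; simp [hs]
      · simp [ht]
    · intro g _
      have : s ≠ crit g := fun h => hs ⟨g, h.symm⟩
      simp [inclMatrix, this]

/-- The homology of the reduced complex is that of the complex. -/
theorem Perturbation.homology {D d h p v : Matrix S S R} (H : Perturbation D d h p v)
    {crit : G → S} (hc : Function.Injective crit)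
    (hp : p = inclMatrix R crit * (inclMatrix R crit).transpose)
    (β : Module.Basis S R M) (β' : Module.Basis G R (G →₀ R)) {dM : M →ₗ[R] M}
    (hD : dM = Matrix.toLin β β D) {deg : S → ℤ × ℤ} (hv : Homogeneous deg 0 v)
    (hh : Homogeneous deg (-1, 0) h) (h1 : Homogeneous deg (1, 0) (D - d))
    (δ : (G →₀ R) →ₗ[R] (G →₀ R))
    (hδ : δ = Matrix.toLin β' β' (fun g g' => (p * D * v * p) (crit g) (crit g'))) :
    δ ∘ₗ δ = 0 ∧ ∀ i j : ℤ, Nonempty (homologyAt δ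
        (Submodule.span R (β' '' {g | deg (crit g) = (i - 1, j)}))
        (Submodule.span R (β' '' {g | deg (crit g) = (i, j)})) ≃ₗ[R]
      homologyAt dM (Submodule.span R (β '' {s | deg s = (i - 1, j)}))
        (Submodule.span R (β '' {s | deg s = (i, j)}))) := by
  set ι := inclMatrix R crit with hι
  have hδ' : (fun g g' => (p * D * v * p) (crit g) (crit g') : Matrix G G R) =
      ι.transpose * (p * D * v * p) * ι := by
    ext g g'
    rw [transpose_mul_mul_inclMatrix]
  rw [hδ'] at hδ
  have ιι : ι.transpose * ι = 1 := transpose_mul_inclMatrix hc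
  have pι : p * ι = ι := by rw [hp, Matrix.mul_assoc, ιι, Matrix.mul_one]
  have ιp : ι.transpose * p = ι.transpose := by rw [hp, ← Matrix.mul_assoc, ιι, Matrix.one_mul]
  have hu : Homogeneous deg 0 (1 - (D - d) * v * h) := by
    refine .sub .one ?_
    have := (h1.mul hv).mul hh
    rwa [show ((1, 0) : ℤ × ℤ) + 0 + (-1, 0) = 0 from rfl] at this
  set u := 1 - (D - d) * v * h with hu'
  have ih : Homogeneous deg (-1, 0) (v * h) := by simpa using hv.mul hh
  subst hδ hD
  simp only [← Matrix.toLin_mul]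
  -- In the basis of critical elements the reduced differential is the compression by `ι`. The
  -- following four identities express that inclusion and projection are chain maps, inverse to each
  -- other up to the homotopy `v * h`.
  have e1 : v * p * ι * (ι.transpose * (p * D * v * p) * ι) = D * (v * p * ι) := by
    calc _ = v * p * (ι * ι.transpose) * (p * D * v * p) * ι := by simp only [Matrix.mul_assoc]
      _ = v * (p * p) * (p * D * v * p) * ι := by rw [← hp]; simp only [Matrix.mul_assoc]
      _ = D * (v * p * ι) := by rw [H.pp, ← H.comm_incl]; simp only [Matrix.mul_assoc]
  have e2 : ι.transpose * (p * u) * D = ι.transpose * (p * D * v * p) * ι * (ι.transpose * (p * u)) := by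
    have cp : p * u * D = p * D * v * p * (p * u) := H.comm_proj
    calc _ = ι.transpose * (p * u * D) := by simp only [Matrix.mul_assoc]
      _ = ι.transpose * (p * D * v * (p * p) * (p * u)) := by rw [cp, H.pp]
      _ = ι.transpose * (p * D * v * (p * (ι * ι.transpose)) * (p * u)) := by rw [← hp]
      _ = _ := by simp only [Matrix.mul_assoc]
  have e3 : ι.transpose * (p * u) * (v * p * ι) = 1 := by
    calc _ = ι.transpose * (p * u * (v * p)) * ι := by simp only [Matrix.mul_assoc]
      _ = 1 := by rw [H.proj_incl, Matrix.mul_assoc, pι, ιι]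
  have e4 : v * p * ι * (ι.transpose * (p * u)) = 1 - D * (v * h) - v * h * D := by
    calc _ = v * (p * (ι * ι.transpose)) * (p * u) := by simp only [Matrix.mul_assoc]
      _ = v * p * (p * u) := by rw [← hp, H.pp]
      _ = _ := H.incl_proj
  refine ⟨?_, fun i j => ?_⟩
  · have : ι.transpose * (p * D * v * p) * ι * (ι.transpose * (p * D * v * p) * ι) = 0 := by
      calc _ = ι.transpose * (p * D * v * p * (ι * ι.transpose) * (p * D * v * p)) * ι := by
            simp only [Matrix.mul_assoc]
        _ = ι.transpose * (p * D * v * (p * p) * (p * D * v * p)) * ι := by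
            rw [← hp]; simp only [Matrix.mul_assoc]
        _ = 0 := by rw [H.pp, H.reduced_sq]; simp
    rw [this, map_zero]
  have hf : ∀ (k : ℤ × ℤ) t g, (v * p * ι) t g ≠ 0 → g ∈ {g | deg (crit g) = k} →
      t ∈ {s | deg s = k} := by
    intro k t g hne hg
    have e : (v * p * ι) t g = v t (crit g) := by
      rw [Matrix.mul_assoc, pι]
      simp [Matrix.mul_apply, hι, inclMatrix]
    rw [e] at hne
    simpa using (hv _ _ hne).trans (congrArg (· + 0) hg)
  have hg : ∀ (k : ℤ × ℤ) g s, (ι.transpose * (p * u)) g s ≠ 0 → s ∈ {s | deg s = k} →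
      g ∈ {g | deg (crit g) = k} := by
    intro k g s hne hs
    have e : (ι.transpose * (p * u)) g s = u (crit g) s := by
      rw [← Matrix.mul_assoc, ιp]
      simp [Matrix.mul_apply, hι, inclMatrix]
    rw [e] at hne
    simpa using (hu _ _ hne).trans (congrArg (· + 0) hs)
  refine homologyAt_equiv (Matrix.toLin β' β (v * p * ι)) (Matrix.toLin β β' (ι.transpose * (p * u)))
    (Matrix.toLin β β (v * h)) ?_ ?_ ?_ ?_ (toLin_mem_span _ _ _ (hf _))
    (toLin_mem_span _ _ _ (hf _)) (toLin_mem_span _ _ _ (hg _)) (toLin_mem_span _ _ _ (hg _))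
    (toLin_mem_span _ _ _ fun t s hne hs => ?_)
  · rw [← Matrix.toLin_mul, ← Matrix.toLin_mul, e1]
  · rw [← Matrix.toLin_mul, ← Matrix.toLin_mul, e2]
  · rw [← Matrix.toLin_mul, e3, Matrix.toLin_one]
  · rw [← Matrix.toLin_mul, ← Matrix.toLin_mul, ← Matrix.toLin_mul, e4, map_sub, map_sub,
      Matrix.toLin_one]
  · have := ih _ _ hne
    rw [Set.mem_ofPred_eq] at hs ⊢
    rw [this, hs]
    ext <;> simp [sub_eq_add_neg]

end Reduction

end

section
namespace GridDiagram

variable {n : ℕ} {D : GridDiagram n}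

open Classical ExteriorAlgebra

/-! ### The bigrading -/

/-- The homological and the quantum degree of a state. -/
def State.deg (s : D.State) : ℤ × ℤ :=
  (Resolution.height s.1 - D.nNeg, (Nat.card (D.Circle s.1) : ℤ) - 2 * s.2.card +
    Resolution.height s.1 + D.nPos - 2 * D.nNeg)

theorem oddPart_eq_span (R : Type) [CommRing R] (i j : ℤ) :
    oddPart D R i j = Submodule.span R (stateBasis D R '' {s | s.deg = (i, j)}) := by
  have key : ∀ ρ : D.Resolution, (⨆ (p : ℕ) (_ : Resolution.height ρ - D.nNeg = i ∧
      (Nat.card (D.Circle ρ) : ℤ) - 2 * p + Resolution.height ρ + D.nPos - 2 * D.nNeg = j),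
      ⋀[R]^p (V R ρ)) =
      Submodule.span R (stdBasis R (D.Circle ρ) '' {S | State.deg ⟨ρ, S⟩ = (i, j)}) := by
    intro ρ
    simp only [V, ← span_stdBasis, ← Submodule.span_iUnion]
    congr 1
    ext z
    simp only [Set.mem_iUnion, Set.mem_image, Set.mem_ofPred_eq, State.deg, Prod.mk.injEq,
      exists_prop]
    constructor
    · rintro ⟨p, h, S, rfl, rfl⟩
      exact ⟨S, h, rfl⟩
    · rintro ⟨S, h, rfl⟩
      exact ⟨S.card, h, S, rfl, rfl⟩
  unfold oddPart
  simp only [key]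
  apply le_antisymm
  · intro z hz
    rw [← Finset.univ_sum_single z]
    refine Submodule.sum_mem _ fun ρ _ => ?_
    have := hz ρ trivial
    have h2 : Submodule.map (LinearMap.single R (fun ρ : D.Resolution => ExteriorAlgebra R (V R ρ)) ρ)
        (Submodule.span R (stdBasis R (D.Circle ρ) '' {S | State.deg ⟨ρ, S⟩ = (i, j)})) ≤
        Submodule.span R (stateBasis D R '' {s | s.deg = (i, j)}) := by
      rw [Submodule.map_span, Submodule.span_le]
      rintro _ ⟨_, ⟨S, hS, rfl⟩, rfl⟩
      exact Submodule.subset_span ⟨⟨ρ, S⟩, hS, by simp [stateBasis]⟩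
    exact h2 ⟨z ρ, this, rfl⟩
  · rw [Submodule.span_le]
    rintro _ ⟨⟨ρ, S⟩, hS, rfl⟩ ρ' _
    by_cases h : ρ' = ρ
    · subst h
      simp only [stateBasis, Pi.basis_apply, Pi.single_eq_same]
      exact Submodule.subset_span ⟨S, hS, rfl⟩
    · simp only [stateBasis, Pi.basis_apply, Pi.single_eq_of_ne h]
      exact Submodule.zero_mem _

theorem IsUp.differAt {ρ ρ' : D.Resolution} {x : D.Crossing} (h : IsUp ρ ρ' x) :
    DifferAt x ρ ρ' := by
  rw [h.2]; exact differAt_up _ _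

theorem IsUp.eq_true {ρ ρ' : D.Resolution} {x : D.Crossing} (h : IsUp ρ ρ' x) : ρ' x = true := by
  rw [h.2]; simp [Resolution.up]

theorem IsUp.height {ρ ρ' : D.Resolution} {x : D.Crossing} (h : IsUp ρ ρ' x) :
    Resolution.height ρ' = Resolution.height ρ + 1 := by
  have e : (Finset.univ.filter fun y => ρ' y = true) =
      insert x (Finset.univ.filter fun y => ρ y = true) := by
    ext y
    by_cases hy : y = x
    · subst hy; simp [h.eq_true]
    · simp [hy, h.differAt y hy]
  unfold Resolution.height
  rw [Nat.card_eq_fintype_card, Nat.card_eq_fintype_card, Fintype.card_subtype,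
    Fintype.card_subtype, e, Finset.card_insert_of_notMem (by simp [h.1])]
  simp

/-- The orientation of the edges that corresponds to a state. -/
def State.omega (s : D.State) : D.Edge → ℤ := GridDiagram.omega s.1 s.2

theorem State.ext_omega {s t : D.State} (h : s.1 = t.1) (h' : s.omega = t.omega) : s = t := by
  obtain ⟨ρ, S⟩ := s
  obtain ⟨ρ', S'⟩ := t
  obtain rfl : ρ = ρ' := h
  obtain rfl : S = S' := omega_injective h'
  rfl

section

variable {τ : Bool} (E : EdgeAssignment D τ)

/-- The sum of the labels drops by one while the height grows by one, so the quantum degree does not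
change. -/
theorem homogeneous_diffMatrix : Homogeneous State.deg (1, 0) (diffMatrix E) := by
  intro t s h
  obtain ⟨x, hx, ha⟩ := exists_isUp_of_ne_zero h
  have := ha.turning hx.differAt hx.1 hx.eq_true
  rw [turning_omega, turning_omega] at this
  have hh := hx.height
  simp only [State.deg, Prod.mk_add_mk, Prod.mk.injEq]
  constructor <;> linarith

theorem wedgeCoeff_eq_zero_of_ne {I : Type} [LinearOrder I] {i j : I} {l : List I} {t : Finset I}
    (hij : i ≠ j) (h : wedgeCoeff (i :: l) t ≠ 0) : wedgeCoeff (j :: l) t = 0 := by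
  by_contra h'
  rw [← ne_eq, wedgeCoeff_ne_zero, List.nodup_cons] at h'
  rw [wedgeCoeff_ne_zero] at h
  have : j ∈ t := (h'.2 j).2 (by simp)
  rw [h.2, List.mem_cons] at this
  exact this.elim (fun h => hij h.symm) h'.1.1

/-- A merge contributes one exterior product. In a split the products with tail and head represent
different basis vectors, so no coefficient 2 or -2 occurs. -/
theorem edgeCoeff_eq (o : Arrows D) (x : D.Crossing) (ρ ρ' : D.Resolution) (S : Finset (D.Circle ρ))
    (S' : Finset (D.Circle ρ')) : edgeCoeff o x ρ ρ' S S' = 0 ∨ edgeCoeff o x ρ ρ' S S' = 1 ∨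
      edgeCoeff o x ρ ρ' S S' = -1 := by
  unfold edgeCoeff
  split_ifs with h
  · exact wedgeCoeff_eq _ _
  · rw [← o.same_iff] at h
    have h1 := wedgeCoeff_eq (circleOf ρ' (o.tail x) :: (toList S).map (circleFun ρ ρ')) S'
    have h2 := wedgeCoeff_eq (circleOf ρ' (o.head x) :: (toList S).map (circleFun ρ ρ')) S'
    by_cases h0 : wedgeCoeff (circleOf ρ' (o.tail x) :: (toList S).map (circleFun ρ ρ')) S' = 0
    · rw [h0]; omega
    · rw [wedgeCoeff_eq_zero_of_ne h h0]; omega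

theorem diffMatrix_eq (s t : D.State) :
    diffMatrix E t s = 0 ∨ diffMatrix E t s = 1 ∨ diffMatrix E t s = -1 := by
  by_cases h : diffMatrix E t s = 0
  · exact Or.inl h
  · obtain ⟨x, hx, -⟩ := exists_isUp_of_ne_zero h
    rw [diffMatrix_apply E hx]
    rcases Int.units_eq_one_or (E.sign s.1 x) with h1 | h1 <;>
      rcases edgeCoeff_eq E.arrows x s.1 t.1 s.2 t.2 with h2 | h2 | h2 <;> simp [h1, h2]

theorem diffMatrix_ne_zero {s t : D.State} {x : D.Crossing} (hx : IsUp s.1 t.1 x) :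
    diffMatrix E t s ≠ 0 ↔ Allowed x s.1 t.1 s.2 t.2 := by
  rw [diffMatrix_apply E hx, ← edgeCoeff_ne_zero E.arrows hx.differAt hx.1 hx.eq_true]
  rcases Int.units_eq_one_or (E.sign s.1 x) with h1 | h1 <;> simp [h1]

/-! ### The cube of states with a given orientation -/

/-- The crossings at which an orientation points into both vertical ends. -/
def State.Free (s : D.State) (x : D.Crossing) : Prop :=
  s.omega x.northEdge = -1 ∧ s.omega x.southEdge = 1

theorem State.free_congr {s t : D.State} (h : s.omega = t.omega) : s.Free = t.Free := by
  unfold State.Free; rw [h]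

theorem State.exists_flip {s : D.State} {x : D.Crossing} (h : s.Free x) :
    ∃ t : D.State, t.1 = Function.update s.1 x (!s.1 x) ∧ t.omega = s.omega := by
  obtain ⟨S', hS'⟩ := exists_omega_eq_of_coherent (x := x) (ρ := s.1)
    (ρ' := Function.update s.1 x (!s.1 x)) (fun y hy => by simp [hy]) (S := s.2)
    (h.1.trans (congrArg _ h.2).symm)
  exact ⟨⟨_, S'⟩, rfl, hS'⟩

/-- Changes the smoothing at a crossing while preserving the orientation of the edges. -/
def State.flip (x : D.Crossing) (s : D.State) : D.State :=
  if h : s.Free x then (State.exists_flip h).choose else s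

theorem State.flip_res {s : D.State} {x : D.Crossing} (h : s.Free x) :
    (s.flip x).1 = Function.update s.1 x (!s.1 x) := by
  rw [State.flip, dif_pos h]; exact (State.exists_flip h).choose_spec.1

theorem State.flip_omega {s : D.State} {x : D.Crossing} (h : s.Free x) :
    (s.flip x).omega = s.omega := by
  rw [State.flip, dif_pos h]; exact (State.exists_flip h).choose_spec.2

theorem State.eq_flip {s t : D.State} {x : D.Crossing} (h : s.Free x)
    (h1 : t.1 = Function.update s.1 x (!s.1 x)) (h2 : t.omega = s.omega) : t = s.flip x :=
  State.ext_omega (h1.trans (State.flip_res h).symm) (h2.trans (State.flip_omega h).symm)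

/-- The filtration by area: an arrow of the differential either flips a free crossing with the
orientation fixed or lowers the area. -/
theorem diffMatrix_cases {s t : D.State} (h : diffMatrix E t s ≠ 0) :
    (t.omega = s.omega ∧ ∃ x, s.Free x ∧ s.1 x = false ∧ t = s.flip x) ∨
      area t.omega < area s.omega := by
  obtain ⟨x, hx, ha⟩ := exists_isUp_of_ne_zero h
  rcases ha.omega_eq_or_area_lt hx.differAt hx.1 hx.eq_true with ⟨h1, h2, h3⟩ | h1
  · refine Or.inl ⟨h1, x, ⟨h2, h3⟩, hx.1, State.eq_flip ⟨h2, h3⟩ ?_ h1⟩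
    rw [hx.2, hx.1]; rfl
  · exact Or.inr h1

variable (R : Type) [CommRing R]

/-- The matrix of the differential over a ring. -/
def diffMatrixOver : Matrix D.State D.State R := (diffMatrix E).map (Int.cast : ℤ → R)

/-- The part of the differential that preserves the orientation of the edges. -/
def leading : Matrix D.State D.State R :=
  fun t s => if t.omega = s.omega then diffMatrixOver E R t s else 0

variable {R} in
theorem ne_zero_of_diffMatrixOver {s t : D.State} (h : diffMatrixOver E R t s ≠ 0) :
    diffMatrix E t s ≠ 0 := fun h' => h (by simp [diffMatrixOver, h'])

theorem diffMatrixOver_mul_self : diffMatrixOver E R * diffMatrixOver E R = 0 := by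
  have := congrArg (fun M : Matrix D.State D.State ℤ => M.map (Int.castRingHom R))
    (diffMatrix_mul_self E)
  simp only [Matrix.map_mul] at this
  refine this.trans ?_
  ext
  simp

theorem oddDifferential_eq : oddDifferential R E =
    Matrix.toLin (stateBasis D R) (stateBasis D R) (diffMatrixOver E R) := by
  refine (stateBasis D R).ext fun s => ?_
  rw [oddDifferential_stateBasis, Matrix.toLin_self]
  simp [diffMatrixOver, Int.cast_smul_eq_zsmul]

/-- For a fixed orientation the free crossings can be smoothed independently, and by
`allowed_of_omega_eq` every flip from 0 to 1 has a coefficient 1 or -1. The square vanishes because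
it is the part of the square of the full differential that preserves the orientation. -/
theorem isCube : IsCube (S := D.State) State.Free (fun s => s.1) State.flip (leading E R) where
  dom_flip h := State.free_congr (State.flip_omega h)
  flip_flip {s x} h := by
    have hf : (s.flip x).Free x := by rw [State.free_congr (State.flip_omega h)]; exact h
    refine (State.eq_flip hf ?_ (State.flip_omega h).symm).symm
    rw [State.flip_res h]; simp
  bit_flip h := State.flip_res h
  comm {s x y} hx hy := by
    have hx' : (s.flip y).Free x := by rw [State.free_congr (State.flip_omega hy)]; exact hx
    have hy' : (s.flip x).Free y := by rw [State.free_congr (State.flip_omega hx)]; exact hy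
    by_cases hxy : x = y
    · rw [hxy]
    refine State.ext_omega ?_ ?_
    · rw [State.flip_res hx', State.flip_res hy', State.flip_res hx, State.flip_res hy,
        Function.update_of_ne hxy, Function.update_of_ne (Ne.symm hxy), Function.update_comm hxy]
    · rw [State.flip_omega hx', State.flip_omega hy', State.flip_omega hx, State.flip_omega hy]
  ne_zero {s t} h := by
    unfold leading at h
    split_ifs at h with h1
    · rcases diffMatrix_cases E (ne_zero_of_diffMatrixOver E h) with ⟨-, h2⟩ | h2
      · exact h2
      · rw [h1] at h2; exact absurd h2 (lt_irrefl _)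
    · exact absurd rfl h
  sq_one {s x} h h0 := by
    have hu : IsUp s.1 (s.flip x).1 x := ⟨h0, by rw [State.flip_res h, h0]; rfl⟩
    have hne : diffMatrix E (s.flip x) s ≠ 0 := by
      rw [diffMatrix_ne_zero E hu]
      exact allowed_of_omega_eq hu.differAt hu.1 hu.eq_true (State.flip_omega h) h.1 h.2
    rw [leading, if_pos (State.flip_omega h), diffMatrixOver]
    rcases diffMatrix_eq E s (s.flip x) with h1 | h1 | h1
    · exact absurd h1 hne
    · simp [h1]
    · simp [h1]
  sq := by
    ext t s
    rw [Matrix.zero_apply]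
    by_cases h : t.omega = s.omega
    · rw [← show (diffMatrixOver E R * diffMatrixOver E R) t s = 0 by
        rw [diffMatrixOver_mul_self, Matrix.zero_apply], Matrix.mul_apply, Matrix.mul_apply]
      refine Finset.sum_congr rfl fun u _ => ?_
      unfold leading
      by_cases h1 : u.omega = s.omega
      · rw [if_pos h1, if_pos (h.trans h1.symm)]
      -- A two-step path that leaves the orientation lowers the area and cannot return to the same
      -- orientation.
      · rw [if_neg h1, mul_zero]
        by_contra hne
        have a1 := diffMatrix_cases E (ne_zero_of_diffMatrixOver E (right_ne_zero_of_mul (Ne.symm hne)))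
        have a2 := diffMatrix_cases E (ne_zero_of_diffMatrixOver E (left_ne_zero_of_mul (Ne.symm hne)))
        rw [h] at a2
        rcases a1 with a1 | a1
        · exact h1 a1.1
        · rcases a2 with a2 | a2
          · exact h1 a2.1.symm
          · exact absurd (a1.trans a2) (lt_irrefl _)
    · rw [Matrix.mul_apply]
      refine Finset.sum_eq_zero fun u _ => ?_
      unfold leading
      by_cases h1 : u.omega = s.omega
      · rw [if_neg fun h2 => h (h2.trans h1), zero_mul]
      · rw [if_neg h1, mul_zero]

end

end GridDiagram

end

section
namespace GridDiagram

variable {n : ℕ} {D : GridDiagram n}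

open Classical ExteriorAlgebra

/-! ### The contraction of the cubes of states -/

/-- A choice, for each nonempty set, of weights on its elements that add up to `1`. -/
structure IsWeight {X R : Type} [Fintype X] [CommRing R] (W : (X → Prop) → X → R) : Prop where
  supp : ∀ p x, W p x ≠ 0 → p x
  sum : ∀ p, (∃ x, p x) → ∑ x, W p x = 1

section

variable {τ : Bool} (E : EdgeAssignment D τ) (R : Type) [CommRing R]

/-- The contraction of the leading part of the differential with given weights. -/
def weightedTranspose (W : (D.Crossing → Prop) → D.Crossing → R) : Matrix D.State D.State R :=
  ∑ x, (IsCube.part State.Free (fun s => s.1) State.flip (leading E R) x).transpose *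
    Matrix.diagonal fun s => W s.Free x

/-- The critical states are those without free crossings. -/
def State.IsCritical (s : D.State) : Prop := ∀ x, ¬ s.Free x

/-- The projection to the critical states. -/
def criticalPart : Matrix D.State D.State R := Matrix.diagonal fun s => if s.IsCritical then 1 else 0

/-- The contraction of the leading part of the differential whose square is zero. -/
def contraction (W : (D.Crossing → Prop) → D.Crossing → R) : Matrix D.State D.State R :=
  weightedTranspose E R W * leading E R * weightedTranspose E R W

/-- The inverse of `1` plus the composite of the contraction and the rest of the differential. -/
def resolvent (W : (D.Crossing → Prop) → D.Crossing → R) : Matrix D.State D.State R :=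
  Ring.inverse (1 + contraction E R W * (diffMatrixOver E R - leading E R))

/-- The matrix of the reduced differential. -/
def reduced (W : (D.Crossing → Prop) → D.Crossing → R) : Matrix D.State D.State R :=
  criticalPart R * diffMatrixOver E R * resolvent E R W * criticalPart R

variable {R} (W : (D.Crossing → Prop) → D.Crossing → R)

theorem homogeneous_diffMatrixOver : Homogeneous State.deg (1, 0) (diffMatrixOver E R) :=
  fun t s h => homogeneous_diffMatrix E t s (ne_zero_of_diffMatrixOver E h)

theorem ne_zero_of_leading {s t : D.State} (h : leading E R t s ≠ 0) :
    diffMatrixOver E R t s ≠ 0 ∧ t.omega = s.omega := by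
  unfold leading at h
  split_ifs at h with h'
  · exact ⟨h, h'⟩
  · exact absurd rfl h

theorem homogeneous_leading : Homogeneous State.deg (1, 0) (leading E R) :=
  fun t s h => homogeneous_diffMatrixOver E t s (ne_zero_of_leading E h).1

theorem ne_zero_of_weightedTranspose {s t : D.State} (h : weightedTranspose E R W t s ≠ 0) :
    leading E R s t ≠ 0 := by
  unfold weightedTranspose at h
  rw [Matrix.sum_apply] at h
  obtain ⟨x, -, hx⟩ := Finset.exists_ne_zero_of_sum_ne_zero h
  rw [Matrix.mul_diagonal, Matrix.transpose_apply, IsCube.part] at hx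
  split_ifs at hx
  · exact left_ne_zero_of_mul hx
  · simp at hx

theorem homogeneous_weightedTranspose :
    Homogeneous State.deg (-1, 0) (weightedTranspose E R W) := by
  intro t s h
  have := homogeneous_leading E _ _ (ne_zero_of_weightedTranspose E W h)
  rw [this]
  ext <;> simp

theorem homogeneous_contraction : Homogeneous State.deg (-1, 0) (contraction E R W) :=
  ((homogeneous_weightedTranspose E W).mul (homogeneous_leading E)).mul
    (homogeneous_weightedTranspose E W)

theorem omega_of_contraction {s t : D.State} (h : contraction E R W t s ≠ 0) :
    t.omega = s.omega := by
  rw [contraction, Matrix.mul_apply] at h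
  obtain ⟨u, -, hu⟩ := Finset.exists_ne_zero_of_sum_ne_zero h
  have h1 := left_ne_zero_of_mul hu
  rw [Matrix.mul_apply] at h1
  obtain ⟨v, -, hv⟩ := Finset.exists_ne_zero_of_sum_ne_zero h1
  have a1 := (ne_zero_of_leading E (ne_zero_of_weightedTranspose E W (right_ne_zero_of_mul hu))).2
  have a2 := (ne_zero_of_leading E (ne_zero_of_weightedTranspose E W (left_ne_zero_of_mul hv))).2
  have a3 := (ne_zero_of_leading E (right_ne_zero_of_mul hv)).2
  rw [← a2, a3, a1]

/-- The contraction preserves the orientation and the rest of the differential lowers the area,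
which takes finitely many values. -/
theorem isNilpotent_contraction_mul :
    IsNilpotent (contraction E R W * (diffMatrixOver E R - leading E R)) := by
  refine isNilpotent_of_lt (fun s => area s.omega) fun t s h => ?_
  rw [Matrix.mul_apply] at h
  obtain ⟨u, -, hu⟩ := Finset.exists_ne_zero_of_sum_ne_zero h
  rw [omega_of_contraction E W (left_ne_zero_of_mul hu)]
  have h1 := right_ne_zero_of_mul hu
  rw [Matrix.sub_apply, leading] at h1
  split_ifs at h1 with h2
  · simp at h1
  · rw [sub_zero] at h1
    rcases diffMatrix_cases E (ne_zero_of_diffMatrixOver E h1) with h3 | h3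
    · exact absurd h3.1 h2
    · exact h3

theorem homogeneous_rest :
    Homogeneous State.deg (1, 0) (diffMatrixOver E R - leading E R) :=
  (homogeneous_diffMatrixOver E).sub (homogeneous_leading E)

theorem homogeneous_resolvent : Homogeneous State.deg 0 (resolvent E R W) :=
  Homogeneous.ringInverse ((homogeneous_contraction E W).mul (homogeneous_rest E))
    (isNilpotent_contraction_mul E W)

theorem not_isCritical_of_leading {s t : D.State} (h : leading E R t s ≠ 0) :
    ¬ s.IsCritical ∧ ¬ t.IsCritical := by
  obtain ⟨x, hx, -, -⟩ := (isCube E R).ne_zero h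
  refine ⟨fun h' => h' x hx, fun h' => h' x ?_⟩
  rw [State.free_congr (ne_zero_of_leading E h).2]
  exact hx

theorem mul_criticalPart {M : Matrix D.State D.State R}
    (h : ∀ t s, M t s ≠ 0 → ¬ s.IsCritical) : M * criticalPart R = 0 := by
  ext t s
  rw [criticalPart, Matrix.mul_diagonal, Matrix.zero_apply]
  by_cases h' : M t s = 0
  · rw [h', zero_mul]
  · rw [if_neg (h t s h'), mul_zero]

theorem criticalPart_mul {M : Matrix D.State D.State R}
    (h : ∀ t s, M t s ≠ 0 → ¬ t.IsCritical) : criticalPart R * M = 0 := by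
  ext t s
  rw [criticalPart, Matrix.diagonal_mul, Matrix.zero_apply]
  by_cases h' : M t s = 0
  · rw [h', mul_zero]
  · rw [if_neg (h t s h'), zero_mul]

/-- The weights depend only on the set of free crossings, which is constant on a cube. They add up
to 1 on noncritical states, where the weighted transpose is therefore a contraction; on critical
states the leading part and the contraction both vanish. -/
theorem perturbation (hW : IsWeight W) : Perturbation (diffMatrixOver E R) (leading E R)
    (contraction E R W) (criticalPart R) (resolvent E R W) := by
  have dp : leading E R * criticalPart R = 0 :=
    mul_criticalPart fun t s h => (not_isCritical_of_leading E h).1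
  have pd : criticalPart R * leading E R = 0 :=
    criticalPart_mul fun t s h => (not_isCritical_of_leading E h).2
  have hp : weightedTranspose E R W * criticalPart R = 0 := mul_criticalPart fun t s h =>
    (not_isCritical_of_leading E (ne_zero_of_weightedTranspose E W h)).2
  have ph : criticalPart R * weightedTranspose E R W = 0 := criticalPart_mul fun t s h =>
    (not_isCritical_of_leading E (ne_zero_of_weightedTranspose E W h)).1
  have htpy : leading E R * weightedTranspose E R W + weightedTranspose E R W * leading E R =
      1 - criticalPart R := by
    refine ((isCube E R).contraction (fun s x => W s.Free x) ?_ ?_).trans ?_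
    · intro s x h
      rw [State.free_congr (State.flip_omega h)]
    · intro s x h
      exact hW.supp _ _ h
    · rw [criticalPart, ← Matrix.diagonal_one, Matrix.diagonal_sub]
      congr 1
      funext s
      by_cases h : s.IsCritical
      · rw [if_pos h, sub_self]
        exact Finset.sum_eq_zero fun x _ => by_contra fun h' => h x (hW.supp _ _ h')
      · rw [if_neg h, sub_zero]
        exact hW.sum _ (_root_.not_forall_not.1 h)
  have sp := Perturbation.special (isCube E R).sq htpy dp hp ph
  have hu := (isNilpotent_contraction_mul E W).isUnit_one_add
  exact {
    sq := diffMatrixOver_mul_self E R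
    htpy := sp.2
    hh := sp.1
    hp := by rw [contraction, Matrix.mul_assoc, hp, Matrix.mul_zero]
    ph := by rw [contraction, ← Matrix.mul_assoc, ← Matrix.mul_assoc, ph]; simp
    dp := dp
    pd := pd
    pp := by
      rw [criticalPart, Matrix.diagonal_mul_diagonal]
      congr 1
      funext s
      split_ifs <;> simp
    left := Ring.inverse_mul_cancel _ hu
    right := Ring.mul_inverse_cancel _ hu }

end

/-- Weights concentrated at one element. -/
def pointWeight {X : Type} (p : X → Prop) (x : X) : ℤ :=
  if h : ∃ y, p y then if x = h.choose then 1 else 0 else 0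

theorem isWeight_pointWeight {X : Type} [Fintype X] : IsWeight (pointWeight (X := X)) where
  supp p x h := by
    unfold pointWeight at h
    split_ifs at h with h1 h2
    · rw [h2]; exact h1.choose_spec
    · exact absurd rfl h
    · exact absurd rfl h
  sum p h := by simp [pointWeight, h]

/-- Equal weights. -/
def equalWeight {X : Type} (p : X → Prop) (x : X) : ℚ :=
  if p x then (Nat.card {x // p x} : ℚ)⁻¹ else 0

theorem isWeight_equalWeight {X : Type} [Fintype X] : IsWeight (equalWeight (X := X)) where
  supp p x h := by
    unfold equalWeight at h
    split_ifs at h with h1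
    · exact h1
    · exact absurd rfl h
  sum p h := by
    obtain ⟨x, hx⟩ := h
    have : (Nat.card {x // p x} : ℚ) ≠ 0 := by
      have : Nonempty {x // p x} := ⟨⟨x, hx⟩⟩
      exact_mod_cast Nat.card_pos.ne'
    unfold equalWeight
    rw [← Finset.sum_filter, Finset.sum_const, nsmul_eq_mul, ← Fintype.card_subtype,
      ← Nat.card_eq_fintype_card]
    exact mul_inv_cancel₀ this

end GridDiagram

end

section
namespace GridDiagram

variable {n : ℕ} {D : GridDiagram n}

open Classical

/-! ### Bigelow's generators as critical states -/

/-- Orientations of the edges that are induced by orientations of the circles of a resolution. -/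
theorem exists_state {ρ : D.Resolution} {Ω : D.Edge → ℤ} (h1 : ∀ e, Ω e = 1 ∨ Ω e = -1)
    (h2 : ∀ e e' c r d d', e.LeavesAt d c r → e'.LeavesAt d' c r → Joined ρ c r d d' →
      d.sgn * Ω e + d'.sgn * Ω e' = 0) : ∃ s : D.State, s.1 = ρ ∧ s.omega = Ω := by
  obtain ⟨S, hS⟩ := exists_omega_eq (ρ := ρ) h1 fun e e' he => by
    refine circle_induction (fun e => Ω e * chi e) (fun e e' c r d d' l l' hj => ?_) he
    have a := h2 e e' c r d d' l l' hj
    have b := hj.chiOut_add l.hasEnd l'.hasEnd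
    rw [← l.sgn_mul_chi, ← l'.sgn_mul_chi] at b
    have sq : ∀ d : Dir, d.sgn = 1 ∨ d.sgn = -1 := fun d => by cases d <;> simp [Dir.sgn]
    rcases sq d with q | q <;> rcases sq d' with q' | q' <;> rw [q, q'] at a b <;>
      [rw [show Ω e = - Ω e' by linarith, show chi e = - chi e' by linarith];
       rw [show Ω e = Ω e' by linarith, show chi e = chi e' by linarith];
       rw [show Ω e = Ω e' by linarith, show chi e = chi e' by linarith];
       rw [show Ω e = - Ω e' by linarith, show chi e = - chi e' by linarith]] <;> ring
  exact ⟨⟨ρ, S⟩, rfl, hS⟩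

theorem State.omega_joined (s : D.State) {e e' : D.Edge} {c r : Fin n} {d d' : Dir}
    (l : e.LeavesAt d c r) (l' : e'.LeavesAt d' c r) (hj : Joined s.1 c r d d') :
    d.sgn * s.omega e + d'.sgn * s.omega e' = 0 := by
  have a := omega_mul_chi_congr (S := s.2) (circleOf_eq_of_joined hj l l')
  have b := hj.chiOut_add l.hasEnd l'.hasEnd
  rw [← l.sgn_mul_chi, ← l'.sgn_mul_chi] at b
  have sq : ∀ d : Dir, d.sgn = 1 ∨ d.sgn = -1 := fun d => by cases d <;> simp [Dir.sgn]
  change d.sgn * GridDiagram.omega s.1 s.2 e + d'.sgn * GridDiagram.omega s.1 s.2 e' = 0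
  rcases sq d with q | q <;> rcases sq d' with q' | q' <;> rw [q, q'] at b ⊢ <;>
    rcases chi_eq e with p | p <;> rcases chi_eq e' with p' | p' <;> rw [p, p'] at a b <;> linarith

/-- The orientation of the edges given by a generator: the edges leave the points of the generator
vertically and enter them horizontally. -/
def genOmega (g : D.Gen) (e : D.Edge) : ℤ :=
  if e.1.1 = true then (if g.row e.1.2.1 ≤ e.1.2.2 then 1 else -1)
  else (if e.1.2.1 < g.row.symm e.1.2.2 then 1 else -1)

/-- The resolution given by a generator. -/
def genRes (s : D.FigureEights) (g : D.Gen) : D.Resolution := fun x =>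
  -- At a point of the generator both smoothings fit the orientation, and a point on an upward arc
  -- selects the 0-smoothing. At other crossings both strands run straight through, and the
  -- smoothing is forced.
  if g.row x.1.1 = x.1.2 then decide (¬ s.IsUp x.1.1 x.1.2 (g.side x.1.1))
  else decide (g.row x.1.1 < x.1.2 ↔ x.1.1 < g.row.symm x.1.2)

theorem genOmega_eq (g : D.Gen) (e : D.Edge) : genOmega g e = 1 ∨ genOmega g e = -1 := by
  unfold genOmega; split_ifs <;> simp

/-- The orientation given by a generator, seen from a lattice point; `1` means outwards. -/
def genOut (g : D.Gen) (c r : Fin n) : Dir → ℤ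
  | .north => if g.row c ≤ r then 1 else -1
  | .south => if g.row c < r then -1 else 1
  | .east => if c < g.row.symm r then 1 else -1
  | .west => if c ≤ g.row.symm r then -1 else 1

theorem Edge.LeavesAt.sgn_mul_genOmega {e : D.Edge} {d : Dir} {c r : Fin n}
    (h : e.LeavesAt d c r) (g : D.Gen) : d.sgn * genOmega g e = genOut g c r d := by
  cases d <;> obtain ⟨h0, h1, h2⟩ := h <;> simp only [genOmega, genOut, Dir.sgn, h0]
  · simp [h1, h2]
  · simp [h1, h2]
  · subst h1
    have : g.row e.1.2.1 ≤ e.1.2.2 ↔ g.row e.1.2.1 < r := by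
      simp only [Fin.le_def, Fin.lt_def]; omega
    simp only [this]; split_ifs <;> simp
  · subst h2
    have : e.1.2.1 < g.row.symm e.1.2.2 ↔ c ≤ g.row.symm e.1.2.2 := by
      simp only [Fin.le_def, Fin.lt_def]; omega
    simp only [Bool.false_eq_true, if_false, this]; split_ifs <;> simp

theorem Gen.bounds (g : D.Gen) (c : Fin n) : (D.lo c ≤ g.row c ∧ g.row c ≤ D.hi c) ∧
    D.lft (g.row c) ≤ c ∧ c ≤ D.rgt (g.row c) := by
  obtain ⟨h1, h2⟩ := g.isPoint c
  refine ⟨h1, ?_⟩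
  generalize g.side c = a at h2
  cases a
  · exact ⟨h2.1.le, h2.2⟩
  · exact ⟨h2.1, h2.2.le⟩

theorem Gen.row_eq_iff (g : D.Gen) (c r : Fin n) : g.row c = r ↔ g.row.symm r = c := by
  rw [Equiv.symm_apply_eq, eq_comm]

theorem Gen.bounds' (g : D.Gen) (r : Fin n) : D.lft r ≤ g.row.symm r ∧ g.row.symm r ≤ D.rgt r := by
  have := (g.bounds (g.row.symm r)).2
  rwa [Equiv.apply_symm_apply] at this

/-- At a point of the generator vertical ends are outward and horizontal ends inward, so any corner
is coherent. At other crossings the forced smoothing joins an outward end with an inward one, and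
away from the crossings the position of the ends decides. -/
theorem genOut_joined (s : D.FigureEights) (g : D.Gen) {c r : Fin n} {d d' : Dir}
    (h1 : D.HasEnd c r d) (h2 : D.HasEnd c r d') (hj : Joined (genRes s g) c r d d') :
    genOut g c r d + genOut g c r d' = 0 := by
  obtain ⟨k1, k2, k3⟩ := D.fin_corner_iff c r
  have b1 := g.bounds c
  have b2 := g.bounds' r
  have hrc := g.row_eq_iff c r
  have hcr : (g.row c : ℕ) = r → (D.lft r : ℕ) ≤ c ∧ (c : ℕ) ≤ D.rgt r := by
    intro h
    have : g.row c = r := Fin.ext h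
    rw [this] at b1
    exact b1.2
  simp only [Fin.le_def, Fin.ext_iff] at b1 b2 hrc
  obtain ⟨⟨b1, b1'⟩, -⟩ := b1
  by_cases hc : D.IsCrossing c r
  · have hr := hj.2 hc
    by_cases hsel : g.row c = r
    · have hv := hj.vert_ne hc
      have h3 := (g.row_eq_iff c r).1 hsel
      cases d <;> cases d' <;> simp only [Dir.vert, ne_eq, not_true_eq_false] at hv <;>
        simp [genOut, hsel, h3]
    · have hval : genRes s g ⟨(c, r), hc⟩ = decide (g.row c < r ↔ c < g.row.symm r) := by
        rw [genRes, if_neg hsel]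
      rw [hval] at hr
      have hsel' : (g.row c : ℕ) ≠ r := fun h => hsel (Fin.ext h)
      simp only [Fin.lt_def] at hr
      by_cases hd : ((g.row c : ℕ) < r ↔ (c : ℕ) < g.row.symm r)
      · rw [decide_eq_true hd] at hr
        cases d <;> cases d' <;> simp only [smoothingJoins, or_self, or_false, or_true] at hr <;>
          simp only [genOut, Fin.le_def, Fin.lt_def] <;> split_ifs <;> omega
      · rw [decide_eq_false hd] at hr
        cases d <;> cases d' <;> simp only [smoothingJoins, or_self, or_false, or_true] at hr <;>
          simp only [genOut, Fin.le_def, Fin.lt_def] <;> split_ifs <;> omega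
  · have hne := hj.1
    unfold IsCrossing at hc
    simp only [Fin.lt_def] at hc
    cases d <;> cases d' <;> (try exact absurd rfl hne) <;>
      simp only [HasEnd, genOut, Fin.le_def, Fin.lt_def] at h1 h2 ⊢ <;> split_ifs <;> omega

theorem exists_genState (s : D.FigureEights) (g : D.Gen) :
    ∃ t : D.State, t.1 = genRes s g ∧ t.omega = genOmega g := by
  refine exists_state (genOmega_eq g) fun e e' c r d d' l l' hj => ?_
  rw [l.sgn_mul_genOmega, l'.sgn_mul_genOmega]
  exact genOut_joined s g l.hasEnd l'.hasEnd hj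

/-- The critical state of a generator. -/
def genState (s : D.FigureEights) (g : D.Gen) : D.State := (exists_genState s g).choose

theorem genState_res (s : D.FigureEights) (g : D.Gen) : (genState s g).1 = genRes s g :=
  (exists_genState s g).choose_spec.1

theorem genState_omega (s : D.FigureEights) (g : D.Gen) : (genState s g).omega = genOmega g :=
  (exists_genState s g).choose_spec.2

theorem omega_north (g : D.Gen) (x : D.Crossing) :
    genOmega g x.northEdge = if g.row x.1.1 ≤ x.1.2 then 1 else -1 := by
  have := (x.edge_leavesAt .north).sgn_mul_genOmega g
  rw [x.northEdge_eq]
  simpa [Dir.sgn, genOut] using this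

theorem omega_south (g : D.Gen) (x : D.Crossing) :
    genOmega g x.southEdge = if g.row x.1.1 < x.1.2 then 1 else -1 := by
  have := (x.edge_leavesAt .south).sgn_mul_genOmega g
  rw [x.southEdge_eq]
  simp only [Dir.sgn, genOut] at this
  split_ifs at this ⊢ <;> linarith

theorem isCritical_genState (s : D.FigureEights) (g : D.Gen) : (genState s g).IsCritical := by
  rintro x ⟨h1, h2⟩
  rw [genState_omega, omega_north] at h1
  rw [genState_omega, omega_south] at h2
  split_ifs at h1 h2 with h3 h4
  exact h3 h4.le

/-- The orientation determines the rows as the points where the vertical segments diverge. At a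
crossing the smoothing then determines the side, and near a puncture only one side meets the
horizontal segment. -/
theorem genState_injective (s : D.FigureEights) : Function.Injective (genState s) := by
  intro g g' h
  have hres : genRes s g = genRes s g' := by rw [← genState_res, ← genState_res, h]
  have hom : genOmega g = genOmega g' := by rw [← genState_omega s, ← genState_omega s, h]
  have key : ∀ (g g' : D.Gen), genOmega g = genOmega g' → ∀ c, g'.row c ≤ g.row c := by
    intro g g' hom c
    by_contra hlt
    rw [not_le] at hlt
    have he : D.HasEnd c (g.row c) .north := ⟨(g.bounds c).1.1, hlt.trans_le (g'.bounds c).1.2⟩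
    obtain ⟨e, l⟩ := D.exists_leavesAt he
    have h1 := l.sgn_mul_genOmega g
    have h2 := l.sgn_mul_genOmega g'
    rw [hom, h2] at h1
    simp only [genOut, if_neg (not_le.2 hlt), le_refl, if_true] at h1
    omega
  have hrow : g.row = g'.row := Equiv.ext fun c => le_antisymm (key _ _ hom.symm c) (key _ _ hom c)
  have hside : g.side = g'.side := by
    funext c
    have p := g.isPoint c
    have p' := g'.isPoint c
    rw [← hrow] at p'
    by_cases hc : D.IsCrossing c (g.row c)
    · have := congrFun hres ⟨(c, g.row c), hc⟩
      simp only [genRes, ← hrow, if_true] at this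
      have h3 : s.IsUp c (g.row c) (g.side c) ↔ s.IsUp c (g.row c) (g'.side c) := by
        simpa using this
      cases h1 : g.side c <;> cases h2 : g'.side c <;> rw [h1, h2] at h3 <;>
        simp only [FigureEights.IsUp, Fin.lt_def, Fin.le_def] at h3 <;> first | rfl | omega
    · obtain ⟨k1, k2, k3⟩ := D.fin_corner_iff c (g.row c)
      simp only [IsCrossing, Fin.lt_def] at hc
      cases h1 : g.side c <;> cases h2 : g'.side c <;> rw [h1] at p <;> rw [h2] at p' <;>
        simp only [IsPoint, Fin.lt_def, Fin.le_def] at p p' <;> first | rfl | omega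
  cases g; cases g'; simp_all

/-- The outward orientation of the state at a lattice point. -/
theorem State.omega_eq (s : D.State) (e : D.Edge) : s.omega e = 1 ∨ s.omega e = -1 :=
  GridDiagram.omega_eq _ _ _

/-- It turns the monotonicity of the orientation along a segment into a point where the orientation
changes; this point may be an end of the segment. -/
theorem exists_threshold (p : ℕ → Prop) {a b : ℕ} (hab : a ≤ b)
    (h : ∀ k, a ≤ k → k + 1 < b → p k → p (k + 1)) :
    ∃ m, a ≤ m ∧ m ≤ b ∧ ∀ k, a ≤ k → k < b → (p k ↔ m ≤ k) := by
  have hex : ∃ m, a ≤ m ∧ (p m ∨ m = b) := ⟨b, hab, Or.inr rfl⟩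
  refine ⟨Nat.find hex, (Nat.find_spec hex).1, Nat.find_min' hex ⟨hab, Or.inr rfl⟩,
    fun k hk hkb => ⟨fun hp => Nat.find_min' hex ⟨hk, Or.inl hp⟩, fun hm => ?_⟩⟩
  have hpm : p (Nat.find hex) := (Nat.find_spec hex).2.resolve_right (by omega)
  obtain ⟨j, rfl⟩ := Nat.exists_eq_add_of_le hm
  clear hm
  induction j with
  | zero => exact hpm
  | succ j ih =>
    have := (Nat.find_spec hex).1
    exact h (Nat.find hex + j) (by omega) (by omega) (ih (by omega) (by omega))

theorem joined_straight {ρ : D.Resolution} {c r : Fin n} (hc : ¬ D.IsCrossing c r) {d d' : Dir}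
    (h : d ≠ d') : Joined ρ c r d d' := ⟨h, fun h' => absurd h' hc⟩

theorem joined_of_smoothing {x : D.Crossing} {ρ : D.Resolution} {d d' : Dir} (hne : d ≠ d')
    (h : smoothingJoins (ρ x) d d') : Joined ρ x.1.1 x.1.2 d d' := ⟨hne, fun _ => Or.inl h⟩

namespace State

/-- The relations between the orientations of the four edges at a crossing. -/
theorem omega_crossing (s : D.State) (x : D.Crossing) :
    s.omega (x.edge .east) = (if s.1 x then s.omega (x.edge .south) else -s.omega (x.edge .north)) ∧
    s.omega (x.edge .west) = (if s.1 x then s.omega (x.edge .north) else -s.omega (x.edge .south)) := by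
  have j := fun {d d'} (hne : d ≠ d') (h : smoothingJoins (s.1 x) d d') =>
    s.omega_joined (x.edge_leavesAt d) (x.edge_leavesAt d') (joined_of_smoothing hne h)
  cases hb : s.1 x <;> rw [hb] at j
  · have a := j (d := .north) (d' := .east) (by simp) trivial
    have b := j (d := .south) (d' := .west) (by simp) trivial
    simp only [Dir.sgn] at a b
    simp only [Bool.false_eq_true, if_false]
    constructor <;> linarith
  · have a := j (d := .north) (d' := .west) (by simp) trivial
    have b := j (d := .south) (d' := .east) (by simp) trivial
    simp only [Dir.sgn] at a b
    simp only [if_true]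
    constructor <;> linarith

variable {s : D.State} (hs : s.IsCritical)

include hs

/-- Going north, the orientation of a column can change from upward to downward only at a free
crossing. So it changes at most once, from downward to upward. -/
theorem IsCritical.vertical {c r : Fin n} {e e' : D.Edge} (l : e.LeavesAt .south c r)
    (l' : e'.LeavesAt .north c r) (h : s.omega e = 1) : s.omega e' = 1 := by
  by_cases hc : D.IsCrossing c r
  · have := hs ⟨(c, r), hc⟩
    unfold State.Free at this
    rw [Crossing.northEdge_eq, Crossing.southEdge_eq, 
      (Crossing.edge_leavesAt ⟨(c, r), hc⟩ .south).unique l,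
      (Crossing.edge_leavesAt ⟨(c, r), hc⟩ .north).unique l'] at this
    exact (s.omega_eq e').resolve_right fun h' => this ⟨h', h⟩
  · have := s.omega_joined l l' (joined_straight hc (by simp))
    simp only [Dir.sgn] at this
    linarith

/-- By coherence, a crossing with both horizontal ends outward has both vertical ends inward and
would be free. So the orientation of a row can only converge. -/
theorem IsCritical.horizontal {c r : Fin n} {e e' : D.Edge} (l : e.LeavesAt .west c r)
    (l' : e'.LeavesAt .east c r) (h : s.omega e = -1) : s.omega e' = -1 := by
  by_cases hc : D.IsCrossing c r
  · have h1 := hs ⟨(c, r), hc⟩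
    have h2 := s.omega_crossing ⟨(c, r), hc⟩
    unfold State.Free at h1
    rw [Crossing.northEdge_eq, Crossing.southEdge_eq] at h1
    rw [(Crossing.edge_leavesAt ⟨(c, r), hc⟩ .west).unique l,
      (Crossing.edge_leavesAt ⟨(c, r), hc⟩ .east).unique l'] at h2
    rcases s.omega_eq (Crossing.edge ⟨(c, r), hc⟩ .north) with a | a <;>
      rcases s.omega_eq (Crossing.edge ⟨(c, r), hc⟩ .south) with b | b <;>
      rw [a, b] at h1 h2 <;> split_ifs at h2 <;> simp_all
  · have := s.omega_joined l l' (joined_straight hc (by simp))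
    simp only [Dir.sgn] at this
    linarith

theorem IsCritical.exists_row (c : Fin n) : ∃ m : Fin n, D.lo c ≤ m ∧ m ≤ D.hi c ∧
    ∀ e : D.Edge, e.1.1 = true → e.1.2.1 = c → (s.omega e = 1 ↔ m ≤ e.1.2.2) := by
  obtain ⟨m, h1, h2, h3⟩ := exists_threshold
    (fun k => ∀ e : D.Edge, e.1.1 = true → e.1.2.1 = c → (e.1.2.2 : ℕ) = k → s.omega e = 1)
    (D.lo_lt_hi c).le fun k hk hk' hp e h1 h2 h3 => by
      have he : D.HasEnd c e.1.2.2 .south := by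
        simp only [HasEnd, Fin.lt_def, Fin.le_def]; omega
      obtain ⟨e', l⟩ := D.exists_leavesAt he
      exact hs.vertical l ⟨h1, h2, rfl⟩ (hp e' l.1 l.2.1 (by have := l.2.2; omega))
  refine ⟨⟨m, by omega⟩, h1, h2, fun e he hc => ?_⟩
  have hb := e.2
  simp only [he, hc, true_and, Bool.true_eq_false, false_and, or_false] at hb
  rw [Fin.le_def, ← h3 e.1.2.2 hb.1 hb.2]
  refine ⟨fun h e' h1 h2 h4 => ?_, fun h => h e he hc rfl⟩
  rwa [show e' = e from Subtype.ext (Prod.ext (h1.trans he.symm)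
    (Prod.ext (h2.trans hc.symm) (Fin.ext h4)))]

theorem IsCritical.exists_col (r : Fin n) : ∃ m : Fin n, D.lft r ≤ m ∧ m ≤ D.rgt r ∧
    ∀ e : D.Edge, e.1.1 = false → e.1.2.2 = r → (s.omega e = -1 ↔ m ≤ e.1.2.1) := by
  obtain ⟨m, h1, h2, h3⟩ := exists_threshold
    (fun k => ∀ e : D.Edge, e.1.1 = false → e.1.2.2 = r → (e.1.2.1 : ℕ) = k → s.omega e = -1)
    (D.lft_lt_rgt r).le fun k hk hk' hp e h1 h2 h3 => by
      have he : D.HasEnd e.1.2.1 r .west := by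
        simp only [HasEnd, Fin.lt_def, Fin.le_def]; omega
      obtain ⟨e', l⟩ := D.exists_leavesAt he
      exact hs.horizontal l ⟨h1, rfl, h2⟩ (hp e' l.1 l.2.2 (by have := l.2.1; omega))
  refine ⟨⟨m, by omega⟩, h1, h2, fun e he hc => ?_⟩
  have hb := e.2
  simp only [he, hc, true_and, Bool.false_eq_true, false_and, false_or] at hb
  rw [Fin.le_def, ← h3 e.1.2.1 hb.1 hb.2]
  refine ⟨fun h e' h1 h2 h4 => ?_, fun h => h e he hc rfl⟩
  rwa [show e' = e from Subtype.ext (Prod.ext (h1.trans he.symm)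
    (Prod.ext (Fin.ext h4) (h2.trans hc.symm)))]

omit hs in
/-- The vertical edges at the turning point of a column point outwards, so the horizontal edges
point inwards. -/
theorem col_eq (s : D.State) {c m k : Fin n} (h1 : D.lo c ≤ m) (h2 : m ≤ D.hi c)
    (h3 : ∀ e : D.Edge, e.1.1 = true → e.1.2.1 = c → (s.omega e = 1 ↔ m ≤ e.1.2.2))
    (k1 : D.lft m ≤ k) (k2 : k ≤ D.rgt m)
    (k3 : ∀ e : D.Edge, e.1.1 = false → e.1.2.2 = m → (s.omega e = -1 ↔ k ≤ e.1.2.1)) :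
    (D.lft m ≤ c ∧ c ≤ D.rgt m) ∧ k = c := by
  have vN : ∀ {e : D.Edge}, e.LeavesAt .north c m → s.omega e = 1 := fun {e} l =>
    (h3 e l.1 l.2.1).2 l.2.2.ge
  have vS : ∀ {e : D.Edge}, e.LeavesAt .south c m → s.omega e = -1 := fun {e} l =>
    (s.omega_eq e).resolve_left fun h => by
      have a := (h3 e l.1 l.2.1).1 h
      have b := l.2.2
      rw [Fin.le_def] at a
      omega
  have hE : ∀ {e : D.Edge}, e.LeavesAt .east c m → s.omega e = -1 → k ≤ c := fun {e} l h => by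
    have := (k3 e l.1 l.2.2).1 h
    rwa [l.2.1] at this
  have hW : ∀ {e : D.Edge}, e.LeavesAt .west c m → s.omega e = 1 → c ≤ k := fun {e} l h => by
    have a := (k3 e l.1 l.2.2).not.1 (by rw [h]; decide)
    have b := l.2.1
    rw [Fin.le_def] at a ⊢
    omega
  obtain ⟨q1, q2, q3⟩ := D.fin_corner_iff c m
  by_cases hc : D.IsCrossing c m
  · have := s.omega_crossing ⟨(c, m), hc⟩
    rw [vN (Crossing.edge_leavesAt ⟨(c, m), hc⟩ .north),
      vS (Crossing.edge_leavesAt ⟨(c, m), hc⟩ .south)] at this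
    have e1 := hE (Crossing.edge_leavesAt ⟨(c, m), hc⟩ _) (by rw [this.1]; split_ifs <;> rfl)
    have e2 := hW (Crossing.edge_leavesAt ⟨(c, m), hc⟩ _) (by rw [this.2]; split_ifs <;> rfl)
    exact ⟨⟨hc.2.1.le, hc.2.2.le⟩, le_antisymm e1 e2⟩
  · have hj := fun {d d' e e'} (hne : d ≠ d') (l : Edge.LeavesAt e d c m)
      (l' : Edge.LeavesAt e' d' c m) => s.omega_joined l l' (joined_straight hc hne)
    have hc' := hc
    unfold IsCrossing at hc'
    simp only [Fin.lt_def, Fin.le_def] at hc' h1 h2 k1 k2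
    -- In the interior of a vertical segment the orientation cannot diverge away from the crossings.
    have corner : m = D.lo c ∨ m = D.hi c := by
      by_contra hno
      simp only [Fin.ext_iff] at hno
      obtain ⟨e, l⟩ := D.exists_leavesAt (c := c) (r := m) (d := .north)
        (by simp only [HasEnd, Fin.lt_def, Fin.le_def]; omega)
      obtain ⟨e', l'⟩ := D.exists_leavesAt (c := c) (r := m) (d := .south)
        (by simp only [HasEnd, Fin.lt_def, Fin.le_def]; omega)
      have := hj (by simp) l l'
      rw [vN l, vS l'] at this
      simp [Dir.sgn] at this
    have corner' := (D.corner_iff c m).1 corner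
    have hv : ∃ d e, d.vert = true ∧ Edge.LeavesAt e d c m ∧ d.sgn * s.omega e = 1 := by
      rcases corner with h | h
      · obtain ⟨e, l⟩ := D.exists_leavesAt (c := c) (r := m) (d := .north)
          (by simp only [HasEnd, Fin.lt_def, Fin.le_def, Fin.ext_iff] at *; omega)
        exact ⟨.north, e, rfl, l, by rw [vN l]; rfl⟩
      · obtain ⟨e, l⟩ := D.exists_leavesAt (c := c) (r := m) (d := .south)
          (by simp only [HasEnd, Fin.lt_def, Fin.le_def, Fin.ext_iff] at *; omega)
        exact ⟨.south, e, rfl, l, by rw [vS l]; rfl⟩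
    obtain ⟨d, e, hd, l, hout⟩ := hv
    rcases corner' with h | h
    · obtain ⟨e', l'⟩ := D.exists_leavesAt (c := c) (r := m) (d := .east)
        (by simp only [HasEnd, Fin.lt_def, Fin.le_def, Fin.ext_iff] at *; omega)
      have := hj (by rintro rfl; simp [Dir.vert] at hd) l l'
      rw [hout] at this
      have := hE l' (by simp only [Dir.sgn] at this; linarith)
      simp only [Fin.le_def, Fin.ext_iff] at *
      omega
    · obtain ⟨e', l'⟩ := D.exists_leavesAt (c := c) (r := m) (d := .west)
        (by simp only [HasEnd, Fin.lt_def, Fin.le_def, Fin.ext_iff] at *; omega)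
      have := hj (by rintro rfl; simp [Dir.vert] at hd) l l'
      rw [hout] at this
      have := hW l' (by simp only [Dir.sgn] at this; linarith)
      simp only [Fin.le_def, Fin.ext_iff] at *
      omega

end State

/-- At a crossing the two sides have opposite directions and so realize the two smoothings. At a
puncture the side is forced by the horizontal segment. -/
theorem exists_side (f : D.FigureEights) {c r : Fin n} (h : D.lo c ≤ r ∧ r ≤ D.hi c)
    (h' : D.lft r ≤ c ∧ c ≤ D.rgt r) (ρ : D.Resolution) : ∃ a, D.IsPoint c r a ∧
      ∀ hc : D.IsCrossing c r, ρ ⟨(c, r), hc⟩ = decide (¬ f.IsUp c r a) := by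
  obtain ⟨k1, k2, k3⟩ := D.fin_corner_iff c r
  by_cases hc : D.IsCrossing c r
  · have pt : ∀ a, D.IsPoint c r a := fun a => ⟨h, by
      cases a
      exacts [⟨hc.2.1, hc.2.2.le⟩, ⟨hc.2.1.le, hc.2.2⟩]⟩
    by_cases hk : f.knot c < r
    · cases hρ : ρ ⟨(c, r), hc⟩
      · exact ⟨.left, pt _, fun _ => by simp [hρ, FigureEights.IsUp, hk]⟩
      · exact ⟨.right, pt _, fun _ => by simp [hρ, FigureEights.IsUp, hk]⟩
    · cases hρ : ρ ⟨(c, r), hc⟩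
      · exact ⟨.right, pt _, fun _ => by simpa [hρ, FigureEights.IsUp] using hk⟩
      · exact ⟨.left, pt _, fun _ => by simpa [hρ, FigureEights.IsUp] using hk⟩
  · by_cases hl : c = D.lft r
    · exact ⟨.right, ⟨h, h'.1, hl ▸ D.lft_lt_rgt r⟩, fun h => absurd h hc⟩
    · exact ⟨.left, ⟨h, lt_of_le_of_ne h'.1 (Ne.symm hl), h'.2⟩, fun h => absurd h hc⟩

/-- Each column diverges at one point and each row converges at one point. Coherence at the point of
a column forces its row to converge there, so these points form a permutation; the smoothings
elsewhere follow from the orientation. -/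
theorem exists_genState_eq (f : D.FigureEights) {s : D.State} (hs : s.IsCritical) :
    ∃ g, genState f g = s := by
  choose row r1 r2 r3 using hs.exists_row
  choose col c1 c2 c3 using hs.exists_col
  have hcol : ∀ c, (D.lft (row c) ≤ c ∧ c ≤ D.rgt (row c)) ∧ col (row c) = c := fun c =>
    s.col_eq (r1 c) (r2 c) (r3 c) (c1 _) (c2 _) (c3 _)
  have hinj : Function.Injective row := Function.LeftInverse.injective fun c => (hcol c).2
  let rowE : Equiv.Perm (Fin n) := Equiv.ofBijective row (Finite.injective_iff_bijective.1 hinj)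
  have hsymm : ∀ r, rowE.symm r = col r := fun r => by
    obtain ⟨c, rfl⟩ := rowE.surjective r
    rw [Equiv.symm_apply_apply]
    exact (hcol c).2.symm
  choose side s1 s2 using fun c => exists_side f ⟨r1 c, r2 c⟩ (hcol c).1 s.1
  refine ⟨⟨rowE, side, s1⟩, ?_⟩
  have hom : (genState f ⟨rowE, side, s1⟩).omega = s.omega := by
    rw [genState_omega]
    funext e
    unfold genOmega
    rw [hsymm]
    have := s.omega_eq e
    split_ifs with h1 h2 h2
    · exact ((r3 _ e h1 rfl).2 h2).symm
    · exact (this.resolve_left fun h => h2 ((r3 _ e h1 rfl).1 h)).symm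
    · exact (this.resolve_right fun h => absurd ((c3 _ e (by simpa using h1) rfl).1 h)
        (not_le.2 h2)).symm
    · exact ((c3 _ e (by simpa using h1) rfl).2 (not_lt.1 h2)).symm
  refine State.ext_omega ?_ hom
  rw [genState_res]
  funext x
  obtain ⟨⟨c, r⟩, hx⟩ := x
  by_cases hsel : row c = r
  · subst hsel
    have : genRes f ⟨rowE, side, s1⟩ ⟨(c, row c), hx⟩ = decide (¬ f.IsUp c (row c) (side c)) :=
      if_pos rfl
    rw [this, s2 c hx]
  · have e1 : genRes f ⟨rowE, side, s1⟩ ⟨(c, r), hx⟩ =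
        decide (row c < r ↔ c < rowE.symm r) := if_neg hsel
    have h1 := s.omega_crossing ⟨(c, r), hx⟩
    have N := omega_north ⟨rowE, side, s1⟩ ⟨(c, r), hx⟩
    have S := omega_south ⟨rowE, side, s1⟩ ⟨(c, r), hx⟩
    have W := (Crossing.edge_leavesAt ⟨(c, r), hx⟩ .east).sgn_mul_genOmega ⟨rowE, side, s1⟩
    rw [← genState_omega f, hom, Crossing.northEdge_eq] at N
    rw [← genState_omega f, hom, Crossing.southEdge_eq] at S
    rw [← genState_omega f, hom] at W
    rw [N, S] at h1
    simp only [genOut, Dir.sgn, one_mul] at W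
    rw [W] at h1
    rw [e1]
    have e2 : (rowE c ≤ r) ↔ row c < r := ⟨fun h => lt_of_le_of_ne h hsel, le_of_lt⟩
    have e3 : (rowE c < r) ↔ row c < r := Iff.rfl
    simp only [e2, e3] at h1
    cases hb : s.1 ⟨(c, r), hx⟩ <;> rw [hb] at h1 <;> simp only [if_true, Bool.false_eq_true, if_false] at h1 <;>
      by_cases p : row c < r <;> by_cases q : c < rowE.symm r <;> simp [p, q] at h1 ⊢

end GridDiagram

end

section
namespace GridDiagram

variable {n : ℕ} {D : GridDiagram n}

open Classical

/-! ### The grading `P` -/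

theorem sum_vertical (f : Fin n → Fin n → ℤ) :
    (∑ e : D.Edge, if e.1.1 = true then f e.1.2.1 e.1.2.2 else 0) =
      ∑ c, ∑ r, if D.lo c ≤ r ∧ r < D.hi c then f c r else 0 := by
  rw [← Finset.sum_subtype (Finset.univ.filter fun e : Bool × Fin n × Fin n =>
    (e.1 = true ∧ D.lo e.2.1 ≤ e.2.2 ∧ e.2.2 < D.hi e.2.1) ∨
    (e.1 = false ∧ D.lft e.2.2 ≤ e.2.1 ∧ e.2.1 < D.rgt e.2.2)) (by simp)
    fun e => if e.1 = true then f e.2.1 e.2.2 else 0, Finset.sum_filter, Fintype.sum_prod_type,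
    Fintype.sum_bool]
  simp [Fintype.sum_prod_type]

/-- Summation by parts for a sign that changes once: what remains are the values at the change and
at both ends. -/
theorem sum_threshold (f : ℕ → ℤ) {a m b : ℕ} (h1 : a ≤ m) (h2 : m ≤ b) :
    ∑ k ∈ Finset.Ico a b, (if m ≤ k then 1 else -1) * (f k - f (k + 1)) = 2 * f m - f a - f b := by
  have tel : ∀ a b, a ≤ b → ∑ k ∈ Finset.Ico a b, (f k - f (k + 1)) = f a - f b := by
    intro a b hab
    induction b, hab using Nat.le_induction with
    | base => simp
    | succ b hab ih => rw [Finset.sum_Ico_succ_top hab, ih]; ring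
  rw [← Finset.sum_Ico_consecutive _ h1 h2]
  have e1 : ∑ k ∈ Finset.Ico a m, (if m ≤ k then 1 else -1) * (f k - f (k + 1)) = -(f a - f m) := by
    rw [← tel a m h1, ← Finset.sum_neg_distrib]
    refine Finset.sum_congr rfl fun k hk => ?_
    rw [if_neg (not_le.2 (Finset.mem_Ico.1 hk).2)]; ring
  have e2 : ∑ k ∈ Finset.Ico m b, (if m ≤ k then 1 else -1) * (f k - f (k + 1)) = f m - f b := by
    rw [← tel m b h2]
    refine Finset.sum_congr rfl fun k hk => ?_
    rw [if_pos (Finset.mem_Ico.1 hk).1]; ring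
  rw [e1, e2]; ring

theorem sum_fin_Ico (F : ℕ → ℤ) {a b : ℕ} (hb : b ≤ n) :
    (∑ r : Fin n, if a ≤ (r : ℕ) ∧ (r : ℕ) < b then F r else 0) = ∑ k ∈ Finset.Ico a b, F k := by
  rw [Fin.sum_univ_eq_sum_range (fun k => if a ≤ k ∧ k < b then F k else 0), ← Finset.sum_filter]
  refine Finset.sum_congr ?_ fun _ _ => rfl
  ext k
  simp only [Finset.mem_filter, Finset.mem_range, Finset.mem_Ico]
  omega

/-- Here the direction of winding of the figure-eights enters: the turning weight at a point of the
generator is -1 on an upward arc and 1 on a downward arc, also at the punctures. -/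
theorem kappa_row (s : D.FigureEights) (g : D.Gen) (c : Fin n) :
    kappa (genRes s g) c (g.row c) = 1 - 2 * if s.IsUp c (g.row c) (g.side c) then 1 else 0 := by
  obtain ⟨k1, k2, k3⟩ := D.fin_corner_iff c (g.row c)
  have p := g.isPoint c
  have l1 := s.lo_le c
  have l2 := s.lt_hi c
  unfold kappa
  rw [dif_pos (g.row c).2]
  simp only [Fin.eta]
  by_cases hc : D.IsCrossing c (g.row c)
  · rw [dif_pos hc]
    have : genRes s g ⟨(c, g.row c), hc⟩ = decide (¬ s.IsUp c (g.row c) (g.side c)) := if_pos rfl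
    rw [this]
    by_cases h : s.IsUp c (g.row c) (g.side c) <;> simp [h]
  · rw [dif_neg hc]
    unfold IsCrossing at hc
    generalize g.side c = a at *
    cases a <;> simp only [IsPoint, FigureEights.IsUp, Fin.lt_def, Fin.le_def, Fin.ext_iff] at * <;>
      split_ifs <;> omega

/-- In each column the turning telescopes to twice the weight at the point minus the weights at the
two ends, and the latter do not depend on the generator. -/
theorem turning_genState (s : D.FigureEights) (g : D.Gen) :
    turning (genState s g).1 (genState s g).omega = 2 * (n : ℤ) - 4 * Pbar s g -
      ∑ c, (kappa D.seifert c (D.lo c) + kappa D.seifert c (D.hi c)) := by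
  have corner : ∀ (ρ ρ' : D.Resolution) (c : Fin n) (r : Fin n), (r = D.lo c ∨ r = D.hi c) →
      kappa ρ c r = kappa ρ' c r := by
    intro ρ ρ' c r h
    have hc : ¬ D.IsCrossing c r := by
      rintro ⟨⟨h1, h2⟩, -⟩
      rcases h with h | h
      · exact absurd h h1.ne'
      · exact absurd h h2.ne
    unfold kappa
    simp [hc]
  rw [genState_res, genState_omega, turning]
  have e1 : ∀ e : D.Edge, genOmega g e * edgeTurn (genRes s g) e =
      if e.1.1 = true then (if (g.row e.1.2.1 : ℕ) ≤ e.1.2.2 then 1 else -1) *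
        (kappa (genRes s g) e.1.2.1 e.1.2.2 - kappa (genRes s g) e.1.2.1 (e.1.2.2 + 1)) else 0 := by
    intro e
    unfold genOmega edgeTurn
    simp only [Fin.le_def]
    split_ifs <;> simp
  rw [Finset.sum_congr rfl fun e _ => e1 e,
    sum_vertical (D := D) fun c r => (if (g.row c : ℕ) ≤ r then 1 else -1) *
        (kappa (genRes s g) c r - kappa (genRes s g) c (r + 1))]
  have e2 : ∀ c, (∑ r : Fin n, if D.lo c ≤ r ∧ r < D.hi c then (if (g.row c : ℕ) ≤ r then 1 else -1) *
        (kappa (genRes s g) c r - kappa (genRes s g) c (r + 1)) else 0) =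
      2 * (1 - 2 * if s.IsUp c (g.row c) (g.side c) then 1 else 0) -
        (kappa D.seifert c (D.lo c) + kappa D.seifert c (D.hi c)) := by
    intro c
    have b := (g.bounds c).1
    simp only [Fin.le_def, Fin.lt_def] at b ⊢
    rw [sum_fin_Ico (fun k => (if (g.row c : ℕ) ≤ k then 1 else -1) *
        (kappa (genRes s g) c k - kappa (genRes s g) c (k + 1))) (D.hi c).2.le,
      sum_threshold _ b.1 b.2, kappa_row, corner _ D.seifert _ _ (Or.inl rfl),
      corner _ D.seifert _ _ (Or.inr rfl)]
    ring
  rw [Finset.sum_congr rfl fun c _ => e2 c, Finset.sum_sub_distrib, ← Finset.mul_sum,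
    Finset.sum_sub_distrib, ← Finset.mul_sum, Pbar]
  simp
  ring

/-- The number of circles of a state labelled `1` minus the number of those labelled `-1`. -/
def State.rot (t : D.State) : ℤ := (Nat.card (D.Circle t.1) : ℤ) - 2 * t.2.card

theorem State.turning_eq (t : D.State) : turning t.1 t.omega = 4 * t.rot := turning_omega _ _

theorem rot_add_Pbar (s : D.FigureEights) (g g' : D.Gen) :
    (genState s g).rot + Pbar s g = (genState s g').rot + Pbar s g' := by
  have h := turning_genState s g
  have h' := turning_genState s g'
  rw [State.turning_eq] at h h'
  linarith

theorem genOmega_xGen (e : D.Edge) (he : e.1.1 = true) :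
    genOmega D.xGen e = if D.Upward e.1.2.1 then 1 else -1 := by
  have hb := e.2
  simp only [he, true_and, Bool.true_eq_false, false_and, or_false] at hb
  have hl : (D.lo e.1.2.1 : ℕ) = min (D.O e.1.2.1 : ℕ) (D.X e.1.2.1) := by
    simp only [lo]; exact Fin.coe_min _ _
  have hh : (D.hi e.1.2.1 : ℕ) = max (D.O e.1.2.1 : ℕ) (D.X e.1.2.1) := by
    simp only [hi]; exact Fin.coe_max _ _
  unfold genOmega
  rw [if_pos he]
  refine if_congr ?_ rfl rfl
  simp only [xGen, Upward, Fin.le_def, Fin.lt_def] at *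
  omega

/-- The orientation belonging to the points nearest to the `X`'s is that of the link, and at every
crossing only the oriented smoothing is compatible with it. -/
theorem genRes_xGen (s : D.FigureEights) : genRes s D.xGen = D.seifert := by
  funext x
  obtain ⟨⟨c, r⟩, hx⟩ := x
  have hl : (D.lo c : ℕ) = min (D.O c : ℕ) (D.X c) := by simp only [lo]; exact Fin.coe_min _ _
  have hh : (D.hi c : ℕ) = max (D.O c : ℕ) (D.X c) := by simp only [hi]; exact Fin.coe_max _ _
  have hf : (D.lft r : ℕ) = min (D.O.symm r : ℕ) (D.X.symm r) := by
    simp only [lft]; exact Fin.coe_min _ _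
  have hr : (D.rgt r : ℕ) = max (D.O.symm r : ℕ) (D.X.symm r) := by
    simp only [rgt]; exact Fin.coe_max _ _
  have hx' := hx
  simp only [Fin.lt_def] at hx'
  have hsel : D.X c ≠ r := fun h => by rw [← h] at hx'; omega
  have e1 : genRes s D.xGen ⟨(c, r), hx⟩ = decide (D.X c < r ↔ c < D.X.symm r) := if_neg hsel
  have e2 : (D.X c < r ↔ c < D.X.symm r) ↔ ¬ D.IsPositive ⟨(c, r), hx⟩ := by
    simp only [IsPositive, Upward, Rightward, Fin.lt_def]
    omega
  rw [e1, seifert]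
  split_ifs with h
  · exact decide_eq_false (by rw [e2]; simpa using h)
  · exact decide_eq_true (e2.2 h)

/-- For the oriented resolution the label of a Seifert circle records whether it runs
counterclockwise, because the spin has the sign of the area. -/
theorem rot_eq (s : D.FigureEights) : D.rot = (genState s D.xGen).rot := by
  obtain ⟨ρ, S, hρ⟩ : ∃ ρ S, genState s D.xGen = ⟨ρ, S⟩ := ⟨_, _, rfl⟩
  have h1 := genState_res s D.xGen
  have h2 := genState_omega s D.xGen
  rw [hρ] at h1 h2 ⊢
  rw [genRes_xGen] at h1
  subst h1
  change GridDiagram.omega D.seifert S = genOmega D.xGen at h2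
  have harea : ∀ C : D.Circle D.seifert, Int.sign (D.signedArea C) = if C ∈ S then -1 else 1 := by
    intro C
    obtain ⟨e, rfl⟩ := exists_circleOf C
    have e1 : D.signedArea (circleOf D.seifert e) =
        label D.seifert S e * (spin D.seifert (circleOf D.seifert e) *
          chiArea D.seifert (circleOf D.seifert e)) := by
      rw [signedArea, ← mul_assoc]
      have := sum_omega_circle D.seifert S e
        fun e' => if e'.1.1 = true then ((e'.1.2.1 : ℕ) : ℤ) else 0
      have e3 : chiArea D.seifert (circleOf D.seifert e) = ∑ e', if circleOf D.seifert e' =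
          circleOf D.seifert e then chi e' * (if e'.1.1 = true then ((e'.1.2.1 : ℕ) : ℤ) else 0)
          else 0 := by
        unfold chiArea
        refine Finset.sum_congr rfl fun e' _ => ?_
        split_ifs <;> simp
      rw [e3]
      refine Eq.trans (Finset.sum_congr rfl fun e' _ => ?_) (this.trans (by congr!))
      by_cases hv : e'.1.1 = true
      · rw [h2, genOmega_xGen e' hv]
        simp [hv]
      · simp [hv]
    have pos := (spin_spec D.seifert (circleOf D.seifert e)).2.2
    rw [e1, Int.sign_mul, Int.sign_eq_one_of_pos pos, mul_one, label]
    split_ifs <;> rfl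
  have h3 : ∀ C : D.Circle D.seifert, (if C ∈ S then (-1 : ℤ) else 1) = 1 - 2 * if C ∈ S then 1 else 0 := by
    intro C; split_ifs <;> ring
  rw [GridDiagram.rot, finsum_eq_sum_of_fintype]
  simp only [harea, h3]
  rw [Finset.sum_sub_distrib, ← Finset.mul_sum, Finset.sum_boole]
  simp [State.rot]

theorem P_eq (s : D.FigureEights) (g : D.Gen) : P s g = -(genState s g).rot - D.writhe := by
  have := rot_add_Pbar s g D.xGen
  rw [P, rot_eq s]
  linarith

end GridDiagram

end

/-! ### The height of the resolution as a sum over the lattice -/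

section
namespace GridDiagram

variable {n : ℕ} {D : GridDiagram n}

open Classical

/-! ### A balance of signs -/

/-- The sign of the difference of two indices. -/
def sg (a b : Fin n) : ℤ := if b < a then 1 else if a < b then -1 else 0

theorem sg_of_lt {a b : Fin n} (h : a < b) : sg a b = -1 := by
  rw [sg, if_neg h.not_gt, if_pos h]

theorem sg_of_gt {a b : Fin n} (h : b < a) : sg a b = 1 := by rw [sg, if_pos h]

theorem sg_self (a : Fin n) : sg a a = 0 := by simp [sg]

theorem sum_punctures (D : GridDiagram n) (f : Fin n → Fin n → ℤ) :
    ∑ c, (f c (D.lo c) + f c (D.hi c)) = ∑ r, (f (D.lft r) r + f (D.rgt r) r) := by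
  have e1 : ∀ c, f c (D.lo c) + f c (D.hi c) = f c (D.O c) + f c (D.X c) := by
    intro c
    rcases le_total (D.O c) (D.X c) with h | h <;> simp [lo, hi, h, add_comm]
  have e2 : ∀ r, f (D.lft r) r + f (D.rgt r) r = f (D.O.symm r) r + f (D.X.symm r) r := by
    intro r
    rcases le_total (D.O.symm r) (D.X.symm r) with h | h <;> simp [lft, rgt, h, add_comm]
  simp only [e1, e2, Finset.sum_add_distrib]
  rw [← Equiv.sum_comp D.O fun r => f (D.O.symm r) r, ← Equiv.sum_comp D.X fun r => f (D.X.symm r) r]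
  simp

/-- The number of punctures in row `y` to the left of column `c`. -/
def leftCount (D : GridDiagram n) (c y : Fin n) : ℤ :=
  (if D.lft y < c then 1 else 0) + if D.rgt y < c then 1 else 0

/-- The number of punctures to the left of column `c` that lie between its lower end and row `m`. -/
def leftArea (D : GridDiagram n) (c m : Fin n) : ℤ :=
  ∑ y, if D.lo c ≤ y ∧ y < m then D.leftCount c y else 0

/-- The punctures in row `y`, counted with the sign of their position relative to column `c`. -/
def sideCount (D : GridDiagram n) (c y : Fin n) : ℤ := sg (D.lft y) c + sg (D.rgt y) c

theorem sideCount_eq (c y : Fin n) : D.sideCount c y =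
    2 - 2 * D.leftCount c y - (if y = D.lo c then 1 else 0) - if y = D.hi c then 1 else 0 := by
  obtain ⟨k1, k2, k3⟩ := D.fin_corner_iff c y
  simp only [sideCount, leftCount, sg, Fin.lt_def, Fin.ext_iff]
  split_ifs <;> omega

/-- A sum of products of signs counts the punctures to the left of the column below and above row
`m`. Up to terms at the ends of the segment and a constant, it is the area that appears in the
winding numbers. -/
theorem sum_sg_mul_sideCount {c m : Fin n} (h1 : D.lo c ≤ m) (h2 : m ≤ D.hi c) :
    ∑ y, sg m y * D.sideCount c y = 4 * (m : ℕ) - 4 * D.leftArea c m -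
      2 * (if D.lo c < m then 1 else 0) + D.sideCount c m +
      (∑ y, (-D.sideCount c y - 4 * if y < D.lo c then D.leftCount c y else 0)) := by
  have e : ∀ y, sg m y * D.sideCount c y = 4 * (if y < m then 1 else 0) -
      4 * (if D.lo c ≤ y ∧ y < m then D.leftCount c y else 0) -
      2 * (if y = D.lo c then (if D.lo c < m then 1 else 0) else 0) +
      (if y = m then D.sideCount c m else 0) +
      (-D.sideCount c y - 4 * if y < D.lo c then D.leftCount c y else 0) := by
    intro y
    have := D.sideCount_eq c y
    rcases lt_trichotomy y m with h | h | h
    · rw [sg_of_gt h, one_mul]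
      have hh : y ≠ D.hi c := (h.trans_le h2).ne
      rw [if_neg hh] at this
      simp only [h, and_true, if_true, h.ne, if_false]
      rcases lt_trichotomy y (D.lo c) with h3 | h3 | h3
      · simp only [h3, h3.ne, h3.not_ge, if_true, if_false] at this ⊢
        linarith
      · subst h3
        simp only [lt_self_iff_false, le_refl, h, if_true, if_false] at this ⊢
        linarith
      · simp only [h3.not_gt, h3.ne', h3.le, if_true, if_false] at this ⊢
        linarith
    · subst h
      rw [sg_self]
      by_cases h3 : y = D.lo c
      · simp [← h3]
      · simp [h3, h1.not_gt]
    · rw [sg_of_lt h]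
      by_cases h3 : y = D.lo c
      · simp [← h3, h.not_gt, h.ne']
      · simp [h3, h.not_gt, h.ne', (h1.trans h.le).not_gt]
  have e4 : (∑ y : Fin n, if y < m then (1 : ℤ) else 0) = (m : ℕ) := by
    have : (Finset.univ.filter fun y : Fin n => y < m) = Finset.Iio m := by ext; simp
    rw [Finset.sum_boole, this, Fin.card_Iio]
  rw [Finset.sum_congr rfl fun y _ => e y, Finset.sum_add_distrib, Finset.sum_add_distrib,
    Finset.sum_sub_distrib, Finset.sum_sub_distrib, ← Finset.mul_sum, ← Finset.mul_sum,
    ← Finset.mul_sum, e4, leftArea]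
  simp

/-- The contribution of a crossing to the height of the resolution of a generator. -/
def heightAt (s : D.FigureEights) (g : D.Gen) (c r : Fin n) : ℤ :=
  if h : D.IsCrossing c r then (if genRes s g ⟨(c, r), h⟩ = true then 1 else 0) else 0

theorem height_genRes (s : D.FigureEights) (g : D.Gen) :
    (genRes s g).height = ∑ c, ∑ r, heightAt s g c r := by
  have h1 : (genRes s g).height = ∑ x : D.Crossing, heightAt s g x.1.1 x.1.2 := by
    rw [Resolution.height, Nat.card_eq_fintype_card, Fintype.card_subtype, ← Finset.sum_boole]
    refine Finset.sum_congr rfl fun x _ => ?_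
    have : D.IsCrossing x.1.1 x.1.2 := x.2
    unfold heightAt
    rw [dif_pos this]
  rw [h1, ← Finset.sum_subtype (Finset.univ.filter fun p : Fin n × Fin n => D.IsCrossing p.1 p.2)
    (fun p => by rw [Finset.mem_filter]; exact ⟨fun h => h.2, fun h => ⟨Finset.mem_univ _, h⟩⟩)
    fun p => heightAt s g p.1 p.2, Finset.sum_filter,
    Fintype.sum_prod_type]
  refine Finset.sum_congr rfl fun c _ => Finset.sum_congr rfl fun r _ => ?_
  by_cases h : D.IsCrossing c r
  · rw [if_pos h]
  · rw [if_neg h, heightAt, dif_neg h]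

/-- The contribution of a point on a crossing. -/
def pointAt (s : D.FigureEights) (g : D.Gen) (c : Fin n) : ℤ :=
  if D.IsCrossing c (g.row c) then
    1 - 2 * (if s.IsUp c (g.row c) (g.side c) then 1 else 0) else 0

/-- A local sign, which depends on the diagram only. -/
def latticeSign (D : GridDiagram n) (c r : Fin n) : ℤ :=
  if D.IsCrossing c r then -4 else if r = D.lo c ∨ r = D.hi c then
    (if r = D.lo c ↔ c = D.lft r then -1 else 1) else 0

/-- The first factor vanishes off the closed vertical segment of column `c`, the second off the
closed horizontal segment of row `r`. At a crossing the product is 4 or -4 and reads off the forced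
smoothing, or it is zero at a point of the generator, where `pointAt` compensates. At a corner the
generator enters twice and drops out. -/
theorem local_balance (s : D.FigureEights) (g : D.Gen) (c r : Fin n) :
    -((sg (D.lo c) r + sg (D.hi c) r - 2 * sg (g.row c) r) *
      (D.sideCount c r - 2 * sg (g.row.symm r) c)) - 8 * heightAt s g c r +
      4 * (if g.row c = r then pointAt s g c else 0) = D.latticeSign c r := by
  have hlo : D.lo c < D.hi c := D.lo_lt_hi c
  have hlr : D.lft r < D.rgt r := D.lft_lt_rgt r
  obtain ⟨b1, b2⟩ := (g.bounds c).1
  obtain ⟨b3, b4⟩ := g.bounds' r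
  have hrc := g.row_eq_iff c r
  have hco := D.corner_iff c r
  by_cases hx : D.IsCrossing c r
  · obtain ⟨⟨x1, x2⟩, x3, x4⟩ := id hx
    rw [heightAt, dif_pos hx, sideCount, sg_of_lt x1, sg_of_gt x2, sg_of_lt x3, sg_of_gt x4,
      latticeSign, if_pos hx]
    by_cases hr : g.row c = r
    · have hs : g.row.symm r = c := hrc.1 hr
      have hx' : D.IsCrossing c (g.row c) := by rwa [hr]
      have e : genRes s g ⟨(c, r), hx⟩ = decide (¬ s.IsUp c r (g.side c)) := if_pos hr
      rw [if_pos hr, pointAt, if_pos hx', hr, hs, sg_self, sg_self, e]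
      by_cases hu : s.IsUp c r (g.side c) <;> simp [hu]
    · have hs : g.row.symm r ≠ c := fun h => hr (hrc.2 h)
      have e : genRes s g ⟨(c, r), hx⟩ = decide (g.row c < r ↔ c < g.row.symm r) := if_neg hr
      rw [if_neg hr, e]
      rcases lt_or_gt_of_ne hr with h1 | h1 <;> rcases lt_or_gt_of_ne hs with h2 | h2
      · simp [sg_of_lt h1, sg_of_lt h2, h1, h2.not_gt]
      · simp [sg_of_lt h1, sg_of_gt h2, h1, h2]
      · simp [sg_of_gt h1, sg_of_lt h2, h1.not_gt, h2.not_gt]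
      · simp [sg_of_gt h1, sg_of_gt h2, h1.not_gt, h2]
  · have hp : (if g.row c = r then pointAt s g c else 0) = 0 := by
      split_ifs with h
      · rw [pointAt, if_neg (by rwa [h])]
      · rfl
    rw [heightAt, dif_neg hx, hp, latticeSign, if_neg hx, sideCount]
    rcases lt_or_ge r (D.lo c) with h1 | h1
    · rw [sg_of_gt h1, sg_of_gt (h1.trans hlo), sg_of_gt (h1.trans_le b1), if_neg]
      · ring
      · rintro (h | h)
        · exact h1.ne h
        · exact (h1.trans hlo).ne h
    rcases lt_or_ge (D.hi c) r with h2 | h2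
    · rw [sg_of_lt h2, sg_of_lt (hlo.trans h2), sg_of_lt (b2.trans_lt h2), if_neg]
      · ring
      · rintro (h | h)
        · exact (hlo.trans h2).ne' h
        · exact h2.ne' h
    rcases lt_or_ge c (D.lft r) with h3 | h3
    · rw [sg_of_gt h3, sg_of_gt (h3.trans hlr), sg_of_gt (h3.trans_le b3), if_neg]
      · ring
      · rw [hco]
        rintro (h | h)
        · exact h3.ne h
        · exact (h3.trans hlr).ne h
    rcases lt_or_ge (D.rgt r) c with h4 | h4
    · rw [sg_of_lt h4, sg_of_lt (hlr.trans h4), sg_of_lt (b4.trans_lt h4), if_neg]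
      · ring
      · rw [hco]
        rintro (h | h)
        · exact (hlr.trans h4).ne' h
        · exact h4.ne' h
    have hc : r = D.lo c ∨ r = D.hi c := by
      by_contra hc
      have hc' := hc
      rw [hco] at hc'
      push Not at hc hc'
      exact hx ⟨⟨lt_of_le_of_ne h1 hc.1.symm, lt_of_le_of_ne h2 hc.2⟩,
        lt_of_le_of_ne h3 hc'.1.symm, lt_of_le_of_ne h4 hc'.2⟩
    rw [if_pos hc]
    have hv : sg (D.lo c) r + sg (D.hi c) r - 2 * sg (g.row c) r =
        (if r = D.lo c then 1 else -1) * if g.row c = r then 1 else -1 := by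
      rcases hc with h | h
      · rw [h] at h2 ⊢
        rw [sg_self, sg_of_gt hlo]
        rcases b1.eq_or_lt with h' | h'
        · simp [← h', sg_self]
        · simp [sg_of_gt h', h'.ne']
      · rw [h, sg_self, sg_of_lt hlo]
        rcases b2.eq_or_lt with h' | h'
        · simp [h', sg_self, hlo.ne']
        · simp [sg_of_lt h', h'.ne, hlo.ne']
    have hh : sg (D.lft r) c + sg (D.rgt r) c - 2 * sg (g.row.symm r) c =
        (if c = D.lft r then 1 else -1) * if g.row c = r then 1 else -1 := by
      simp only [hrc]
      rcases hco.1 hc with h | h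
      · rw [← h] at b3 hlr ⊢
        rw [sg_self, sg_of_gt hlr]
        rcases b3.eq_or_lt with h' | h'
        · simp [← h', sg_self]
        · simp [sg_of_gt h', h'.ne']
      · rw [← h] at b4 hlr ⊢
        rw [sg_self, sg_of_lt hlr]
        rcases b4.eq_or_lt with h' | h'
        · simp [h', sg_self, hlr.ne']
        · simp [sg_of_lt h', h'.ne, hlr.ne']
    rw [hv, hh]
    clear hv hh hp hc hco hrc
    split_ifs <;> grind

/-- A pair of columns contributes according to whether it is in order or inverted, which brings in
`T`. -/
theorem sum_sg_mul_sg (e : Equiv.Perm (Fin n)) :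
    ∑ c, ∑ c', sg (e c) (e c') * sg c' c =
      n * (n - 1) - 4 * ∑ c, ∑ c', if c < c' ∧ e c < e c' then 1 else 0 := by
  have h1 : ∀ c c', sg (e c) (e c') * sg c' c = (1 - if c = c' then 1 else 0) -
      2 * (if c < c' ∧ e c < e c' then 1 else 0) - 2 * (if c' < c ∧ e c' < e c then 1 else 0) := by
    intro c c'
    rcases lt_trichotomy c c' with h | h | h
    · have : e c ≠ e c' := fun h' => h.ne (e.injective h')
      rcases lt_or_gt_of_ne this with h' | h' <;>
        simp [sg_of_lt, sg_of_gt, h, h', h.ne, h.not_gt, h'.not_gt]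
    · subst h; simp [sg_self]
    · have : e c ≠ e c' := fun h' => h.ne' (e.injective h')
      rcases lt_or_gt_of_ne this with h' | h' <;>
        simp [sg_of_lt, sg_of_gt, h, h', h.ne', h.not_gt, h'.not_gt]
  have h2 : (∑ c : Fin n, ∑ c', if c' < c ∧ e c' < e c then (1 : ℤ) else 0) =
      ∑ c, ∑ c', if c < c' ∧ e c < e c' then 1 else 0 := Finset.sum_comm
  simp only [h1, Finset.sum_sub_distrib, ← Finset.mul_sum, h2]
  simp
  ring

/-- The leftover terms at the point of each column, collected into `Pbar` and the corrections of the
winding numbers. -/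
theorem column_balance (s : D.FigureEights) (g : D.Gen) (c : Fin n) :
    -2 * (if D.lo c < g.row c then 1 else 0) + D.sideCount c (g.row c) + pointAt s g c =
      -2 * (if s.IsUp c (g.row c) (g.side c) then 1 else 0) +
        4 * (if g.side c = .right ∧ g.row c = D.lo c then 1 else 0) - 1 := by
  obtain ⟨k1, k2, k3⟩ := D.fin_corner_iff c (g.row c)
  have p := g.isPoint c
  have l1 := s.lo_le c
  have l2 := s.lt_hi c
  unfold pointAt sideCount sg IsCrossing
  generalize g.side c = a at *
  cases a <;> simp only [IsPoint, FigureEights.IsUp, Fin.lt_def, Fin.le_def, Fin.ext_iff,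
    reduceCtorEq, false_and, true_and, if_false] at * <;> split_ifs <;> omega

/-- The sum of the areas and corrections that make up the winding numbers of a generator. -/
def windingSum (s : D.FigureEights) (g : D.Gen) : ℤ :=
  ∑ c, (D.leftArea c (g.row c) + (if s.IsUp c (g.row c) (g.side c) then 1 else 0) -
    if g.side c = .right ∧ g.row c = D.lo c then 1 else 0)

/-- Expanding the product of `local_balance` and summing over the lattice gives the areas from the
two mixed terms and `T` from the term quadratic in the generator. The right-hand side does not
contain the generator, so the combination on the left is an invariant of the diagram. -/
theorem sum_balance (s : D.FigureEights) (g : D.Gen) :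
    8 * (2 * T g - 2 * windingSum s g + Pbar s g - (genRes s g).height) =
      ∑ c, ∑ r, (D.latticeSign c r + (sg (D.lo c) r + sg (D.hi c) r) * D.sideCount c r) +
        4 * (n * (n - 1) + n - ∑ c, ∑ y, (-D.sideCount c y -
          4 * if y < D.lo c then D.leftCount c y else 0)) - 16 * ∑ c : Fin n, ((c : ℕ) : ℤ) := by
  have key := Finset.sum_congr rfl fun c (_ : c ∈ Finset.univ) =>
    Finset.sum_congr rfl fun r (_ : r ∈ Finset.univ) => local_balance s g c r
  have hA : ∀ c, (∑ r, sg (g.row c) r * D.sideCount c r) = _ := fun c =>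
    sum_sg_mul_sideCount (g.bounds c).1.1 (g.bounds c).1.2
  -- The two mixed terms agree, since the punctures may be listed by columns or by rows.
  have hB : ∑ c, ∑ r, (sg (D.lo c) r + sg (D.hi c) r) * sg (g.row.symm r) c =
      ∑ c, ∑ r, sg (g.row c) r * D.sideCount c r := by
    rw [Finset.sum_comm, ← Equiv.sum_comp g.row]
    refine Finset.sum_congr rfl fun c' _ => ?_
    have := D.sum_punctures fun x y => sg (g.row c') y * sg x c'
    simp only [← mul_add] at this
    unfold sideCount
    rw [← this]
    refine Finset.sum_congr rfl fun c _ => ?_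
    have anti : ∀ a b : Fin n, sg a b = -sg b a := by
      intro a b
      rcases lt_trichotomy a b with h | h | h
      · rw [sg_of_lt h, sg_of_gt h]
      · rw [h, sg_self]; rfl
      · rw [sg_of_lt h, sg_of_gt h]; rfl
    rw [Equiv.symm_apply_apply, anti (D.lo c), anti (D.hi c), anti c']
    ring
  have hD := Finset.sum_congr rfl fun c (_ : c ∈ Finset.univ) => column_balance s g c
  have hE : ∑ c, ((g.row c : ℕ) : ℤ) = ∑ c : Fin n, ((c : ℕ) : ℤ) :=
    Equiv.sum_comp g.row fun c => ((c : ℕ) : ℤ)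
  have hC : ∑ c, ∑ r, sg (g.row c) r * sg (g.row.symm r) c = n * (n - 1) - 4 * T g := by
    rw [T, ← sum_sg_mul_sg]
    refine Finset.sum_congr rfl fun c _ => ?_
    rw [← Equiv.sum_comp g.row]
    simp
  have hF : ∀ c, ∑ r, (if g.row c = r then pointAt s g c else 0) = pointAt s g c := by simp
  have hG : ∀ c r, -((sg (D.lo c) r + sg (D.hi c) r - 2 * sg (g.row c) r) *
      (D.sideCount c r - 2 * sg (g.row.symm r) c)) =
      -((sg (D.lo c) r + sg (D.hi c) r) * D.sideCount c r) +
      2 * ((sg (D.lo c) r + sg (D.hi c) r) * sg (g.row.symm r) c) +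
      2 * (sg (g.row c) r * D.sideCount c r) - 4 * (sg (g.row c) r * sg (g.row.symm r) c) := by
    intros; ring
  simp only [hG, Finset.sum_add_distrib, Finset.sum_sub_distrib, ← Finset.mul_sum,
    Finset.sum_neg_distrib, hB, hC, hF, hA, hE, ← height_genRes] at key hD ⊢
  simp only [windingSum, Pbar, Finset.sum_add_distrib, Finset.sum_sub_distrib]
  simp only [Finset.sum_const, Finset.card_univ, Fintype.card_fin, nsmul_eq_mul,
    mul_one] at hD
  linarith

end GridDiagram

end

section
namespace GridDiagram

variable {n : ℕ} {D : GridDiagram n}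

open Classical

/-! ### Winding numbers -/

theorem rayCrossing_symm (p u v : ℤ × ℤ) : rayCrossing p v u = -rayCrossing p u v := by
  have h : (u.1 - v.1) * (p.2 - v.2) - (u.2 - v.2) * (p.1 - v.1) =
      -((v.1 - u.1) * (p.2 - u.2) - (v.2 - u.2) * (p.1 - u.1)) := by ring
  simp only [rayCrossing, h]
  generalize (v.1 - u.1) * (p.2 - u.2) - (v.2 - u.2) * (p.1 - u.1) = a
  split_ifs <;> omega

theorem rayCrossing_eq_zero {p u v : ℤ × ℤ} (h : ¬ (u.2 ≤ p.2 ∧ p.2 < v.2))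
    (h' : ¬ (v.2 ≤ p.2 ∧ p.2 < u.2)) : rayCrossing p u v = 0 := by
  simp only [rayCrossing]
  rw [if_neg fun k => h ⟨k.1, k.2.1⟩, if_neg fun k => h' ⟨k.1, k.2.1⟩]

theorem rayCrossing_vertical (p : ℤ × ℤ) (x y y' : ℤ) : rayCrossing p (x, y) (x, y') =
    if p.1 < x then (if y ≤ p.2 then 1 else 0) - (if y' ≤ p.2 then 1 else 0) else 0 := by
  by_cases h1 : y ≤ p.2 ∧ p.2 < y'
  · have : 0 < (y' - y) := by omega
    simp only [rayCrossing, h1, true_and, sub_self, zero_mul, zero_sub, if_true]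
    have e : 0 < -((y' - y) * (p.1 - x)) ↔ p.1 < x := by
      rw [neg_pos, mul_neg_iff]; omega
    simp only [e]
    split_ifs <;> omega
  by_cases h2 : y' ≤ p.2 ∧ p.2 < y
  · have : 0 < (y - y') := by omega
    rw [rayCrossing_symm]
    simp only [rayCrossing, h2, true_and, sub_self, zero_mul, zero_sub, if_true]
    have e : 0 < -((y - y') * (p.1 - x)) ↔ p.1 < x := by
      rw [neg_pos, mul_neg_iff]; omega
    simp only [e]
    split_ifs <;> omega
  rw [rayCrossing_eq_zero h1 h2]
  split_ifs <;> omega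

theorem pathCrossing_cons (p u v : ℤ × ℤ) (l : List (ℤ × ℤ)) :
    pathCrossing p (u :: v :: l) = rayCrossing p u v + pathCrossing p (v :: l) := by
  simp [pathCrossing]

theorem pathCrossing_singleton (p u : ℤ × ℤ) : pathCrossing p [u] = 0 := by simp [pathCrossing]

theorem pathCrossing_append (p u : ℤ × ℤ) (l l' : List (ℤ × ℤ)) :
    pathCrossing p (l ++ u :: l') = pathCrossing p (l ++ [u]) + pathCrossing p (u :: l') := by
  induction l with
  | nil => simp [pathCrossing_singleton]
  | cons v l ih =>
    cases l with
    | nil => simp [pathCrossing_cons, pathCrossing_singleton]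
    | cons w l =>
      simp only [List.cons_append, pathCrossing_cons] at ih ⊢
      rw [ih]; ring

theorem pathCrossing_reverse (p : ℤ × ℤ) (l : List (ℤ × ℤ)) :
    pathCrossing p l.reverse = -pathCrossing p l := by
  induction l with
  | nil => simp [pathCrossing]
  | cons v l ih =>
    cases l with
    | nil => simp [pathCrossing_singleton]
    | cons w l =>
      rw [List.reverse_cons, List.reverse_cons, List.append_assoc, List.singleton_append,
        pathCrossing_append, ← List.reverse_cons, ih, pathCrossing_cons, pathCrossing_cons,
        pathCrossing_singleton, rayCrossing_symm]
      ring

theorem pathCrossing_reverse_append (p u : ℤ × ℤ) (l l' : List (ℤ × ℤ)) :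
    pathCrossing p ((u :: l).reverse ++ u :: l') =
      pathCrossing p (u :: l') - pathCrossing p (u :: l) := by
  rw [List.reverse_cons, List.append_assoc, List.singleton_append, pathCrossing_append,
    pathCrossing_cons, ← List.reverse_cons, pathCrossing_reverse,
    rayCrossing_eq_zero (by omega) (by omega)]
  ring

theorem exists_pathTo_eq (s : D.FigureEights) (c r : Fin n) (a : Side) : ∃ l, s.pathTo c r a =
    (4 * ((c : ℕ) : ℤ) - 1, 4 * ((D.lo c : ℕ) : ℤ) - 1) :: l := by
  unfold FigureEights.pathTo FigureEights.polygon
  cases a <;> dsimp only <;> split_ifs <;> exact ⟨_, rfl⟩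

/-- Horizontal segments do not cross a horizontal ray, and the common starting point of the two
paths on a figure-eight lets them be counted separately. -/
theorem winding_eq (s : D.FigureEights) (p : ℤ × ℤ) (g h : D.Gen) : winding s p g h =
    ∑ c, (pathCrossing p (s.pathTo c (g.row c) (g.side c)) -
      pathCrossing p (s.pathTo c (h.row c) (h.side c))) := by
  have e : ∀ (r : Fin n) (c c' : Fin n) (a a' : Side),
      pathCrossing p [sidePoint c r a, sidePoint c' r a'] = 0 := by
    intro r c c' a a'
    have h : (sidePoint c r a).2 = (sidePoint c' r a').2 := by cases a <;> cases a' <;> rfl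
    rw [pathCrossing_cons, pathCrossing_singleton, rayCrossing_eq_zero (by omega) (by omega)]
    rfl
  rw [winding, Finset.sum_eq_zero fun r _ => e r _ _ _ _, zero_add]
  refine Finset.sum_congr rfl fun c _ => ?_
  obtain ⟨l, hl⟩ := exists_pathTo_eq s c (g.row c) (g.side c)
  obtain ⟨l', hl'⟩ := exists_pathTo_eq s c (h.row c) (h.side c)
  rw [hl, hl', pathCrossing_reverse_append]

/-- Only the vertical sides cross the ray. The right side of the figure-eight lies beyond the
punctures of the columns up to `c`, the left side only beyond those of the columns before `c`. -/
theorem pathCrossing_pathTo (s : D.FigureEights) (g : D.Gen) (c c₀ r₀ : Fin n) :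
    pathCrossing (puncture c₀ r₀) (s.pathTo c (g.row c) (g.side c)) = 
    match g.side c with
    | .right => if g.row c ≤ s.knot c then
        (if c₀ ≤ c ∧ D.lo c ≤ r₀ ∧ r₀ < g.row c then 1 else 0)
      else (if c₀ ≤ c ∧ D.lo c ≤ r₀ ∧ r₀ ≤ s.knot c then 1 else 0) +
        (if c₀ < c ∧ s.knot c < r₀ ∧ r₀ ≤ D.hi c then 1 else 0) -
        (if c₀ ≤ c ∧ g.row c ≤ r₀ ∧ r₀ ≤ D.hi c then 1 else 0)
    | .left => if s.knot c < g.row c then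
        (if c₀ ≤ c ∧ D.lo c ≤ r₀ ∧ r₀ ≤ s.knot c then 1 else 0) +
        (if c₀ < c ∧ s.knot c < r₀ ∧ r₀ < g.row c then 1 else 0)
      else (if c₀ ≤ c ∧ D.lo c ≤ r₀ ∧ r₀ ≤ s.knot c then 1 else 0) -
        (if c₀ = c ∧ s.knot c < r₀ ∧ r₀ ≤ D.hi c then 1 else 0) -
        (if c₀ < c ∧ g.row c ≤ r₀ ∧ r₀ ≤ s.knot c then 1 else 0) := by
  have p := (g.isPoint c).1
  have l1 := s.lo_le c
  have l2 := s.lt_hi c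
  have e1 : ∀ x x' y : ℤ, rayCrossing (puncture c₀ r₀) (x, y) (x', y) = 0 := fun x x' y =>
    rayCrossing_eq_zero (by dsimp only; omega) (by dsimp only; omega)
  -- The strands of the self-intersection stay strictly between the heights of two consecutive rows,
  -- so no ray from a puncture meets them.
  have e2 : ∀ (x x' : ℤ) (k : Fin n), rayCrossing (puncture c₀ r₀) (x, 4 * (k : ℕ) + 2 - 1)
      (x', 4 * (k : ℕ) + 2 + 1) = 0 := fun x x' y =>
    rayCrossing_eq_zero (by simp only [puncture]; omega) (by simp only [puncture]; omega)
  have e3 : ∀ (x x' : ℤ) (k : Fin n), rayCrossing (puncture c₀ r₀) (x, 4 * (k : ℕ) + 2 + 1)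
      (x', 4 * (k : ℕ) + 2 - 1) = 0 := fun x x' y => by rw [rayCrossing_symm, e2]; rfl
  generalize g.row c = r at *
  generalize g.side c = a at *
  simp only [Fin.lt_def, Fin.le_def] at p l1 l2
  cases a
  · dsimp only
    by_cases h : s.knot c < r
    · have : s.pathTo c r .left = (s.polygon c).take 4 ++ [sidePoint c r .left] := by
        simp [FigureEights.pathTo, h]
      rw [this, if_pos h]
      simp only [FigureEights.polygon, List.take, List.cons_append, List.nil_append,
        pathCrossing_cons, pathCrossing_singleton, sidePoint, e1, e2, rayCrossing_vertical]
      simp only [puncture, Fin.lt_def, Fin.le_def] at h ⊢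
      split_ifs <;> omega
    · have : s.pathTo c r .left = (s.polygon c).take 8 ++ [sidePoint c r .left] := by
        simp [FigureEights.pathTo, h]
      rw [this, if_neg h]
      simp only [FigureEights.polygon, List.take, List.cons_append, List.nil_append,
        pathCrossing_cons, pathCrossing_singleton, sidePoint, e1, e2, e3, rayCrossing_vertical]
      simp only [puncture, Fin.lt_def, Fin.le_def, Fin.ext_iff] at h ⊢
      split_ifs <;> omega
  · dsimp only
    by_cases h : r ≤ s.knot c
    · have : s.pathTo c r .right = (s.polygon c).take 2 ++ [sidePoint c r .right] := by
        simp [FigureEights.pathTo, h]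
      rw [this, if_pos h]
      simp only [FigureEights.polygon, List.take, List.cons_append, List.nil_append,
        pathCrossing_cons, pathCrossing_singleton, sidePoint, e1, rayCrossing_vertical]
      simp only [puncture, Fin.lt_def, Fin.le_def] at h ⊢
      split_ifs <;> omega
    · have : s.pathTo c r .right = (s.polygon c).take 6 ++ [sidePoint c r .right] := by
        simp [FigureEights.pathTo, h]
      rw [this, if_neg h]
      simp only [FigureEights.polygon, List.take, List.cons_append, List.nil_append,
        pathCrossing_cons, pathCrossing_singleton, sidePoint, e1, e2, rayCrossing_vertical]
      simp only [puncture, Fin.lt_def, Fin.le_def] at h ⊢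
      split_ifs <;> omega

/-- Punctures of earlier columns are counted below the point, whichever way the path takes around
the figure-eight. The two punctures of the column itself give the correction for an upward point,
minus one at the lower end on the right side. -/
theorem pathCrossing_column (s : D.FigureEights) (g : D.Gen) (c c₀ : Fin n) :
    pathCrossing (puncture c₀ (D.lo c₀)) (s.pathTo c (g.row c) (g.side c)) +
      pathCrossing (puncture c₀ (D.hi c₀)) (s.pathTo c (g.row c) (g.side c)) =
    (if D.lo c ≤ D.lo c₀ ∧ D.lo c₀ < g.row c then (if c₀ < c then 1 else 0) else 0) +
    (if D.lo c ≤ D.hi c₀ ∧ D.hi c₀ < g.row c then (if c₀ < c then 1 else 0) else 0) +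
    if c₀ = c then (if s.IsUp c (g.row c) (g.side c) then 1 else 0) -
      (if g.side c = .right ∧ g.row c = D.lo c then 1 else 0) else 0 := by
  have p := (g.isPoint c).1
  have l1 := s.lo_le c
  have l2 := s.lt_hi c
  rw [pathCrossing_pathTo, pathCrossing_pathTo]
  generalize g.row c = r at *
  generalize g.side c = a at *
  by_cases hc : c₀ = c
  · subst hc
    cases a <;> simp only [FigureEights.IsUp, Fin.lt_def, Fin.le_def, Fin.ext_iff, reduceCtorEq,
      false_and, true_and, and_true, if_false, lt_self_iff_false, le_refl, if_true] at * <;>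
      split_ifs <;> omega
  · rw [if_neg hc, add_zero]
    rcases lt_or_gt_of_ne hc with h | h
    · have h1 := D.lo_lt_hi c₀
      simp only [h, h.le, hc, true_and, false_and, if_true, if_false]
      cases a <;> simp only [Fin.lt_def, Fin.le_def] at * <;> clear h hc
      · by_cases hk : (s.knot c : ℕ) < r <;> simp only [hk, if_true, if_false] <;>
          (congr 1 <;> split_ifs <;> omega)
      · by_cases hk : (r : ℕ) ≤ s.knot c <;> simp only [hk, if_true, if_false] <;>
          (congr 1 <;> split_ifs <;> omega)
    · cases a <;> simp [h.not_ge, h.not_gt, hc]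

theorem Q_eq (s : D.FigureEights) (g : D.Gen) : Q s g = windingSum s g - windingSum s D.xGen := by
  have e : ∀ g : D.Gen, ∑ c₀, ∑ c, (pathCrossing (puncture c₀ (D.O c₀))
        (s.pathTo c (g.row c) (g.side c)) + pathCrossing (puncture c₀ (D.X c₀))
        (s.pathTo c (g.row c) (g.side c))) = windingSum s g := by
    intro g
    have e1 : ∀ c₀ c, pathCrossing (puncture c₀ (D.O c₀)) (s.pathTo c (g.row c) (g.side c)) +
        pathCrossing (puncture c₀ (D.X c₀)) (s.pathTo c (g.row c) (g.side c)) =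
        pathCrossing (puncture c₀ (D.lo c₀)) (s.pathTo c (g.row c) (g.side c)) +
        pathCrossing (puncture c₀ (D.hi c₀)) (s.pathTo c (g.row c) (g.side c)) := by
      intro c₀ c
      rcases le_total (D.O c₀) (D.X c₀) with h | h <;> simp [lo, hi, h, add_comm]
    rw [Finset.sum_comm, windingSum]
    refine Finset.sum_congr rfl fun c _ => ?_
    simp only [e1, pathCrossing_column]
    rw [Finset.sum_add_distrib, D.sum_punctures fun x y => if D.lo c ≤ y ∧ y < g.row c then
      (if x < c then 1 else 0) else 0]
    rw [Finset.sum_ite_eq' Finset.univ c, if_pos (Finset.mem_univ _), ← add_sub_assoc, leftArea]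
    congr 2
    refine Finset.sum_congr rfl fun y _ => ?_
    unfold leftCount
    split_ifs <;> rfl
  rw [← e, ← e, Q, Qrel, ← Finset.sum_sub_distrib]
  refine Finset.sum_congr rfl fun c₀ _ => ?_
  rw [winding_eq, winding_eq, ← Finset.sum_add_distrib, ← Finset.sum_sub_distrib]
  refine Finset.sum_congr rfl fun c _ => ?_
  ring

/-- The invariant combination of `sum_balance` is evaluated at the generator of the `X`'s, whose
height is the number of negative crossings. -/
theorem J_eq (s : D.FigureEights) (g : D.Gen) : J s g = (genState s g).rot +
    (genRes s g).height + D.nPos - 2 * D.nNeg := by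
  have h1 := sum_balance s g
  rw [← sum_balance s D.xGen, genRes_xGen] at h1
  have h2 : D.seifert.height = D.nNeg := by
    unfold Resolution.height nNeg seifert
    congr! 3
    simp
  have h3 := rot_add_Pbar s g D.xGen
  rw [J, rot_eq s, Q_eq, writhe]
  linarith

theorem deg_genState (s : D.FigureEights) (g : D.Gen) :
    (genState s g).deg = (P s g + J s g, J s g) := by
  rw [J_eq, P_eq, ← genState_res]
  ext
  · simp only [State.deg, writhe]
    ring
  · simp only [State.deg, State.rot]

end GridDiagram

end

section
namespace GridDiagram

variable {n : ℕ} {D : GridDiagram n}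

open Classical

/-! ### The differential on Bigelow's generators -/

instance genFintype : Fintype D.Gen :=
  Fintype.ofInjective (fun g : D.Gen => (g.row, fun c => decide (g.side c = .left))) (by
    rintro ⟨r, a, h⟩ ⟨r', a', h'⟩ e
    obtain ⟨rfl, e2⟩ := Prod.mk.inj e
    congr
    funext c
    have := congrFun e2 c
    revert this
    generalize ha : a c = u
    generalize hb : a' c = v
    simp only [ha, hb]
    cases u <;> cases v <;> simp)

variable {R : Type} [CommRing R] {τ : Bool}

/-- The reduced differential, on the module generated by Bigelow's generators. -/
def genDifferential (s : D.FigureEights) (E : EdgeAssignment D τ)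
    (W : (D.Crossing → Prop) → D.Crossing → R) : (D.Gen →₀ R) →ₗ[R] (D.Gen →₀ R) :=
  Matrix.toLin Finsupp.basisSingleOne Finsupp.basisSingleOne
    (fun g h => reduced E R W (genState s g) (genState s h))

theorem genDifferential_apply (s : D.FigureEights) (E : EdgeAssignment D τ)
    (W : (D.Crossing → Prop) → D.Crossing → R) (g h : D.Gen) :
    genDifferential s E W (Finsupp.single g 1) h =
      reduced E R W (genState s h) (genState s g) := by
  have := Matrix.toLin_self Finsupp.basisSingleOne Finsupp.basisSingleOne
    (fun g h : D.Gen => reduced E R W (genState s g) (genState s h)) g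
  rw [Finsupp.coe_basisSingleOne] at this
  rw [genDifferential, this, Finsupp.finsetSum_apply]
  simp [Finsupp.single_apply]

theorem homogeneous_reduced (E : EdgeAssignment D τ) (W : (D.Crossing → Prop) → D.Crossing → R) :
    Homogeneous State.deg (1, 0) (reduced E R W) := by
  have h : Homogeneous State.deg 0 (criticalPart (D := D) R) := .diagonal _
  have := ((h.mul (homogeneous_diffMatrixOver E)).mul (homogeneous_resolvent E W)).mul h
  rw [reduced]
  simpa using this

theorem genPart_eq (s : D.FigureEights) (k j : ℤ) : genPart s R k j =
    Submodule.span R (Finsupp.basisSingleOne '' {g : D.Gen | (genState s g).deg = (k + j, j)}) := by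
  have : {g : D.Gen | P s g = k ∧ J s g = j} = {g | (genState s g).deg = (k + j, j)} := by
    ext g
    simp only [Set.mem_ofPred_eq, deg_genState, Prod.mk.injEq]
    omega
  rw [genPart, this, Finsupp.supported_eq_span_single]
  rw [Finsupp.coe_basisSingleOne]

/-- Bigelow's generators are exactly the critical states, with matching gradings, so the reduced
complex is a complex on them. -/
theorem computesOddKh (s : D.FigureEights) (E : EdgeAssignment D τ)
    {W : (D.Crossing → Prop) → D.Crossing → R} (hW : IsWeight W) :
    ComputesOddKh R s E (genDifferential s E W) := by
  have hp : criticalPart R =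
      inclMatrix R (genState s) * (inclMatrix R (genState s)).transpose := by
    rw [inclMatrix_mul_transpose (genState_injective s), criticalPart]
    congr 1
    funext t
    refine if_congr ⟨fun h => exists_genState_eq s h, ?_⟩ rfl rfl
    rintro ⟨g, rfl⟩
    exact isCritical_genState s g
  obtain ⟨h1, h2⟩ := (perturbation E W hW).homology (genState_injective s) hp (stateBasis D R)
    Finsupp.basisSingleOne (oddDifferential_eq E R) (deg := State.deg) (homogeneous_resolvent E W)
    (homogeneous_contraction E W) (homogeneous_rest E) (genDifferential s E W) rfl
  refine ⟨h1, fun g h hne => ?_, fun k j => ?_⟩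
  · rw [genDifferential_apply] at hne
    have := homogeneous_reduced E W _ _ hne
    rw [deg_genState, deg_genState] at this
    simp only [Prod.mk_add_mk, Prod.mk.injEq] at this
    omega
  · have := h2 (k + j) j
    rw [← oddPart_eq_span, ← oddPart_eq_span, ← genPart_eq, 
      show k + j - 1 = k - 1 + j by ring, ← genPart_eq] at this
    rwa [show k - 1 + j = k + j - 1 by ring] at this

end GridDiagram

end

section
namespace GridDiagram

variable {n : ℕ} {D : GridDiagram n}

open Classical

/-! ### Special points and arcs -/

/-- The opposite direction. -/
def _root_.Dir.opp : Dir → Dir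
  | .north => .south
  | .east => .west
  | .south => .north
  | .west => .east

variable (D) in
/-- The punctures and the crossings. -/
def IsSpecial (c r : Fin n) : Prop :=
  (D.lo c ≤ r ∧ r ≤ D.hi c) ∧ (D.lft r ≤ c ∧ c ≤ D.rgt r)

variable (D) in
/-- The punctures and the crossings, as a type. -/
abbrev SpecialPoint : Type := {p : Fin n × Fin n // D.IsSpecial p.1 p.2}

/-- `q` lies on the same segment as `p`, in a given direction from `p`. -/
def Ahead (d : Dir) (p q : D.SpecialPoint) : Prop :=
  match d with
  | .north => p.1.1 = q.1.1 ∧ p.1.2 < q.1.2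
  | .south => p.1.1 = q.1.1 ∧ q.1.2 < p.1.2
  | .east => p.1.2 = q.1.2 ∧ p.1.1 < q.1.1
  | .west => p.1.2 = q.1.2 ∧ q.1.1 < p.1.1

theorem Ahead.opp {d : Dir} {p q : D.SpecialPoint} (h : Ahead d p q) : Ahead d.opp q p := by
  cases d <;> exact ⟨h.1.symm, h.2⟩

theorem Ahead.trichotomy {d : Dir} {p q q' : D.SpecialPoint} (h : Ahead d p q)
    (h' : Ahead d p q') : q = q' ∨ Ahead d q q' ∨ Ahead d q' q := by
  obtain ⟨⟨c, r⟩, hp⟩ := p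
  obtain ⟨⟨c1, r1⟩, hq⟩ := q
  obtain ⟨⟨c2, r2⟩, hq'⟩ := q'
  simp only [Ahead, Subtype.mk.injEq, Prod.mk.injEq] at *
  cases d <;> simp only [Fin.lt_def, Fin.ext_iff] at * <;> omega

/-- The next special point in a given direction. -/
def Next (d : Dir) (p q : D.SpecialPoint) : Prop :=
  Ahead d p q ∧ ∀ q', Ahead d p q' → ¬ Ahead d q' q

/-- The edges that leave a special point. -/
def Edge.Leaves (e : D.Edge) (d : Dir) (p : D.SpecialPoint) : Prop := e.LeavesAt d p.1.1 p.1.2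

theorem isSpecial_hi (D : GridDiagram n) (c : Fin n) : D.IsSpecial c (D.hi c) := by
  obtain ⟨k1, k2, k3⟩ := D.fin_corner_iff c (D.hi c)
  simp only [IsSpecial, Fin.le_def]
  omega

theorem isSpecial_lo (D : GridDiagram n) (c : Fin n) : D.IsSpecial c (D.lo c) := by
  obtain ⟨k1, k2, k3⟩ := D.fin_corner_iff c (D.lo c)
  simp only [IsSpecial, Fin.le_def]
  omega

theorem isSpecial_lft (D : GridDiagram n) (r : Fin n) : D.IsSpecial (D.lft r) r := by
  obtain ⟨k1, k2, k3⟩ := D.fin_corner_iff (D.lft r) r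
  simp only [IsSpecial, Fin.le_def]
  omega

theorem isSpecial_rgt (D : GridDiagram n) (r : Fin n) : D.IsSpecial (D.rgt r) r := by
  obtain ⟨k1, k2, k3⟩ := D.fin_corner_iff (D.rgt r) r
  simp only [IsSpecial, Fin.le_def]
  omega

/-- Unit edges depend on the grid. For the comparison of diagrams, ends and crossings are expressed
by the relation `Ahead` between special points, which a bijection can respect. -/
theorem hasEnd_iff (p : D.SpecialPoint) (d : Dir) :
    D.HasEnd p.1.1 p.1.2 d ↔ ∃ q, Ahead d p q := by
  obtain ⟨⟨c, r⟩, ⟨h1, h2⟩, h3, h4⟩ := p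
  dsimp only at h1 h2 h3 h4
  constructor
  · intro h
    cases d
    · exact ⟨⟨(c, D.hi c), D.isSpecial_hi c⟩, rfl, h.2⟩
    · exact ⟨⟨(D.rgt r, r), D.isSpecial_rgt r⟩, rfl, h.2⟩
    · exact ⟨⟨(c, D.lo c), D.isSpecial_lo c⟩, rfl, h.1⟩
    · exact ⟨⟨(D.lft r, r), D.isSpecial_lft r⟩, rfl, h.1⟩
  · rintro ⟨⟨⟨c', r'⟩, ⟨g1, g2⟩, g3, g4⟩, hq⟩
    cases d <;> obtain ⟨rfl, hq⟩ := hq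
    · exact ⟨h1, hq.trans_le g2⟩
    · exact ⟨h3, hq.trans_le g4⟩
    · exact ⟨g1.trans_lt hq, h2⟩
    · exact ⟨g3.trans_lt hq, h4⟩

theorem isCrossing_iff (p : D.SpecialPoint) :
    D.IsCrossing p.1.1 p.1.2 ↔ ∀ d, ∃ q, Ahead d p q := by
  simp only [← hasEnd_iff]
  constructor
  · intro h d
    exact Crossing.hasEnd ⟨p.1, h⟩ d
  · intro h
    exact ⟨⟨(h .south).1, (h .north).2⟩, (h .west).1, (h .east).2⟩

theorem IsCrossing.isSpecial {c r : Fin n} (h : D.IsCrossing c r) : D.IsSpecial c r :=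
  ⟨⟨h.1.1.le, h.1.2.le⟩, h.2.1.le, h.2.2.le⟩

/-- The direction of an edge. -/
def Edge.dir (e : D.Edge) : Dir := if e.1.1 then .north else .east

theorem Edge.LeavesAt.dir_eq {e : D.Edge} {d : Dir} {c r : Fin n} (h : e.LeavesAt d c r) :
    (d = e.dir ∧ d.sgn = 1) ∨ (d = e.dir.opp ∧ d.sgn = -1) := by
  cases d <;> simp [Edge.dir, h.1, Dir.opp, Dir.sgn]

/-- `e` lies on the arc that starts at `p` and leads north or east. -/
def Starts (p : D.SpecialPoint) (e : D.Edge) : Prop :=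
  (e.1.1 = true ∧ e.1.2.1 = p.1.1 ∧ p.1.2 ≤ e.1.2.2 ∧ ∀ q, Ahead .north p q → e.1.2.2 < q.1.2) ∨
  (e.1.1 = false ∧ e.1.2.2 = p.1.2 ∧ p.1.1 ≤ e.1.2.1 ∧ ∀ q, Ahead .east p q → e.1.2.1 < q.1.1)

theorem exists_starts (e : D.Edge) : ∃ p, Starts p e := by
  obtain ⟨⟨b, c, r⟩, he⟩ := e
  cases b
  · simp only [Bool.false_eq_true, false_and, false_or, true_and] at he
    obtain ⟨p, hp, hm⟩ := Finset.exists_max_image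
      (Finset.univ.filter fun p : D.SpecialPoint => p.1.2 = r ∧ p.1.1 ≤ c) (fun p => p.1.1)
      ⟨⟨(D.lft r, r), D.isSpecial_lft r⟩, by simp [he.1]⟩
    simp only [Finset.mem_filter, Finset.mem_univ, true_and] at hp hm
    refine ⟨p, Or.inr ⟨rfl, hp.1.symm, hp.2, fun q hq => ?_⟩⟩
    by_contra h
    exact (hm q ⟨hq.1.symm.trans hp.1, not_lt.1 h⟩).not_gt hq.2
  · simp only [Bool.true_eq_false, false_and, or_false, true_and] at he
    obtain ⟨p, hp, hm⟩ := Finset.exists_max_image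
      (Finset.univ.filter fun p : D.SpecialPoint => p.1.1 = c ∧ p.1.2 ≤ r) (fun p => p.1.2)
      ⟨⟨(c, D.lo c), D.isSpecial_lo c⟩, by simp [he.1]⟩
    simp only [Finset.mem_filter, Finset.mem_univ, true_and] at hp hm
    refine ⟨p, Or.inl ⟨rfl, hp.1.symm, hp.2, fun q hq => ?_⟩⟩
    by_contra h
    exact (hm q ⟨hq.1.symm.trans hp.1, not_lt.1 h⟩).not_gt hq.2

theorem Starts.unique {p q : D.SpecialPoint} {e : D.Edge} (h : Starts p e) (h' : Starts q e) :
    p = q := by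
  rcases h with ⟨a1, a2, a3, a4⟩ | ⟨a1, a2, a3, a4⟩ <;>
    rcases h' with ⟨b1, b2, b3, b4⟩ | ⟨b1, b2, b3, b4⟩
  · rcases lt_trichotomy p.1.2 q.1.2 with h | h | h
    · exact absurd (a4 q ⟨a2.symm.trans b2, h⟩) b3.not_gt
    · exact Subtype.ext (Prod.ext (a2.symm.trans b2) h)
    · exact absurd (b4 p ⟨b2.symm.trans a2, h⟩) a3.not_gt
  · simp [a1] at b1
  · simp [a1] at b1
  · rcases lt_trichotomy p.1.1 q.1.1 with h | h | h
    · exact absurd (a4 q ⟨a2.symm.trans b2, h⟩) b3.not_gt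
    · exact Subtype.ext (Prod.ext h (a2.symm.trans b2))
    · exact absurd (b4 p ⟨b2.symm.trans a2, h⟩) a3.not_gt

theorem Edge.Leaves.starts {e : D.Edge} {p : D.SpecialPoint} (h : e.Leaves e.dir p) :
    Starts p e := by
  by_cases hb : e.1.1 = true
  · have : e.dir = .north := if_pos hb
    rw [this] at h
    exact Or.inl ⟨hb, h.2.1, h.2.2.ge, fun q hq => h.2.2.trans_lt hq.2⟩
  · have : e.dir = .east := if_neg hb
    rw [this] at h
    exact Or.inr ⟨by simpa using hb, h.2.2, h.2.1.ge, fun q hq => h.2.1.trans_lt hq.2⟩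

theorem Starts.next {e : D.Edge} {p q : D.SpecialPoint} (h : Starts q e)
    (h' : e.Leaves e.dir.opp p) : Next e.dir q p := by
  rcases h with ⟨a1, a2, a3, a4⟩ | ⟨a1, a2, a3, a4⟩
  · have : e.dir = .north := if_pos a1
    rw [this] at h' ⊢
    obtain ⟨-, h1, h2⟩ := h'
    simp only [Fin.le_def, Fin.lt_def] at *
    refine ⟨⟨a2.symm.trans h1, ?_⟩, fun q' hq' hh => ?_⟩
    · simp only [Fin.lt_def]; omega
    · have := a4 q' hq'
      have := hh.2
      simp only [Fin.lt_def] at *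
      omega
  · have : e.dir = .east := if_neg (by simp [a1])
    rw [this] at h' ⊢
    obtain ⟨-, h1, h2⟩ := h'
    simp only [Fin.le_def, Fin.lt_def] at *
    refine ⟨⟨a2.symm.trans h2, ?_⟩, fun q' hq' hh => ?_⟩
    · simp only [Fin.lt_def]; omega
    · have := a4 q' hq'
      have := hh.2
      simp only [Fin.lt_def] at *
      omega

theorem Next.starts {e : D.Edge} {p q : D.SpecialPoint} (h : Next e.dir q p)
    (h' : e.Leaves e.dir.opp p) : Starts q e := by
  obtain ⟨q', hq'⟩ := exists_starts e
  have h2 := hq'.next h'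
  rcases Ahead.trichotomy h.1.opp h2.1.opp with rfl | h3 | h3
  · exact hq'
  · have := h3.opp
    have e1 : ∀ d : Dir, d.opp.opp = d := by intro d; cases d <;> rfl
    rw [e1] at this
    exact absurd h.1 (h2.2 q this)
  · have := h3.opp
    have e1 : ∀ d : Dir, d.opp.opp = d := by intro d; cases d <;> rfl
    rw [e1] at this
    exact absurd h2.1 (h.2 q' this)

/-- A function on the edges that does not change where two edges meet in the interior of a single
segment. -/
def ConstOnArcs {α : Type*} (f : D.Edge → α) : Prop :=
  ∀ e e' c r d d', ¬ D.IsSpecial c r → e.LeavesAt d c r → e'.LeavesAt d' c r → d ≠ d' → f e = f e'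

theorem Starts.of_straight {p : D.SpecialPoint} {e e' : D.Edge} {c r : Fin n}
    (hs : ¬ D.IsSpecial c r) (h : e.LeavesAt e.dir c r) (h' : e'.LeavesAt e.dir.opp c r)
    (he' : Starts p e') : Starts p e := by
  by_cases hb : e.1.1 = true
  · have : e.dir = .north := if_pos hb
    rw [this] at h h'
    obtain ⟨-, h1, h2⟩ := h
    obtain ⟨b1, b2, b3⟩ := h'
    rcases he' with ⟨a1, a2, a3, a4⟩ | ⟨a1, a2, a3, a4⟩
    · refine Or.inl ⟨hb, h1.trans (b2.symm.trans a2), ?_, fun q hq => ?_⟩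
      · simp only [Fin.le_def, h2] at *; omega
      · have := a4 q hq
        have hne : (q.1.2 : ℕ) ≠ r := by
          intro h
          apply hs
          have := q.2
          rwa [Fin.ext h, ← hq.1, ← a2, b2] at this
        simp only [Fin.lt_def, h2] at *
        omega
    · simp [a1] at b1
  · have : e.dir = .east := if_neg hb
    rw [this] at h h'
    obtain ⟨-, h1, h2⟩ := h
    obtain ⟨b1, b2, b3⟩ := h'
    rcases he' with ⟨a1, a2, a3, a4⟩ | ⟨a1, a2, a3, a4⟩
    · simp [a1] at b1
    · refine Or.inr ⟨by simpa using hb, h2.trans (b3.symm.trans a2), ?_, fun q hq => ?_⟩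
      · simp only [Fin.le_def, h1] at *; omega
      · have := a4 q hq
        have hne : (q.1.1 : ℕ) ≠ c := by
          intro h
          apply hs
          have := q.2
          rwa [Fin.ext h, ← hq.1, ← a2, b3] at this
        simp only [Fin.lt_def, h1] at *
        omega

theorem straight {c r : Fin n} {d d' : Dir} (hs : ¬ D.IsSpecial c r) (h : D.HasEnd c r d)
    (h' : D.HasEnd c r d') (hd : d ≠ d') : d' = d.opp := by
  obtain ⟨k1, k2, k3⟩ := D.fin_corner_iff c r
  simp only [IsSpecial, Fin.le_def] at hs
  cases d <;> cases d' <;> simp only [HasEnd, Fin.lt_def, Fin.le_def, Dir.opp, ne_eq,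
    not_true_eq_false, reduceCtorEq] at * <;> omega

/-- Edge by edge back to the beginning of the arc, along which only interior points of a single
segment are passed. -/
theorem ConstOnArcs.eq_of_starts {α : Type*} {f : D.Edge → α} (hf : ConstOnArcs f)
    {p : D.SpecialPoint} {e e₀ : D.Edge} (h : Starts p e) (h₀ : e₀.Leaves e.dir p) : f e = f e₀ := by
  by_cases hb : e.1.1 = true
  · have hd : e.dir = .north := if_pos hb
    rw [hd] at h₀
    obtain ⟨k, hk⟩ : ∃ k : ℕ, k = (e.1.2.2 : ℕ) - (p.1.2 : ℕ) := ⟨_, rfl⟩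
    induction k generalizing e with
    | zero =>
      rcases h with ⟨a1, a2, a3, a4⟩ | ⟨a1, a2, a3, a4⟩
      · have : e.LeavesAt .north p.1.1 p.1.2 := by
          refine ⟨hb, a2, ?_⟩
          simp only [Fin.le_def, Fin.ext_iff] at *; omega
        rw [this.unique h₀]
      · simp [hb] at a1
    | succ k ih =>
      rcases h with ⟨a1, a2, a3, a4⟩ | ⟨a1, a2, a3, a4⟩
      · have hl : e.LeavesAt .north e.1.2.1 e.1.2.2 := ⟨hb, rfl, rfl⟩
        have hns : ¬ D.IsSpecial e.1.2.1 e.1.2.2 := by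
          intro hs
          have := a4 ⟨_, hs⟩ ⟨a2.symm, by simp only [Fin.le_def, Fin.lt_def] at *; omega⟩
          exact lt_irrefl _ this
        have hs : D.HasEnd e.1.2.1 e.1.2.2 .south := by
          have h1 := hl.hasEnd
          have h2 := p.2.1.1
          rw [← a2] at h2
          simp only [HasEnd, Fin.le_def, Fin.lt_def] at *
          omega
        obtain ⟨e', he'⟩ := D.exists_leavesAt hs
        obtain ⟨b1, b2, b3⟩ := id he'
        have he1 : Starts p e' := by
          refine Or.inl ⟨b1, b2.trans a2, ?_, fun q hq => ?_⟩
          · simp only [Fin.le_def] at *; omega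
          · have := a4 q hq
            simp only [Fin.lt_def] at *
            omega
        rw [hf e e' _ _ _ _ hns hl he' (by simp)]
        exact ih he1 b1 (if_pos b1) (by omega)
      · simp [hb] at a1
  · have hd : e.dir = .east := if_neg hb
    rw [hd] at h₀
    obtain ⟨k, hk⟩ : ∃ k : ℕ, k = (e.1.2.1 : ℕ) - (p.1.1 : ℕ) := ⟨_, rfl⟩
    induction k generalizing e with
    | zero =>
      rcases h with ⟨a1, a2, a3, a4⟩ | ⟨a1, a2, a3, a4⟩
      · simp [a1] at hb
      · have : e.LeavesAt .east p.1.1 p.1.2 := by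
          refine ⟨a1, ?_, a2⟩
          simp only [Fin.le_def, Fin.ext_iff] at *; omega
        rw [this.unique h₀]
    | succ k ih =>
      rcases h with ⟨a1, a2, a3, a4⟩ | ⟨a1, a2, a3, a4⟩
      · simp [a1] at hb
      · have hl : e.LeavesAt .east e.1.2.1 e.1.2.2 := ⟨a1, rfl, rfl⟩
        have hns : ¬ D.IsSpecial e.1.2.1 e.1.2.2 := by
          intro hs
          have := a4 ⟨_, hs⟩ ⟨a2.symm, by simp only [Fin.le_def, Fin.lt_def] at *; omega⟩
          exact lt_irrefl _ this
        have hs : D.HasEnd e.1.2.1 e.1.2.2 .west := by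
          have h1 := hl.hasEnd
          have h2 := p.2.2.1
          rw [← a2] at h2
          simp only [HasEnd, Fin.le_def, Fin.lt_def] at *
          omega
        obtain ⟨e', he'⟩ := D.exists_leavesAt hs
        obtain ⟨b1, b2, b3⟩ := id he'
        have he1 : Starts p e' := by
          refine Or.inr ⟨b1, b3.trans a2, ?_, fun q hq => ?_⟩
          · simp only [Fin.le_def] at *; omega
          · have := a4 q hq
            simp only [Fin.lt_def] at *
            omega
        rw [hf e e' _ _ _ _ hns hl he' (by simp)]
        exact ih he1 (by simp [b1]) (if_neg (by simp [b1])) (by omega)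

theorem ConstOnArcs.eq_of_next {α : Type*} {f : D.Edge → α} (hf : ConstOnArcs f) {d : Dir}
    {p q : D.SpecialPoint} (h : Next d p q) {e e' : D.Edge} (he : e.Leaves d p)
    (he' : e'.Leaves d.opp q) : f e = f e' := by
  have oo : ∀ d : Dir, d.opp.opp = d := by intro d; cases d <;> rfl
  have swap : Next d.opp q p := ⟨h.1.opp, fun q' h1 h2 => h.2 q' (by
    have := h2.opp; rwa [oo] at this) (by have := h1.opp; rwa [oo] at this)⟩
  rcases he'.dir_eq with ⟨h1, -⟩ | ⟨h1, -⟩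
  · have h2 : e.dir.opp = d := by
      rcases he.dir_eq with ⟨h3, -⟩ | ⟨h3, -⟩
      · exfalso
        unfold Edge.dir at h1 h3
        rw [h3] at h1
        split_ifs at h1 <;> simp [Dir.opp] at h1
      · exact h3.symm
    have h3 : d.opp = e.dir := by rw [← h2, oo]
    rw [h3] at he' swap
    rw [← h2] at he
    exact hf.eq_of_starts (swap.starts he) he'
  · have h2 : d = e'.dir := by rw [← oo d, h1, oo]
    rw [h2] at he h
    rw [h2] at he'
    exact (hf.eq_of_starts (h.starts he') he).symm

theorem constOnArcs_circleOf (ρ : D.Resolution) : ConstOnArcs (circleOf ρ) :=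
  fun _ _ _ _ _ _ hs h h' hd =>
    circleOf_eq_of_joined ⟨hd, fun hc => absurd hc.isSpecial hs⟩ h h'

theorem sgn_opp (d : Dir) : d.opp.sgn = -d.sgn := by cases d <;> rfl

theorem constOnArcs_chi : ConstOnArcs (chi (D := D)) := by
  intro e e' c r d d' hs h h' hd
  have h1 := chiOut_add h.hasEnd h'.hasEnd hd fun hc => absurd hc.isSpecial hs
  rw [← h.sgn_mul_chi, ← h'.sgn_mul_chi, straight hs h.hasEnd h'.hasEnd hd, sgn_opp] at h1
  cases d <;> simp only [Dir.sgn] at h1 <;> omega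

end GridDiagram

end

section
namespace GridDiagram

variable {n m : ℕ} {D : GridDiagram n} {D' : GridDiagram m}

open Classical

/-! ### Isomorphisms of rectangular diagrams -/

/-- Turns a direction by 180 degrees unless `b` is true. -/
def _root_.Dir.turn (b : Bool) (d : Dir) : Dir := if b then d else d.opp

theorem opp_opp (d : Dir) : d.opp.opp = d := by cases d <;> rfl

theorem turn_turn (b : Bool) (d : Dir) : (d.turn b).turn b = d := by
  cases b <;> simp [Dir.turn, opp_opp]

theorem turn_opp (b : Bool) (d : Dir) : d.opp.turn b = (d.turn b).opp := by
  cases b <;> simp [Dir.turn]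

theorem turn_injective (b : Bool) : Function.Injective (Dir.turn b) := fun d d' h => by
  rw [← turn_turn b d, h, turn_turn]

/-- An isomorphism of rectangular diagrams: a bijection of their special points that preserves
segments and, up to local rotations by 180 degrees, the directions on them. -/
structure GridIso (D : GridDiagram n) (D' : GridDiagram m) where
  pt : D.SpecialPoint ≃ D'.SpecialPoint
  keep : D.SpecialPoint → Bool
  ahead : ∀ {d p q}, Ahead (d.turn (keep p)) (pt p) (pt q) ↔ Ahead d p q
  keep_eq : ∀ {d p q}, Ahead d p q → keep p = keep q
  upward : ∀ p, D'.Upward (pt p).1.1 ↔ (keep p = true ↔ D.Upward p.1.1)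
  rightward : ∀ p, D'.Rightward (pt p).1.2 ↔ (keep p = true ↔ D.Rightward p.1.2)

namespace GridIso

variable (F : GridIso D D')

/-- The inverse isomorphism. -/
def symm : GridIso D' D where
  pt := F.pt.symm
  keep p := F.keep (F.pt.symm p)
  ahead {d p q} := by
    rw [← F.ahead, turn_turn, Equiv.apply_symm_apply, Equiv.apply_symm_apply]
  keep_eq {d p q} h := by
    refine F.keep_eq (d := d.turn (F.keep (F.pt.symm p))) ?_
    rwa [← F.ahead, turn_turn, Equiv.apply_symm_apply, Equiv.apply_symm_apply]
  upward p := by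
    have := F.upward (F.pt.symm p)
    rw [Equiv.apply_symm_apply] at this
    rw [this]
    tauto
  rightward p := by
    have := F.rightward (F.pt.symm p)
    rw [Equiv.apply_symm_apply] at this
    rw [this]
    tauto

theorem hasEnd_iff (p : D.SpecialPoint) (d : Dir) :
    D'.HasEnd (F.pt p).1.1 (F.pt p).1.2 (d.turn (F.keep p)) ↔ D.HasEnd p.1.1 p.1.2 d := by
  rw [GridDiagram.hasEnd_iff, GridDiagram.hasEnd_iff, ← F.pt.exists_congr_right]
  exact exists_congr fun q => F.ahead

theorem isCrossing_iff (p : D.SpecialPoint) :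
    D'.IsCrossing (F.pt p).1.1 (F.pt p).1.2 ↔ D.IsCrossing p.1.1 p.1.2 := by
  have e : ∀ {n : ℕ} {D : GridDiagram n} (p : D.SpecialPoint),
      D.IsCrossing p.1.1 p.1.2 ↔ ∀ d, D.HasEnd p.1.1 p.1.2 d := fun p => by
    simp only [GridDiagram.isCrossing_iff, GridDiagram.hasEnd_iff]
  rw [e, e]
  constructor
  · intro h d
    exact (F.hasEnd_iff p d).1 (h _)
  · intro h d
    rw [← turn_turn (F.keep p) d]
    exact (F.hasEnd_iff p _).2 (h _)

/-- A crossing as a special point. -/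
def _root_.GridDiagram.Crossing.pt (x : D.Crossing) : D.SpecialPoint :=
  ⟨x.1, IsCrossing.isSpecial x.2⟩

/-- The bijection of the crossings. -/
def crossing : D.Crossing ≃ D'.Crossing where
  toFun x := ⟨(F.pt x.pt).1, (F.isCrossing_iff x.pt).2 x.2⟩
  invFun x := ⟨(F.symm.pt x.pt).1, (F.symm.isCrossing_iff x.pt).2 x.2⟩
  left_inv x := by
    apply Subtype.ext
    have h : (F.pt.symm (F.pt x.pt)).1 = x.pt.1 := by rw [Equiv.symm_apply_apply]
    exact h
  right_inv x := by
    apply Subtype.ext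
    have h : (F.pt (F.pt.symm x.pt)).1 = x.pt.1 := by rw [Equiv.apply_symm_apply]
    exact h

theorem crossing_pt (x : D.Crossing) : (F.crossing x).pt = F.pt x.pt := rfl

/-- The corresponding resolution. -/
def res (ρ : D.Resolution) : D'.Resolution := fun x => ρ (F.crossing.symm x)

theorem res_crossing (ρ : D.Resolution) (x : D.Crossing) : F.res ρ (F.crossing x) = ρ x := by
  simp [res]

theorem symm_res_res (ρ : D.Resolution) : F.symm.res (F.res ρ) = ρ := by
  funext x
  exact F.res_crossing ρ x

theorem res_symm_res (ρ : D'.Resolution) : F.res (F.symm.res ρ) = ρ := by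
  funext x
  exact F.symm.res_crossing ρ x

/-- The bijection of the resolutions. -/
def resEquiv : D.Resolution ≃ D'.Resolution := ⟨F.res, F.symm.res, F.symm_res_res, F.res_symm_res⟩

theorem res_update (ρ : D.Resolution) (x : D.Crossing) (b : Bool) :
    F.res (Function.update ρ x b) = Function.update (F.res ρ) (F.crossing x) b := by
  funext y
  obtain ⟨y, rfl⟩ := F.crossing.surjective y
  rw [res_crossing]
  by_cases h : y = x
  · subst h; simp
  · rw [Function.update_of_ne h, Function.update_of_ne (F.crossing.injective.ne h), res_crossing]

theorem res_up (ρ : D.Resolution) (x : D.Crossing) :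
    F.res (ρ.up x) = (F.res ρ).up (F.crossing x) := F.res_update ρ x true

theorem isPositive_iff (x : D.Crossing) : D'.IsPositive (F.crossing x) ↔ D.IsPositive x := by
  have h1 := F.upward x.pt
  have h2 := F.rightward x.pt
  change ¬ (D'.Upward (F.pt x.pt).1.1 ↔ D'.Rightward (F.pt x.pt).1.2) ↔
    ¬ (D.Upward x.pt.1.1 ↔ D.Rightward x.pt.1.2)
  rw [h1, h2]
  tauto

theorem nPos_eq (F : GridIso D D') : D'.nPos = D.nPos := congrArg Nat.cast
  (Nat.card_congr (F.crossing.subtypeEquiv fun x => (F.isPositive_iff x).symm)).symm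

theorem nNeg_eq (F : GridIso D D') : D'.nNeg = D.nNeg := congrArg Nat.cast
  (Nat.card_congr (F.crossing.subtypeEquiv fun x => (F.isPositive_iff x).not.symm)).symm

theorem height_res (ρ : D.Resolution) : (F.res ρ).height = ρ.height := congrArg Nat.cast
  (Nat.card_congr (F.crossing.subtypeEquiv fun x => by rw [res_crossing])).symm

/-- Edges that leave corresponding special points in corresponding directions. -/
def Match (e : D.Edge) (e' : D'.Edge) : Prop :=
  ∃ d p, e.Leaves d p ∧ e'.Leaves (d.turn (F.keep p)) (F.pt p)

variable {F} in
theorem Match.symm {e : D.Edge} {e' : D'.Edge} (h : F.Match e e') : F.symm.Match e' e := by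
  obtain ⟨d, p, h1, h2⟩ := h
  refine ⟨_, _, h2, ?_⟩
  change e.Leaves ((d.turn (F.keep p)).turn (F.keep (F.pt.symm (F.pt p)))) (F.pt.symm (F.pt p))
  rwa [Equiv.symm_apply_apply, turn_turn]

theorem exists_leaves {e : D.Edge} {d : Dir} {p : D.SpecialPoint} (h : e.Leaves d p) :
    ∃ e' : D'.Edge, e'.Leaves (d.turn (F.keep p)) (F.pt p) :=
  D'.exists_leavesAt ((F.hasEnd_iff p d).2 h.hasEnd)

/-- The edge at the beginning of the arc of `e`. -/
theorem exists_start (e : D.Edge) : ∃ p, Starts p e ∧ ∃ e₀ : D.Edge, e₀.Leaves e.dir p := by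
  obtain ⟨p, hp⟩ := exists_starts e
  refine ⟨p, hp, D.exists_leavesAt ?_⟩
  obtain ⟨p2, p3⟩ := p.2
  have he := e.2
  rcases hp with ⟨a1, a2, a3, a4⟩ | ⟨a1, a2, a3, a4⟩
  · rw [Edge.dir, if_pos a1]
    simp only [a1, a2, true_and, Bool.true_eq_false, false_and, or_false] at he
    exact ⟨p2.1, a3.trans_lt he.2⟩
  · rw [Edge.dir, if_neg (by simp [a1])]
    simp only [a1, a2, true_and, Bool.false_eq_true, false_and, false_or] at he
    exact ⟨p3.1, a3.trans_lt he.2⟩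

/-- An edge on the arc that corresponds to the arc of `e`. -/
theorem exists_image (e : D.Edge) : ∃ p, Starts p e ∧
    ∃ e' : D'.Edge, e'.Leaves (e.dir.turn (F.keep p)) (F.pt p) := by
  obtain ⟨p, hp, e₀, h₀⟩ := exists_start e
  exact ⟨p, hp, F.exists_leaves h₀⟩

/-- Arcs of the two diagrams may have different lengths, so the image is just an edge at one end of
the corresponding arc. Only functions that are constant on arcs are evaluated on it. -/
def image (e : D.Edge) : D'.Edge := (F.exists_image e).choose_spec.2.choose

theorem image_spec {e : D.Edge} {p : D.SpecialPoint} (h : Starts p e) :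
    (F.image e).Leaves (e.dir.turn (F.keep p)) (F.pt p) := by
  obtain rfl := h.unique (F.exists_image e).choose_spec.1
  exact (F.exists_image e).choose_spec.2.choose_spec

theorem next_iff {d : Dir} {p q : D.SpecialPoint} :
    Next (d.turn (F.keep p)) (F.pt p) (F.pt q) ↔ Next d p q := by
  unfold Next
  rw [F.ahead, ← F.pt.forall_congr_right]
  refine and_congr_right fun _ => forall_congr' fun q' => ?_
  rw [F.ahead]
  refine imp_congr_right fun h => ?_
  rw [F.keep_eq h, F.ahead]

/-- A function that is constant on arcs agrees on the image of an edge and on edges that match. -/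
theorem image_eq_of_match {α : Type*} {f : D'.Edge → α} (hf : ConstOnArcs f) {e : D.Edge}
    {d : Dir} {p : D.SpecialPoint} {e' : D'.Edge} (h : e.Leaves d p)
    (h' : e'.Leaves (d.turn (F.keep p)) (F.pt p)) : f (F.image e) = f e' := by
  rcases Edge.LeavesAt.dir_eq h with ⟨rfl, -⟩ | ⟨rfl, -⟩
  · rw [(F.image_spec h.starts).unique h']
  · obtain ⟨q, hq⟩ := exists_starts e
    have hn := hq.next h
    refine hf.eq_of_next (F.next_iff.2 hn) (F.image_spec hq) ?_
    rw [F.keep_eq hn.1, ← turn_opp]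
    exact h'

/-- A half turn preserves each of the two smoothings; it only exchanges the two arcs. -/
theorem joined_turn {ρ : D.Resolution} {p : D.SpecialPoint} {d d' : Dir}
    (h : Joined ρ p.1.1 p.1.2 d d') : Joined (F.res ρ) (F.pt p).1.1 (F.pt p).1.2
      (d.turn (F.keep p)) (d'.turn (F.keep p)) := by
  refine ⟨(turn_injective _).ne h.1, fun hc => ?_⟩
  have hx := (F.isCrossing_iff p).1 hc
  have e : F.res ρ ⟨((F.pt p).1.1, (F.pt p).1.2), hc⟩ = ρ ⟨(p.1.1, p.1.2), hx⟩ :=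
    F.res_crossing ρ ⟨(p.1.1, p.1.2), hx⟩
  have := h.2 hx
  rw [e]
  generalize ρ ⟨(p.1.1, p.1.2), hx⟩ = b at *
  cases F.keep p <;> cases b <;> cases d <;> cases d' <;>
    simp_all [smoothingJoins, Dir.turn, Dir.opp]

omit F in
theorem _root_.GridDiagram.Starts.straight {e e' : D.Edge} {c r : Fin n} {d d' : Dir}
    (hs : ¬ D.IsSpecial c r) (h : e.LeavesAt d c r) (h' : e'.LeavesAt d' c r) (hd : d ≠ d')
    {p : D.SpecialPoint} (hp : Starts p e) : Starts p e' ∧ e.dir = e'.dir := by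
  have h1 := GridDiagram.straight hs h.hasEnd h'.hasEnd hd
  rcases h.dir_eq with ⟨h2, -⟩ | ⟨h2, -⟩ <;> rcases h'.dir_eq with ⟨h3, -⟩ | ⟨h3, -⟩
  · exfalso
    rw [h1, h2] at h3
    unfold Edge.dir at h3
    split_ifs at h3 <;> simp [Dir.opp] at h3
  · have h4 : e'.dir = e.dir := by rw [h1, h2] at h3; rw [← opp_opp e'.dir, ← h3, opp_opp]
    refine ⟨?_, h4.symm⟩
    obtain ⟨q, hq⟩ := exists_starts e'
    rw [h2] at h
    rw [h1, h2] at h'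
    rwa [hp.unique (Starts.of_straight hs h h' hq)]
  · have h4 : e'.dir = e.dir := by rw [← h3, h1, h2, opp_opp]
    refine ⟨?_, h4.symm⟩
    rw [h3] at h'
    rw [h2, ← h4] at h
    exact Starts.of_straight hs h' h hp
  · exfalso
    rw [h1, h2, opp_opp] at h3
    unfold Edge.dir at h3
    split_ifs at h3 <;> simp [Dir.opp] at h3

theorem image_of_straight {e e' : D.Edge} {c r : Fin n} {d d' : Dir} (hs : ¬ D.IsSpecial c r)
    (h : e.LeavesAt d c r) (h' : e'.LeavesAt d' c r) (hd : d ≠ d') : F.image e = F.image e' := by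
  obtain ⟨p, hp⟩ := exists_starts e
  obtain ⟨h1, h2⟩ := hp.straight hs h h' hd
  have e1 := F.image_spec hp
  rw [h2] at e1
  exact e1.unique (F.image_spec h1)

/-- At special points the joins correspond, and between them the image does not change. -/
theorem circleOf_image {ρ : D.Resolution} {e e' : D.Edge} (h : circleOf ρ e = circleOf ρ e') :
    circleOf (F.res ρ) (F.image e) = circleOf (F.res ρ) (F.image e') := by
  refine circle_induction (fun e => circleOf (F.res ρ) (F.image e)) ?_ h
  intro e e' c r d d' h1 h2 h3
  by_cases hs : D.IsSpecial c r
  · obtain ⟨f, hf⟩ := F.exists_leaves (p := ⟨(c, r), hs⟩) h1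
    obtain ⟨f', hf'⟩ := F.exists_leaves (p := ⟨(c, r), hs⟩) h2
    rw [F.image_eq_of_match (constOnArcs_circleOf _) (p := ⟨(c, r), hs⟩) h1 hf,
      F.image_eq_of_match (constOnArcs_circleOf _) (p := ⟨(c, r), hs⟩) h2 hf']
    exact circleOf_eq_of_joined (F.joined_turn (p := ⟨(c, r), hs⟩) h3) hf hf'
  · rw [F.image_of_straight hs h1 h2 h3.1]

/-- The map of the circles. -/
def circle (ρ : D.Resolution) (C : D.Circle ρ) : D'.Circle (F.res ρ) :=
  circleOf (F.res ρ) (F.image (Quot.out C))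

variable {F} in
theorem Match.circle {e : D.Edge} {e' : D'.Edge} (h : F.Match e e') (ρ : D.Resolution) :
    F.circle ρ (circleOf ρ e) = circleOf (F.res ρ) e' := by
  obtain ⟨d, p, h1, h2⟩ := h
  have : circleOf ρ (Quot.out (circleOf ρ e)) = circleOf ρ e := Quot.out_eq _
  rw [GridIso.circle, F.circleOf_image this, F.image_eq_of_match (constOnArcs_circleOf _) h1 h2]

theorem exists_match {ρ : D.Resolution} (C : D.Circle ρ) :
    ∃ e e', F.Match e e' ∧ circleOf ρ e = C := by
  obtain ⟨e, rfl⟩ := exists_circleOf C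
  obtain ⟨p, hp, e₀, h₀⟩ := exists_start e
  obtain ⟨e', he'⟩ := F.exists_leaves h₀
  exact ⟨e₀, e', ⟨_, _, h₀, he'⟩, ((constOnArcs_circleOf ρ).eq_of_starts hp h₀).symm⟩

theorem exists_match' {ρ : D'.Resolution} (C : D'.Circle ρ) :
    ∃ e e', F.Match e e' ∧ circleOf ρ e' = C := by
  obtain ⟨e', e, h, rfl⟩ := F.symm.exists_match C
  obtain ⟨d, p, h1, h2⟩ := h.symm
  refine ⟨e, e', ⟨d, p, h1, ?_⟩, rfl⟩
  change e'.Leaves (d.turn (F.keep (F.pt.symm (F.pt p)))) (F.pt p) at h2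
  rwa [Equiv.symm_apply_apply] at h2

theorem circle_bijective (ρ : D.Resolution) : Function.Bijective (F.circle ρ) := by
  constructor
  · intro C C' h
    obtain ⟨e, f, hm, rfl⟩ := F.exists_match C
    obtain ⟨e', f', hm', rfl⟩ := F.exists_match C'
    rw [hm.circle, hm'.circle] at h
    have := congrArg (F.symm.circle _) h
    rw [hm.symm.circle, hm'.symm.circle, F.symm_res_res] at this
    exact this
  · intro C
    obtain ⟨e, e', h, rfl⟩ := F.exists_match' C
    exact ⟨circleOf ρ e, h.circle ρ⟩

/-- The bijection of the circles. -/
def circleEquiv (ρ : D.Resolution) : D.Circle ρ ≃ D'.Circle (F.res ρ) :=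
  Equiv.ofBijective _ (F.circle_bijective ρ)

end GridIso

end GridDiagram

end

section
namespace GridDiagram

variable {n m : ℕ} {D : GridDiagram n} {D' : GridDiagram m}

open Classical

/-! ### Turning at special points -/

/-- The weight of a corner is expressed by the ends present there, in a form that is invariant under
a half turn, since a corner has exactly one vertical and one horizontal end. -/
theorem kappa_special (ρ : D.Resolution) (p : D.SpecialPoint) : kappa ρ p.1.1 p.1.2 =
    if h : D.IsCrossing p.1.1 p.1.2 then (if ρ ⟨p.1, h⟩ then 1 else -1)
    else if D.HasEnd p.1.1 p.1.2 .north ↔ D.HasEnd p.1.1 p.1.2 .east then -1 else 1 := by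
  obtain ⟨⟨c, r⟩, hp⟩ := p
  obtain ⟨k1, k2, k3⟩ := D.fin_corner_iff c r
  unfold kappa
  rw [dif_pos r.2]
  simp only [Fin.eta]
  by_cases h : D.IsCrossing c r
  · rw [dif_pos h, dif_pos h]
  · rw [dif_neg h, dif_neg h]
    have hp' : (D.lo c ≤ r ∧ r ≤ D.hi c) ∧ D.lft r ≤ c ∧ c ≤ D.rgt r := hp
    simp only [IsCrossing, HasEnd, Fin.lt_def, Fin.le_def, Fin.ext_iff] at hp' h ⊢
    split_ifs <;> omega

theorem kappa_of_not_isSpecial (ρ : D.Resolution) {c : Fin n} {y : ℕ}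
    (h : ∀ hy : y < n, ¬ D.IsSpecial c ⟨y, hy⟩) : kappa ρ c y = 0 := by
  unfold kappa
  by_cases hy : y < n
  · rw [dif_pos hy, dif_neg fun h' => h hy h'.isSpecial, if_neg]
    rintro (h' | h')
    · subst h'; exact h hy (D.isSpecial_lo c)
    · subst h'; exact h hy (D.isSpecial_hi c)
  · rw [dif_neg hy]

/-- The value of a function on the edge that leaves a special point, with the sign of the
direction. -/
def outward (w : D.Edge → ℤ) (p : D.SpecialPoint) (d : Dir) : ℤ :=
  ∑ e, if e.Leaves d p then d.sgn * w e else 0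

theorem outward_eq (w : D.Edge → ℤ) {p : D.SpecialPoint} {d : Dir} {e : D.Edge}
    (h : e.Leaves d p) : outward w p d = d.sgn * w e := by
  rw [outward, Finset.sum_eq_single e (fun e' _ hne => if_neg fun h' => hne (h'.unique h)) (by simp),
    if_pos h]

theorem outward_of_not_hasEnd (w : D.Edge → ℤ) {p : D.SpecialPoint} {d : Dir}
    (h : ¬ D.HasEnd p.1.1 p.1.2 d) : outward w p d = 0 :=
  Finset.sum_eq_zero fun _ _ => if_neg fun h' => h (Edge.LeavesAt.hasEnd h')

/-- Summation by special points, where all turning weights are concentrated; this form can be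
compared between diagrams. -/
theorem sum_edgeTurn (ρ : D.Resolution) (w : D.Edge → ℤ) : ∑ e, w e * edgeTurn ρ e =
    ∑ p : D.SpecialPoint,
      kappa ρ p.1.1 p.1.2 * (outward w p .north + outward w p .south) := by
  have key : ∀ (c : Fin n) (y : ℕ), (∑ p : D.SpecialPoint,
      if p.1.1 = c ∧ (p.1.2 : ℕ) = y then kappa ρ p.1.1 p.1.2 else 0) = kappa ρ c y := by
    intro c y
    by_cases h : ∃ hy : y < n, D.IsSpecial c ⟨y, hy⟩
    · obtain ⟨hy, h⟩ := h
      rw [Finset.sum_eq_single ⟨(c, ⟨y, hy⟩), h⟩]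
      · simp
      · intro p _ hne
        refine if_neg fun h' => hne (Subtype.ext (Prod.ext h'.1 (Fin.ext h'.2)))
      · simp
    · rw [kappa_of_not_isSpecial ρ fun hy h' => h ⟨hy, h'⟩]
      refine Finset.sum_eq_zero fun p _ => if_neg ?_
      rintro ⟨rfl, rfl⟩
      exact h ⟨p.1.2.2, p.2⟩
  have hR : ∀ p : D.SpecialPoint,
      kappa ρ p.1.1 p.1.2 * (outward w p .north + outward w p .south) =
      ∑ e, w e * ((if e.1.1 = true then (if p.1.1 = e.1.2.1 ∧ (p.1.2 : ℕ) = e.1.2.2 then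
        kappa ρ p.1.1 p.1.2 else 0) else 0) - if e.1.1 = true then
        (if p.1.1 = e.1.2.1 ∧ (p.1.2 : ℕ) = e.1.2.2 + 1 then kappa ρ p.1.1 p.1.2 else 0) else 0) := by
    intro p
    rw [outward, outward, ← Finset.sum_add_distrib, Finset.mul_sum]
    refine Finset.sum_congr rfl fun e _ => ?_
    by_cases hv : e.1.1 = true
    · have h1 : e.Leaves .north p ↔ p.1.1 = e.1.2.1 ∧ (p.1.2 : ℕ) = e.1.2.2 :=
        ⟨fun h => ⟨h.2.1.symm, congrArg Fin.val h.2.2.symm⟩, fun h => ⟨hv, h.1.symm, Fin.ext h.2.symm⟩⟩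
      have h2 : e.Leaves .south p ↔ p.1.1 = e.1.2.1 ∧ (p.1.2 : ℕ) = e.1.2.2 + 1 :=
        ⟨fun h => ⟨h.2.1.symm, h.2.2.symm⟩, fun h => ⟨hv, h.1.symm, h.2.symm⟩⟩
      simp only [h1, h2, hv, if_true, Dir.sgn]
      split_ifs <;> ring
    · have h1 : ¬ e.Leaves .north p := fun h => hv h.1
      have h2 : ¬ e.Leaves .south p := fun h => hv h.1
      rw [if_neg h1, if_neg h2, if_neg hv, if_neg hv]
      ring
  rw [Finset.sum_congr rfl fun p _ => hR p, Finset.sum_comm]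
  refine Finset.sum_congr rfl fun e _ => ?_
  rw [← Finset.mul_sum, Finset.sum_sub_distrib, edgeTurn]
  split_ifs
  · rw [key, key]
  · simp

namespace GridIso

variable (F : GridIso D D')

theorem kappa_pt (ρ : D.Resolution) (p : D.SpecialPoint) :
    kappa (F.res ρ) (F.pt p).1.1 (F.pt p).1.2 = kappa ρ p.1.1 p.1.2 := by
  rw [kappa_special, kappa_special]
  by_cases h : D.IsCrossing p.1.1 p.1.2
  · have h' := (F.isCrossing_iff p).2 h
    rw [dif_pos h, dif_pos h']
    have : F.res ρ ⟨(F.pt p).1, h'⟩ = ρ ⟨p.1, h⟩ := F.res_crossing ρ ⟨p.1, h⟩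
    rw [this]
  · rw [dif_neg h, dif_neg ((F.isCrossing_iff p).not.2 h)]
    refine if_congr ?_ rfl rfl
    have e1 := F.hasEnd_iff p .north
    have e2 := F.hasEnd_iff p .east
    have e3 := F.hasEnd_iff p .south
    have e4 := F.hasEnd_iff p .west
    cases hk : F.keep p
    · rw [hk] at e3 e4
      change D'.HasEnd _ _ .north ↔ _ at e3
      change D'.HasEnd _ _ .east ↔ _ at e4
      rw [e3, e4]
      obtain ⟨k1, k2, k3⟩ := D.fin_corner_iff p.1.1 p.1.2
      have := p.2
      simp only [IsSpecial, IsCrossing, HasEnd, Fin.lt_def, Fin.le_def] at *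
      omega
    · rw [hk] at e1 e2
      change D'.HasEnd _ _ .north ↔ _ at e1
      change D'.HasEnd _ _ .east ↔ _ at e2
      rw [e1, e2]

/-- Compares the checkerboard orientations of the two diagrams. -/
def parity (e : D.Edge) : ℤ :=
  chi e * chi (F.image e) * if F.keep (exists_starts e).choose = true then 1 else -1

theorem parity_eq_of_starts {e : D.Edge} {p : D.SpecialPoint} (h : Starts p e) :
    F.parity e = chi e * chi (F.image e) * if F.keep p = true then 1 else -1 := by
  rw [parity, (exists_starts e).choose_spec.unique h]

theorem sgn_turn (b : Bool) (d : Dir) : (d.turn b).sgn = d.sgn * if b = true then 1 else -1 := by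
  cases b <;> simp [Dir.turn, sgn_opp]

theorem parity_eq {e : D.Edge} {e' : D'.Edge} {d : Dir} {p : D.SpecialPoint} (h : e.Leaves d p)
    (h' : e'.Leaves (d.turn (F.keep p)) (F.pt p)) :
    F.parity e = d.sgn * chi e * ((d.turn (F.keep p)).sgn * chi e') := by
  obtain ⟨q, hq⟩ := exists_starts e
  have hk : F.keep q = F.keep p := by
    rcases Edge.LeavesAt.dir_eq h with ⟨rfl, -⟩ | ⟨rfl, -⟩
    · rw [hq.unique h.starts]
    · exact F.keep_eq (hq.next h).1
  rw [F.parity_eq_of_starts hq, F.image_eq_of_match constOnArcs_chi h h', hk, sgn_turn]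
  have : d.sgn * d.sgn = 1 := by cases d <;> rfl
  linear_combination (-chi e * chi e' * if F.keep p = true then 1 else -1) * this

/-- Both checkerboard orientations change from outward to inward whenever two ends are joined, so
their comparison is constant on each circle. -/
theorem parity_congr {ρ : D.Resolution} {e e' : D.Edge} (h : circleOf ρ e = circleOf ρ e') :
    F.parity e = F.parity e' := by
  refine circle_induction F.parity ?_ h
  intro e e' c r d d' h1 h2 h3
  by_cases hs : D.IsSpecial c r
  · obtain ⟨f, hf⟩ := F.exists_leaves (p := ⟨(c, r), hs⟩) h1
    obtain ⟨f', hf'⟩ := F.exists_leaves (p := ⟨(c, r), hs⟩) h2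
    rw [F.parity_eq (p := ⟨(c, r), hs⟩) h1 hf, F.parity_eq (p := ⟨(c, r), hs⟩) h2 hf']
    have a := h3.chiOut_add h1.hasEnd h2.hasEnd
    have b := (F.joined_turn (p := ⟨(c, r), hs⟩) h3).chiOut_add
      (Edge.LeavesAt.hasEnd hf) (Edge.LeavesAt.hasEnd hf')
    rw [← h1.sgn_mul_chi, ← h2.sgn_mul_chi] at a
    rw [← Edge.LeavesAt.sgn_mul_chi hf, ← Edge.LeavesAt.sgn_mul_chi hf'] at b
    rw [eq_neg_of_add_eq_zero_left a, eq_neg_of_add_eq_zero_left b]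
    ring
  · obtain ⟨p, hp⟩ := exists_starts e
    rw [F.parity_eq_of_starts hp, F.parity_eq_of_starts (hp.straight hs h1 h2 h3.1).1,
      constOnArcs_chi _ _ _ _ _ _ hs h1 h2 h3.1, F.image_of_straight hs h1 h2 h3.1]

/-- The turning weights correspond, so the turning number changes only by the comparison of the two
checkerboard orientations. -/
theorem spin_circle (ρ : D.Resolution) (e : D.Edge) :
    spin (F.res ρ) (F.circle ρ (circleOf ρ e)) = F.parity e * spin ρ (circleOf ρ e) := by
  have conv : ∀ {n : ℕ} {D : GridDiagram n} (ρ : D.Resolution) (C : D.Circle ρ), 4 * spin ρ C =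
      ∑ p : D.SpecialPoint, kappa ρ p.1.1 p.1.2 *
        (outward (fun e => if circleOf ρ e = C then chi e else 0) p .north +
          outward (fun e => if circleOf ρ e = C then chi e else 0) p .south) := by
    intro n D ρ C
    rw [← sum_edgeTurn, ← (spin_spec ρ C).2.1]
    refine Finset.sum_congr rfl fun e _ => ?_
    split_ifs <;> simp
  have hout : ∀ p d, outward (fun e' => if circleOf (F.res ρ) e' =
      F.circle ρ (circleOf ρ e) then chi e' else 0) (F.pt p) (d.turn (F.keep p)) =
      F.parity e * outward (fun e' => if circleOf ρ e' = circleOf ρ e then chi e' else 0) p d := by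
    intro p d
    by_cases h : D.HasEnd p.1.1 p.1.2 d
    · obtain ⟨f, hf⟩ := D.exists_leavesAt h
      obtain ⟨f', hf'⟩ := F.exists_leaves (p := p) hf
      rw [outward_eq _ hf', outward_eq _ (p := p) hf, ← Match.circle (F := F) ⟨d, p, hf, hf'⟩ ρ]
      simp only [(F.circle_bijective ρ).1.eq_iff]
      by_cases hc : circleOf ρ f = circleOf ρ e
      · rw [if_pos hc, if_pos hc, ← F.parity_congr hc, F.parity_eq hf hf']
        have h1 : d.sgn * d.sgn = 1 := by cases d <;> rfl
        have h2 : chi f * chi f = 1 := by rcases chi_eq f with h | h <;> rw [h] <;> rfl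
        linear_combination (-(d.turn (F.keep p)).sgn * chi f') * h1 -
          ((d.turn (F.keep p)).sgn * chi f' * d.sgn * d.sgn) * h2
      · rw [if_neg hc, if_neg hc]; ring
    · rw [outward_of_not_hasEnd _ ((F.hasEnd_iff p d).not.2 h), outward_of_not_hasEnd _ h, mul_zero]
  have h4 : 4 * spin (F.res ρ) (F.circle ρ (circleOf ρ e)) =
      F.parity e * (4 * spin ρ (circleOf ρ e)) := by
    rw [conv, conv, Finset.mul_sum, ← F.pt.sum_comp]
    refine Finset.sum_congr rfl fun p _ => ?_
    rw [F.kappa_pt]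
    have a := hout p .north
    have b := hout p .south
    cases hk : F.keep p <;> rw [hk] at a b
    · change outward _ _ .south = _ at a
      change outward _ _ .north = _ at b
      rw [a, b]; ring
    · change outward _ _ .north = _ at a
      change outward _ _ .south = _ at b
      rw [a, b]; ring
  linarith

/-- The bijection of the states. -/
def state : D.State ≃ D'.State :=
  Equiv.sigmaCongr F.resEquiv fun ρ => (F.circleEquiv ρ).finsetCongr

theorem state_mk (ρ : D.Resolution) (S : Finset (D.Circle ρ)) :
    F.state ⟨ρ, S⟩ = ⟨F.res ρ, S.map (F.circleEquiv ρ).toEmbedding⟩ := rfl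

theorem state_res (s : D.State) : (F.state s).1 = F.res s.1 := rfl

/-- The parity that enters the spin cancels the one that enters the checkerboard orientation, so the
geometric orientation of the edges is transported. -/
theorem omega_state (s : D.State) {e : D.Edge} {e' : D'.Edge} {d : Dir} {p : D.SpecialPoint}
    (h : e.Leaves d p) (h' : e'.Leaves (d.turn (F.keep p)) (F.pt p)) :
    (d.turn (F.keep p)).sgn * (F.state s).omega e' = d.sgn * s.omega e := by
  obtain ⟨ρ, S⟩ := s
  change _ * GridDiagram.omega (F.res ρ) (S.map (F.circleEquiv ρ).toEmbedding) e' =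
    _ * GridDiagram.omega ρ S e
  have hc := Match.circle (F := F) ⟨d, p, h, h'⟩ ρ
  have hl : label (F.res ρ) (S.map (F.circleEquiv ρ).toEmbedding) e' = label ρ S e := by
    have hm : circleOf (F.res ρ) e' ∈ S.map (F.circleEquiv ρ).toEmbedding ↔ circleOf ρ e ∈ S := by
      rw [← hc]
      exact Finset.mem_map' (F.circleEquiv ρ).toEmbedding
    by_cases hS : circleOf ρ e ∈ S
    · rw [label, label, if_pos hS, if_pos (hm.2 hS)]
    · rw [label, label, if_neg hS, if_neg (hm.not.2 hS)]
  unfold GridDiagram.omega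
  rw [hl, ← hc, F.spin_circle, F.parity_eq h h']
  have h1 : (d.turn (F.keep p)).sgn * (d.turn (F.keep p)).sgn = 1 := by
    cases d.turn (F.keep p) <;> rfl
  have h2 : chi e' * chi e' = 1 := by rcases chi_eq e' with h | h <;> rw [h] <;> rfl
  linear_combination (label ρ S e * d.sgn * chi e * spin ρ (circleOf ρ e) * chi e' * chi e') * h1 +
    (label ρ S e * d.sgn * chi e * spin ρ (circleOf ρ e)) * h2

omit F in
theorem constOnArcs_omega (s : D.State) : ConstOnArcs s.omega := by
  intro e e' c r d d' hs h h' hd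
  have h1 := s.omega_joined h h' ⟨hd, fun hc => absurd hc.isSpecial hs⟩
  rw [GridDiagram.straight hs h.hasEnd h'.hasEnd hd, sgn_opp] at h1
  cases d <;> simp only [Dir.sgn] at h1 <;> omega

theorem omega_state_eq_iff (s t : D.State) :
    (F.state s).omega = (F.state t).omega ↔ s.omega = t.omega := by
  have cancel : ∀ (d : Dir) (a b : ℤ), d.sgn * a = d.sgn * b → a = b := by
    intro d a b h; cases d <;> simp only [Dir.sgn] at h <;> omega
  constructor
  · intro h
    funext e
    obtain ⟨p, hp, e₀, h₀⟩ := exists_start e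
    obtain ⟨e', h'⟩ := F.exists_leaves h₀
    rw [(constOnArcs_omega s).eq_of_starts hp h₀, (constOnArcs_omega t).eq_of_starts hp h₀]
    apply cancel e.dir
    rw [← F.omega_state s h₀ h', ← F.omega_state t h₀ h', h]
  · intro h
    funext e
    obtain ⟨q, hq, e₀, h₀⟩ := exists_start e
    rw [(constOnArcs_omega _).eq_of_starts hq h₀, (constOnArcs_omega _).eq_of_starts hq h₀]
    obtain ⟨p, rfl⟩ := F.pt.surjective q
    have hend : D.HasEnd p.1.1 p.1.2 (e.dir.turn (F.keep p)) := by
      rw [← F.hasEnd_iff, turn_turn]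
      exact Edge.LeavesAt.hasEnd h₀
    obtain ⟨f, hf⟩ := D.exists_leavesAt hend
    have h₀' : e₀.Leaves ((e.dir.turn (F.keep p)).turn (F.keep p)) (F.pt p) := by rwa [turn_turn]
    apply cancel ((e.dir.turn (F.keep p)).turn (F.keep p))
    rw [F.omega_state s hf h₀', F.omega_state t hf h₀', h]

theorem leaves_crossing (x : D.Crossing) :
    F.Match x.northEdge (if F.keep x.pt then (F.crossing x).northEdge else (F.crossing x).southEdge) ∧
    F.Match x.southEdge
      (if F.keep x.pt then (F.crossing x).southEdge else (F.crossing x).northEdge) := by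
  have a : ∀ {n : ℕ} {D : GridDiagram n} (x : D.Crossing),
      x.northEdge.Leaves .north x.pt ∧ x.southEdge.Leaves .south x.pt := by
    intro n D x
    rw [x.northEdge_eq, x.southEdge_eq]
    exact ⟨x.edge_leavesAt _, x.edge_leavesAt _⟩
  constructor
  · refine ⟨.north, x.pt, (a x).1, ?_⟩
    rw [← crossing_pt]
    cases F.keep x.pt
    · exact (a _).2
    · exact (a _).1
  · refine ⟨.south, x.pt, (a x).2, ?_⟩
    rw [← crossing_pt]
    cases F.keep x.pt
    · exact (a _).1
    · exact (a _).2

theorem free_state_iff (s : D.State) (x : D.Crossing) :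
    (F.state s).Free (F.crossing x) ↔ s.Free x := by
  have a : ∀ {n : ℕ} {D : GridDiagram n} (x : D.Crossing),
      x.northEdge.Leaves .north x.pt ∧ x.southEdge.Leaves .south x.pt := by
    intro n D x
    rw [x.northEdge_eq, x.southEdge_eq]
    exact ⟨x.edge_leavesAt _, x.edge_leavesAt _⟩
  have h1 := (a (F.crossing x)).1
  have h2 := (a (F.crossing x)).2
  rw [crossing_pt] at h1 h2
  unfold State.Free
  cases hk : F.keep x.pt
  · have e1 := F.omega_state s (a x).1 (e' := (F.crossing x).southEdge) (by rw [hk]; exact h2)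
    have e2 := F.omega_state s (a x).2 (e' := (F.crossing x).northEdge) (by rw [hk]; exact h1)
    rw [hk] at e1 e2
    simp only [Dir.turn, Dir.sgn, Dir.opp, Bool.false_eq_true, if_false] at e1 e2
    omega
  · have e1 := F.omega_state s (a x).1 (e' := (F.crossing x).northEdge) (by rw [hk]; exact h1)
    have e2 := F.omega_state s (a x).2 (e' := (F.crossing x).southEdge) (by rw [hk]; exact h2)
    rw [hk] at e1 e2
    simp only [Dir.turn, Dir.sgn, if_true] at e1 e2
    omega

theorem isCritical_state_iff (s : D.State) : (F.state s).IsCritical ↔ s.IsCritical := by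
  unfold State.IsCritical
  rw [← F.crossing.forall_congr_right]
  exact forall_congr' fun x => (F.free_state_iff s x).not

theorem state_flip {s : D.State} {x : D.Crossing} (h : s.Free x) :
    F.state (s.flip x) = (F.state s).flip (F.crossing x) := by
  refine State.eq_flip ((F.free_state_iff s x).2 h) ?_ ?_
  · rw [state_res, State.flip_res h, res_update, state_res, res_crossing]
  · rw [omega_state_eq_iff, State.flip_omega h]

theorem deg_state (s : D.State) : (F.state s).deg = s.deg := by
  obtain ⟨ρ, S⟩ := s
  rw [state_mk]
  have : Nat.card (D'.Circle (F.res ρ)) = Nat.card (D.Circle ρ) :=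
    (Nat.card_congr (F.circleEquiv ρ)).symm
  simp only [State.deg, F.height_res, F.nPos_eq, F.nNeg_eq, this, Finset.card_map]

end GridIso

end GridDiagram

end

section
namespace GridDiagram

variable {n m : ℕ} {D : GridDiagram n} {D' : GridDiagram m}

open Classical ExteriorAlgebra

/-! ### Faces of the cube of resolutions -/

theorem circleOf_cases {x : D.Crossing} {ρ ρ' : D.Resolution} (h : DifferAt x ρ ρ') {e e' : D.Edge}
    (hne : circleOf ρ e ≠ circleOf ρ e') (he : circleOf ρ' e = circleOf ρ' e') :
    (circleOf ρ e = circleOf ρ x.northEdge ∧ circleOf ρ e' = circleOf ρ x.southEdge) ∨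
      (circleOf ρ e = circleOf ρ x.southEdge ∧ circleOf ρ e' = circleOf ρ x.northEdge) := by
  have := pinch_eq_of_circleOf_eq h he
  unfold pinch at this
  split_ifs at this with h1 h2 h2
  · exact absurd (h1.trans h2.symm) hne
  · exact Or.inr ⟨h1, this.symm⟩
  · exact Or.inl ⟨this, h2⟩
  · exact absurd this hne

theorem SameAt.circleFun {x : D.Crossing} {ρ ρ' : D.Resolution} (h : DifferAt x ρ ρ')
    (hs : SameAt x ρ') (e : D.Edge) : circleFun ρ ρ' (circleOf ρ e) = circleOf ρ' e :=
  hs.refines h.symm (Quot.out_eq (circleOf ρ e))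

theorem differAt_up_up {x y : D.Crossing} (hxy : x ≠ y) (ρ : D.Resolution) :
    DifferAt x (ρ.up y) ((ρ.up x).up y) := by
  rw [Resolution.up, Resolution.up, Resolution.up, Function.update_comm hxy]
  exact differAt_up _ _

section Faces

variable {x y : D.Crossing} {ρ : D.Resolution}

theorem sameAt_up_x (hx : ρ x = false) : SameAt x (ρ.up x) ↔ ¬ SameAt x ρ :=
  sameAt_up (differAt_up x ρ) hx (by simp [Resolution.up])

theorem sameAt_up_up_right (hxy : x ≠ y) (hy : ρ y = false) :
    SameAt y ((ρ.up x).up y) ↔ ¬ SameAt y (ρ.up x) :=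
  sameAt_up (differAt_up y _) (by simp [Resolution.up, hxy.symm, hy]) (by simp [Resolution.up])

/-- In a ladybug face both crossings split a circle and merge the two parts again. -/
theorem IsLadybug.sameAt (h : IsLadybug ρ x y) (hxy : x ≠ y)
    (hy : ρ y = false) : ¬ SameAt x (ρ.up x) ∧ ¬ SameAt y (ρ.up y) ∧ SameAt x ((ρ.up x).up y) ∧
      SameAt y ((ρ.up x).up y) ∧
      ((circleOf (ρ.up x) y.northEdge = circleOf (ρ.up x) x.northEdge ∧
        circleOf (ρ.up x) y.southEdge = circleOf (ρ.up x) x.southEdge) ∨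
      (circleOf (ρ.up x) y.northEdge = circleOf (ρ.up x) x.southEdge ∧
        circleOf (ρ.up x) y.southEdge = circleOf (ρ.up x) x.northEdge)) := by
  obtain ⟨h1, h2⟩ := h
  have a : ¬ SameAt x (ρ.up x) := fun h' => h2 (h'.refines (differAt_up x ρ).symm h1)
  have b : ¬ SameAt y (ρ.up y) := fun h' => (sameAt_up_x hy).1 h' h1
  have c : SameAt y ((ρ.up x).up y) := (sameAt_up_up_right hxy hy).2 h2
  have d := circleOf_cases (differAt_up x ρ).symm h2 h1
  refine ⟨a, b, ?_, c, d⟩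
  unfold SameAt
  rcases d with ⟨e1, e2⟩ | ⟨e1, e2⟩
  · rw [← c.refines (differAt_up y _).symm e1, ← c.refines (differAt_up y _).symm e2]
    exact c
  · rw [← c.refines (differAt_up y _).symm e1, ← c.refines (differAt_up y _).symm e2]
    exact c.symm

theorem isLadybug_of_sameAt (hx : ρ x = false) (h1 : ¬ SameAt x (ρ.up x))
    (h2 : ¬ SameAt y (ρ.up x)) (h3 : SameAt x ((ρ.up x).up y)) : IsLadybug ρ x y := by
  refine ⟨?_, h2⟩
  have hs : SameAt x ρ := not_not.1 ((sameAt_up_x hx).not.1 h1)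
  rcases circleOf_cases (differAt_up y (ρ.up x)) h1 h3 with ⟨e1, e2⟩ | ⟨e1, e2⟩
  · rw [← hs.refines (differAt_up x ρ) e1, ← hs.refines (differAt_up x ρ) e2]
    exact hs
  · rw [← hs.refines (differAt_up x ρ) e1, ← hs.refines (differAt_up x ρ) e2]
    exact hs.symm

theorem single_sub_single_ne_zero {I : Type} {a b : I} (h : a ≠ b) :
    (Finsupp.single a 1 - Finsupp.single b 1 : I →₀ ℤ) ≠ 0 := by
  intro h'
  have := DFunLike.congr_fun h' a
  simp [h.symm] at this

/-- Contraction with the coordinate `i` maps the product to minus `w i` times `v`. -/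
theorem ι_mul_ι_ne_zero {I : Type} {v w : I →₀ ℤ} (hv : v ≠ 0) {i : I} (hi : v i = 0)
    (hw : w i ≠ 0) : ι ℤ v * ι ℤ w ≠ 0 := by
  intro h
  have e := CliffordAlgebra.contractLeft_ι_mul (Q := (0 : QuadraticForm ℤ (I →₀ ℤ)))
    (Finsupp.lapply i) v (CliffordAlgebra.ι _ w)
  rw [CliffordAlgebra.contractLeft_ι, Finsupp.lapply_apply, Finsupp.lapply_apply, hi, zero_smul,
    zero_sub, ← Algebra.commutes, ← Algebra.smul_def] at e
  have h' : CliffordAlgebra.ι (0 : QuadraticForm ℤ (I →₀ ℤ)) v * CliffordAlgebra.ι _ w = 0 := h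
  rw [h', map_zero, eq_comm, neg_eq_zero, ← map_smul] at e
  exact smul_ne_zero hw hv ((ι_eq_zero_iff (R := ℤ) (w i • v)).1 e)

/-- The composites of a face that is not a ladybug do not vanish. -/
theorem edgeMap_edgeMap_one_ne_zero (o : Arrows D) (hxy : x ≠ y) (hx : ρ x = false)
    (hy : ρ y = false) (hl : ¬ IsLadybug ρ x y) :
    edgeMap ℤ o y (ρ.up x) ((ρ.up x).up y) (edgeMap ℤ o x ρ (ρ.up x) 1) ≠ 0 := by
  have hm : ∀ a b : D.Circle (ρ.up x), ExteriorAlgebra.map (circleMap ℤ (ρ.up x) ((ρ.up x).up y))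
      (ι ℤ (Finsupp.single a 1 - Finsupp.single b 1)) = ι ℤ (Finsupp.single
        (circleFun (ρ.up x) ((ρ.up x).up y) a) 1 -
        Finsupp.single (circleFun (ρ.up x) ((ρ.up x).up y) b) 1) := by
    intro a b
    rw [map_apply_ι, circleMap, map_sub, Finsupp.lmapDomain_apply, Finsupp.lmapDomain_apply,
      Finsupp.mapDomain_single, Finsupp.mapDomain_single]
    rfl
  have dy := differAt_up y (ρ.up x)
  -- The four cases are merges and splits at the two crossings. A split followed by a merge
  -- annihilates the unit only if the two parts are merged again, that is, on a ladybug.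
  by_cases h1 : SameAt x (ρ.up x) <;> by_cases h2 : SameAt y ((ρ.up x).up y) <;>
    simp only [edgeMap, o.same_iff, h1, h2, if_true, if_false, LinearMap.comp_apply,
      AlgHom.toLinearMap_apply, map_one, LinearMap.mulLeft_apply, mul_one]
  · exact one_ne_zero
  · rw [ne_eq, ι_eq_zero_iff]
    exact single_sub_single_ne_zero fun h => h2 ((o.same_iff _ _).1 h)
  · rw [hm, ne_eq, ι_eq_zero_iff]
    refine single_sub_single_ne_zero fun h => hl ?_
    rw [h2.circleFun dy, h2.circleFun dy, o.same_iff] at h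
    exact isLadybug_of_sameAt hx h1 ((sameAt_up_up_right hxy hy).1 h2) h
  · have hc := single_sub_single_ne_zero fun h => h2 ((o.same_iff y _).1 h)
    have h3 : SameAt y (ρ.up x) := not_not.1 ((sameAt_up_up_right hxy hy).not.1 h2)
    have h4 : circleOf (ρ.up x) (o.tail x) ≠ circleOf (ρ.up x) (o.head x) :=
      fun h => h1 ((o.same_iff x _).1 h)
    have key : ∀ (e e' : D.Edge), circleOf (ρ.up x) e ≠ circleOf (ρ.up x) e' →
        ¬ Through y (ρ.up x) e →
        circleFun (ρ.up x) ((ρ.up x).up y) (circleOf (ρ.up x) e) ≠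
          circleFun (ρ.up x) ((ρ.up x).up y) (circleOf (ρ.up x) e') ∧
        circleOf ((ρ.up x).up y) (o.tail y) ≠
          circleFun (ρ.up x) ((ρ.up x).up y) (circleOf (ρ.up x) e) ∧
        circleOf ((ρ.up x).up y) (o.head y) ≠
          circleFun (ρ.up x) ((ρ.up x).up y) (circleOf (ρ.up x) e) := by
      intro e e' hne ht
      have h5 : circleFun (ρ.up x) ((ρ.up x).up y) (circleOf (ρ.up x) e) =
        circleOf ((ρ.up x).up y) e := (circleFun_eq_iff dy ht _).2 rfl
      have ht' := (through_congr dy e).not.1 ht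
      rw [h5]
      refine ⟨fun h => hne ((circleFun_eq_iff dy ht _).1 h.symm).symm, ?_⟩
      unfold Through at ht'
      rcases o.ends y with ⟨a, b⟩ | ⟨a, b⟩ <;> rw [a, b] <;> tauto
    rw [hm]
    -- The second split affects one circle only, so one of the two parts of the first split is
    -- untouched; its coordinate shows that the product does not vanish.
    have ht : ¬ Through y (ρ.up x) (o.tail x) ∨ ¬ Through y (ρ.up x) (o.head x) := by
      by_contra! h
      unfold Through at h
      rw [← show circleOf (ρ.up x) y.northEdge = circleOf (ρ.up x) y.southEdge from h3,
        or_self, or_self] at h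
      exact h4 (h.1.trans h.2.symm)
    rcases ht with ht | ht
    · obtain ⟨k1, k2, k3⟩ := key _ _ h4 ht
      exact ι_mul_ι_ne_zero hc (i := circleFun (ρ.up x) ((ρ.up x).up y) (circleOf (ρ.up x) (o.tail x)))
        (by simp [k2, k3]) (by simp [k1.symm])
    · obtain ⟨k1, k2, k3⟩ := key _ _ h4.symm ht
      exact ι_mul_ι_ne_zero hc (i := circleFun (ρ.up x) ((ρ.up x).up y) (circleOf (ρ.up x) (o.head x)))
        (by simp [k2, k3]) (by simp [k1.symm])

theorem mul_eq_one_iff_eq {u v : ℤˣ} : u * v = 1 ↔ u = v := by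
  rw [mul_eq_one_iff_eq_inv, Int.units_inv_eq_self]

/-- Reversing one of the two arrows exchanges the two kinds of ladybugs, and reversing both does
not. So for assignments of equal type the product of the signs of a face changes by the product of
the arrow signs. -/
theorem sign_arith {u u' δ δ' : ℤˣ} {t t' T : Prop} (h : u = 1 ↔ (t ↔ T)) (h' : u' = 1 ↔ (t' ↔ T))
    (hδ : (t' ↔ t) ↔ δ = δ') : u * u' = δ * δ' := by
  have ne_one : ∀ {u : ℤˣ}, u ≠ 1 → u = -1 := fun h => (Int.units_eq_one_or _).resolve_left h
  have hu : u = u' ↔ δ = δ' := by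
    rw [← hδ]
    by_cases h1 : u = 1 <;> by_cases h2 : u' = 1
    · rw [h1, h2]; tauto
    · have : u ≠ u' := fun e => h2 (e ▸ h1)
      tauto
    · have : u ≠ u' := fun e => h1 (e ▸ h2)
      tauto
    · rw [ne_one h1, ne_one h2]; tauto
  by_cases e : δ = δ'
  · rw [mul_eq_one_iff_eq.2 e, mul_eq_one_iff_eq.2 (hu.2 e)]
  · rw [ne_one (mt mul_eq_one_iff_eq.1 e), ne_one (mt mul_eq_one_iff_eq.1 (mt hu.1 e))]

/-- Two linear relations with unit coefficients between the same vectors, one of which is not zero,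
are proportional. This is where the absence of torsion is used. -/
theorem units_mul_eq {I : Type} [LinearOrder I] {p q p' q' : ℤˣ}
    {u v : ExteriorAlgebra ℤ (I →₀ ℤ)} (hu : u ≠ 0) (h1 : (p : ℤ) • u + (q : ℤ) • v = 0)
    (h2 : (p' : ℤ) • u + (q' : ℤ) • v = 0) : p * p' = q * q' := by
  have h3 : ((q' : ℤ) * p - q * p') • u = 0 := by
    have e1 := congrArg ((q' : ℤ) • ·) h1
    have e2 := congrArg ((q : ℤ) • ·) h2
    simp only [smul_add, smul_smul, smul_zero] at e1 e2
    rw [sub_smul, eq_neg_of_add_eq_zero_left e1, eq_neg_of_add_eq_zero_left e2, mul_comm (q : ℤ)]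
    exact sub_self _
  have h4 : ((q' : ℤ) * p - q * p') = 0 := by
    have e := congrArg (stdBasis ℤ _).repr h3
    rw [map_smul, map_zero, smul_eq_zero] at e
    exact e.resolve_right fun h' => hu ((stdBasis ℤ _).repr.map_eq_zero_iff.1 h')
  have h5 : q' * p = q * p' := Units.ext (by push_cast; exact sub_eq_zero.1 h4)
  have h6 := mul_eq_one_iff_eq.2 h5
  rw [← mul_eq_one_iff_eq, ← h6]
  ac_rfl

end Faces

namespace GridIso

variable (F : GridIso D D')

/-! ### Isomorphisms and the edge maps -/

/-- The isomorphism of exterior algebras. -/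
def ext (ρ : D.Resolution) : ExteriorAlgebra ℤ (V ℤ ρ) →ₐ[ℤ] ExteriorAlgebra ℤ (V ℤ (F.res ρ)) :=
  ExteriorAlgebra.map (Finsupp.lmapDomain ℤ ℤ (F.circle ρ))

theorem ext_injective (ρ : D.Resolution) : Function.Injective (F.ext ρ) := by
  refine map_injective ⟨Finsupp.lmapDomain ℤ ℤ (F.circleEquiv ρ).symm, ?_⟩
  refine Finsupp.lhom_ext fun C a => ?_
  simp only [LinearMap.comp_apply, Finsupp.lmapDomain_apply, Finsupp.mapDomain_single]
  rw [show F.circle ρ C = F.circleEquiv ρ C from rfl, Equiv.symm_apply_apply]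
  rfl

variable (o : Arrows D) (o' : Arrows D')

/-- Compares the arrows of two diagrams. -/
def arrowSign (x : D.Crossing) : ℤˣ :=
  if (o x = o' (F.crossing x) ↔ F.keep x.pt = true) then 1 else -1

theorem match_tail_head (x : D.Crossing) : (F.arrowSign o o' x = 1 ∧
      F.Match (o.tail x) (o'.tail (F.crossing x)) ∧ F.Match (o.head x) (o'.head (F.crossing x))) ∨
    (F.arrowSign o o' x = -1 ∧
      F.Match (o.tail x) (o'.head (F.crossing x)) ∧ F.Match (o.head x) (o'.tail (F.crossing x))) := by
  obtain ⟨h1, h2⟩ := F.leaves_crossing x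
  unfold arrowSign Arrows.tail Arrows.head
  cases o x <;> cases o' (F.crossing x) <;> cases hk : F.keep x.pt <;>
    simp only [hk, if_true, if_false, Bool.false_eq_true] at h1 h2 ⊢ <;> simp [h1, h2]

theorem circle_eq_iff {ρ : D.Resolution} {e f : D.Edge} {e' f' : D'.Edge} (h : F.Match e e')
    (h' : F.Match f f') : circleOf (F.res ρ) e' = circleOf (F.res ρ) f' ↔
      circleOf ρ e = circleOf ρ f := by
  rw [← h.circle, ← h'.circle, (F.circle_bijective ρ).1.eq_iff]

theorem sameAt_res (x : D.Crossing) (ρ : D.Resolution) :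
    SameAt (F.crossing x) (F.res ρ) ↔ SameAt x ρ := by
  obtain ⟨h1, h2⟩ := F.leaves_crossing x
  unfold SameAt
  rw [← F.circle_eq_iff h1 h2]
  split_ifs
  · rfl
  · exact eq_comm

theorem differAt_res {x : D.Crossing} {ρ ρ' : D.Resolution} (h : DifferAt x ρ ρ') :
    DifferAt (F.crossing x) (F.res ρ) (F.res ρ') := by
  intro y hy
  obtain ⟨y, rfl⟩ := F.crossing.surjective y
  rw [res_crossing, res_crossing, h y fun e => hy (congrArg _ e)]

/-- After a split the representing edges of a circle may lie on different parts, depending on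
choices. This is the only way in which the lift of circles fails to commute with an isomorphism. -/
theorem circleFun_circle {x : D.Crossing} {ρ ρ' : D.Resolution} (h : DifferAt x ρ ρ')
    (C : D.Circle ρ) :
    circleFun (F.res ρ) (F.res ρ') (F.circle ρ C) = F.circle ρ' (circleFun ρ ρ' C) ∨
    (¬ SameAt x ρ' ∧
      (circleFun (F.res ρ) (F.res ρ') (F.circle ρ C) = circleOf _ (F.crossing x).northEdge ∨
        circleFun (F.res ρ) (F.res ρ') (F.circle ρ C) = circleOf _ (F.crossing x).southEdge) ∧
      (F.circle ρ' (circleFun ρ ρ' C) = circleOf _ (F.crossing x).northEdge ∨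
        F.circle ρ' (circleFun ρ ρ' C) = circleOf _ (F.crossing x).southEdge)) := by
  obtain ⟨e, e', hm, rfl⟩ := F.exists_match C
  rw [hm.circle]
  by_cases hs : SameAt x ρ'
  · rw [hs.circleFun h, ((F.sameAt_res x ρ').2 hs).circleFun (F.differAt_res h), hm.circle]
    exact Or.inl rfl
  · obtain ⟨h1, h2⟩ := F.leaves_crossing x
    have hth : Through x ρ e ↔ Through (F.crossing x) (F.res ρ) e' := by
      unfold Through
      rw [← F.circle_eq_iff hm h1, ← F.circle_eq_iff hm h2]
      split_ifs
      · rfl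
      · exact or_comm
    by_cases ht : Through x ρ e
    · refine Or.inr ⟨hs, (circleFun_through (F.differAt_res h) _).2 (hth.1 ht), ?_⟩
      have := (circleFun_through h _).2 ht
      rcases this with h3 | h3
      · rw [h3, h1.circle]
        split_ifs
        · exact Or.inl rfl
        · exact Or.inr rfl
      · rw [h3, h2.circle]
        split_ifs
        · exact Or.inr rfl
        · exact Or.inl rfl
    · left
      rw [(circleFun_eq_iff h ht _).2 rfl,
        (circleFun_eq_iff (F.differAt_res h) (hth.not.1 ht) _).2 rfl, hm.circle]

/-- The sign by which an isomorphism fails to commute with the edge maps. -/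
def mapSign (x : D.Crossing) (ρ' : D.Resolution) : ℤˣ :=
  if SameAt x ρ' then 1 else F.arrowSign o o' x

/-- For a split the arrow may be reversed, which gives a sign. The ambiguity of the lift is killed
by the factor that is the difference of the two parts. -/
theorem edgeMap_ext {x : D.Crossing} {ρ ρ' : D.Resolution} (h : DifferAt x ρ ρ')
    (z : ExteriorAlgebra ℤ (V ℤ ρ)) :
    edgeMap ℤ o' (F.crossing x) (F.res ρ) (F.res ρ') (F.ext ρ z) =
      ((F.mapSign o o' x ρ' : ℤˣ) : ℤ) • F.ext ρ' (edgeMap ℤ o x ρ ρ' z) := by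
  have comp : ∀ {M N K : Type} [AddCommGroup M] [AddCommGroup N] [AddCommGroup K]
      (f : M →ₗ[ℤ] N) (g : N →ₗ[ℤ] K) (z : ExteriorAlgebra ℤ M),
      ExteriorAlgebra.map g (ExteriorAlgebra.map f z) = ExteriorAlgebra.map (g ∘ₗ f) z :=
    fun f g z => DFunLike.congr_fun (map_comp_map f g) z
  by_cases hs : SameAt x ρ'
  · rw [edgeMap, edgeMap, if_pos ((o'.same_iff _ _).2 ((F.sameAt_res x ρ').2 hs)),
      if_pos ((o.same_iff _ _).2 hs), mapSign, if_pos hs, Units.val_one, one_smul]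
    simp only [AlgHom.toLinearMap_apply, ext, comp]
    congr 2
    refine Finsupp.lhom_ext fun C a => ?_
    simp only [circleMap, LinearMap.comp_apply, Finsupp.lmapDomain_apply, Finsupp.mapDomain_single]
    exact congrArg (Finsupp.single · a) ((F.circleFun_circle h C).resolve_right fun h' => h'.1 hs)
  · rw [edgeMap, edgeMap, if_neg fun h => hs ((F.sameAt_res x ρ').1 ((o'.same_iff _ _).1 h)),
      if_neg fun h => hs ((o.same_iff _ _).1 h), mapSign, if_neg hs]
    simp only [LinearMap.comp_apply, LinearMap.mulLeft_apply, AlgHom.toLinearMap_apply, map_mul,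
      ext, comp, map_apply_ι, map_sub, Finsupp.lmapDomain_apply, Finsupp.mapDomain_single]
    rw [← smul_mul_assoc, ← map_sub, ← map_sub]
    have e1 : ((F.arrowSign o o' x : ℤˣ) : ℤ) • ι ℤ
        (Finsupp.single (F.circle ρ' (circleOf ρ' (o.tail x))) (1 : ℤ) -
          Finsupp.single (F.circle ρ' (circleOf ρ' (o.head x))) 1) =
        ι ℤ (Finsupp.single (circleOf (F.res ρ') (o'.tail (F.crossing x))) 1 -
          Finsupp.single (circleOf (F.res ρ') (o'.head (F.crossing x))) 1) := by
      rw [← map_smul]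
      congr 1
      rcases F.match_tail_head o o' x with ⟨h0, h1, h2⟩ | ⟨h0, h1, h2⟩ <;>
        rw [h0, h1.circle, h2.circle]
      · simp
      · simp
    rw [e1]
    refine ι_mul_map_congr _ _ _ (fun v => ?_) z
    induction v using Finsupp.induction_linear with
    | zero => exact ⟨0, by simp⟩
    | add v w hv hw =>
      obtain ⟨a, ha⟩ := hv
      obtain ⟨b, hb⟩ := hw
      exact ⟨a + b, by rw [map_add, map_add, add_sub_add_comm, ha, hb, add_smul]⟩
    | single C a =>
      simp only [circleMap, LinearMap.comp_apply, Finsupp.lmapDomain_apply,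
        Finsupp.mapDomain_single]
      change ∃ b : ℤ, Finsupp.single (circleFun (F.res ρ) (F.res ρ') (F.circle ρ C)) a -
        Finsupp.single (F.circle ρ' (circleFun ρ ρ' C)) a = _
      have hs1 : ∀ C : D'.Circle (F.res ρ'), Finsupp.single C a = a • Finsupp.single C (1 : ℤ) := by
        simp
      simp only [hs1]
      rcases F.circleFun_circle h C with h1 | ⟨-, h1, h2⟩
      · exact ⟨0, by rw [h1]; simp⟩
      · rcases o'.ends (F.crossing x) with ⟨h3, h4⟩ | ⟨h3, h4⟩ <;> rw [h3, h4] <;>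
          rcases h1 with h1 | h1 <;> rcases h2 with h2 | h2 <;> rw [h1, h2]
        all_goals first
          | exact ⟨0, by module⟩
          | exact ⟨a, by module⟩
          | exact ⟨-a, by module⟩

variable {τ : Bool} (E : EdgeAssignment D τ) (E' : EdgeAssignment D' τ)

/-- The product of the signs of two corresponding edges of the cubes and of the sign by which the
edge maps differ. -/
def edgeSign (ρ : D.Resolution) (x : D.Crossing) : ℤˣ :=
  E.sign ρ x * E'.sign (F.res ρ) (F.crossing x) * F.mapSign E.arrows E'.arrows x (ρ.up x)

theorem isLadybug_res {ρ : D.Resolution} {x y : D.Crossing} :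
    IsLadybug (F.res ρ) (F.crossing x) (F.crossing y) ↔ IsLadybug ρ x y := by
  have h1 := F.sameAt_res y ρ
  have h2 := F.sameAt_res y (ρ.up x)
  rw [F.res_up] at h2
  exact and_congr h1 h2.not

theorem tailMeetsTail_res {ρ : D.Resolution} {x y : D.Crossing} (hxy : x ≠ y) (hy : ρ y = false)
    (hl : IsLadybug ρ x y) : (TailMeetsTail o' (F.res ρ) (F.crossing x) (F.crossing y) ↔
      TailMeetsTail o ρ x y) ↔ F.arrowSign o o' x = F.arrowSign o o' y := by
  obtain ⟨l1, -, -, -, l5⟩ := hl.sameAt hxy hy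
  have hh : circleOf (ρ.up x) (o.tail x) ≠ circleOf (ρ.up x) (o.head x) ∧
      ((circleOf (ρ.up x) (o.tail y) = circleOf (ρ.up x) (o.tail x) ∧
        circleOf (ρ.up x) (o.head y) = circleOf (ρ.up x) (o.head x)) ∨
      (circleOf (ρ.up x) (o.tail y) = circleOf (ρ.up x) (o.head x) ∧
        circleOf (ρ.up x) (o.head y) = circleOf (ρ.up x) (o.tail x))) := by
    refine ⟨fun h => l1 ((o.same_iff _ _).1 h), ?_⟩
    rcases o.ends x with ⟨e1, e2⟩ | ⟨e1, e2⟩ <;>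
      rcases o.ends y with ⟨e3, e4⟩ | ⟨e3, e4⟩ <;> rw [e1, e2, e3, e4] <;> tauto
  have ne1 : (-1 : ℤˣ) ≠ 1 := by decide
  unfold TailMeetsTail
  rw [← F.res_up]
  obtain ⟨hne, hh⟩ := hh
  rcases F.match_tail_head o o' x with ⟨h0, h1, h2⟩ | ⟨h0, h1, h2⟩ <;>
    rcases F.match_tail_head o o' y with ⟨h3, h4, h5⟩ | ⟨h3, h4, h5⟩ <;>
    rw [h0, h3]
  · rw [F.circle_eq_iff h4 h1]
    simp
  · rw [F.circle_eq_iff h5 h1]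
    rcases hh with ⟨e1, e2⟩ | ⟨e1, e2⟩ <;> rw [e1, e2] <;> simp [hne.symm, ne1.symm]
  · rw [F.circle_eq_iff h4 h2]
    rcases hh with ⟨e1, e2⟩ | ⟨e1, e2⟩ <;> rw [e1] <;> simp [hne, hne.symm, ne1]
  · rw [F.circle_eq_iff h5 h2]
    rcases hh with ⟨e1, e2⟩ | ⟨e1, e2⟩ <;> rw [e1, e2] <;> simp [hne, hne.symm]

/-- On a ladybug the type determines the product of the signs of the face. On every other face the
composites do not vanish, and anticommutation in both cubes determines it. -/
theorem edgeSign_cocycle {ρ : D.Resolution} {x y : D.Crossing} (hxy : x ≠ y) (hx : ρ x = false)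
    (hy : ρ y = false) : F.edgeSign E E' ρ x * F.edgeSign E E' (ρ.up x) y =
      F.edgeSign E E' ρ y * F.edgeSign E E' (ρ.up y) x := by
  have comm : (ρ.up y).up x = (ρ.up x).up y := Function.update_comm hxy.symm _ _ _
  have hx' : F.res ρ (F.crossing x) = false := by rw [res_crossing, hx]
  have hy' : F.res ρ (F.crossing y) = false := by rw [res_crossing, hy]
  have hxy' := F.crossing.injective.ne hxy
  unfold edgeSign
  rw [comm]
  by_cases hl : IsLadybug ρ x y
  · obtain ⟨l1, l2, l3, l4, l5⟩ := hl.sameAt hxy hy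
    have a := E.ladybug ρ x y hxy hx hy hl
    have a' := E'.ladybug _ _ _ hxy' hx' hy' (F.isLadybug_res.2 hl)
    rw [mapSign, mapSign, mapSign, mapSign, if_neg l1, if_pos l4, if_neg l2, if_pos l3]
    rw [← F.res_up, ← F.res_up] at a'
    have key := sign_arith a a' (F.tailMeetsTail_res E.arrows E'.arrows hxy hy hl)
    rw [← mul_eq_one_iff_eq, mul_one, mul_one, ← mul_eq_one_iff_eq.2 key]
    ac_rfl
  · have hz := edgeMap_edgeMap_one_ne_zero E.arrows hxy hx hy hl
    have a := LinearMap.congr_fun (E.anticomm ρ x y hxy hx hy) 1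
    have a' : ∀ r₁ r₂ r₃, r₁ = (F.res ρ).up (F.crossing x) → r₂ = (F.res ρ).up (F.crossing y) →
        r₃ = ((F.res ρ).up (F.crossing x)).up (F.crossing y) →
        ((E'.sign (F.res ρ) (F.crossing x) * E'.sign r₁ (F.crossing y) : ℤˣ) : ℤ) •
          edgeMap ℤ E'.arrows (F.crossing y) r₁ r₃
            (edgeMap ℤ E'.arrows (F.crossing x) (F.res ρ) r₁ (F.ext ρ 1)) +
        ((E'.sign (F.res ρ) (F.crossing y) * E'.sign r₂ (F.crossing x) : ℤˣ) : ℤ) •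
          edgeMap ℤ E'.arrows (F.crossing x) r₂ r₃
            (edgeMap ℤ E'.arrows (F.crossing y) (F.res ρ) r₂ (F.ext ρ 1)) = 0 := by
      rintro _ _ _ rfl rfl rfl
      exact LinearMap.congr_fun (E'.anticomm _ _ _ hxy' hx' hy') _
    have a' := a' _ _ _ (F.res_up _ _) (F.res_up _ _) (by rw [← F.res_up, ← F.res_up])
    rw [F.edgeMap_ext E.arrows E'.arrows (differAt_up x ρ),
      F.edgeMap_ext E.arrows E'.arrows (differAt_up y ρ), LinearMap.map_smul, LinearMap.map_smul,
      F.edgeMap_ext E.arrows E'.arrows (differAt_up y _),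
      F.edgeMap_ext E.arrows E'.arrows (differAt_up_up hxy ρ), smul_smul, smul_smul, smul_smul,
      smul_smul, ← map_smul (F.ext _), ← map_smul (F.ext _), ← map_add (F.ext _), ← map_zero (F.ext _), ← Units.val_mul,
      ← Units.val_mul, ← Units.val_mul, ← Units.val_mul] at a'
    have a'' := F.ext_injective _ a'
    have := units_mul_eq hz a a''
    rw [← mul_eq_one_iff_eq] at this ⊢
    rw [← this]
    ac_rfl

end GridIso

end GridDiagram

end

/-! ### Changes of sign on a cube -/

section
/-- A sign on the edges of a cube whose product around each face is `1` comes from signs on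
the vertices. -/
theorem exists_gauge {X : Type} [Fintype X] [DecidableEq X] (r : (X → Bool) → X → ℤˣ)
    (h : ∀ ρ x y, x ≠ y → ρ x = false → ρ y = false → r ρ x * r (Function.update ρ x true) y =
      r ρ y * r (Function.update ρ y true) x) :
    ∃ γ : (X → Bool) → ℤˣ, ∀ ρ x, ρ x = false → r ρ x = γ ρ * γ (Function.update ρ x true) := by
  suffices H : ∀ s : Finset X, ∃ γ : (X → Bool) → ℤˣ, ∀ ρ, ∀ x ∈ s, ρ x = false →
      r ρ x = γ ρ * γ (Function.update ρ x true) by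
    obtain ⟨γ, hγ⟩ := H Finset.univ
    exact ⟨γ, fun ρ x => hγ ρ x (Finset.mem_univ x)⟩
  intro s
  induction s using Finset.induction_on with
  | empty => exact ⟨1, by simp⟩
  | insert a s ha ih =>
    obtain ⟨γ, hγ⟩ := ih
    -- In the new direction `a` the signs on the half `ρ a = false` are kept, and on the other half
    -- they are transported along the edge in direction `a`. The condition on the faces makes this
    -- consistent with the earlier directions.
    refine ⟨fun ρ => if ρ a = true then r (Function.update ρ a false) a *
      γ (Function.update ρ a false) else γ ρ, fun ρ x hx h0 => ?_⟩
    beta_reduce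
    have sq : ∀ u : ℤˣ, u * u = 1 := Int.units_mul_self
    by_cases hxa : x = a
    · subst hxa
      rw [if_neg (by simp [h0]), if_pos (by simp), Function.update_idem, ← h0,
        Function.update_eq_self, mul_left_comm, sq, mul_one]
    · have hs := (Finset.mem_insert.1 hx).resolve_left hxa
      rw [Function.update_of_ne (Ne.symm hxa)]
      by_cases ha : ρ a = true
      · rw [if_pos ha, if_pos ha, Function.update_comm hxa]
        set σ := Function.update ρ a false with hσ
        have e1 : ρ = Function.update σ a true := by
          rw [hσ, Function.update_idem, ← ha, Function.update_eq_self]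
        have hσx : σ x = false := by rw [hσ, Function.update_of_ne hxa, h0]
        have e2 := h σ x a hxa hσx (by simp [hσ])
        rw [← e1, hγ σ x hs hσx] at e2
        rw [← mul_one (r ρ x), ← sq (r σ a)]
        calc _ = r σ a * (r σ a * r ρ x) := by ac_rfl
          _ = _ := by rw [← e2]; ac_rfl
      · rw [if_neg ha, if_neg ha]
        exact hγ ρ x hs h0

/-! ### Signed permutations of bases -/

section SignedPerm

variable {S S' R : Type} [CommRing R]

/-- Matrices that correspond to each other under a bijection of the bases with signs. -/
def SignedPerm (Θ : S ≃ S') (η : S → ℤˣ) (M : Matrix S S R) (M' : Matrix S' S' R) : Prop :=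
  ∀ t s, M' (Θ t) (Θ s) = ((η t * η s : ℤˣ) : ℤ) • M t s

variable {Θ : S ≃ S'} {η : S → ℤˣ} {M N : Matrix S S R} {M' N' : Matrix S' S' R}

namespace SignedPerm

theorem mul [Fintype S] [Fintype S'] (h : SignedPerm Θ η M M') (h' : SignedPerm Θ η N N') :
    SignedPerm Θ η (M * N) (M' * N') := by
  intro t s
  rw [Matrix.mul_apply, Matrix.mul_apply, ← Θ.sum_comp, Finset.smul_sum]
  refine Finset.sum_congr rfl fun u _ => ?_
  rw [h, h', smul_mul_smul_comm, ← Units.val_mul]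
  congr 2
  rw [mul_mul_mul_comm, mul_comm (η t), ← mul_one (η t * η s), ← Int.units_mul_self (η u)]
  ac_rfl

theorem add (h : SignedPerm Θ η M M') (h' : SignedPerm Θ η N N') :
    SignedPerm Θ η (M + N) (M' + N') := fun t s => by
  rw [Matrix.add_apply, Matrix.add_apply, h, h', smul_add]

theorem sub (h : SignedPerm Θ η M M') (h' : SignedPerm Θ η N N') :
    SignedPerm Θ η (M - N) (M' - N') := fun t s => by
  rw [Matrix.sub_apply, Matrix.sub_apply, h, h', smul_sub]

theorem diagonal [DecidableEq S] [DecidableEq S'] {a : S → R} {b : S' → R}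
    (h : ∀ s, b (Θ s) = a s) : SignedPerm Θ η (Matrix.diagonal a) (Matrix.diagonal b) := by
  intro t s
  by_cases e : t = s
  · subst e
    rw [Matrix.diagonal_apply_eq, Matrix.diagonal_apply_eq, Int.units_mul_self, h, Units.val_one,
      one_smul]
  · rw [Matrix.diagonal_apply_ne _ e, Matrix.diagonal_apply_ne _ (Θ.injective.ne e), smul_zero]

theorem one [DecidableEq S] [DecidableEq S'] :
    SignedPerm Θ η (1 : Matrix S S R) (1 : Matrix S' S' R) := by
  rw [← Matrix.diagonal_one, ← Matrix.diagonal_one]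
  exact diagonal fun _ => rfl

theorem ext (h : SignedPerm Θ η M M') (h' : SignedPerm Θ η M N') : M' = N' := by
  ext t s
  obtain ⟨t, rfl⟩ := Θ.surjective t
  obtain ⟨s, rfl⟩ := Θ.surjective s
  rw [h, h']

/-- The transported inverse is a right inverse of `M'`, and inverses are unique. -/
theorem ringInverse [Fintype S] [Fintype S'] [DecidableEq S] [DecidableEq S']
    (h : SignedPerm Θ η M M') (hM : IsUnit M) (hM' : IsUnit M') :
    SignedPerm Θ η (Ring.inverse M) (Ring.inverse M') := by
  let N' : Matrix S' S' R := fun t s =>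
    ((η (Θ.symm t) * η (Θ.symm s) : ℤˣ) : ℤ) • Ring.inverse M (Θ.symm t) (Θ.symm s)
  have h' : SignedPerm Θ η (Ring.inverse M) N' := fun t s => by simp [N']
  have e := h.mul h'
  rw [Ring.mul_inverse_cancel _ hM] at e
  have e' : M' * N' = 1 := e.ext one
  have : Ring.inverse M' = N' := by
    rw [← mul_one (Ring.inverse M'), ← e', ← mul_assoc, Ring.inverse_mul_cancel _ hM', one_mul]
  rw [this]
  exact h'

end SignedPerm

end SignedPerm

/-! ### Transport of the reduced complex along an isomorphism of diagrams -/

namespace GridDiagram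

variable {n m : ℕ} {D : GridDiagram n} {D' : GridDiagram m}

open Classical ExteriorAlgebra

theorem equalWeight_equiv {X Y : Type} (e : X ≃ Y) {p : X → Prop} {q : Y → Prop}
    (h : ∀ x, q (e x) ↔ p x) (x : X) : equalWeight q (e x) = equalWeight p x := by
  unfold equalWeight
  rw [Nat.card_congr (e.subtypeEquiv fun x => (h x).symm)]
  exact if_congr (h x) rfl rfl

/-- It describes the points of a generator by the orientation alone, as the places where vertical
edges leave; in this form they are transported by an isomorphism. -/
theorem row_eq_iff_forall (g : D.Gen) (p : D.SpecialPoint) :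
    g.row p.1.1 = p.1.2 ↔
      ∀ d : Dir, d.vert = true → ∀ e : D.Edge, e.Leaves d p → d.sgn * genOmega g e = 1 := by
  have hb := (g.bounds p.1.1).1
  constructor
  · intro h d hd e he
    rw [Edge.LeavesAt.sgn_mul_genOmega he]
    cases d <;> simp [Dir.vert, genOut, h] at hd ⊢
  · intro h
    apply le_antisymm
    · by_cases hN : D.HasEnd p.1.1 p.1.2 .north
      · obtain ⟨e, he⟩ := D.exists_leavesAt hN
        have := h .north rfl e he
        rw [Edge.LeavesAt.sgn_mul_genOmega he, genOut] at this
        split_ifs at this with h'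
        exact h'
      · exact hb.2.trans (not_lt.1 fun h' => hN ⟨p.2.1.1, h'⟩)
    · by_cases hS : D.HasEnd p.1.1 p.1.2 .south
      · obtain ⟨e, he⟩ := D.exists_leavesAt hS
        have := h .south rfl e he
        rw [Edge.LeavesAt.sgn_mul_genOmega he, genOut] at this
        split_ifs at this with h'
        exact not_lt.1 h'
      · exact (not_lt.1 fun h' => hS ⟨h', p.2.1.2⟩).trans hb.1

namespace GridIso

variable (F : GridIso D D')

theorem exists_basisSign (ρ : D.Resolution) (S : Finset (D.Circle ρ)) : ∃ ε : ℤˣ,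
    F.ext ρ (stdBasis ℤ _ S) = (ε : ℤ) • stdBasis ℤ _ (S.map (F.circleEquiv ρ).toEmbedding) := by
  have hn : ((toList S).map (F.circle ρ)).Nodup :=
    (nodup_toList S).map (F.circle_bijective ρ).1
  have hS : ((toList S).map (F.circle ρ)).toFinset = S.map (F.circleEquiv ρ).toEmbedding := by
    ext C
    simp only [List.mem_toFinset, List.mem_map, mem_toList, Finset.mem_map]
    rfl
  have := map_wedge (F.circle ρ) (toList S) ℤ
  rw [wedge_eq ((toList S).map (F.circle ρ)), hS] at this
  rw [stdBasis_eq, ext, this]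
  rcases wedgeSign_eq hn with h | h
  · exact ⟨1, by rw [h]; rfl⟩
  · exact ⟨-1, by rw [h]; rfl⟩

/-- The sign of a basis vector. -/
def basisSign (s : D.State) : ℤˣ := (F.exists_basisSign s.1 s.2).choose

theorem basisSign_mul_edgeCoeff (o : Arrows D) (o' : Arrows D') {x : D.Crossing} {s t : D.State}
    (h : DifferAt x s.1 t.1) : (F.basisSign s : ℤ) * edgeCoeff o' (F.crossing x) (F.state s).1
      (F.state t).1 (F.state s).2 (F.state t).2 =
    (F.mapSign o o' x t.1 : ℤ) * (edgeCoeff o x s.1 t.1 s.2 t.2 * F.basisSign t) := by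
  obtain ⟨ρ, S⟩ := s
  obtain ⟨ρ', T⟩ := t
  have hb : ∀ s : D.State, F.ext s.1 (stdBasis ℤ _ s.2) = (F.basisSign s : ℤ) •
      stdBasis ℤ _ (s.2.map (F.circleEquiv s.1).toEmbedding) :=
    fun s => (F.exists_basisSign s.1 s.2).choose_spec
  have e := congrArg (fun z => (stdBasis ℤ _).repr z (T.map (F.circleEquiv ρ').toEmbedding))
    (F.edgeMap_ext o o' h (stdBasis ℤ _ S))
  have e1 := hb ⟨ρ, S⟩
  have e2 := fun T => hb ⟨ρ', T⟩
  simp only at e1 e2 e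
  rw [e1, map_smul, edgeMap_stdBasis, edgeMap_stdBasis] at e
  simp only [map_sum, map_smul, e2, Finsupp.smul_apply, Finsupp.finsetSum_apply,
    Module.Basis.repr_self, Finsupp.single_apply, smul_eq_mul, mul_ite, mul_one, mul_zero,
    Finset.sum_ite_eq', Finset.mem_univ, if_true, Finset.map_inj] at e
  exact e

variable {τ : Bool} (E : EdgeAssignment D τ) (E' : EdgeAssignment D' τ)

theorem exists_vertexSign : ∃ γ : D.Resolution → ℤˣ, ∀ ρ x, ρ x = false →
    F.edgeSign E E' ρ x = γ ρ * γ (ρ.up x) :=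
  exists_gauge _ fun _ _ _ hxy hx hy => F.edgeSign_cocycle E E' hxy hx hy

/-- The sign of a state. -/
def stateSign (s : D.State) : ℤˣ := (F.exists_vertexSign E E').choose s.1 * F.basisSign s

theorem isUp_res {ρ ρ' : D.Resolution} {x : D.Crossing} :
    IsUp (F.res ρ) (F.res ρ') (F.crossing x) ↔ IsUp ρ ρ' x := by
  rw [IsUp, IsUp, res_crossing, ← F.res_up]
  exact and_congr_right fun _ => (F.resEquiv.injective.eq_iff (a := ρ') (b := ρ.up x))

/-- The sign of a state combines the vertex sign, which absorbs the edge assignments and the arrows,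
with the sign from reordering the factors of the exterior product. -/
theorem diffMatrix_state : SignedPerm F.state (F.stateSign E E') (diffMatrix E) (diffMatrix E') := by
  intro t s
  rw [diffMatrix, diffMatrix, ← F.crossing.sum_comp, Finset.smul_sum]
  refine Finset.sum_congr rfl fun x _ => ?_
  have hu : IsUp (F.state s).1 (F.state t).1 (F.crossing x) ↔ IsUp s.1 t.1 x := F.isUp_res
  by_cases h : IsUp s.1 t.1 x
  · rw [if_pos h, if_pos (hu.2 h)]
    have e := F.basisSign_mul_edgeCoeff E.arrows E'.arrows (s := s) (t := t) h.differAt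
    have g := (F.exists_vertexSign E E').choose_spec s.1 x h.1
    rw [← h.2] at g
    have g' := congrArg (Units.val : ℤˣ → ℤ) g
    have sq : ∀ u : ℤˣ, (u : ℤ) * u = 1 := fun u => by
      rw [← Units.val_mul, Int.units_mul_self, Units.val_one]
    rw [edgeSign, ← h.2] at g'
    change ((E'.sign (F.res s.1) (F.crossing x) : ℤˣ) : ℤ) * _ = _
    simp only [stateSign, Units.val_mul, smul_eq_mul] at g' ⊢
    linear_combination
      (-(E'.sign (F.res s.1) (F.crossing x) : ℤ) * edgeCoeff E'.arrows (F.crossing x) (F.state s).1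
        (F.state t).1 (F.state s).2 (F.state t).2) * sq (F.basisSign s) +
      (E'.sign (F.res s.1) (F.crossing x) : ℤ) * F.basisSign s * e -
      ((E'.sign (F.res s.1) (F.crossing x) : ℤ) * F.basisSign s *
        F.mapSign E.arrows E'.arrows x t.1 * edgeCoeff E.arrows x s.1 t.1 s.2 t.2 *
        F.basisSign t) * sq (E.sign s.1 x) +
      ((F.basisSign t : ℤ) * F.basisSign s * E.sign s.1 x *
        edgeCoeff E.arrows x s.1 t.1 s.2 t.2) * g'
  · rw [if_neg h, if_neg (hu.not.2 h), smul_zero]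

theorem row_eq_iff {s : D.FigureEights} {s' : D'.FigureEights} {g : D.Gen} {g' : D'.Gen}
    (h : genState s' g' = F.state (genState s g)) (p : D.SpecialPoint) :
    g'.row (F.pt p).1.1 = (F.pt p).1.2 ↔ g.row p.1.1 = p.1.2 := by
  have vert : ∀ b (d : Dir), (d.turn b).vert = d.vert := by
    intro b d; cases b <;> cases d <;> rfl
  rw [row_eq_iff_forall, row_eq_iff_forall, ← genState_omega s, ← genState_omega s', h]
  constructor
  · intro H d hd e he
    obtain ⟨e', he'⟩ := F.exists_leaves he
    rw [← F.omega_state _ he he']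
    exact H _ (by rw [vert, hd]) e' he'
  · intro H d hd e' he'
    rw [← turn_turn (F.keep p) d] at he' ⊢
    obtain ⟨e, he⟩ := D.exists_leavesAt ((F.hasEnd_iff p _).1 (Edge.LeavesAt.hasEnd he'))
    rw [F.omega_state _ he he']
    exact H _ (by rw [vert, hd]) e he

variable {R : Type} [CommRing R]

theorem diffMatrixOver_state :
    SignedPerm F.state (F.stateSign E E') (diffMatrixOver E R) (diffMatrixOver E' R) := by
  intro t s
  rw [diffMatrixOver, diffMatrixOver, Matrix.map_apply, F.diffMatrix_state E E']
  simp

theorem leading_state :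
    SignedPerm F.state (F.stateSign E E') (leading E R) (leading E' R) := by
  intro t s
  rw [leading, leading, F.diffMatrixOver_state E E']
  by_cases h : t.omega = s.omega
  · rw [if_pos h, if_pos ((F.omega_state_eq_iff t s).2 h)]
  · rw [if_neg h, if_neg ((F.omega_state_eq_iff t s).not.2 h), smul_zero]

variable {W : (D.Crossing → Prop) → D.Crossing → R} {W' : (D'.Crossing → Prop) → D'.Crossing → R}
  (hW : ∀ p q, (∀ x, q (F.crossing x) ↔ p x) → ∀ x, W' q (F.crossing x) = W p x)

include hW

/-- The free crossings correspond, so naturality of the weights is all that is needed. Equal weights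
are natural; an arbitrarily chosen crossing need not be. -/
theorem weightedTranspose_state : SignedPerm F.state (F.stateSign E E') (weightedTranspose E R W)
    (weightedTranspose E' R W') := by
  intro t s
  rw [weightedTranspose, weightedTranspose, Matrix.sum_apply, Matrix.sum_apply,
    ← F.crossing.sum_comp, Finset.smul_sum]
  refine Finset.sum_congr rfl fun x _ => ?_
  rw [Matrix.mul_diagonal, Matrix.mul_diagonal, Matrix.transpose_apply, Matrix.transpose_apply,
    hW _ _ (F.free_state_iff s), IsCube.part, IsCube.part, F.leading_state E E',
    ← smul_mul_assoc, mul_comm (F.stateSign E E' t)]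
  congr 1
  have hx : (F.state t).1 (F.crossing x) = t.1 x := F.res_crossing t.1 x
  by_cases h : t.Free x
  · rw [hx, ← F.state_flip h]
    simp only [F.free_state_iff, EmbeddingLike.apply_eq_iff_eq, smul_ite, smul_zero]
  · rw [if_neg fun h' => h ((F.free_state_iff t x).1 h'.1), if_neg fun h' => h h'.1, smul_zero]

theorem reduced_state :
    SignedPerm F.state (F.stateSign E E') (reduced E R W) (reduced E' R W') := by
  have hd := F.diffMatrixOver_state E E' (R := R)
  have hl := F.leading_state E E' (R := R)
  have hw := F.weightedTranspose_state E E' hW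
  have hc : SignedPerm F.state (F.stateSign E E') (criticalPart (D := D) R)
      (criticalPart (D := D') R) :=
    .diagonal fun s => if_congr (F.isCritical_state_iff s) rfl rfl
  exact ((hc.mul hd).mul ((SignedPerm.one.add (((hw.mul hl).mul hw).mul (hd.sub hl))).ringInverse
    (isNilpotent_contraction_mul E W).isUnit_one_add
    (isNilpotent_contraction_mul E' W').isUnit_one_add)).mul hc

/-- Critical states correspond under the isomorphism, for any choice of the figure-eights; these
only decide which side of a crossing stands for which smoothing. -/
theorem exists_genEquiv (s : D.FigureEights) (s' : D'.FigureEights) :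
    ∃ (σ : D.Gen ≃ D'.Gen) (η : D.Gen → ℤˣ),
      (∀ g, P s' (σ g) = P s g ∧ J s' (σ g) = J s g ∧
        ∀ p, (σ g).row (F.pt p).1.1 = (F.pt p).1.2 ↔ g.row p.1.1 = p.1.2) ∧
      ∀ g h, genDifferential s' E' W' (Finsupp.single (σ g) 1) (σ h) =
        ((η g * η h : ℤˣ) : ℤ) • genDifferential s E W (Finsupp.single g 1) h := by
  have hex : ∀ g : D.Gen, ∃ g' : D'.Gen, genState s' g' = F.state (genState s g) := fun g =>
    exists_genState_eq s' ((F.isCritical_state_iff _).2 (isCritical_genState s g))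
  choose φ hφ using hex
  have hb : Function.Bijective φ := by
    constructor
    · intro g g' h
      have := congrArg (genState s') h
      rw [hφ, hφ] at this
      exact genState_injective s (F.state.injective this)
    · intro g'
      obtain ⟨t, ht⟩ := F.state.surjective (genState s' g')
      have hc : t.IsCritical := by
        rw [← F.isCritical_state_iff, ht]; exact isCritical_genState s' g'
      obtain ⟨g, rfl⟩ := exists_genState_eq s hc
      exact ⟨g, genState_injective s' ((hφ g).trans ht)⟩
  refine ⟨Equiv.ofBijective φ hb, fun g => F.stateSign E E' (genState s g), fun g => ?_,
    fun g h => ?_⟩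
  · have hd := F.deg_state (genState s g)
    rw [← hφ, deg_genState, deg_genState, Prod.mk.injEq] at hd
    exact ⟨by change P s' (φ g) = _; omega, hd.2, F.row_eq_iff (hφ g)⟩
  · rw [genDifferential_apply, genDifferential_apply]
    change reduced E' R W' (genState s' (φ h)) (genState s' (φ g)) = _
    rw [hφ, hφ, F.reduced_state E E' hW, mul_comm (F.stateSign E E' (genState s g))]

end GridIso

end GridDiagram

end

section
/-! ### Diffeomorphisms that preserve vertical and horizontal segments -/

theorem det_eq (L : ℝ × ℝ →L[ℝ] ℝ × ℝ) :
    L.det = (L (1, 0)).1 * (L (0, 1)).2 - (L (0, 1)).1 * (L (1, 0)).2 := by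
  rw [ContinuousLinearMap.det, ← LinearMap.det_toMatrix (Module.Basis.finTwoProd ℝ),
    Matrix.det_fin_two]
  simp [LinearMap.toMatrix_apply]

section Segments

open Set

/-- A continuous injective function on an interval preserves or reverses the order. -/
theorem lt_iff_of_injOn {g : ℝ → ℝ} {a b : ℝ} (hab : a ≤ b) (hc : ContinuousOn g (Icc a b))
    (hi : InjOn g (Icc a b)) :
    (StrictMonoOn g (Icc a b) ∧ ∀ x ∈ Icc a b, ∀ y ∈ Icc a b, g x < g y ↔ x < y) ∨
      (StrictAntiOn g (Icc a b) ∧ ∀ x ∈ Icc a b, ∀ y ∈ Icc a b, g x < g y ↔ y < x) :=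
  (hc.strictMonoOn_of_injOn_Icc' hab hi).imp
    (fun h => ⟨h, fun _ hx _ hy => h.lt_iff_lt hx hy⟩)
    (fun h => ⟨h, fun _ hx _ hy => h.lt_iff_gt hx hy⟩)

variable {f : ℝ × ℝ → ℝ × ℝ} {a b a₀ a₁ b₀ b₁ : ℝ}

/-- The derivative along the segment can be computed within it, which covers the punctures at the
ends. Only weak monotonicity is used, so only weak inequalities result. -/
theorem derivative_vertical (hf : DifferentiableAt ℝ f (a, b)) (hb : b₀ < b₁) (h : b ∈ Icc b₀ b₁)
    (hv : ∀ y ∈ Icc b₀ b₁, (f (a, y)).1 = (f (a, b)).1) : (fderiv ℝ f (a, b) (0, 1)).1 = 0 ∧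
      (MonotoneOn (fun y => (f (a, y)).2) (Icc b₀ b₁) → 0 ≤ (fderiv ℝ f (a, b) (0, 1)).2) ∧
      (AntitoneOn (fun y => (f (a, y)).2) (Icc b₀ b₁) → (fderiv ℝ f (a, b) (0, 1)).2 ≤ 0) := by
  have hg : HasDerivAt (fun y : ℝ => (a, y)) (0, 1) b :=
    (hasDerivAt_const b a).prodMk (hasDerivAt_id b)
  have hu := uniqueDiffOn_Icc hb b h
  have d1 := (hf.hasFDerivAt.fst.comp_hasDerivAt b hg).hasDerivWithinAt (s := Icc b₀ b₁)
  have d2 := (hf.hasFDerivAt.snd.comp_hasDerivAt b hg).hasDerivWithinAt (s := Icc b₀ b₁)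
  refine ⟨?_, fun hm => ?_, fun hm => ?_⟩
  · exact hu.eq_deriv _ d1 ((hasDerivWithinAt_const b _ _).congr (fun y hy => hv y hy) rfl)
  · exact hm.derivWithin_nonneg.trans_eq (d2.derivWithin hu)
  · exact (d2.derivWithin hu).symm.trans_le hm.derivWithin_nonpos

theorem derivative_horizontal (hf : DifferentiableAt ℝ f (a, b)) (ha : a₀ < a₁)
    (h : a ∈ Icc a₀ a₁) (hv : ∀ x ∈ Icc a₀ a₁, (f (x, b)).2 = (f (a, b)).2) :
    (fderiv ℝ f (a, b) (1, 0)).2 = 0 ∧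
      (MonotoneOn (fun x => (f (x, b)).1) (Icc a₀ a₁) → 0 ≤ (fderiv ℝ f (a, b) (1, 0)).1) ∧
      (AntitoneOn (fun x => (f (x, b)).1) (Icc a₀ a₁) → (fderiv ℝ f (a, b) (1, 0)).1 ≤ 0) := by
  have hg : HasDerivAt (fun x : ℝ => (x, b)) (1, 0) a :=
    (hasDerivAt_id a).prodMk (hasDerivAt_const a b)
  have hu := uniqueDiffOn_Icc ha a h
  have d1 := (hf.hasFDerivAt.snd.comp_hasDerivAt a hg).hasDerivWithinAt (s := Icc a₀ a₁)
  have d2 := (hf.hasFDerivAt.fst.comp_hasDerivAt a hg).hasDerivWithinAt (s := Icc a₀ a₁)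
  refine ⟨?_, fun hm => ?_, fun hm => ?_⟩
  · exact hu.eq_deriv _ d1 ((hasDerivWithinAt_const a _ _).congr (fun y hy => hv y hy) rfl)
  · exact hm.derivWithin_nonneg.trans_eq (d2.derivWithin hu)
  · exact (d2.derivWithin hu).symm.trans_le hm.derivWithin_nonpos

theorem not_strictMonoOn {g : ℝ → ℝ} {a b : ℕ} (hab : a < b)
    (h : StrictAntiOn g (Icc (a : ℝ) b)) : ¬ StrictMonoOn g (Icc (a : ℝ) b) := fun h' => by
  have hab' : (a : ℝ) < b := Nat.cast_lt.2 hab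
  have l : (a : ℝ) ∈ Icc (a : ℝ) b := left_mem_Icc.2 hab'.le
  have r : (b : ℝ) ∈ Icc (a : ℝ) b := right_mem_Icc.2 hab'.le
  exact lt_asymm (h l r hab') (h' l r hab')

end Segments

/-! ### The isomorphism of diagrams induced by a diffeomorphism -/

namespace GridDiagram

variable {n m : ℕ} {D : GridDiagram n} {D' : GridDiagram m}

open Classical Set

theorem mem_vSegment {c : Fin n} {p : ℝ × ℝ} : p ∈ D.vSegment c ↔
    p.1 = (c : ℕ) ∧ p.2 ∈ Icc ((D.lo c : ℕ) : ℝ) (D.hi c : ℕ) := by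
  have h : ((D.lo c : ℕ) : ℝ) ≤ (D.hi c : ℕ) := Nat.cast_le.2 (D.lo_lt_hi c).le
  rw [vSegment, planePoint, planePoint, ← Prod.image_mk_segment_right, segment_eq_Icc h]
  constructor
  · rintro ⟨y, hy, rfl⟩; exact ⟨rfl, hy⟩
  · rintro ⟨h1, h2⟩; exact ⟨p.2, h2, Prod.ext h1.symm rfl⟩

theorem mem_hSegment {r : Fin n} {p : ℝ × ℝ} : p ∈ D.hSegment r ↔
    p.2 = (r : ℕ) ∧ p.1 ∈ Icc ((D.lft r : ℕ) : ℝ) (D.rgt r : ℕ) := by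
  have h : ((D.lft r : ℕ) : ℝ) ≤ (D.rgt r : ℕ) := Nat.cast_le.2 (D.lft_lt_rgt r).le
  rw [hSegment, planePoint, planePoint, ← Prod.image_mk_segment_left, segment_eq_Icc h]
  constructor
  · rintro ⟨y, hy, rfl⟩; exact ⟨rfl, hy⟩
  · rintro ⟨h1, h2⟩; exact ⟨p.1, h2, Prod.ext rfl h1.symm⟩

theorem planePoint_injective {c r c' r' : Fin n} (h : planePoint c r = planePoint c' r') :
    c = c' ∧ r = r' := by
  simpa [planePoint, Fin.ext_iff] using h

/-- The special points are the points of intersection of the segments. -/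
theorem isSpecial_iff {c r : Fin n} : D.IsSpecial c r ↔
    planePoint c r ∈ D.vSegment c ∧ planePoint c r ∈ D.hSegment r := by
  rw [mem_vSegment, mem_hSegment]
  simp only [planePoint, Set.mem_Icc, Nat.cast_le, true_and]
  rfl

theorem eq_planePoint {c r : Fin n} {p : ℝ × ℝ} (h : p ∈ D.vSegment c) (h' : p ∈ D.hSegment r) :
    p = planePoint c r :=
  Prod.ext (mem_vSegment.1 h).1 (mem_hSegment.1 h').1

theorem isSpecial_X (c : Fin n) : D.IsSpecial c (D.X c) := by
  rcases (D.eq_lo_or_eq_hi c (D.X c)).2 (Or.inr rfl) with h | h <;> rw [h]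
  exacts [D.isSpecial_lo c, D.isSpecial_hi c]

theorem isSpecial_O (c : Fin n) : D.IsSpecial c (D.O c) := by
  rcases (D.eq_lo_or_eq_hi c (D.O c)).2 (Or.inl rfl) with h | h <;> rw [h]
  exacts [D.isSpecial_lo c, D.isSpecial_hi c]

namespace Carries

variable {f : Diffeomorph (modelWithCornersSelf ℝ (ℝ × ℝ)) (modelWithCornersSelf ℝ (ℝ × ℝ))
  (ℝ × ℝ) (ℝ × ℝ) ∞} (H : Carries D D' f)

include H

/-- The column to which a column is sent. -/
def col (c : Fin n) : Fin m := (H.vertical c).choose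

/-- The row to which a row is sent. -/
def row (r : Fin n) : Fin m := (H.horizontal r).choose

theorem image_vSegment (c : Fin n) : f '' D.vSegment c = D'.vSegment (H.col c) :=
  (H.vertical c).choose_spec

theorem image_hSegment (r : Fin n) : f '' D.hSegment r = D'.hSegment (H.row r) :=
  (H.horizontal r).choose_spec

theorem map_vSegment {c : Fin n} {p : ℝ × ℝ} (h : p ∈ D.vSegment c) :
    f p ∈ D'.vSegment (H.col c) := H.image_vSegment c ▸ mem_image_of_mem f h

theorem map_hSegment {r : Fin n} {p : ℝ × ℝ} (h : p ∈ D.hSegment r) :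
    f p ∈ D'.hSegment (H.row r) := H.image_hSegment r ▸ mem_image_of_mem f h

theorem map_planePoint {c r : Fin n} (h : D.IsSpecial c r) :
    f (planePoint c r) = planePoint (H.col c) (H.row r) := by
  obtain ⟨h1, h2⟩ := isSpecial_iff.1 h
  exact eq_planePoint (H.map_vSegment h1) (H.map_hSegment h2)

theorem isSpecial {c r : Fin n} (h : D.IsSpecial c r) : D'.IsSpecial (H.col c) (H.row r) := by
  obtain ⟨h1, h2⟩ := isSpecial_iff.1 h
  rw [isSpecial_iff, ← H.map_planePoint h]
  exact ⟨H.map_vSegment h1, H.map_hSegment h2⟩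

theorem X_col (c : Fin n) : D'.X (H.col c) = H.row (D.X c) := by
  have h : f (planePoint c (D.X c)) ∈ range fun c => planePoint c (D'.X c) :=
    H.punctureX ▸ mem_image_of_mem f (mem_range_self c)
  obtain ⟨c', h⟩ := h
  rw [H.map_planePoint (isSpecial_X c)] at h
  obtain ⟨h1, h2⟩ := planePoint_injective h
  rw [← h2, h1]

theorem O_col (c : Fin n) : D'.O (H.col c) = H.row (D.O c) := by
  have h : f (planePoint c (D.O c)) ∈ range fun c => planePoint c (D'.O c) :=
    H.punctureO ▸ mem_image_of_mem f (mem_range_self c)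
  obtain ⟨c', h⟩ := h
  rw [H.map_planePoint (isSpecial_O c)] at h
  obtain ⟨h1, h2⟩ := planePoint_injective h
  rw [← h2, h1]

theorem col_injective : Function.Injective H.col := by
  intro c c' h
  have h1 : D.vSegment c = D.vSegment c' := f.injective.image_injective
    ((H.image_vSegment c).trans (h ▸ (H.image_vSegment c').symm))
  have h2 := (isSpecial_iff.1 (D.isSpecial_lo c)).1
  rw [h1, mem_vSegment] at h2
  exact Fin.ext (by simpa [planePoint] using h2.1)

theorem row_injective : Function.Injective H.row := by
  intro r r' h
  have h1 : D.hSegment r = D.hSegment r' := f.injective.image_injective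
    ((H.image_hSegment r).trans (h ▸ (H.image_hSegment r').symm))
  have h2 := (isSpecial_iff.1 (D.isSpecial_lft r)).2
  rw [h1, mem_hSegment] at h2
  exact Fin.ext (by simpa [planePoint] using h2.1)

theorem col_surjective : Function.Surjective H.col := by
  intro c'
  have h : planePoint c' (D'.X c') ∈ f '' range fun c => planePoint c (D.X c) :=
    H.punctureX ▸ mem_range_self c'
  obtain ⟨_, ⟨c, rfl⟩, h⟩ := h
  rw [H.map_planePoint (isSpecial_X c)] at h
  exact ⟨c, (planePoint_injective h).1⟩

theorem row_surjective : Function.Surjective H.row := by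
  intro r'
  obtain ⟨c, hc⟩ := H.col_surjective (D'.X.symm r')
  exact ⟨D.X c, by rw [← X_col, hc, Equiv.apply_symm_apply]⟩

/-- The bijection of the special points. -/
def specialPoint : D.SpecialPoint ≃ D'.SpecialPoint :=
  Equiv.ofBijective (fun p => ⟨(H.col p.1.1, H.row p.1.2), H.isSpecial p.2⟩) (by
    constructor
    · intro p q h
      have h' := congrArg Subtype.val h
      exact Subtype.ext (Prod.ext (H.col_injective (congrArg Prod.fst h'))
        (H.row_injective (congrArg Prod.snd h')))
    · rintro ⟨⟨c', r'⟩, hp⟩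
      obtain ⟨c, rfl⟩ := H.col_surjective c'
      obtain ⟨r, rfl⟩ := H.row_surjective r'
      obtain ⟨h1, h2⟩ := isSpecial_iff.1 hp
      rw [← H.image_vSegment] at h1
      rw [← H.image_hSegment] at h2
      obtain ⟨p, hp1, hp2⟩ := h1
      obtain ⟨q, hq1, hq2⟩ := h2
      obtain rfl := f.injective (hp2.trans hq2.symm)
      obtain rfl := eq_planePoint hp1 hq1
      exact ⟨⟨(c, r), isSpecial_iff.2 ⟨hp1, hq1⟩⟩, rfl⟩)

/-- The diffeomorphism preserves the direction of the vertical segment in column `c`. -/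
def VMono (f : ℝ × ℝ → ℝ × ℝ) (D : GridDiagram n) (c : Fin n) : Prop :=
  StrictMonoOn (fun y => (f ((c : ℕ), y)).2) (Icc ((D.lo c : ℕ) : ℝ) (D.hi c : ℕ))

/-- The diffeomorphism preserves the direction of the horizontal segment in row `r`. -/
def HMono (f : ℝ × ℝ → ℝ × ℝ) (D : GridDiagram n) (r : Fin n) : Prop :=
  StrictMonoOn (fun x => (f (x, (r : ℕ))).1) (Icc ((D.lft r : ℕ) : ℝ) (D.rgt r : ℕ))

theorem vertical_cases (c : Fin n) : (VMono f D c ∧ ∀ r r', D.IsSpecial c r → D.IsSpecial c r' →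
      (H.row r < H.row r' ↔ r < r')) ∨
    (StrictAntiOn (fun y => (f ((c : ℕ), y)).2) (Icc ((D.lo c : ℕ) : ℝ) (D.hi c : ℕ)) ∧
      ∀ r r', D.IsSpecial c r → D.IsSpecial c r' → (H.row r < H.row r' ↔ r' < r)) := by
  have hm : ∀ y ∈ Icc ((D.lo c : ℕ) : ℝ) (D.hi c : ℕ), (f ((c : ℕ), y)).1 = (H.col c : ℕ) :=
    fun y hy => (mem_vSegment.1 (H.map_vSegment (mem_vSegment.2 ⟨rfl, hy⟩))).1
  have hlt : ((D.lo c : ℕ) : ℝ) ≤ (D.hi c : ℕ) := Nat.cast_le.2 (D.lo_lt_hi c).le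
  have hp : ∀ r, D.IsSpecial c r → (((r : ℕ) : ℝ) ∈ Icc ((D.lo c : ℕ) : ℝ) (D.hi c : ℕ) ∧
      (f ((c : ℕ), (r : ℕ))).2 = (H.row r : ℕ)) := fun r hr =>
    ⟨(mem_vSegment.1 (isSpecial_iff.1 hr).1).2, congrArg Prod.snd (H.map_planePoint hr)⟩
  rcases lt_iff_of_injOn hlt (g := fun y => (f ((c : ℕ), y)).2)
    ((f.continuous.comp (by fun_prop)).snd.continuousOn) (by
      intro y hy y' hy' h
      have := f.injective (Prod.ext ((hm y hy).trans (hm y' hy').symm) h)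
      exact congrArg Prod.snd this) with ⟨h1, h2⟩ | ⟨h1, h2⟩
  · refine Or.inl ⟨h1, fun r r' hr hr' => ?_⟩
    have := h2 _ (hp r hr).1 _ (hp r' hr').1
    rw [(hp r hr).2, (hp r' hr').2, Nat.cast_lt, Nat.cast_lt] at this
    exact this
  · refine Or.inr ⟨h1, fun r r' hr hr' => ?_⟩
    have := h2 _ (hp r hr).1 _ (hp r' hr').1
    rw [(hp r hr).2, (hp r' hr').2, Nat.cast_lt, Nat.cast_lt] at this
    exact this

theorem horizontal_cases (r : Fin n) : (HMono f D r ∧ ∀ c c', D.IsSpecial c r → D.IsSpecial c' r →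
      (H.col c < H.col c' ↔ c < c')) ∨
    (StrictAntiOn (fun x => (f (x, (r : ℕ))).1) (Icc ((D.lft r : ℕ) : ℝ) (D.rgt r : ℕ)) ∧
      ∀ c c', D.IsSpecial c r → D.IsSpecial c' r → (H.col c < H.col c' ↔ c' < c)) := by
  have hm : ∀ x ∈ Icc ((D.lft r : ℕ) : ℝ) (D.rgt r : ℕ), (f (x, (r : ℕ))).2 = (H.row r : ℕ) :=
    fun x hx => (mem_hSegment.1 (H.map_hSegment (mem_hSegment.2 ⟨rfl, hx⟩))).1
  have hlt : ((D.lft r : ℕ) : ℝ) ≤ (D.rgt r : ℕ) := Nat.cast_le.2 (D.lft_lt_rgt r).le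
  have hp : ∀ c, D.IsSpecial c r → (((c : ℕ) : ℝ) ∈ Icc ((D.lft r : ℕ) : ℝ) (D.rgt r : ℕ) ∧
      (f ((c : ℕ), (r : ℕ))).1 = (H.col c : ℕ)) := fun c hc =>
    ⟨(mem_hSegment.1 (isSpecial_iff.1 hc).2).2, congrArg Prod.fst (H.map_planePoint hc)⟩
  rcases lt_iff_of_injOn hlt (g := fun x => (f (x, (r : ℕ))).1)
    ((f.continuous.comp (by fun_prop)).fst.continuousOn) (by
      intro x hx x' hx' h
      have := f.injective (Prod.ext h ((hm x hx).trans (hm x' hx').symm))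
      exact congrArg Prod.fst this) with ⟨h1, h2⟩ | ⟨h1, h2⟩
  · refine Or.inl ⟨h1, fun c c' hc hc' => ?_⟩
    have := h2 _ (hp c hc).1 _ (hp c' hc').1
    rw [(hp c hc).2, (hp c' hc').2, Nat.cast_lt, Nat.cast_lt] at this
    exact this
  · refine Or.inr ⟨h1, fun c c' hc hc' => ?_⟩
    have := h2 _ (hp c hc).1 _ (hp c' hc').1
    rw [(hp c hc).2, (hp c' hc').2, Nat.cast_lt, Nat.cast_lt] at this
    exact this

/-- At a special point the derivative is diagonal, since both segments through it are mapped to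
segments of the same kind. Its determinant is positive, so the diffeomorphism cannot reverse just
one of the two directions. -/
theorem vMono_iff_hMono {c r : Fin n} (h : D.IsSpecial c r) : VMono f D c ↔ HMono f D r := by
  obtain ⟨h1, h2⟩ := isSpecial_iff.1 h
  have hd : DifferentiableAt ℝ f (((c : ℕ) : ℝ), ((r : ℕ) : ℝ)) :=
    f.contDiff.differentiable (by simp) _
  have m1 := (mem_vSegment.1 h1).2
  have m2 := (mem_hSegment.1 h2).2
  obtain ⟨v1, v2, v3⟩ := derivative_vertical hd (Nat.cast_lt.2 (D.lo_lt_hi c)) m1 fun y hy =>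
    (mem_vSegment.1 (H.map_vSegment (mem_vSegment.2 ⟨rfl, hy⟩))).1.trans
      (mem_vSegment.1 (H.map_vSegment h1)).1.symm
  obtain ⟨w1, w2, w3⟩ := derivative_horizontal hd (Nat.cast_lt.2 (D.lft_lt_rgt r)) m2 fun x hx =>
    (mem_hSegment.1 (H.map_hSegment (mem_hSegment.2 ⟨rfl, hx⟩))).1.trans
      (mem_hSegment.1 (H.map_hSegment h2)).1.symm
  have ho := H.orientation (((c : ℕ) : ℝ), ((r : ℕ) : ℝ))
  rw [det_eq, v1, zero_mul, sub_zero] at ho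
  constructor
  · intro hv
    rcases H.horizontal_cases r with h' | h'
    · exact h'.1
    · exact absurd ho (mul_nonpos_of_nonpos_of_nonneg (w3 h'.1.antitoneOn) (v2 hv.monotoneOn)).not_gt
  · intro hh
    rcases H.vertical_cases c with h' | h'
    · exact h'.1
    · exact absurd ho (mul_nonpos_of_nonneg_of_nonpos (w2 hh.monotoneOn) (v3 h'.1.antitoneOn)).not_gt

theorem row_lt_iff {c r r' : Fin n} (hr : D.IsSpecial c r) (hr' : D.IsSpecial c r') :
    H.row r < H.row r' ↔ if VMono f D c then r < r' else r' < r := by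
  rcases H.vertical_cases c with h | h
  · rw [if_pos h.1, h.2 r r' hr hr']
  · rw [if_neg (show ¬ VMono f D c from not_strictMonoOn (D.lo_lt_hi c) h.1), h.2 r r' hr hr']

theorem col_lt_iff {r c c' : Fin n} (hc : D.IsSpecial c r) (hc' : D.IsSpecial c' r) :
    H.col c < H.col c' ↔ if VMono f D c then c < c' else c' < c := by
  rw [H.vMono_iff_hMono hc]
  rcases H.horizontal_cases r with h | h
  · rw [if_pos h.1, h.2 c c' hc hc']
  · rw [if_neg (show ¬ HMono f D r from not_strictMonoOn (D.lft_lt_rgt r) h.1), h.2 c c' hc hc']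

omit H in
theorem and_congr_of {a b c d : Prop} (h : a ↔ b) (h' : b → (c ↔ d)) : a ∧ c ↔ b ∧ d :=
  and_congr_left' h |>.trans (and_congr_right h')

/-- The isomorphism of rectangular diagrams induced by a diffeomorphism. -/
def gridIso : GridIso D D' where
  pt := H.specialPoint
  keep p := decide (VMono f D p.1.1)
  ahead {d p q} := by
    have hr : p.1.1 = q.1.1 → ((H.row p.1.2 < H.row q.1.2 ↔
        if VMono f D p.1.1 then p.1.2 < q.1.2 else q.1.2 < p.1.2) ∧
        (H.row q.1.2 < H.row p.1.2 ↔ if VMono f D p.1.1 then q.1.2 < p.1.2 else p.1.2 < q.1.2)) :=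
      fun h => ⟨H.row_lt_iff p.2 (h ▸ q.2), H.row_lt_iff (h ▸ q.2) p.2⟩
    have hc : p.1.2 = q.1.2 → ((H.col p.1.1 < H.col q.1.1 ↔
        if VMono f D p.1.1 then p.1.1 < q.1.1 else q.1.1 < p.1.1) ∧
        (H.col q.1.1 < H.col p.1.1 ↔ if VMono f D p.1.1 then q.1.1 < p.1.1 else p.1.1 < q.1.1)) :=
      fun h => ⟨H.col_lt_iff p.2 (h ▸ q.2), by
        rw [H.vMono_iff_hMono p.2, h, ← H.vMono_iff_hMono q.2]
        exact H.col_lt_iff q.2 (h ▸ p.2)⟩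
    have ec : H.col p.1.1 = H.col q.1.1 ↔ p.1.1 = q.1.1 := H.col_injective.eq_iff
    have er : H.row p.1.2 = H.row q.1.2 ↔ p.1.2 = q.1.2 := H.row_injective.eq_iff
    by_cases hv : VMono f D p.1.1 <;> simp only [hv, if_true, if_false, decide_true, decide_false] at *
    · cases d
      · exact and_congr_of ec fun h => (hr h).1
      · exact and_congr_of er fun h => (hc h).1
      · exact and_congr_of ec fun h => (hr h).2
      · exact and_congr_of er fun h => (hc h).2
    · cases d
      · exact and_congr_of ec fun h => (hr h).2
      · exact and_congr_of er fun h => (hc h).2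
      · exact and_congr_of ec fun h => (hr h).1
      · exact and_congr_of er fun h => (hc h).1
  keep_eq {d p q} h := by
    have hv : VMono f D p.1.1 ↔ VMono f D q.1.1 := by
      cases d
      · rw [h.1]
      · rw [H.vMono_iff_hMono p.2, H.vMono_iff_hMono q.2, h.1]
      · rw [h.1]
      · rw [H.vMono_iff_hMono p.2, H.vMono_iff_hMono q.2, h.1]
    simp only [hv]
  upward p := by
    change D'.X (H.col p.1.1) < D'.O (H.col p.1.1) ↔ _
    rw [H.X_col, H.O_col, H.row_lt_iff (isSpecial_X _) (isSpecial_O _), Upward]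
    have := D.ne p.1.1
    by_cases hv : VMono f D p.1.1
    · simp [hv]
    · simp [hv, this.le_iff_lt]
  rightward p := by
    change D'.O.symm (H.row p.1.2) < D'.X.symm (H.row p.1.2) ↔ _
    have hO : D'.O.symm (H.row p.1.2) = H.col (D.O.symm p.1.2) := by
      rw [Equiv.symm_apply_eq, O_col, Equiv.apply_symm_apply]
    have hX : D'.X.symm (H.row p.1.2) = H.col (D.X.symm p.1.2) := by
      rw [Equiv.symm_apply_eq, X_col, Equiv.apply_symm_apply]
    have sO : D.IsSpecial (D.O.symm p.1.2) p.1.2 := by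
      have := isSpecial_O (D := D) (D.O.symm p.1.2)
      rwa [Equiv.apply_symm_apply] at this
    have sX : D.IsSpecial (D.X.symm p.1.2) p.1.2 := by
      have := isSpecial_X (D := D) (D.X.symm p.1.2)
      rwa [Equiv.apply_symm_apply] at this
    rw [hO, hX, H.col_lt_iff sO sX, H.vMono_iff_hMono sO, ← H.vMono_iff_hMono p.2, Rightward]
    have hne : D.X.symm p.1.2 ≠ D.O.symm p.1.2 := fun h => by
      have := D.ne (D.O.symm p.1.2)
      rw [← h, Equiv.apply_symm_apply, h, Equiv.apply_symm_apply] at this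
      exact this rfl
    by_cases hv : VMono f D p.1.1
    · simp [hv]
    · simp [hv, hne.le_iff_lt]

theorem image_nearest {g : D.Gen} {g' : D'.Gen} (h : ∀ p, g'.row (H.gridIso.pt p).1.1 =
    (H.gridIso.pt p).1.2 ↔ g.row p.1.1 = p.1.2) : f '' g.nearest = g'.nearest := by
  have hs : ∀ {n : ℕ} {D : GridDiagram n} (g : D.Gen) (c : Fin n), D.IsSpecial c (g.row c) :=
    fun g c => g.bounds c
  ext q
  constructor
  · rintro ⟨_, ⟨c, rfl⟩, rfl⟩
    rw [H.map_planePoint (hs g c)]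
    have := (h ⟨(c, g.row c), hs g c⟩).2 rfl
    exact ⟨H.col c, congrArg (planePoint _) this⟩
  · rintro ⟨c', rfl⟩
    obtain ⟨⟨⟨c, r⟩, hp⟩, hq⟩ := H.gridIso.pt.surjective ⟨(c', g'.row c'), hs g' c'⟩
    have h1 := h ⟨(c, r), hp⟩
    rw [hq] at h1
    have h2 : g.row c = r := h1.1 rfl
    refine ⟨_, ⟨c, rfl⟩, ?_⟩
    have h3 := congrArg Subtype.val hq
    beta_reduce
    rw [h2, H.map_planePoint hp]
    exact congrArg₂ planePoint (congrArg Prod.fst h3) (congrArg Prod.snd h3)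

end Carries

end GridDiagram

/-! ### The main theorem -/

theorem mainTheorem7 (τ : Bool) :
    (∀ (n : ℕ) (D : GridDiagram n) (s : D.FigureEights) (E : GridDiagram.EdgeAssignment D τ),
      ∃ δ : (D.Gen →₀ ℤ) →ₗ[ℤ] (D.Gen →₀ ℤ), GridDiagram.ComputesOddKh ℤ s E δ) ∧
    (∃ δ : ∀ (n : ℕ) (D : GridDiagram n), D.FigureEights → GridDiagram.EdgeAssignment D τ →
        ((D.Gen →₀ ℚ) →ₗ[ℚ] (D.Gen →₀ ℚ)),
      (∀ (n : ℕ) (D : GridDiagram n) (s : D.FigureEights) (E : GridDiagram.EdgeAssignment D τ),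
        GridDiagram.ComputesOddKh ℚ s E (δ n D s E)) ∧
      ∀ (n m : ℕ) (D : GridDiagram n) (D' : GridDiagram m)
        (s : D.FigureEights) (s' : D'.FigureEights)
        (E : GridDiagram.EdgeAssignment D τ) (E' : GridDiagram.EdgeAssignment D' τ)
        (f : Diffeomorph (modelWithCornersSelf ℝ (ℝ × ℝ)) (modelWithCornersSelf ℝ (ℝ × ℝ))
          (ℝ × ℝ) (ℝ × ℝ) ∞),
        GridDiagram.Carries D D' f →
        ∃ (σ : D.Gen ≃ D'.Gen) (η : D.Gen → ℤˣ),
          (∀ g, GridDiagram.P s' (σ g) = GridDiagram.P s g ∧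
            GridDiagram.J s' (σ g) = GridDiagram.J s g ∧ f '' g.nearest = (σ g).nearest) ∧
          ∀ g h, δ m D' s' E' (Finsupp.single (σ g) 1) (σ h) =
            ((η g * η h : ℤˣ) : ℤ) • δ n D s E (Finsupp.single g 1) h) := by
  -- Weight 1 at one free crossing needs no denominators; equal weights over the rationals make no
  -- choice.
  refine ⟨fun n D s E => ⟨_, GridDiagram.computesOddKh s E GridDiagram.isWeight_pointWeight⟩,
    fun n D s E => GridDiagram.genDifferential s E GridDiagram.equalWeight,
    fun n D s E => GridDiagram.computesOddKh s E GridDiagram.isWeight_equalWeight, ?_⟩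
  intro n m D D' s s' E E' f H
  -- Equal weights depend only on the number of free crossings, which gives the required naturality.
  obtain ⟨σ, η, h1, h2⟩ := H.gridIso.exists_genEquiv E E' (W := GridDiagram.equalWeight) (W' := GridDiagram.equalWeight)
    (fun p q h x => GridDiagram.equalWeight_equiv H.gridIso.crossing h x) s s'
  exact ⟨σ, η, fun g => ⟨(h1 g).1, (h1 g).2.1, H.image_nearest (h1 g).2.2⟩, h2⟩

end

end
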